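/- **Model.** Let $M=(m_{ij})$ be an $N\times N$ row-stochastic matrix, $\mathrm{init}$ a probability vector, $\sigma>0$, $0<\alpha_i<1$, $B_i>0$ ($i=1,\dots,N$), and let $\phi^{(i)}$ be probability laws on $(0,\infty)$ (waiting times) that are asymptotic power laws, i.e. their Laplace transforms satisfy $$\phi^{(i)}(s)=1-B_is^{\alpha_i}+o(|s|^{\alpha_i})\qquad(s\to0,\ \operatorname{Re}s>0).\tag{1}$$ A particle in internal state $i$ waits a time with law $\phi^{(i)}$, then makes a centred Gaussian jump with Fourier transform $e^{-\sigma^2k^2}=1-\sigma^2k^2+\cdots$, and its new internal state is $j$ with probability $m_{ij}$; all waiting times and jumps are independent given the chain of internal states. Let $x(t)$ be the position, $i(t)$ the internal state and $A(t)=\int_0^tU(x(\tau))\,d\tau$. **Continuum limit.** The equations are understood in the continuum limit with $K_i=\sigma^2/B_i$ fixed: let $\varepsilon=\varepsilon_n\to0^+$ be any positive sequence; in the $\varepsilon$-process the waiting time in state $i$ is multiplied by $\varepsilon^{1/\alpha_i}$ and the jump variance $2\sigma^2$ by $\varepsilon$, so that $B_i$ is replaced by $B_i^\varepsilon=\varepsilon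 B_i$ and $\sigma^2$ by $\varepsilon\sigma^2$, while $K_i$, $M$ and $\mathrm{init}$ stay the same. Let $U:\mathbb R\to\mathbb R$ be measurable and locally bounded, and $\rho\in\mathbb C$ such that $\operatorname{Re}(\rho U)$ is bounded below (this covers the Laplace transform $\rho\ge0$, $U\ge0$, and the Fourier transform $\rho\in i\mathbb R$, $U$ arbitrary). Write $c(x)=\rho U(x)$ and, for $0<\beta<1$, let $$\mathcal D_t^{\beta}f(x,t)=\frac1{\Gamma(1-\beta)}\Big[\frac{\partial}{\partial t}+c(x)\Big]\int_0^t\frac{e^{-(t-\tau)c(x)}}{(t-\tau)^{\beta}}f(x,\tau)\,d\tau$$ be the fractional substantial derivative. All equations are in the sense of distributions on $\mathbb R\times\mathbb R$ in $(x,t)$ (resp. $(x_0,t)$), all functions being extended by $0$ to $t<0$. **Forward equation.** For the $\varepsilon$-process with $x(0)=0$ and initial internal distribution $\mathrm{init}$, let $g_\varepsilon^{(i)}(x,A,t)$ be the joint density (a measure in $(x,A)$) of $x(t)$ and $A(t)$ on $\{i(t)=i\}$, $G_\varepsilon^{(i)}(x,\rho,t)=\int e^{-\rho A}g_\varepsilon^{(i)}(x,A,t)\,dA$,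 and $G_\varepsilon=(G_\varepsilon^{(1)},\dots,G_\varepsilon^{(N)})^T$. Then $g_\varepsilon^{(i)}(x,A,0)=\mathrm{init}_i\,\delta(x)\delta(A)$. Let $R_\varepsilon$ be the vector of distributions defined by $$M^T\partial_tG_\varepsilon-\delta(x)\delta(t)\,\mathrm{init}=(M^T-I)\,\mathrm{diag}\big((B_i^{\varepsilon})^{-1}\mathcal D_t^{1-\alpha_i}\big)G_\varepsilon+M^T\partial_x^2\,\mathrm{diag}\big(K_i\mathcal D_t^{1-\alpha_i}\big)G_\varepsilon-\rho U(x)M^TG_\varepsilon+R_\varepsilon .$$ As $\varepsilon\to0$: (a) $\varepsilon R_\varepsilon\to0$ and $\sum_iR^{(i)}_\varepsilon\to0$, i.e. the forward equation holds to the leading order $1/\varepsilon$, and its sum over the internal states holds up to a vanishing error; (b) if the relation $\phi^{(i)}(s)=1-B_is^{\alpha_i}$ holds up to terms of smaller order than its square, i.e. $\phi^{(i)}(s)=1-B_is^{\alpha_i}+o(|s|^{2\alpha_i})$ as $s\to0$, $\operatorname{Re}s>0$, for every $i$, then $R_\varepsilon\to0$: every component of the forward equation holds up to a vanishing error. **Backward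 equation.** Let $g_{x_0,\varepsilon}^{(i)}(A,t)$ be the density (a measure in $A$) of $A(t)$ for the $\varepsilon$-process started at $x_0$ in internal state $i$, $G^{(i)}_{x_0,\varepsilon}(\rho,t)=\int e^{-\rho A}g^{(i)}_{x_0,\varepsilon}(A,t)\,dA$, and $G_{x_0,\varepsilon}$ the column vector of these. Then $g^{(i)}_{x_0,\varepsilon}(A,0)=\delta(A)$, and under (1) alone: (c) if $U\in C^2$, then, with $\mathbf 1=(1,\dots,1)^T$ and $R'_\varepsilon\to0$ as $\varepsilon\to0$, $$M\partial_tG_{x_0,\varepsilon}-\delta(t)\mathbf 1=\mathrm{diag}\big((B_i^{\varepsilon})^{-1}\mathcal D_t^{1-\alpha_i}\big)(M-I)G_{x_0,\varepsilon}+\mathrm{diag}\big(K_i\mathcal D_t^{1-\alpha_i}\big)M\partial_{x_0}^2G_{x_0,\varepsilon}-\rho U(x_0)MG_{x_0,\varepsilon}+R'_\varepsilon ;$$ (d) for every measurable locally bounded $U$ (for which the product of a non-smooth function with a distribution in (c) need not make sense), the equation obtained from (c) by applying the substantial fractional integral of order $1-\alpha_i$ to its $i$-th component holds, with $R''_\varepsilon\to0$: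 $$\mathcal D_t^{\alpha_i}(MG_{x_0,\varepsilon})_i-\frac{t^{-\alpha_i}e^{-t\rho U(x_0)}}{\Gamma(1-\alpha_i)}=\frac1{B_i^\varepsilon}\big((M-I)G_{x_0,\varepsilon}\big)_i+K_i\,\partial_{x_0}^2(MG_{x_0,\varepsilon})_i+R''^{(i)}_\varepsilon ;$$ (e) the density of $A(t)$, $t\ge0$, for the process started at $x_0$ with initial internal distribution $(\lambda^{(i)})_i$ is $\sum_i\lambda^{(i)}g^{(i)}_{x_0,\varepsilon}(A,t)$. -/

import Mathlib

open scoped NNReal ContDiff Topology Asymptotics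
open MeasureTheory ProbabilityTheory Filter

universe u v

noncomputable section

namespace FcP

/-- A continuous-time random walk with `N` internal states, given through its law.
`state k`, `wait k`, `jump k` are the `k`-th internal state, the waiting time spent in it, and the
jump made at the end of that waiting time.  The states form a Markov chain with transition
matrix `M` (`M i j` is the probability to go from `i` to `j`) and initial distribution `init`;
given the states, all waiting times and jumps are independent, a waiting time in state `i` has law
`μ i`, and the jumps are centred Gaussian with variance `s`. -/
structure Walk {N : ℕ} (M : Matrix (Fin N) (Fin N) ℝ) (init : Fin N → ℝ)
    (μ : Fin N → Measure ℝ) (s : ℝ≥0) where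
  Ω : Type u
  [mΩ : MeasurableSpace Ω]
  P : Measure Ω
  state : ℕ → Ω → Fin N
  wait : ℕ → Ω → ℝ
  jump : ℕ → Ω → ℝ
  measurable_state : ∀ k, Measurable (state k)
  measurable_wait : ∀ k, Measurable (wait k)
  measurable_jump : ∀ k, Measurable (jump k)
  law : ∀ (n : ℕ) (i : ℕ → Fin N) (S C : ℕ → Set ℝ),
    (∀ k, MeasurableSet (S k)) → (∀ k, MeasurableSet (C k)) →
    P {w | ∀ k ≤ n, state k w = i k ∧ wait k w ∈ S k ∧ jump k w ∈ C k} =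
      ENNReal.ofReal (init (i 0) * ∏ k ∈ Finset.range n, M (i k) (i (k + 1))) *
        ∏ k ∈ Finset.range (n + 1), μ (i k) (S k) * gaussianReal 0 s (C k)

attribute [instance] Walk.mΩ

namespace Walk

variable {N : ℕ} {M : Matrix (Fin N) (Fin N) ℝ} {init : Fin N → ℝ}
  {μ : Fin N → Measure ℝ} {s : ℝ≥0}

/-- The time of the `n`-th renewal; `renewalTime 0 = 0`. -/
def renewalTime (F : Walk M init μ s) (n : ℕ) (w : F.Ω) : ℝ :=
  ∑ k ∈ Finset.range n, F.wait k w

/-- The number of renewals up to and including time `t`. -/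
def count (F : Walk M init μ s) (t : ℝ) (w : F.Ω) : ℕ :=
  sInf {n : ℕ | t < F.renewalTime (n + 1) w}

/-- The position `x(t)` of the particle that starts at `x₀`. -/
def position (F : Walk M init μ s) (x₀ t : ℝ) (w : F.Ω) : ℝ :=
  x₀ + ∑ k ∈ Finset.range (F.count t w), F.jump k w

/-- The internal state at time `t`. -/
def internal (F : Walk M init μ s) (t : ℝ) (w : F.Ω) : Fin N :=
  F.state (F.count t w) w

/-- The functional `A = ∫₀ᵗ U(x(τ)) dτ`. -/
def functional (F : Walk M init μ s) (U : ℝ → ℝ) (x₀ t : ℝ) (w : F.Ω) : ℝ :=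
  ∫ r in (0 : ℝ)..t, U (F.position x₀ r w)

/-- The joint distribution `g⁽ⁱ⁾(x, A, t) dx dA` of position and functional, on the event that
the particle is in the internal state `i` at time `t`. -/
def jointLaw (F : Walk M init μ s) (U : ℝ → ℝ) (x₀ : ℝ) (i : Fin N) (t : ℝ) :
    Measure (ℝ × ℝ) :=
  (F.P.restrict {w | F.internal t w = i}).map
    (fun w => (F.position x₀ t w, F.functional U x₀ t w))

/-- The distribution `g_{x₀}(A, t) dA` of the functional, the particle starting at `x₀`. -/
def functionalLaw (F : Walk M init μ s) (U : ℝ → ℝ) (x₀ t : ℝ) : Measure ℝ :=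
  F.P.map (F.functional U x₀ t)

end Walk

/-- A time-dependent distribution in the space variable: `g t h` is the value at the test
function `h` of the distribution at time `t`. -/
abbrev DistPath := ℝ → (ℝ → ℂ) → ℂ

/-- Smooth compactly supported test functions `ψ(x, t)` of space and time. -/
def IsTest (ψ : ℝ → ℝ → ℂ) : Prop :=
  ContDiff ℝ ∞ (fun p : ℝ × ℝ => ψ p.1 p.2) ∧ HasCompactSupport (fun p : ℝ × ℝ => ψ p.1 p.2)

/-- `G⁽ⁱ⁾(x, ρ, t) = ∫ exp(-ρ A) g⁽ⁱ⁾(x, A, t) dA`, the particle starting at `0`, as a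
distribution in `x`. -/
def forwardG {N : ℕ} {M : Matrix (Fin N) (Fin N) ℝ} {init : Fin N → ℝ}
    {μ : Fin N → Measure ℝ} {s : ℝ≥0} (F : Walk.{u} M init μ s) (U : ℝ → ℝ) (ρ : ℂ)
    (i : Fin N) : DistPath :=
  fun t h => ∫ p : ℝ × ℝ, Complex.exp (-ρ * p.2) * h p.1 ∂(F.jointLaw U 0 i t)

/-- `G_{x₀}⁽ⁱ⁾(ρ, t) = ∫ exp(-ρ A) g_{x₀}⁽ⁱ⁾(A, t) dA`, a function of `x₀`, regarded as a
distribution in `x₀`; `F i` is the process that starts in the internal state `i`. -/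
def backwardG {N : ℕ} {M : Matrix (Fin N) (Fin N) ℝ} {init : Fin N → Fin N → ℝ}
    {μ : Fin N → Measure ℝ} {s : ℝ≥0} (F : ∀ i, Walk.{u} M (init i) μ s) (U : ℝ → ℝ) (ρ : ℂ)
    (i : Fin N) : DistPath :=
  fun t h => ∫ x₀ : ℝ, h x₀ * ∫ a : ℝ, Complex.exp (-ρ * a) ∂((F i).functionalLaw U x₀ t)

/-- A matrix acting on a vector of distributions. -/
def act {N : ℕ} (A : Matrix (Fin N) (Fin N) ℝ) (g : Fin N → DistPath) (i : Fin N) : DistPath :=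
  fun t h => ∑ j, (A i j : ℂ) * g j t h

/-- The second distributional derivative in the space variable. -/
def dxx (g : DistPath) : DistPath := fun t h => g t (iteratedDeriv 2 h)

/-- The pairing of `g`, extended by `0` to `t < 0`, with `ψ`. -/
def pair (g : DistPath) (ψ : ℝ → ℝ → ℂ) : ℂ :=
  ∫ t in Set.Ioi (0 : ℝ), g t (fun x => ψ x t)

/-- The pairing with `ψ` of the distributional time derivative of `g`, extended by `0` to
`t < 0`. -/
def dtPair (g : DistPath) (ψ : ℝ → ℝ → ℂ) : ℂ :=
  ∫ t in Set.Ioi (0 : ℝ), g t (fun x => -deriv (ψ x) t)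

/-- The pairing with `ψ` of the fractional substantial derivative of order `β ∈ (0, 1)`,
`𝒟ᵝ g = Γ(1-β)⁻¹ (∂/∂t + c(x)) ∫₀ᵗ (t-r)^(-β) exp(-(t-r) c(x)) g(x, r) dr`,
where `c(x) = ρ U(x)`.  The outer `∂/∂t` is moved to the test function. -/
def substPair (β : ℝ) (c : ℝ → ℂ) (g : DistPath) (ψ : ℝ → ℝ → ℂ) : ℂ :=
  ∫ t in Set.Ioi (0 : ℝ), ((Real.Gamma (1 - β))⁻¹ : ℂ) *
    ∫ r in (0 : ℝ)..t, (((t - r) ^ (-β) : ℝ) : ℂ) *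
      g r (fun x => Complex.exp (-((t - r : ℝ) : ℂ) * c x) * (-deriv (ψ x) t + c x * ψ x t))

/-- The defect (left side minus right side, paired with `ψ`) in the `i`-th component of the
forward equation
`Mᵀ ∂ₜG = (Mᵀ - I) diag(B⁻¹) 𝒟^(1-α) G + Mᵀ ∂ₓₓ diag(K) 𝒟^(1-α) G - c(x) Mᵀ G`,
with the initial source `δ(x) δ(t) init`. -/
def forwardDefect {N : ℕ} (M : Matrix (Fin N) (Fin N) ℝ) (init α B K : Fin N → ℝ) (c : ℝ → ℂ)
    (G : Fin N → DistPath) (ψ : ℝ → ℝ → ℂ) (i : Fin N) : ℂ :=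
  (∑ j, (M.transpose i j : ℂ) * dtPair (G j) ψ - (init i : ℂ) * ψ 0 0) -
    (∑ j, ((M.transpose - 1) i j : ℂ) * ((B j : ℂ)⁻¹ * substPair (1 - α j) c (G j) ψ) +
      ∑ j, (M.transpose i j : ℂ) * ((K j : ℂ) *
        substPair (1 - α j) c (G j) (fun x t => iteratedDeriv 2 (fun y => ψ y t) x)) -
      ∑ j, (M.transpose i j : ℂ) * pair (G j) (fun x t => c x * ψ x t))

/-- The defect in the `i`-th component of the backward equation
`M ∂ₜG = diag(B⁻¹) 𝒟^(1-α) (M - I) G + diag(K) 𝒟^(1-α) M ∂ₓₓG - c(x) M G`,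
with the initial value `G = (1, …, 1)` at `t = 0`. -/
def backwardDefect {N : ℕ} (M : Matrix (Fin N) (Fin N) ℝ) (α B K : Fin N → ℝ) (c : ℝ → ℂ)
    (G : Fin N → DistPath) (ψ : ℝ → ℝ → ℂ) (i : Fin N) : ℂ :=
  (dtPair (act M G i) ψ - ∫ x : ℝ, ψ x 0) -
    ((B i : ℂ)⁻¹ * substPair (1 - α i) c (act (M - 1) G i) ψ +
      (K i : ℂ) * substPair (1 - α i) c (act M (fun j => dxx (G j)) i) ψ -
      pair (act M G i) (fun x t => c x * ψ x t))

/-- The defect in the `i`-th component of the backward equation after the substantial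
fractional integral of order `1 - α i` (the left inverse of `𝒟^(1-α i)`) has been applied to it,
`𝒟^α M G - t^(-α) exp(-t c(x)) / Γ(1-α) = B⁻¹ (M - I) G + K ∂ₓₓ M G`.
No derivative of `c` occurs in it. -/
def backwardIntegratedDefect {N : ℕ} (M : Matrix (Fin N) (Fin N) ℝ) (α B K : Fin N → ℝ)
    (c : ℝ → ℂ) (G : Fin N → DistPath) (ψ : ℝ → ℝ → ℂ) (i : Fin N) : ℂ :=
  (substPair (α i) c (act M G i) ψ -
      ∫ t in Set.Ioi (0 : ℝ), ((Real.Gamma (1 - α i))⁻¹ : ℂ) * ((t ^ (-α i) : ℝ) : ℂ) *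
        ∫ x : ℝ, Complex.exp (-(t : ℂ) * c x) * ψ x t) -
    ((B i : ℂ)⁻¹ * pair (act (M - 1) G i) ψ + (K i : ℂ) * pair (dxx (act M G i)) ψ)

/-- The error `φ(s) - (1 - b s^a)` in the power-law form of the Laplace transform of `μ`. -/
def laplaceError (μ : Measure ℝ) (a b : ℝ) (s : ℂ) : ℂ :=
  (∫ t : ℝ, Complex.exp (-s * t) ∂μ) - (1 - (b : ℂ) * s ^ (a : ℂ))

/-- The waiting-time laws with time in state `i` rescaled by `ε^(1/α i)`, which turns
`1 - B i s^(α i)` into `1 - ε B i s^(α i)`. -/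
def scaledWait {N : ℕ} (α : Fin N → ℝ) (μ : Fin N → Measure ℝ) (ε : ℝ) (i : Fin N) : Measure ℝ :=
  (μ i).map (fun t => ε ^ (1 / α i) * t)

end FcP

end

/-!
The law of a walk on path space is determined by its values on cylinders (`IsChainLaw.unique`), so
all walks may be replaced by the canonical family `P a` of path laws started in the state `a`.
A walk forgets its past at the first jump (`IsChainFamily.map_consPath`), and every expectation
below splits there: a contribution of the first waiting time, during which position and state are
constant, plus the expectation after the jump.

*Multipliers.*  A test function is a superposition `mode X` of exponentials in time whose symbol
`X` decays faster than any power (`IsTest.eq_mode`).  With `z` the Laplace variable shifted by the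
rate `c(x)`, the operators in time become multipliers of the symbol: the substantial derivative is
`z`, the fractional integral of order `1 - β` is `z^(β - 1)`, a waiting time is its Laplace
transform `φ(z)`, and the first sojourn is `(1 - φ(z)) / z`.  Writing
`1 - φ(z) = b z^α (1 - kappa(z))` with `b = ε B`, the first sojourn of the fractional derivative
of `ψ` gives `b ψ` up to `kappa`.  The power law, which is assumed only near `0`, bounds `kappa` on
the whole half plane `Re z ≥ 1` by `o(1)` times a power of `|z|` (by `o(ε) |z|²` under the sharper
power law), and the decay of the symbols absorbs the growth (`eventually_norm_mode_kappa_le`).  No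
inversion of Laplace transforms of the unknown functions is needed.

*Forward equation.*  Contract the equation with a state vector `w` and move all operators to the
test function: the defect is the expectation over the initial state of the value function of
`forwardTest`, minus its expected value `w ⊗ ψ` (`Walk.sum_forwardDefect_eq`).  The first-step
equation of the difference (`IsTest.value_sub_stepOp_eq`) has a source made of the term with
`M w - w` times `kappa`, of terms with the jump variance times `o(1)`, and of the Taylor remainder
of the jump, of order `ε^(3/2)`.  The one-step operator contracts by `1 - k ε`, because one rescaled
waiting time damps by that much, so the difference is at most the source divided by `k ε`
(`IsDamped.norm_le_of_sub_stepOp`).  The terms with the jump variance always survive this division.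
The term with `M w - w` survives it under the sharper power law, vanishes for `w = (1, …, 1)` since
`M` is stochastic, and otherwise is `o(1)` only after multiplication with `ε`.

*Backward equation.*  For a fixed starting point, the renewal equation pairs the backward functions
with one arbitrary function of time (`setIntegral_startMean_mul`).  Divided by `b`, it contains
`b⁻¹ (M G - G)`, the jump term `b⁻¹ (γ_s * M G - M G)`, where `γ_s` is the Gaussian law of a jump,
and errors that are linear in `kappa` without any loss of `ε` (`eventually_norm_renewal_le`).
Pairing with the fractional derivative of `ψ` gives the equation itself, pairing with `ψ` gives its
fractional integral.  The backward functions have no known smoothness in space, so the diffusion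
approximation of the jump term is made on the test side, where two derivatives of `U` are enough
(`norm_integral_gaussian_sub_le`), and replacing `γ_s * M G` by `M G` in the term of order one uses
the continuity of translations in `L¹` (`IsDampedOn.eventually_norm_boxPair_sub_le`).

The law of the walk is affine in its initial distribution (`IsChainLaw.eq_sum`), which gives the
mixture formula for the law of the functional.
-/

noncomputable section

namespace FcP

/-! ### The law of the walk on path space -/

section

/-- The space of trajectories: the `k`-th entry holds the `k`-th internal state, waiting time and
jump. -/
abbrev Path (N : ℕ) := ℕ → Fin N × ℝ × ℝ

/-- The cylinder of paths with prescribed states and with waiting times and jumps in prescribed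
sets, up to step `n`. -/
def cyl {N : ℕ} (n : ℕ) (i : ℕ → Fin N) (S C : ℕ → Set ℝ) : Set (Path N) :=
  {p | ∀ k ≤ n, (p k).1 = i k ∧ (p k).2.1 ∈ S k ∧ (p k).2.2 ∈ C k}

/-- `Q` is the law on path space of a walk with transition matrix `M`, initial distribution `init`,
waiting-time laws `μ` and jump variance `s`: it has the prescribed values on cylinders. -/
def IsChainLaw {N : ℕ} (M : Matrix (Fin N) (Fin N) ℝ) (init : Fin N → ℝ)
    (μ : Fin N → Measure ℝ) (s : ℝ≥0) (Q : Measure (Path N)) : Prop :=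
  ∀ (n : ℕ) (i : ℕ → Fin N) (S C : ℕ → Set ℝ),
    (∀ k, MeasurableSet (S k)) → (∀ k, MeasurableSet (C k)) →
    Q (cyl n i S C) =
      ENNReal.ofReal (init (i 0) * ∏ k ∈ Finset.range n, M (i k) (i (k + 1))) *
        ∏ k ∈ Finset.range (n + 1), μ (i k) (S k) * gaussianReal 0 s (C k)

variable {N : ℕ} {M : Matrix (Fin N) (Fin N) ℝ} {init : Fin N → ℝ}
  {μ : Fin N → Measure ℝ} {s : ℝ≥0}

/-- The trajectory of a walk. -/
def Walk.path (F : Walk M init μ s) (w : F.Ω) : Path N :=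
  fun k => (F.state k w, F.wait k w, F.jump k w)

lemma Walk.measurable_path (F : Walk M init μ s) : Measurable F.path :=
  measurable_pi_lambda _ fun k =>
    (F.measurable_state k).prodMk ((F.measurable_wait k).prodMk (F.measurable_jump k))

lemma measurableSet_cyl (n : ℕ) (i : ℕ → Fin N) {S C : ℕ → Set ℝ}
    (hS : ∀ k, MeasurableSet (S k)) (hC : ∀ k, MeasurableSet (C k)) :
    MeasurableSet (cyl n i S C) := by
  have : cyl n i S C = ⋂ k, ⋂ (_ : k ≤ n), (fun p : Path N => p k) ⁻¹' ({i k} ×ˢ (S k ×ˢ C k)) := by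
    ext p; simp [cyl]
  rw [this]
  refine MeasurableSet.iInter fun k => MeasurableSet.iInter fun _ => ?_
  exact (measurable_pi_apply k) ((measurableSet_singleton _).prod ((hS k).prod (hC k)))

/-- The law of the trajectory of a walk. -/
def Walk.pathLaw (F : Walk M init μ s) : Measure (Path N) := F.P.map F.path

lemma Walk.isChainLaw (F : Walk M init μ s) : IsChainLaw M init μ s F.pathLaw := by
  intro n i S C hS hC
  rw [Walk.pathLaw, Measure.map_apply F.measurable_path (measurableSet_cyl n i hS hC)]
  exact F.law n i S C hS hC

lemma IsChainLaw.measure_univ [∀ i, IsProbabilityMeasure (μ i)] {Q : Measure (Path N)}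
    (h : IsChainLaw M init μ s Q) : Q Set.univ = ∑ i, ENNReal.ofReal (init i) := by
  have hU : (Set.univ : Set (Path N)) =
      ⋃ i ∈ (Finset.univ : Finset (Fin N)), cyl 0 (fun _ => i) (fun _ => Set.univ)
        (fun _ => Set.univ) := by
    ext p; simp [cyl]
  rw [hU, measure_biUnion_finset]
  · refine Finset.sum_congr rfl fun i _ => ?_
    rw [h 0 _ _ _ (fun _ => MeasurableSet.univ) (fun _ => MeasurableSet.univ)]
    simp
  · intro a _ b _ hab
    refine Set.disjoint_left.2 fun p hp hp' => hab ?_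
    exact ((hp 0 le_rfl).1).symm.trans (hp' 0 le_rfl).1
  · exact fun i _ => measurableSet_cyl _ _ (fun _ => MeasurableSet.univ) fun _ => MeasurableSet.univ

/-- The cylinders with measurable bases. -/
def cylinderSets (N : ℕ) : Set (Set (Path N)) :=
  {A | ∃ n i S C, (∀ k, MeasurableSet (S k)) ∧ (∀ k, MeasurableSet (C k)) ∧ A = cyl n i S C}

lemma isPiSystem_cylinderSets : IsPiSystem (cylinderSets N) := by
  classical
  rintro _ ⟨n, i, S, C, hS, hC, rfl⟩ _ ⟨n', i', S', C', hS', hC', rfl⟩ ⟨q, hq, hq'⟩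
  refine ⟨max n n', fun k => (q k).1,
    fun k => (if k ≤ n then S k else Set.univ) ∩ (if k ≤ n' then S' k else Set.univ),
    fun k => (if k ≤ n then C k else Set.univ) ∩ (if k ≤ n' then C' k else Set.univ), ?_, ?_, ?_⟩
  · intro k
    refine MeasurableSet.inter ?_ ?_ <;> split_ifs <;> simp [hS, hS']
  · intro k
    refine MeasurableSet.inter ?_ ?_ <;> split_ifs <;> simp [hC, hC']
  · ext p
    constructor
    · rintro ⟨hp, hp'⟩ k hk
      by_cases h1 : k ≤ n
      · by_cases h2 : k ≤ n'
        · have e := hp k h1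
          have e' := hp' k h2
          simp only [h1, h2, if_true]
          exact ⟨e.1.trans (hq k h1).1.symm, ⟨e.2.1, e'.2.1⟩, e.2.2, e'.2.2⟩
        · have e := hp k h1
          simp only [h1, h2, if_true, if_false]
          exact ⟨e.1.trans (hq k h1).1.symm, ⟨e.2.1, trivial⟩, e.2.2, trivial⟩
      · have h2 : k ≤ n' := by omega
        have e := hp' k h2
        simp only [h1, h2, if_true, if_false]
        exact ⟨e.1.trans (hq' k h2).1.symm, ⟨trivial, e.2.1⟩, trivial, e.2.2⟩
    · intro hp
      refine ⟨fun k h1 => ?_, fun k h1 => ?_⟩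
      · have e := hp k (h1.trans (le_max_left _ _))
        simp only [h1, if_true] at e
        exact ⟨e.1.trans (hq k h1).1, e.2.1.1, e.2.2.1⟩
      · have e := hp k (h1.trans (le_max_right _ _))
        simp only [h1, if_true] at e
        exact ⟨e.1.trans (hq' k h1).1, e.2.1.2, e.2.2.2⟩

lemma generateFrom_cylinderSets :
    (inferInstance : MeasurableSpace (Path N)) = MeasurableSpace.generateFrom (cylinderSets N) := by
  classical
  refine le_antisymm ?_ (MeasurableSpace.generateFrom_le ?_)
  · refine iSup_le fun k => ?_
    -- the coordinate `k` is measurable for the generated σ-algebra since a rectangle in it is a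
    -- finite union of cylinders of length `k`
    have key : ∀ (j : Fin N) (S C : Set ℝ), MeasurableSet S → MeasurableSet C →
        MeasurableSet[MeasurableSpace.generateFrom (cylinderSets N)]
          {p : Path N | (p k).1 = j ∧ (p k).2.1 ∈ S ∧ (p k).2.2 ∈ C} := by
      intro j S C hS hC
      have : {p : Path N | (p k).1 = j ∧ (p k).2.1 ∈ S ∧ (p k).2.2 ∈ C} =
          ⋃ v : Fin k → Fin N, cyl k (fun l => if h : l < k then v ⟨l, h⟩ else j)
            (fun l => if l < k then Set.univ else S) (fun l => if l < k then Set.univ else C) := by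
        ext p
        simp only [cyl, Set.mem_ofPred_eq, Set.mem_iUnion]
        constructor
        · intro hp
          refine ⟨fun l => (p l).1, fun l hl => ?_⟩
          by_cases h : l < k
          · simp [h]
          · obtain rfl : l = k := by omega
            simpa using hp
        · rintro ⟨v, hv⟩
          simpa using hv k le_rfl
      rw [this]
      refine MeasurableSet.iUnion fun v => MeasurableSpace.measurableSet_generateFrom
        ⟨k, _, _, _, fun l => ?_, fun l => ?_, rfl⟩
      · split_ifs <;> simp [hS]
      · split_ifs <;> simp [hC]
    have h1 : Measurable[MeasurableSpace.generateFrom (cylinderSets N)]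
        (fun p : Path N => (p k).1) := by
      refine @measurable_to_countable' _ _ _ _ (_) _ fun j => ?_
      have := key j _ _ MeasurableSet.univ MeasurableSet.univ
      simpa [Set.preimage] using this
    have h2 : Measurable[MeasurableSpace.generateFrom (cylinderSets N)]
        (fun p : Path N => (p k).2.1) := by
      intro S hS
      have : MeasurableSet[MeasurableSpace.generateFrom (cylinderSets N)]
          (⋃ j, {p : Path N | (p k).1 = j ∧ (p k).2.1 ∈ S ∧ (p k).2.2 ∈ Set.univ}) :=
        MeasurableSet.iUnion fun j => key j _ _ hS MeasurableSet.univ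
      convert this using 1
      ext p; simp
    have h3 : Measurable[MeasurableSpace.generateFrom (cylinderSets N)]
        (fun p : Path N => (p k).2.2) := by
      intro S hS
      have : MeasurableSet[MeasurableSpace.generateFrom (cylinderSets N)]
          (⋃ j, {p : Path N | (p k).1 = j ∧ (p k).2.1 ∈ Set.univ ∧ (p k).2.2 ∈ S}) :=
        MeasurableSet.iUnion fun j => key j _ _ MeasurableSet.univ hS
      convert this using 1
      ext p; simp
    exact (h1.prodMk (h2.prodMk h3)).comap_le
  · rintro _ ⟨n, i, S, C, hS, hC, rfl⟩
    exact measurableSet_cyl n i hS hC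

/-- The cylinder formula determines the law of the walk. -/
lemma IsChainLaw.unique [∀ i, IsProbabilityMeasure (μ i)] {Q Q' : Measure (Path N)}
    (h : IsChainLaw M init μ s Q) (h' : IsChainLaw M init μ s Q') : Q = Q' := by
  have : IsFiniteMeasure Q := ⟨by
    rw [h.measure_univ]; exact ENNReal.sum_lt_top.2 fun _ _ => ENNReal.ofReal_lt_top⟩
  refine ext_of_generate_finite _ generateFrom_cylinderSets isPiSystem_cylinderSets ?_
    (by rw [h.measure_univ, h'.measure_univ])
  rintro _ ⟨n, i, S, C, hS, hC, rfl⟩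
  rw [h n i S C hS hC, h' n i S C hS hC]

/-- `P a` is the law of the walk with initial state `a`. -/
def IsChainFamily (M : Matrix (Fin N) (Fin N) ℝ) (μ : Fin N → Measure ℝ) (s : ℝ≥0)
    (P : Fin N → Measure (Path N)) : Prop :=
  ∀ a, IsChainLaw M (Pi.single a 1) μ s (P a)

lemma IsChainFamily.isProbabilityMeasure [∀ i, IsProbabilityMeasure (μ i)]
    {P : Fin N → Measure (Path N)} (h : IsChainFamily M μ s P) (a : Fin N) :
    IsProbabilityMeasure (P a) := by
  classical
  refine ⟨?_⟩
  rw [(h a).measure_univ, Finset.sum_eq_single a]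
  · simp
  · intro b _ hb; simp [hb]
  · simp

/-- The law of the walk with a general initial distribution is a mixture. -/
lemma IsChainLaw.eq_sum [∀ i, IsProbabilityMeasure (μ i)] {Q : Measure (Path N)}
    {P : Fin N → Measure (Path N)} (hinit : ∀ i, 0 ≤ init i)
    (h : IsChainLaw M init μ s Q) (hP : IsChainFamily M μ s P) :
    Q = ∑ a, ENNReal.ofReal (init a) • P a := by
  classical
  refine h.unique fun n i S C hS hC => ?_
  rw [Measure.finsetSum_apply, Finset.sum_eq_single (i 0)]
  · rw [Measure.smul_apply, hP _ n i S C hS hC, smul_eq_mul, ← mul_assoc,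
      ← ENNReal.ofReal_mul (hinit _)]
    simp
  · intro b _ hb
    rw [Measure.smul_apply, hP _ n i S C hS hC]
    simp [Ne.symm hb]
  · simp

/-- The path with first state `a`, first waiting time and jump `q`, and continuation `p`. -/
def consPath (a : Fin N) (q : ℝ × ℝ) (p : Path N) : Path N
  | 0 => (a, q)
  | k + 1 => p k

lemma measurable_consPath (a : Fin N) :
    Measurable (fun r : (ℝ × ℝ) × Path N => consPath a r.1 r.2) := by
  refine measurable_pi_lambda _ fun k => ?_
  cases k with
  | zero => exact measurable_const.prodMk measurable_fst
  | succ k => exact (measurable_pi_apply k).comp measurable_snd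

/-- The first step: waiting time and jump are independent, and the path after the first jump is a
walk that starts in a state drawn from the row `a` of `M`. -/
lemma IsChainFamily.map_consPath [∀ i, IsProbabilityMeasure (μ i)]
    (hM : M ∈ Matrix.rowStochastic ℝ (Fin N)) {P : Fin N → Measure (Path N)}
    (h : IsChainFamily M μ s P) (a : Fin N) :
    P a = (((μ a).prod (gaussianReal 0 s)).prod (∑ b, ENNReal.ofReal (M a b) • P b)).map
      (fun r => consPath a r.1 r.2) := by
  classical
  have := h.isProbabilityMeasure
  have hsum : ∑ b, ENNReal.ofReal (M a b) = 1 := by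
    rw [← ENNReal.ofReal_sum_of_nonneg fun b _ => hM.1 a b]
    have := congrFun hM.2 a
    simp only [Matrix.mulVec, dotProduct, Pi.one_apply, mul_one] at this
    rw [this]; simp
  refine (h a).unique fun n i S C hS hC => ?_
  have hfin : IsFiniteMeasure (∑ b, ENNReal.ofReal (M a b) • P b) := ⟨by
    simp [Measure.finsetSum_apply, hsum]⟩
  rw [Measure.map_apply (measurable_consPath a) (measurableSet_cyl n i hS hC)]
  -- the preimage of a cylinder is a rectangle times the cylinder shifted by one step
  have hpre : (fun r : (ℝ × ℝ) × Path N => consPath a r.1 r.2) ⁻¹' cyl n i S C =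
      if a = i 0 then (S 0 ×ˢ C 0) ×ˢ (if n = 0 then Set.univ else
        cyl (n - 1) (fun k => i (k + 1)) (fun k => S (k + 1)) (fun k => C (k + 1))) else ∅ := by
    ext ⟨q, p⟩
    by_cases ha : a = i 0
    · rw [if_pos ha]
      simp only [Set.mem_preimage, cyl, Set.mem_ofPred_eq, Set.mem_prod]
      constructor
      · intro hp
        refine ⟨⟨(hp 0 (Nat.zero_le _)).2.1, (hp 0 (Nat.zero_le _)).2.2⟩, ?_⟩
        split_ifs with hn
        · trivial
        · exact fun k hk => hp (k + 1) (by omega)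
      · rintro ⟨hq, hp⟩ k hk
        cases k with
        | zero => exact ⟨ha, hq.1, hq.2⟩
        | succ k =>
          rw [if_neg (by omega)] at hp
          exact hp k (by omega)
    · rw [if_neg ha]
      simp only [Set.mem_preimage, cyl, Set.mem_ofPred_eq, Set.mem_empty_iff_false, iff_false]
      exact fun hp => ha (hp 0 (Nat.zero_le _)).1
  rw [hpre]
  split_ifs with ha hn
  · subst hn
    rw [Measure.prod_prod, Measure.prod_prod]
    simp [Measure.finsetSum_apply, hsum, ← ha]
  · obtain ⟨m, rfl⟩ := Nat.exists_eq_succ_of_ne_zero hn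
    rw [Measure.prod_prod, Measure.prod_prod, Measure.finsetSum_apply,
      Finset.sum_eq_single (i 1)]
    · rw [Measure.smul_apply, Nat.succ_sub_one,
        h _ m _ _ _ (fun k => hS (k + 1)) (fun k => hC (k + 1)), smul_eq_mul,
        Nat.succ_eq_add_one, Finset.prod_range_succ' _ (m + 1), Finset.prod_range_succ' _ m, ha]
      simp only [Pi.single_eq_same, one_mul, zero_add]
      have hpr : ∏ k ∈ Finset.range (m + 1), M (i k) (i (k + 1)) =
          M (i 0) (i 1) * ∏ k ∈ Finset.range m, M (i (k + 1)) (i (k + 1 + 1)) := by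
        rw [Finset.prod_range_succ', mul_comm]
      rw [hpr, ENNReal.ofReal_mul (hM.1 _ _)]
      ring
    · intro b _ hb
      rw [Measure.smul_apply, Nat.succ_sub_one,
        h _ m _ _ _ (fun k => hS (k + 1)) (fun k => hC (k + 1))]
      simp [Ne.symm hb]
    · simp
  · simp [Ne.symm ha]

/-- The first-step decomposition of an expectation. -/
lemma IsChainFamily.integral_eq [∀ i, IsProbabilityMeasure (μ i)]
    (hM : M ∈ Matrix.rowStochastic ℝ (Fin N)) {P : Fin N → Measure (Path N)}
    (h : IsChainFamily M μ s P) (a : Fin N) {f : Path N → ℂ} (hf : Measurable f)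
    {K : ℝ} (hK : ∀ p, ‖f p‖ ≤ K) :
    ∫ p, f p ∂(P a) = ∫ w, ∫ y, ∑ b, (M a b : ℂ) * ∫ p, f (consPath a (w, y) p) ∂(P b)
      ∂(gaussianReal 0 s) ∂(μ a) := by
  have := h.isProbabilityMeasure
  have hint : ∀ (ν : Measure (Path N)) [IsFiniteMeasure ν], Integrable f ν := fun ν _ =>
    Integrable.of_bound hf.aestronglyMeasurable K (Eventually.of_forall hK)
  have hfin : IsFiniteMeasure (∑ b, ENNReal.ofReal (M a b) • P b) := ⟨by
    simp only [Measure.finsetSum_apply, Measure.smul_apply, measure_univ, smul_eq_mul, mul_one]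
    exact ENNReal.sum_lt_top.2 fun _ _ => ENNReal.ofReal_lt_top⟩
  have hcm := hf.comp (measurable_consPath a)
  have hci : ∀ (ν : Measure ((ℝ × ℝ) × Path N)) [IsFiniteMeasure ν],
      Integrable (fun r => f (consPath a r.1 r.2)) ν := fun ν _ =>
    Integrable.of_bound hcm.aestronglyMeasurable K (Eventually.of_forall fun _ => hK _)
  conv_lhs => rw [h.map_consPath hM a]
  rw [integral_map (measurable_consPath a).aemeasurable hf.aestronglyMeasurable,
    integral_prod _ (hci _), integral_prod _ (hci _).integral_prod_left]
  refine integral_congr_ae (Eventually.of_forall fun w => ?_)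
  refine integral_congr_ae (Eventually.of_forall fun y => ?_)
  have hcw : ∀ (ν : Measure (Path N)) [IsFiniteMeasure ν],
      Integrable (fun p => f (consPath a (w, y) p)) ν := fun ν _ =>
    Integrable.of_bound (hcm.comp (measurable_const.prodMk measurable_id)).aestronglyMeasurable K
      (Eventually.of_forall fun _ => hK _)
  dsimp only
  have hsm : ∀ b, IsFiniteMeasure (ENNReal.ofReal (M a b) • P b) := fun b =>
    ⟨by simp⟩
  rw [integral_finsetSum_measure fun b _ => hcw _]
  refine Finset.sum_congr rfl fun b _ => ?_
  rw [integral_smul_measure, ENNReal.toReal_ofReal (hM.1 a b), Complex.real_smul]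

end

/-! ### Functionals of a trajectory -/

section
variable {N : ℕ} {M : Matrix (Fin N) (Fin N) ℝ} {init : Fin N → ℝ}
  {μ : Fin N → Measure ℝ} {s : ℝ≥0}

/-- The time of the `n`-th renewal of a path. -/
def pathTime (n : ℕ) (p : Path N) : ℝ := ∑ k ∈ Finset.range n, (p k).2.1

/-- The number of renewals of a path up to time `t`. -/
def pathCount (t : ℝ) (p : Path N) : ℕ := sInf {n : ℕ | t < pathTime (n + 1) p}

/-- The position at time `t` along a path that starts at `x`. -/
def pathPos (x t : ℝ) (p : Path N) : ℝ := x + ∑ k ∈ Finset.range (pathCount t p), (p k).2.2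

/-- The internal state at time `t` along a path. -/
def pathState (t : ℝ) (p : Path N) : Fin N := (p (pathCount t p)).1

/-- The functional `∫₀ᵗ U(x(τ)) dτ` along a path that starts at `x`. -/
def pathFun (U : ℝ → ℝ) (x t : ℝ) (p : Path N) : ℝ := ∫ r in (0 : ℝ)..t, U (pathPos x r p)

/-- Infinitely many renewals take infinitely long along the path. -/
def GoodPath (p : Path N) : Prop := ∀ t : ℝ, ∃ n, t < pathTime (n + 1) p

lemma measurable_pathTime (n : ℕ) : Measurable (pathTime n : Path N → ℝ) :=
  Finset.measurable_sum _ fun k _ => (measurable_pi_apply k).snd.fst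

lemma measurable_pathCount : Measurable (fun q : ℝ × Path N => pathCount q.1 q.2) := by
  refine measurable_to_countable' fun n => ?_
  have hm : ∀ m, MeasurableSet {q : ℝ × Path N | q.1 < pathTime (m + 1) q.2} := fun m =>
    measurableSet_lt measurable_fst ((measurable_pathTime _).comp measurable_snd)
  have : (fun q : ℝ × Path N => pathCount q.1 q.2) ⁻¹' {n} =
      ({q | q.1 < pathTime (n + 1) q.2} ∩ ⋂ m, ⋂ (_ : m < n), {q | q.1 < pathTime (m + 1) q.2}ᶜ) ∪
        (if n = 0 then ⋂ m, {q : ℝ × Path N | q.1 < pathTime (m + 1) q.2}ᶜ else ∅) := by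
    ext q
    simp only [Set.mem_preimage, Set.mem_singleton_iff, pathCount, Set.mem_union, Set.mem_inter_iff,
      Set.mem_ofPred_eq, Set.mem_iInter, Set.mem_compl_iff]
    constructor
    · rintro rfl
      by_cases hne : {n : ℕ | q.1 < pathTime (n + 1) q.2}.Nonempty
      · exact Or.inl ⟨Nat.sInf_mem hne, fun m hm => Nat.notMem_of_lt_sInf hm⟩
      · right
        rw [Set.not_nonempty_iff_eq_empty] at hne
        rw [hne, Nat.sInf_empty, if_pos rfl]
        simp only [Set.mem_iInter]
        intro m hm
        have : m ∈ {n : ℕ | q.1 < pathTime (n + 1) q.2} := hm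
        rw [hne] at this
        exact this
    · rintro (⟨h1, h2⟩ | h)
      · refine le_antisymm (Nat.sInf_le h1) ?_
        by_contra hlt
        exact h2 _ (not_le.1 hlt)
          (Nat.sInf_mem (s := {n : ℕ | q.1 < pathTime (n + 1) q.2}) ⟨n, h1⟩)
      · split_ifs at h with hn
        · have : {n : ℕ | q.1 < pathTime (n + 1) q.2} = ∅ := by
            ext m
            simp only [Set.mem_iInter] at h
            simpa using h m
          rw [this, Nat.sInf_empty, hn]
        · exact absurd h (by simp)
  rw [this]
  refine MeasurableSet.union ((hm n).inter ?_) ?_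
  · exact MeasurableSet.iInter fun m => MeasurableSet.iInter fun _ => (hm m).compl
  · split_ifs
    · exact MeasurableSet.iInter fun m => (hm m).compl
    · simp

lemma Measurable.comp_nat {α β : Type*} [MeasurableSpace α] [MeasurableSpace β]
    {f : ℕ → α → β} (hf : ∀ n, Measurable (f n)) {g : α → ℕ} (hg : Measurable g) :
    Measurable (fun a => f (g a) a) := by
  have : Measurable (fun q : ℕ × α => f q.1 q.2) := measurable_from_prod_countable_right hf
  exact this.comp (hg.prodMk measurable_id)

lemma measurable_pathPos :
    Measurable (fun q : ℝ × ℝ × Path N => pathPos q.1 q.2.1 q.2.2) := by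
  refine measurable_fst.add ?_
  exact Measurable.comp_nat (f := fun n q => ∑ k ∈ Finset.range n, (q.2.2 k).2.2)
    (fun n => Finset.measurable_sum _ fun k _ => by
      have : Measurable fun q : ℝ × ℝ × Path N => q.2.2 k :=
        (measurable_pi_apply k).comp measurable_snd.snd
      exact this.snd.snd)
    (measurable_pathCount.comp measurable_snd)

lemma measurable_pathState : Measurable (fun q : ℝ × Path N => pathState q.1 q.2) :=
  Measurable.comp_nat (f := fun n q => (q.2 n).1)
    (fun n => ((measurable_pi_apply n).comp measurable_snd).fst) measurable_pathCount

lemma measurable_pathFun {U : ℝ → ℝ} (hU : Measurable U) :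
    Measurable (fun q : ℝ × ℝ × Path N => pathFun U q.1 q.2.1 q.2.2) := by
  have h : ∀ f g : ℝ × ℝ × Path N → ℝ, Measurable f → Measurable g →
      Measurable fun q => ∫ r in Set.Ioc (f q) (g q), U (pathPos q.1 r q.2.2) := by
    intro f g hf hg
    have h1 : ∀ q : ℝ × ℝ × Path N, ∫ r in Set.Ioc (f q) (g q), U (pathPos q.1 r q.2.2) =
        ∫ r, (Set.Ioc (f q) (g q)).indicator (fun r => U (pathPos q.1 r q.2.2)) r := fun q =>
      (integral_indicator measurableSet_Ioc).symm
    simp_rw [h1]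
    refine (StronglyMeasurable.integral_prod_right
      (f := fun q r => (Set.Ioc (f q) (g q)).indicator (fun r => U (pathPos q.1 r q.2.2)) r)
      (Measurable.stronglyMeasurable ?_)).measurable
    have h2 : (Function.uncurry fun (q : ℝ × ℝ × Path N) (r : ℝ) =>
        (Set.Ioc (f q) (g q)).indicator (fun r => U (pathPos q.1 r q.2.2)) r) =
        {z : (ℝ × ℝ × Path N) × ℝ | f z.1 < z.2 ∧ z.2 ≤ g z.1}.indicator
          (fun z => U (pathPos z.1.1 z.2 z.1.2.2)) := by
      ext z; simp [Set.indicator, Function.uncurry]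
    rw [h2]
    refine Measurable.indicator ?_ ?_
    · exact hU.comp (measurable_pathPos.comp
        (measurable_fst.fst.prodMk (measurable_snd.prodMk measurable_fst.snd.snd)))
    · exact (measurableSet_lt (hf.comp measurable_fst) measurable_snd).inter
        (measurableSet_le measurable_snd (hg.comp measurable_fst))
  unfold pathFun intervalIntegral
  exact (h _ _ measurable_const measurable_snd.fst).sub (h _ _ measurable_snd.fst measurable_const)

/-! #### The first renewal along a path -/

lemma pathTime_succ_cons (n : ℕ) (a : Fin N) (w y : ℝ) (p : Path N) :
    pathTime (n + 1) (consPath a (w, y) p) = w + pathTime n p := by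
  rw [pathTime, Finset.sum_range_succ', add_comm]
  rfl

lemma pathCount_cons_of_lt {t w : ℝ} (h : t < w) (a : Fin N) (y : ℝ) (p : Path N) :
    pathCount t (consPath a (w, y) p) = 0 := by
  refine Nat.sInf_eq_zero.2 (Or.inl ?_)
  rw [Set.mem_ofPred_eq, pathTime_succ_cons]
  simpa [pathTime] using h

lemma pathCount_cons_of_le {t w : ℝ} (h : w ≤ t) (a : Fin N) (y : ℝ) {p : Path N}
    (hp : GoodPath p) : pathCount t (consPath a (w, y) p) = pathCount (t - w) p + 1 := by
  have hS : {n : ℕ | t - w < pathTime (n + 1) p}.Nonempty := hp (t - w)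
  have hmem : t < pathTime (sInf {n : ℕ | t - w < pathTime (n + 1) p} + 1 + 1)
      (consPath a (w, y) p) := by
    have := Nat.sInf_mem hS
    rw [Set.mem_ofPred_eq] at this
    rw [pathTime_succ_cons]; linarith
  refine le_antisymm (Nat.sInf_le hmem) ?_
  refine le_csInf ⟨_, hmem⟩ fun n hn => ?_
  rw [Set.mem_ofPred_eq, pathTime_succ_cons] at hn
  cases n with
  | zero => simp [pathTime] at hn; linarith
  | succ n =>
    refine Nat.succ_le_succ (Nat.sInf_le ?_)
    rw [Set.mem_ofPred_eq]; linarith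

lemma pathPos_cons_of_lt {t w : ℝ} (h : t < w) (x : ℝ) (a : Fin N) (y : ℝ) (p : Path N) :
    pathPos x t (consPath a (w, y) p) = x := by
  simp [pathPos, pathCount_cons_of_lt h]

lemma pathState_cons_of_lt {t w : ℝ} (h : t < w) (a : Fin N) (y : ℝ) (p : Path N) :
    pathState t (consPath a (w, y) p) = a := by
  simp [pathState, pathCount_cons_of_lt h, consPath]

lemma pathPos_cons_of_le {t w : ℝ} (h : w ≤ t) (x : ℝ) (a : Fin N) (y : ℝ) {p : Path N}
    (hp : GoodPath p) : pathPos x t (consPath a (w, y) p) = pathPos (x + y) (t - w) p := by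
  rw [pathPos, pathCount_cons_of_le h a y hp, Finset.sum_range_succ', pathPos]
  simp only [consPath]; ring

lemma pathState_cons_of_le {t w : ℝ} (h : w ≤ t) (a : Fin N) (y : ℝ) {p : Path N}
    (hp : GoodPath p) : pathState t (consPath a (w, y) p) = pathState (t - w) p := by
  rw [pathState, pathCount_cons_of_le h a y hp, pathState]; rfl

lemma GoodPath.cons {p : Path N} (hp : GoodPath p) (a : Fin N) (w y : ℝ) :
    GoodPath (consPath a (w, y) p) := fun t => by
  obtain ⟨n, hn⟩ := hp (t - w)
  exact ⟨n + 1, by rw [pathTime_succ_cons]; linarith⟩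

/-- Up to any fixed time a good path visits finitely many positions, so that `U` is integrable
along it. -/
lemma GoodPath.intervalIntegrable {U : ℝ → ℝ} (hU : Measurable U) {p : Path N} (hp : GoodPath p)
    (x : ℝ) (t₀ t₁ : ℝ) : IntervalIntegrable (fun r => U (pathPos x r p)) volume t₀ t₁ := by
  obtain ⟨n, hn⟩ := hp (max t₀ t₁)
  have hmeas : Measurable (fun r => U (pathPos x r p)) :=
    hU.comp (measurable_pathPos.comp
      (measurable_const.prodMk (measurable_id.prodMk measurable_const)))
  rw [intervalIntegrable_iff]
  refine Measure.integrableOn_of_bounded (M := ∑ m ∈ Finset.range (n + 1),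
    |U (x + ∑ k ∈ Finset.range m, (p k).2.2)|) (by simp) hmeas.aestronglyMeasurable ?_
  refine (ae_restrict_iff' measurableSet_uIoc).2 (Eventually.of_forall fun r hr => ?_)
  have hc : pathCount r p ≤ n := Nat.sInf_le (lt_of_le_of_lt hr.2 hn)
  exact Finset.single_le_sum (f := fun m => |U (x + ∑ k ∈ Finset.range m, (p k).2.2)|)
    (fun _ _ => abs_nonneg _) (Finset.mem_range.2 (Nat.lt_succ_of_le hc))

lemma pathFun_cons_of_le_wait (U : ℝ → ℝ) {t w : ℝ} (h0 : 0 ≤ t) (h : t ≤ w) (x : ℝ) (a : Fin N)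
    (y : ℝ) (p : Path N) : pathFun U x t (consPath a (w, y) p) = t * U x := by
  have : pathFun U x t (consPath a (w, y) p) = ∫ _ in (0 : ℝ)..t, U x := by
    refine intervalIntegral.integral_congr_ae ?_
    have : ∀ᵐ r : ℝ, r ≠ t := by simp [ae_iff, measure_singleton]
    filter_upwards [this] with r hr hrm
    rw [Set.uIoc_of_le h0] at hrm
    rw [pathPos_cons_of_lt (lt_of_lt_of_le (lt_of_le_of_ne hrm.2 hr) h)]
  rw [this]; simp

lemma pathFun_cons_of_le {U : ℝ → ℝ} (hU : Measurable U) {t w : ℝ} (h0 : 0 ≤ w) (h : w ≤ t)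
    (x : ℝ) (a : Fin N) (y : ℝ) {p : Path N} (hp : GoodPath p) :
    pathFun U x t (consPath a (w, y) p) = w * U x + pathFun U (x + y) (t - w) p := by
  rw [pathFun, ← intervalIntegral.integral_add_adjacent_intervals (b := w)
    ((hp.cons a w y).intervalIntegrable hU x _ _) ((hp.cons a w y).intervalIntegrable hU x _ _)]
  congr 1
  · exact pathFun_cons_of_le_wait U h0 le_rfl x a y p
  · rw [pathFun, ← sub_self w, ← intervalIntegral.integral_comp_sub_right]
    refine intervalIntegral.integral_congr fun r hr => ?_
    rw [Set.uIcc_of_le h] at hr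
    rw [pathPos_cons_of_le hr.1 x a y hp]

/-! #### Almost every path is good -/

/-- Waiting times are positive and there are finitely many states, so one waiting time damps by a
factor `θ < 1` in the mean, whatever the state. -/
lemma exists_lintegral_exp_neg_le [∀ i, IsProbabilityMeasure (μ i)]
    (hpos : ∀ i, μ i (Set.Iic 0) = 0) :
    ∃ θ : ENNReal, θ < 1 ∧ ∀ i, ∫⁻ w, ENNReal.ofReal (Real.exp (-w)) ∂(μ i) ≤ θ := by
  refine ⟨Finset.univ.sup fun i => ∫⁻ w, ENNReal.ofReal (Real.exp (-w)) ∂(μ i), ?_,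
    fun i => Finset.le_sup (f := fun i => ∫⁻ w, ENNReal.ofReal (Real.exp (-w)) ∂(μ i))
      (Finset.mem_univ i)⟩
  rw [Finset.sup_lt_iff (by simp)]
  intro i _
  have hae : ∀ᵐ w ∂(μ i), ENNReal.ofReal (Real.exp (-w)) < 1 := by
    have : ∀ᵐ w ∂(μ i), w ∉ Set.Iic (0 : ℝ) := measure_eq_zero_iff_ae_notMem.1 (hpos i)
    filter_upwards [this] with w hw
    rw [ENNReal.ofReal_lt_one]
    simpa using hw
  have h1 : ∫⁻ w, ENNReal.ofReal (Real.exp (-w)) ∂(μ i) ≤ 1 := by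
    calc _ ≤ ∫⁻ _, 1 ∂(μ i) := lintegral_mono_ae (hae.mono fun w hw => hw.le)
      _ = 1 := by simp
  calc _ < ∫⁻ _, 1 ∂(μ i) := lintegral_strict_mono (IsProbabilityMeasure.ne_zero _)
          aemeasurable_const (ne_top_of_le_ne_top ENNReal.one_ne_top h1) hae
    _ = 1 := by simp

lemma IsChainFamily.lintegral_exp_neg_pathTime_le [∀ i, IsProbabilityMeasure (μ i)]
    (hM : M ∈ Matrix.rowStochastic ℝ (Fin N)) {P : Fin N → Measure (Path N)}
    (h : IsChainFamily M μ s P) {θ : ENNReal}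
    (hθ : ∀ i, ∫⁻ w, ENNReal.ofReal (Real.exp (-w)) ∂(μ i) ≤ θ) (n : ℕ) (a : Fin N) :
    ∫⁻ p, ENNReal.ofReal (Real.exp (-pathTime n p)) ∂(P a) ≤ θ ^ n := by
  have := h.isProbabilityMeasure
  induction n generalizing a with
  | zero => simp [pathTime]
  | succ n ih =>
    have hm : ∀ n, Measurable fun p : Path N => ENNReal.ofReal (Real.exp (-pathTime n p)) :=
      fun n => (Real.measurable_exp.comp (measurable_pathTime n).neg).ennreal_ofReal
    have hfin : IsFiniteMeasure (∑ b, ENNReal.ofReal (M a b) • P b) := ⟨by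
      simp only [Measure.finsetSum_apply, Measure.smul_apply, measure_univ, smul_eq_mul, mul_one]
      exact ENNReal.sum_lt_top.2 fun _ _ => ENNReal.ofReal_lt_top⟩
    have hsum : ∑ b, ENNReal.ofReal (M a b) = 1 := by
      rw [← ENNReal.ofReal_sum_of_nonneg fun b _ => hM.1 a b]
      have := congrFun hM.2 a
      simp only [Matrix.mulVec, dotProduct, Pi.one_apply, mul_one] at this
      rw [this]; simp
    rw [h.map_consPath hM a, lintegral_map (hm _) (measurable_consPath a)]
    have e : ∀ r : (ℝ × ℝ) × Path N,
        ENNReal.ofReal (Real.exp (-pathTime (n + 1) (consPath a r.1 r.2))) =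
        ENNReal.ofReal (Real.exp (-r.1.1)) * ENNReal.ofReal (Real.exp (-pathTime n r.2)) := by
      rintro ⟨⟨w, y⟩, p⟩
      rw [pathTime_succ_cons, ← ENNReal.ofReal_mul (Real.exp_pos _).le, ← Real.exp_add]
      congr 2; ring
    simp_rw [e]
    have hw : Measurable fun q : ℝ => ENNReal.ofReal (Real.exp (-q)) := by fun_prop
    rw [lintegral_prod_mul (f := fun q : ℝ × ℝ => ENNReal.ofReal (Real.exp (-q.1)))
      (hw.comp measurable_fst).aemeasurable (hm n).aemeasurable, pow_succ']
    gcongr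
    · rw [lintegral_prod (fun q : ℝ × ℝ => ENNReal.ofReal (Real.exp (-q.1)))
        (hw.comp measurable_fst).aemeasurable]
      simpa using hθ a
    · rw [lintegral_finsetSum_measure]
      calc _ ≤ ∑ b, ENNReal.ofReal (M a b) * θ ^ n := by
            refine Finset.sum_le_sum fun b _ => ?_
            rw [lintegral_smul_measure, smul_eq_mul]
            gcongr
            exact ih b
        _ = θ ^ n := by rw [← Finset.sum_mul, hsum, one_mul]

/-- Renewals do not accumulate: by Chebyshev's inequality the probability of more than `n` renewals
before time `m` is at most `e^m θ^(n+1)`. -/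
lemma IsChainFamily.ae_goodPath [∀ i, IsProbabilityMeasure (μ i)]
    (hpos : ∀ i, μ i (Set.Iic 0) = 0)
    (hM : M ∈ Matrix.rowStochastic ℝ (Fin N)) {P : Fin N → Measure (Path N)}
    (h : IsChainFamily M μ s P) (a : Fin N) : ∀ᵐ p ∂(P a), GoodPath p := by
  obtain ⟨θ, hθ1, hθ⟩ := exists_lintegral_exp_neg_le hpos
  have key : ∀ m : ℕ, ∀ᵐ p ∂(P a), ∃ n, (m : ℝ) < pathTime (n + 1) p := by
    intro m
    rw [ae_iff]
    have hm : ∀ n, Measurable fun p : Path N => ENNReal.ofReal (Real.exp (-pathTime (n + 1) p)) :=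
      fun n => (Real.measurable_exp.comp (measurable_pathTime (n + 1)).neg).ennreal_ofReal
    have hle : ∀ n : ℕ, P a {p | ¬∃ n, (m : ℝ) < pathTime (n + 1) p} ≤
        ENNReal.ofReal (Real.exp m) * θ ^ (n + 1) := by
      intro n
      have h1 : ∫⁻ p, ENNReal.ofReal (Real.exp m) *
          ENNReal.ofReal (Real.exp (-pathTime (n + 1) p)) ∂(P a) ≤
          ENNReal.ofReal (Real.exp m) * θ ^ (n + 1) := by
        rw [lintegral_const_mul _ (hm n)]
        gcongr
        exact h.lintegral_exp_neg_pathTime_le hM hθ _ _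
      refine le_trans ?_ ((mul_meas_ge_le_lintegral₀ (Measurable.aemeasurable ?_) 1).trans h1)
      · rw [one_mul]
        refine measure_mono fun p hp => ?_
        simp only [Set.mem_ofPred_eq, not_exists, not_lt] at hp ⊢
        rw [← ENNReal.ofReal_mul (Real.exp_pos _).le, ← Real.exp_add, ENNReal.one_le_ofReal]
        exact Real.one_le_exp (by linarith [hp n])
      · exact measurable_const.mul
          (Real.measurable_exp.comp (measurable_pathTime _).neg).ennreal_ofReal
    have hlim : Tendsto (fun n : ℕ => ENNReal.ofReal (Real.exp m) * θ ^ (n + 1)) atTop (𝓝 0) := by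
      have := ENNReal.Tendsto.const_mul (a := ENNReal.ofReal (Real.exp m))
        ((ENNReal.tendsto_pow_atTop_nhds_zero_of_lt_one hθ1).comp (tendsto_add_atTop_nat 1))
        (Or.inr ENNReal.ofReal_ne_top)
      simpa using this
    exact le_antisymm (ge_of_tendsto' hlim hle) zero_le
  filter_upwards [ae_all_iff.2 key] with p hp t
  obtain ⟨m, hm⟩ := exists_nat_ge t
  obtain ⟨n, hn⟩ := hp m
  exact ⟨n, lt_of_le_of_lt hm hn⟩

end

/-! ### The renewal equation -/

section
variable {N : ℕ} {M : Matrix (Fin N) (Fin N) ℝ} {init : Fin N → ℝ}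
  {μ : Fin N → Measure ℝ} {s : ℝ≥0}

/-- A vector of measurable functions of space and time with `‖h j x t‖ ≤ K exp(-b t)`. -/
structure IsDamped (b K : ℝ) (h : Fin N → ℝ → ℝ → ℂ) : Prop where
  measurable : ∀ j, Measurable (fun q : ℝ × ℝ => h j q.1 q.2)
  norm_le : ∀ j x t, ‖h j x t‖ ≤ K * Real.exp (-(b * t))

/-- The weight `exp(-ρ A(t))` of a path. -/
def pathWeight (U : ℝ → ℝ) (ρ : ℂ) (x t : ℝ) (p : Path N) : ℂ :=
  Complex.exp (-ρ * (pathFun U x t p : ℂ))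

/-- The weighted time integral of the test function `h` along a path that starts at time `T`. -/
def pathIntegral (U : ℝ → ℝ) (ρ : ℂ) (h : Fin N → ℝ → ℝ → ℂ) (x T : ℝ) (p : Path N) : ℂ :=
  ∫ t in Set.Ioi (0 : ℝ), pathWeight U ρ x t p * h (pathState t p) (pathPos x t p) (T + t)

/-- The expectation of `pathIntegral` for the walk with initial state `a`. -/
def value (U : ℝ → ℝ) (ρ : ℂ) (P : Fin N → Measure (Path N)) (h : Fin N → ℝ → ℝ → ℂ)
    (a : Fin N) (x T : ℝ) : ℂ := ∫ p, pathIntegral U ρ h x T p ∂(P a)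

/-- The contribution to `value` of the time before the first jump, at a site with rate `c`. -/
def holdInt (μ : Measure ℝ) (c : ℂ) (f : ℝ → ℂ) (T : ℝ) : ℂ :=
  ∫ w, (∫ u in (0 : ℝ)..w, Complex.exp (-(u : ℂ) * c) * f (T + u)) ∂μ

/-- The expectation of `f` after one waiting time, weighted with the rate `c`. -/
def waitShift (μ : Measure ℝ) (c : ℂ) (f : ℝ → ℂ) (T : ℝ) : ℂ :=
  ∫ w, Complex.exp (-(w : ℂ) * c) * f (T + w) ∂μ

/-- The expectation of `v` after a jump and a change of the internal state. -/
def jumpAvg (M : Matrix (Fin N) (Fin N) ℝ) (s : ℝ≥0) (v : Fin N → ℝ → ℝ → ℂ)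
    (a : Fin N) (x T : ℝ) : ℂ :=
  ∫ y, ∑ b, (M a b : ℂ) * v b (x + y) T ∂(gaussianReal 0 s)

/-- The weighted one-step transition operator of the walk. -/
def stepOp (M : Matrix (Fin N) (Fin N) ℝ) (μ : Fin N → Measure ℝ) (s : ℝ≥0) (c : ℝ → ℂ)
    (v : Fin N → ℝ → ℝ → ℂ) (a : Fin N) (x T : ℝ) : ℂ :=
  waitShift (μ a) (c x) (jumpAvg M s v a x) T

lemma setIntegral_Ioi_eq_shift {E : Type*} [NormedAddCommGroup E] [NormedSpace ℝ E]
    (f : ℝ → E) (w : ℝ) : ∫ t in Set.Ioi w, f t = ∫ u in Set.Ioi (0 : ℝ), f (w + u) := by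
  have := (measurePreserving_add_left volume w).setIntegral_preimage_emb
    (measurableEmbedding_addLeft w) f (Set.Ioi w)
  rw [← this]
  congr 2
  ext u; simp

section
variable {U : ℝ → ℝ} {ρ : ℂ} {C : ℝ}

lemma norm_exp_neg_mul_le {c : ℂ} (hc : -C ≤ c.re) {w : ℝ} (hw : 0 ≤ w) :
    ‖Complex.exp (-(w : ℂ) * c)‖ ≤ Real.exp (C * w) := by
  rw [Complex.norm_exp]
  refine Real.exp_le_exp.2 ?_
  simp only [neg_mul, Complex.neg_re, Complex.mul_re, Complex.ofReal_re, Complex.ofReal_im,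
    zero_mul, sub_zero]
  nlinarith

lemma norm_pathWeight_le (hC0 : 0 ≤ C) (hC : ∀ x, -C ≤ (ρ * (U x : ℂ)).re) {t : ℝ} (ht : 0 ≤ t)
    (x : ℝ) (p : Path N) : ‖pathWeight U ρ x t p‖ ≤ Real.exp (C * t) := by
  rw [pathWeight, Complex.norm_exp]
  refine Real.exp_le_exp.2 ?_
  have e : (-ρ * (pathFun U x t p : ℂ)).re = -(ρ.re * pathFun U x t p) := by simp
  rw [e]
  by_cases hi : IntervalIntegrable (fun r => U (pathPos x r p)) volume 0 t
  · have h1 : ∫ _ in (0 : ℝ)..t, -C ≤ ∫ r in (0 : ℝ)..t, ρ.re * U (pathPos x r p) := by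
      refine intervalIntegral.integral_mono_on ht (by simp) (hi.const_mul _) fun r _ => ?_
      simpa using hC (pathPos x r p)
    rw [intervalIntegral.integral_const_mul] at h1
    simp only [intervalIntegral.integral_const, smul_eq_mul, sub_zero] at h1
    rw [pathFun]; linarith
  · rw [pathFun, intervalIntegral.integral_undef hi]
    simpa using mul_nonneg hC0 ht

lemma measurable_pathWeight (hU : Measurable U) :
    Measurable (fun q : ℝ × ℝ × Path N => pathWeight U ρ q.1 q.2.1 q.2.2) :=
  Complex.measurable_exp.comp
    (measurable_const.mul (Complex.measurable_ofReal.comp (measurable_pathFun hU)))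

lemma measurable_state_comp {α : Type*} [MeasurableSpace α] {h : Fin N → α → ℂ}
    (hh : ∀ j, Measurable (h j)) : Measurable (fun q : Fin N × α => h q.1 q.2) :=
  measurable_from_prod_countable_right hh

lemma IsDamped.measurable_integrand {b K : ℝ} {h : Fin N → ℝ → ℝ → ℂ} (hh : IsDamped b K h)
    (hU : Measurable U) : Measurable (fun q : (ℝ × ℝ × Path N) × ℝ =>
      pathWeight U ρ q.1.1 q.2 q.1.2.2 *
        h (pathState q.2 q.1.2.2) (pathPos q.1.1 q.2 q.1.2.2) (q.1.2.1 + q.2)) := by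
  have h1 : Measurable fun q : (ℝ × ℝ × Path N) × ℝ => (q.1.1, q.2, q.1.2.2) :=
    measurable_fst.fst.prodMk (measurable_snd.prodMk measurable_fst.snd.snd)
  refine ((measurable_pathWeight hU).comp h1).mul ?_
  exact (measurable_state_comp hh.measurable).comp
    ((measurable_pathState.comp (measurable_snd.prodMk measurable_fst.snd.snd)).prodMk
      ((measurable_pathPos.comp h1).prodMk (measurable_fst.snd.fst.add measurable_snd)))

lemma IsDamped.measurable_pathIntegral {b K : ℝ} {h : Fin N → ℝ → ℝ → ℂ} (hh : IsDamped b K h)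
    (hU : Measurable U) :
    Measurable (fun q : ℝ × ℝ × Path N => pathIntegral U ρ h q.1 q.2.1 q.2.2) :=
  ((hh.measurable_integrand hU).stronglyMeasurable.integral_prod_right'
    (ν := volume.restrict (Set.Ioi (0 : ℝ)))).measurable

lemma IsDamped.norm_integrand_le {K : ℝ} {h : Fin N → ℝ → ℝ → ℂ} (hh : IsDamped (C + 1) K h)
    (hC0 : 0 ≤ C) (hC : ∀ x, -C ≤ (ρ * (U x : ℂ)).re) (x T : ℝ) {t : ℝ} (ht : 0 ≤ t)
    (p : Path N) :
    ‖pathWeight U ρ x t p * h (pathState t p) (pathPos x t p) (T + t)‖ ≤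
      K * Real.exp (-((C + 1) * T)) * Real.exp (-t) := by
  rw [norm_mul]
  calc _ ≤ Real.exp (C * t) * (K * Real.exp (-((C + 1) * (T + t)))) :=
        mul_le_mul (norm_pathWeight_le hC0 hC ht x p) (hh.norm_le _ _ _) (norm_nonneg _)
          (Real.exp_pos _).le
    _ = K * (Real.exp (C * t) * Real.exp (-((C + 1) * (T + t)))) := by ring
    _ = K * (Real.exp (-((C + 1) * T)) * Real.exp (-t)) := by
        rw [← Real.exp_add, ← Real.exp_add]; congr 2; ring
    _ = _ := by ring

lemma IsDamped.integrableOn_integrand {K : ℝ} {h : Fin N → ℝ → ℝ → ℂ}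
    (hh : IsDamped (C + 1) K h) (hU : Measurable U) (hC0 : 0 ≤ C)
    (hC : ∀ x, -C ≤ (ρ * (U x : ℂ)).re) (x T : ℝ) (p : Path N) :
    IntegrableOn (fun t => pathWeight U ρ x t p * h (pathState t p) (pathPos x t p) (T + t))
      (Set.Ioi 0) := by
  have hm : Measurable
      (fun t => pathWeight U ρ x t p * h (pathState t p) (pathPos x t p) (T + t)) :=
    (hh.measurable_integrand (ρ := ρ) hU).comp (f := fun t : ℝ => ((x, T, p), t))
      (measurable_const.prodMk measurable_id)
  refine Integrable.mono'
    (g := fun t => K * Real.exp (-((C + 1) * T)) * Real.exp (-t))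
    ((integrableOn_exp_neg_Ioi 0).const_mul _) hm.aestronglyMeasurable ?_
  exact (ae_restrict_iff' measurableSet_Ioi).2
    (Eventually.of_forall fun t ht => hh.norm_integrand_le hC0 hC x T (le_of_lt ht) p)

lemma IsDamped.norm_pathIntegral_le {K : ℝ} {h : Fin N → ℝ → ℝ → ℂ}
    (hh : IsDamped (C + 1) K h) (hC0 : 0 ≤ C)
    (hC : ∀ x, -C ≤ (ρ * (U x : ℂ)).re) (x T : ℝ) (p : Path N) :
    ‖pathIntegral U ρ h x T p‖ ≤ K * Real.exp (-((C + 1) * T)) := by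
  have := norm_integral_le_of_norm_le (μ := volume.restrict (Set.Ioi (0 : ℝ)))
    (f := fun t => pathWeight U ρ x t p * h (pathState t p) (pathPos x t p) (T + t))
    (g := fun t => K * Real.exp (-((C + 1) * T)) * Real.exp (-t))
    ((integrableOn_exp_neg_Ioi 0).const_mul _)
    ((ae_restrict_iff' measurableSet_Ioi).2
      (Eventually.of_forall fun t ht => hh.norm_integrand_le hC0 hC x T (le_of_lt ht) p))
  rwa [integral_const_mul, integral_exp_neg_Ioi_zero, mul_one] at this

lemma IsDamped.value [∀ i, IsProbabilityMeasure (μ i)] {P : Fin N → Measure (Path N)}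
    (hP : IsChainFamily M μ s P) {K : ℝ} {h : Fin N → ℝ → ℝ → ℂ}
    (hh : IsDamped (C + 1) K h) (hU : Measurable U) (hC0 : 0 ≤ C)
    (hC : ∀ x, -C ≤ (ρ * (U x : ℂ)).re) : IsDamped (C + 1) K (value U ρ P h) := by
  have := hP.isProbabilityMeasure
  refine ⟨fun a => ?_, fun a x T => ?_⟩
  · have : Measurable (fun q : (ℝ × ℝ) × Path N => pathIntegral U ρ h q.1.1 q.1.2 q.2) :=
      (hh.measurable_pathIntegral (ρ := ρ) hU).comp
        (f := fun q : (ℝ × ℝ) × Path N => (q.1.1, q.1.2, q.2))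
          (measurable_fst.fst.prodMk (measurable_fst.snd.prodMk measurable_snd))
    exact (this.stronglyMeasurable.integral_prod_right' (ν := P a)).measurable
  · have := norm_integral_le_of_norm_le_const (μ := P a)
      (Eventually.of_forall fun p => hh.norm_pathIntegral_le hC0 hC x T p)
    simpa [FcP.value] using this

lemma IsDamped.measurable_time {b K : ℝ} {h : Fin N → ℝ → ℝ → ℂ} (hh : IsDamped b K h)
    (a : Fin N) (x : ℝ) : Measurable (h a x) :=
  (hh.measurable a).comp (f := fun t : ℝ => (x, t)) (measurable_const.prodMk measurable_id)

lemma sum_row (hM : M ∈ Matrix.rowStochastic ℝ (Fin N)) (a : Fin N) : ∑ b, M a b = 1 := by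
  have := congrFun hM.2 a
  simpa only [Matrix.mulVec, dotProduct, Pi.one_apply, mul_one] using this

lemma IsDamped.norm_sum_le (hM : M ∈ Matrix.rowStochastic ℝ (Fin N)) {b K : ℝ}
    {v : Fin N → ℝ → ℝ → ℂ} (hv : IsDamped b K v) (a : Fin N) (x T : ℝ) :
    ‖∑ b, (M a b : ℂ) * v b x T‖ ≤ K * Real.exp (-(b * T)) := by
  calc _ ≤ ∑ b', M a b' * (K * Real.exp (-(b * T))) := by
        refine norm_sum_le_of_le _ fun b' _ => ?_
        rw [norm_mul, Complex.norm_real, Real.norm_of_nonneg (hM.1 a b')]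
        exact mul_le_mul_of_nonneg_left (hv.norm_le _ _ _) (hM.1 a b')
    _ = _ := by rw [← Finset.sum_mul, sum_row hM, one_mul]

lemma IsDamped.measurable_sum {b K : ℝ} {v : Fin N → ℝ → ℝ → ℂ} (hv : IsDamped b K v) (a : Fin N) :
    Measurable fun q : ℝ × ℝ => ∑ b, (M a b : ℂ) * v b q.1 q.2 :=
  Finset.measurable_sum _ fun j _ => measurable_const.mul (hv.measurable j)

lemma IsDamped.integrable_jump (hM : M ∈ Matrix.rowStochastic ℝ (Fin N)) {b K : ℝ}
    {v : Fin N → ℝ → ℝ → ℂ} (hv : IsDamped b K v) (a : Fin N) (x T : ℝ) :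
    Integrable (fun y => ∑ b, (M a b : ℂ) * v b (x + y) T) (gaussianReal 0 s) :=
  Integrable.of_bound ((hv.measurable_sum a).comp (f := fun y : ℝ => (x + y, T))
    ((measurable_const.add measurable_id).prodMk measurable_const)).aestronglyMeasurable _
    (Eventually.of_forall fun y => hv.norm_sum_le hM a (x + y) T)

lemma IsDamped.jumpAvg (hM : M ∈ Matrix.rowStochastic ℝ (Fin N)) {b K : ℝ}
    {v : Fin N → ℝ → ℝ → ℂ} (hv : IsDamped b K v) : IsDamped b K (jumpAvg M s v) := by
  refine ⟨fun a => ?_, fun a x T => ?_⟩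
  · have : Measurable fun q : (ℝ × ℝ) × ℝ => ∑ b, (M a b : ℂ) * v b (q.1.1 + q.2) q.1.2 :=
      (hv.measurable_sum a).comp (f := fun q : (ℝ × ℝ) × ℝ => (q.1.1 + q.2, q.1.2))
        ((measurable_fst.fst.add measurable_snd).prodMk measurable_fst.snd)
    exact (this.stronglyMeasurable.integral_prod_right' (ν := gaussianReal 0 s)).measurable
  · have := norm_integral_le_of_norm_le_const (μ := gaussianReal 0 s)
      (Eventually.of_forall fun y => hv.norm_sum_le hM a (x + y) T)
    simpa [FcP.jumpAvg] using this

section OneVariable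

variable {ν : Measure ℝ} {c : ℂ} {f : ℝ → ℂ} {K : ℝ}

lemma norm_shift_le (hc : -C ≤ c.re) (hf : ∀ t, ‖f t‖ ≤ K * Real.exp (-((C + 1) * t)))
    (T : ℝ) {w : ℝ} (hw : 0 ≤ w) :
    ‖Complex.exp (-(w : ℂ) * c) * f (T + w)‖ ≤
      K * Real.exp (-((C + 1) * T)) * Real.exp (-w) := by
  rw [norm_mul]
  calc _ ≤ Real.exp (C * w) * (K * Real.exp (-((C + 1) * (T + w)))) :=
        mul_le_mul (norm_exp_neg_mul_le hc hw) (hf _) (norm_nonneg _) (Real.exp_pos _).le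
    _ = K * (Real.exp (C * w) * Real.exp (-((C + 1) * (T + w)))) := by ring
    _ = K * (Real.exp (-((C + 1) * T)) * Real.exp (-w)) := by
        rw [← Real.exp_add, ← Real.exp_add]; congr 2; ring
    _ = _ := by ring

lemma ae_pos_of_measure_Iic (hpos : ν (Set.Iic 0) = 0) : ∀ᵐ w ∂ν, 0 < w := by
  filter_upwards [measure_eq_zero_iff_ae_notMem.1 hpos] with w hw
  simpa using hw

lemma integrable_exp_neg_of_pos [IsFiniteMeasure ν] (hpos : ν (Set.Iic 0) = 0) :
    Integrable (fun w => Real.exp (-w)) ν :=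
  Integrable.of_bound (by fun_prop) 1 ((ae_pos_of_measure_Iic hpos).mono fun w hw => by
    rw [Real.norm_of_nonneg (Real.exp_pos _).le]
    exact Real.exp_le_one_iff.2 (by linarith))

lemma measurable_shift (hf : Measurable f) (T : ℝ) :
    Measurable fun w : ℝ => Complex.exp (-(w : ℂ) * c) * f (T + w) := by fun_prop

lemma integrable_shift [IsFiniteMeasure ν] (hpos : ν (Set.Iic 0) = 0) (hc : -C ≤ c.re)
    (hfm : Measurable f) (hf : ∀ t, ‖f t‖ ≤ K * Real.exp (-((C + 1) * t))) (T : ℝ) :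
    Integrable (fun w : ℝ => Complex.exp (-(w : ℂ) * c) * f (T + w)) ν :=
  Integrable.mono' ((integrable_exp_neg_of_pos hpos).const_mul _)
    (measurable_shift hfm T).aestronglyMeasurable
    ((ae_pos_of_measure_Iic hpos).mono fun _ hw => norm_shift_le hc hf T hw.le)

lemma norm_waitShift_le [IsFiniteMeasure ν] (hpos : ν (Set.Iic 0) = 0) (hc : -C ≤ c.re)
    (hf : ∀ t, ‖f t‖ ≤ K * Real.exp (-((C + 1) * t))) (T : ℝ) :
    ‖waitShift ν c f T‖ ≤ K * Real.exp (-((C + 1) * T)) * ∫ w, Real.exp (-w) ∂ν := by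
  rw [← integral_const_mul]
  exact norm_integral_le_of_norm_le ((integrable_exp_neg_of_pos hpos).const_mul _)
    ((ae_pos_of_measure_Iic hpos).mono fun _ hw => norm_shift_le hc hf T hw.le)

lemma integrableOn_shift_Ioi (hc : -C ≤ c.re)
    (hfm : Measurable f) (hf : ∀ t, ‖f t‖ ≤ K * Real.exp (-((C + 1) * t))) (T : ℝ) :
    IntegrableOn (fun w : ℝ => Complex.exp (-(w : ℂ) * c) * f (T + w)) (Set.Ioi 0) :=
  Integrable.mono' ((integrableOn_exp_neg_Ioi 0).const_mul _)
    (measurable_shift hfm T).aestronglyMeasurable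
    ((ae_restrict_iff' measurableSet_Ioi).2
      (Eventually.of_forall fun _ hw => norm_shift_le hc hf T (le_of_lt hw)))

lemma norm_holdPrimitive_le (hc : -C ≤ c.re)
    (hf : ∀ t, ‖f t‖ ≤ K * Real.exp (-((C + 1) * t))) (T : ℝ) {w : ℝ} (hw : 0 ≤ w) :
    ‖∫ u in (0 : ℝ)..w, Complex.exp (-(u : ℂ) * c) * f (T + u)‖ ≤
      K * Real.exp (-((C + 1) * T)) := by
  have hK : 0 ≤ K * Real.exp (-((C + 1) * T)) := (norm_nonneg _).trans (hf T)
  rw [intervalIntegral.integral_of_le hw]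
  have h1 := norm_integral_le_of_norm_le (μ := volume.restrict (Set.Ioc (0 : ℝ) w))
    (f := fun u : ℝ => Complex.exp (-(u : ℂ) * c) * f (T + u))
    (g := fun u => K * Real.exp (-((C + 1) * T)) * Real.exp (-u))
    (IntegrableOn.mono_set ((integrableOn_exp_neg_Ioi 0).const_mul _) Set.Ioc_subset_Ioi_self)
    ((ae_restrict_iff' measurableSet_Ioc).2
      (Eventually.of_forall fun _ hu => norm_shift_le hc hf T (le_of_lt hu.1)))
  refine h1.trans ?_
  calc _ ≤ ∫ u in Set.Ioi (0 : ℝ), K * Real.exp (-((C + 1) * T)) * Real.exp (-u) :=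
        setIntegral_mono_set ((integrableOn_exp_neg_Ioi 0).const_mul _)
          (Eventually.of_forall fun u => mul_nonneg hK (Real.exp_pos _).le)
          (LE.le.eventuallyLE Set.Ioc_subset_Ioi_self)
    _ = _ := by rw [integral_const_mul, integral_exp_neg_Ioi_zero, mul_one]

lemma continuous_holdPrimitive (hfm : Measurable f)
    (hf : ∀ t, ‖f t‖ ≤ K * Real.exp (-((C + 1) * t))) (T : ℝ) :
    Continuous fun w : ℝ => ∫ u in (0 : ℝ)..w, Complex.exp (-(u : ℂ) * c) * f (T + u) := by
  refine intervalIntegral.continuous_primitive (fun t₀ t₁ => ?_) 0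
  refine IntervalIntegrable.continuousOn_mul ?_ (by fun_prop)
  refine IntervalIntegrable.mono_fun'
    (g := fun u => K * Real.exp (-((C + 1) * (T + u)))) ?_
    (hfm.comp (measurable_const.add measurable_id)).aestronglyMeasurable
    (Eventually.of_forall fun u => hf _)
  exact Continuous.intervalIntegrable (by fun_prop) _ _

lemma integrable_holdPrimitive [IsFiniteMeasure ν] (hpos : ν (Set.Iic 0) = 0) (hc : -C ≤ c.re)
    (hfm : Measurable f) (hf : ∀ t, ‖f t‖ ≤ K * Real.exp (-((C + 1) * t))) (T : ℝ) :
    Integrable (fun w : ℝ => ∫ u in (0 : ℝ)..w, Complex.exp (-(u : ℂ) * c) * f (T + u)) ν :=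
  Integrable.of_bound (continuous_holdPrimitive hfm hf T).aestronglyMeasurable _
    ((ae_pos_of_measure_Iic hpos).mono fun _ hw => norm_holdPrimitive_le hc hf T hw.le)

end OneVariable

/-- Splitting the time integral along a path at the first jump. -/
lemma IsDamped.pathIntegral_cons {K : ℝ} {h : Fin N → ℝ → ℝ → ℂ}
    (hh : IsDamped (C + 1) K h) (hU : Measurable U) (hC0 : 0 ≤ C)
    (hC : ∀ x, -C ≤ (ρ * (U x : ℂ)).re) (x T : ℝ) (a : Fin N) {w : ℝ} (hw : 0 < w) (y : ℝ)
    {p : Path N} (hp : GoodPath p) :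
    pathIntegral U ρ h x T (consPath a (w, y) p) =
      (∫ u in (0 : ℝ)..w, Complex.exp (-(u : ℂ) * (ρ * (U x : ℂ))) * h a x (T + u)) +
      Complex.exp (-(w : ℂ) * (ρ * (U x : ℂ))) * pathIntegral U ρ h (x + y) (T + w) p := by
  have hi := hh.integrableOn_integrand hU hC0 hC x T (consPath a (w, y) p)
  rw [pathIntegral, ← Set.Ioc_union_Ioi_eq_Ioi hw.le, setIntegral_union
    (Set.Ioc_disjoint_Ioi le_rfl) measurableSet_Ioi
    (hi.mono_set Set.Ioc_subset_Ioi_self) (hi.mono_set (Set.Ioi_subset_Ioi hw.le))]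
  congr 1
  · rw [← intervalIntegral.integral_of_le hw.le]
    refine intervalIntegral.integral_congr_ae ?_
    have : ∀ᵐ r : ℝ, r ≠ w := by simp [ae_iff, measure_singleton]
    filter_upwards [this] with r hr hrm
    rw [Set.uIoc_of_le hw.le] at hrm
    have hlt : r < w := lt_of_le_of_ne hrm.2 hr
    rw [pathPos_cons_of_lt hlt, pathState_cons_of_lt hlt, pathWeight,
      pathFun_cons_of_le_wait U hrm.1.le hrm.2]
    congr 2
    push_cast; ring
  · have e : ∀ t : ℝ, t ∈ Set.Ioi w →
        pathWeight U ρ x t (consPath a (w, y) p) * h (pathState t (consPath a (w, y) p))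
          (pathPos x t (consPath a (w, y) p)) (T + t) =
        Complex.exp (-(w : ℂ) * (ρ * (U x : ℂ))) * (pathWeight U ρ (x + y) (t - w) p *
          h (pathState (t - w) p) (pathPos (x + y) (t - w) p) (T + w + (t - w))) := by
      intro t ht
      have hle : w ≤ t := le_of_lt ht
      rw [pathPos_cons_of_le hle x a y hp, pathState_cons_of_le hle a y hp, pathWeight,
        pathFun_cons_of_le hU hw.le hle x a y hp, pathWeight, ← mul_assoc, ← Complex.exp_add]
      congr 2
      · push_cast; ring
      · ring
    rw [setIntegral_congr_fun measurableSet_Ioi e, integral_const_mul, pathIntegral]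
    congr 1
    rw [setIntegral_Ioi_eq_shift]
    simp only [add_sub_cancel_left]

/-- The renewal equation: what happens before the first jump plus what happens after it. -/
lemma IsDamped.value_eq [∀ i, IsProbabilityMeasure (μ i)] (hpos : ∀ i, μ i (Set.Iic 0) = 0)
    (hM : M ∈ Matrix.rowStochastic ℝ (Fin N)) {P : Fin N → Measure (Path N)}
    (hP : IsChainFamily M μ s P) {K : ℝ} {h : Fin N → ℝ → ℝ → ℂ}
    (hh : IsDamped (C + 1) K h) (hU : Measurable U) (hC0 : 0 ≤ C)
    (hC : ∀ x, -C ≤ (ρ * (U x : ℂ)).re) (a : Fin N) (x T : ℝ) :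
    FcP.value U ρ P h a x T = holdInt (μ a) (ρ * (U x : ℂ)) (h a x) T +
      stepOp M μ s (fun x => ρ * (U x : ℂ)) (FcP.value U ρ P h) a x T := by
  have := hP.isProbabilityMeasure
  have hv := hh.value (ρ := ρ) hP hU hC0 hC
  have hj := hv.jumpAvg (s := s) hM
  have hfm := hh.measurable_time a x
  have hjm := hj.measurable_time a x
  have hmJ : ∀ x T, Measurable fun p : Path N => pathIntegral U ρ h x T p := fun x T =>
    (hh.measurable_pathIntegral (ρ := ρ) hU).comp (f := fun p : Path N => (x, T, p))
      (measurable_const.prodMk (measurable_const.prodMk measurable_id))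
  have I1 := integrable_holdPrimitive (hpos a) (hC x) hfm (hh.norm_le a x) T
  have I2 := integrable_shift (hpos a) (hC x) hjm (hj.norm_le a x) T
  have I3 := hP.integral_eq hM a (hmJ x T) (hh.norm_pathIntegral_le hC0 hC x T)
  unfold holdInt stepOp waitShift
  refine I3.trans (Eq.trans ?_ (integral_add I1 I2))
  refine integral_congr_ae ((ae_pos_of_measure_Iic (hpos a)).mono fun w hw => ?_)
  dsimp only
  have e : ∀ y b, ∫ p, pathIntegral U ρ h x T (consPath a (w, y) p) ∂(P b) =
      (∫ u in (0 : ℝ)..w, Complex.exp (-(u : ℂ) * (ρ * (U x : ℂ))) * h a x (T + u)) +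
      Complex.exp (-(w : ℂ) * (ρ * (U x : ℂ))) * FcP.value U ρ P h b (x + y) (T + w) := by
    intro y b
    rw [integral_congr_ae ((hP.ae_goodPath hpos hM b).mono fun p hp =>
      hh.pathIntegral_cons hU hC0 hC x T a hw y hp), integral_add (integrable_const _)
      ((Integrable.of_bound (hmJ _ _).aestronglyMeasurable _
        (Eventually.of_forall fun p => hh.norm_pathIntegral_le hC0 hC _ _ p)).const_mul _),
      integral_const_mul]
    simp [FcP.value]
  simp_rw [e, mul_add, Finset.sum_add_distrib, ← Finset.sum_mul]
  have hrow : ∑ b, (M a b : ℂ) = 1 := by exact_mod_cast sum_row hM a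
  simp_rw [hrow, one_mul, mul_left_comm _ (Complex.exp _), ← Finset.mul_sum]
  rw [integral_add (integrable_const _) ((hv.integrable_jump hM a x (T + w)).const_mul _),
    integral_const_mul]
  simp [FcP.jumpAvg]

/-- The transition operator contracts damped functions by the factor `θ`, so a damped function
that it almost fixes is small. -/
lemma IsDamped.norm_le_of_sub_stepOp [∀ i, IsProbabilityMeasure (μ i)]
    (hpos : ∀ i, μ i (Set.Iic 0) = 0)
    (hM : M ∈ Matrix.rowStochastic ℝ (Fin N)) {c : ℝ → ℂ} (hc : ∀ x, -C ≤ (c x).re)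
    {θ : ℝ} (hθ1 : θ < 1) (hθ : ∀ i, ∫ w, Real.exp (-w) ∂(μ i) ≤ θ)
    {v : Fin N → ℝ → ℝ → ℂ} {K : ℝ} (hv : IsDamped (C + 1) K v) {η : ℝ}
    (h : ∀ a x T, ‖v a x T - stepOp M μ s c v a x T‖ ≤ η * Real.exp (-((C + 1) * T)))
    (a : Fin N) (x T : ℝ) : ‖v a x T‖ ≤ η / (1 - θ) * Real.exp (-((C + 1) * T)) := by
  have hθ0 : 0 ≤ θ := (integral_nonneg fun w => (Real.exp_pos _).le).trans (hθ a)
  have h1 : 0 < 1 - θ := by linarith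
  have hK : 0 ≤ K := by
    have := (norm_nonneg _).trans (hv.norm_le a x 0)
    simpa using this
  have hη : 0 ≤ η := by
    have := (norm_nonneg _).trans (h a x 0)
    simpa using this
  -- each use of the equation replaces the a priori bound `K` by `η + θ K`
  have key : ∀ n : ℕ, IsDamped (C + 1) (η / (1 - θ) + θ ^ n * K) v := by
    intro n
    induction n with
    | zero =>
      refine ⟨hv.measurable, fun a x T => (hv.norm_le a x T).trans ?_⟩
      have : 0 ≤ η / (1 - θ) := by positivity
      gcongr
      linarith
    | succ n ih =>
      refine ⟨hv.measurable, fun a x T => ?_⟩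
      have h2 := norm_waitShift_le (hpos a) (hc x)
        (fun t => (ih.jumpAvg (s := s) hM).norm_le a x t) T
      have h3 : ‖stepOp M μ s c v a x T‖ ≤
          (η / (1 - θ) + θ ^ n * K) * Real.exp (-((C + 1) * T)) * θ := by
        refine h2.trans (mul_le_mul_of_nonneg_left (hθ a) ?_)
        have : 0 ≤ η / (1 - θ) := by positivity
        positivity
      calc ‖v a x T‖ = ‖(v a x T - stepOp M μ s c v a x T) + stepOp M μ s c v a x T‖ := by
            rw [sub_add_cancel]
        _ ≤ η * Real.exp (-((C + 1) * T)) +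
            (η / (1 - θ) + θ ^ n * K) * Real.exp (-((C + 1) * T)) * θ :=
            (norm_add_le _ _).trans (add_le_add (h a x T) h3)
        _ = (η / (1 - θ) + θ ^ (n + 1) * K) * Real.exp (-((C + 1) * T)) := by
            field_simp
            ring
  have hlim : Tendsto (fun n : ℕ => (η / (1 - θ) + θ ^ n * K) * Real.exp (-((C + 1) * T))) atTop
      (𝓝 ((η / (1 - θ) + 0 * K) * Real.exp (-((C + 1) * T)))) :=
    (((tendsto_pow_atTop_nhds_zero_of_lt_one hθ0 hθ1).mul_const K).const_add _).mul_const _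
  have := ge_of_tendsto' hlim fun n => (key n).norm_le a x T
  simpa using this

end

end

/-! ### Superpositions of exponentials -/

/-- The points `b + 2πiξ` of a vertical line in the Laplace plane. -/
def freq (b ξ : ℝ) : ℂ := (b : ℂ) + (2 * Real.pi * ξ : ℝ) * Complex.I

/-- The inverse Laplace transform of the symbol `X` along the line `freq b`. -/
def mode (b : ℝ) (X : ℝ → ℂ) (T : ℝ) : ℂ := ∫ ξ, Complex.exp (-freq b ξ * (T : ℂ)) * X ξ

/-- A measurable symbol that decays like the power `m` of the Laplace variable. -/
structure IsSymbol (b : ℝ) (m : ℕ) (K : ℝ) (X : ℝ → ℂ) : Prop where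
  measurable : Measurable X
  norm_le : ∀ ξ, ‖X ξ‖ * ‖freq b ξ‖ ^ m ≤ K

/-- The Laplace transform of a measure. -/
def laplace (ν : Measure ℝ) (z : ℂ) : ℂ := ∫ t : ℝ, Complex.exp (-z * t) ∂ν

lemma freq_re (b ξ : ℝ) : (freq b ξ).re = b := by simp [freq]

lemma measurable_freq (b : ℝ) : Measurable (freq b) := by unfold freq; fun_prop

lemma le_norm_freq (b ξ : ℝ) : b ≤ ‖freq b ξ‖ := by
  have := Complex.re_le_norm (freq b ξ)
  rwa [freq_re] at this

lemma one_add_sq_le_norm_freq_sq {b : ℝ} (hb : 1 ≤ b) (ξ : ℝ) : 1 + ξ ^ 2 ≤ ‖freq b ξ‖ ^ 2 := by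
  have h1 : ‖freq b ξ‖ ^ 2 = b ^ 2 + (2 * Real.pi * ξ) ^ 2 := by
    rw [Complex.sq_norm, Complex.normSq_apply, freq_re]
    have : (freq b ξ).im = 2 * Real.pi * ξ := by simp [freq]
    rw [this]; ring
  rw [h1]
  have h2 : 1 ≤ b ^ 2 := by nlinarith
  have h3 : 1 ≤ (2 * Real.pi) ^ 2 := by nlinarith [Real.pi_gt_three]
  have h4 : (2 * Real.pi * ξ) ^ 2 = (2 * Real.pi) ^ 2 * ξ ^ 2 := by ring
  nlinarith [sq_nonneg ξ]

lemma norm_exp_freq (b ξ T : ℝ) : ‖Complex.exp (-freq b ξ * (T : ℂ))‖ = Real.exp (-(b * T)) := by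
  rw [Complex.norm_exp]; simp [freq]

lemma IsSymbol.nonneg {b K : ℝ} {m : ℕ} {X : ℝ → ℂ} (h : IsSymbol b m K X) : 0 ≤ K :=
  le_trans (by positivity) (h.norm_le 0)

lemma IsSymbol.norm_le_inv {b K : ℝ} {m : ℕ} {X : ℝ → ℂ} (hb : 1 ≤ b) (hm : 2 ≤ m)
    (h : IsSymbol b m K X) (ξ : ℝ) : ‖X ξ‖ ≤ K * (1 + ξ ^ 2)⁻¹ := by
  have h1 := one_add_sq_le_norm_freq_sq hb ξ
  have h2 : ‖freq b ξ‖ ^ 2 ≤ ‖freq b ξ‖ ^ m := pow_le_pow_right₀ (hb.trans (le_norm_freq b ξ)) hm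
  have h3 : 0 < 1 + ξ ^ 2 := by positivity
  rw [← div_eq_mul_inv, le_div_iff₀ h3]
  exact (mul_le_mul_of_nonneg_left (h1.trans h2) (norm_nonneg _)).trans (h.norm_le ξ)

lemma IsSymbol.integrable {b K : ℝ} {m : ℕ} {X : ℝ → ℂ} (hb : 1 ≤ b) (hm : 2 ≤ m)
    (h : IsSymbol b m K X) : Integrable X :=
  Integrable.mono' (integrable_inv_one_add_sq.const_mul K) h.measurable.aestronglyMeasurable
    (Eventually.of_forall (h.norm_le_inv hb hm))

lemma integrable_mode {b : ℝ} {X : ℝ → ℂ} (hX : Integrable X) (T : ℝ) :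
    Integrable fun ξ => Complex.exp (-freq b ξ * (T : ℂ)) * X ξ := by
  refine hX.bdd_mul (c := Real.exp (-(b * T)))
    (Complex.measurable_exp.comp
      ((measurable_freq b).neg.mul_const _)).aestronglyMeasurable
    (Eventually.of_forall fun ξ => (norm_exp_freq b ξ T).le)

lemma norm_mode_le {b K : ℝ} {m : ℕ} {X : ℝ → ℂ} (hb : 1 ≤ b) (hm : 2 ≤ m)
    (h : IsSymbol b m K X) (T : ℝ) : ‖mode b X T‖ ≤ K * Real.pi * Real.exp (-(b * T)) := by
  have := norm_integral_le_of_norm_le (f := fun ξ => Complex.exp (-freq b ξ * (T : ℂ)) * X ξ)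
    (g := fun ξ => Real.exp (-(b * T)) * (K * (1 + ξ ^ 2)⁻¹))
    ((integrable_inv_one_add_sq.const_mul K).const_mul _)
    (Eventually.of_forall fun ξ => by
      rw [norm_mul, norm_exp_freq]
      exact mul_le_mul_of_nonneg_left (h.norm_le_inv hb hm ξ) (Real.exp_pos _).le)
  rw [integral_const_mul, integral_const_mul, integral_univ_inv_one_add_sq] at this
  calc _ ≤ _ := this
    _ = _ := by ring

lemma mode_sub {b : ℝ} {X Y : ℝ → ℂ} (hX : Integrable X) (hY : Integrable Y) (T : ℝ) :
    mode b (fun ξ => X ξ - Y ξ) T = mode b X T - mode b Y T := by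
  simp only [mode, mul_sub]
  exact integral_sub (integrable_mode hX T) (integrable_mode hY T)

lemma mode_add {b : ℝ} {X Y : ℝ → ℂ} (hX : Integrable X) (hY : Integrable Y) (T : ℝ) :
    mode b (fun ξ => X ξ + Y ξ) T = mode b X T + mode b Y T := by
  simp only [mode, mul_add]
  exact integral_add (integrable_mode hX T) (integrable_mode hY T)

lemma mode_const_mul {b : ℝ} (k : ℂ) (X : ℝ → ℂ) (T : ℝ) :
    mode b (fun ξ => k * X ξ) T = k * mode b X T := by
  simp only [mode, mul_left_comm _ k]
  exact integral_const_mul _ _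

/-- An average of multipliers acts on a superposition of exponentials through the average. -/
lemma integral_mode {b : ℝ} {X : ℝ → ℂ} (hX : Integrable X) {ν : Measure ℝ} [SFinite ν]
    {m : ℝ → ℝ → ℂ} (hm : Measurable (fun q : ℝ × ℝ => m q.1 q.2)) {G : ℝ → ℝ}
    (hG : Integrable G ν) (hmG : ∀ᵐ w ∂ν, ∀ ξ, ‖m w ξ‖ ≤ G w) (T : ℝ) :
    ∫ w, mode b (fun ξ => m w ξ * X ξ) T ∂ν = mode b (fun ξ => (∫ w, m w ξ ∂ν) * X ξ) T := by
  unfold mode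
  rw [integral_integral_swap]
  · congr 1; ext ξ
    dsimp only
    rw [← integral_mul_const, ← integral_const_mul]
  · have h1 := hG.mul_prod (integrable_mode (b := b) hX T).norm
    refine Integrable.mono' h1 ?_ ?_
    · have h2 : AEStronglyMeasurable (fun q : ℝ × ℝ => X q.2) (ν.prod volume) :=
        hX.aestronglyMeasurable.comp_snd
      have h3 : Measurable fun q : ℝ × ℝ => Complex.exp (-freq b q.2 * (T : ℂ)) := by
        have := measurable_freq b
        fun_prop
      exact h3.aestronglyMeasurable.mul (hm.aestronglyMeasurable.mul h2)
    · have : ∀ᵐ q : ℝ × ℝ ∂(ν.prod volume), ∀ ξ, ‖m q.1 ξ‖ ≤ G q.1 :=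
        Measure.quasiMeasurePreserving_fst.ae hmG
      filter_upwards [this] with q hq
      simp only [Function.uncurry, norm_mul]
      calc _ = ‖m q.1 q.2‖ * (‖Complex.exp (-freq b q.2 * T)‖ * ‖X q.2‖) := by ring
        _ ≤ _ := mul_le_mul_of_nonneg_right (hq _) (by positivity)

/-- The Laplace transform of a power, at complex arguments: both sides are analytic in `z` and
agree on the positive reals. -/
lemma integral_rpow_mul_cexp_neg_mul_Ioi {a : ℝ} (ha : 0 < a) {z : ℂ} (hz : 0 < z.re) :
    ∫ u in Set.Ioi (0 : ℝ), ((u ^ (a - 1) : ℝ) : ℂ) * Complex.exp (-z * u) =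
      (Real.Gamma a : ℂ) * z ^ (-(a : ℂ)) := by
  set ν : Measure ℝ := (volume.restrict (Set.Ioi (0 : ℝ))).withDensity
    (fun u => ((Real.toNNReal (u ^ (a - 1)) : ℝ≥0) : ENNReal)) with hν
  have hmeas : Measurable fun u : ℝ => Real.toNNReal (u ^ (a - 1)) := by fun_prop
  have hmgf : ∀ z : ℂ, complexMGF (fun u => -u) ν z =
      ∫ u in Set.Ioi (0 : ℝ), ((u ^ (a - 1) : ℝ) : ℂ) * Complex.exp (-z * u) := by
    intro z
    rw [complexMGF, hν, integral_withDensity_eq_integral_smul hmeas]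
    refine setIntegral_congr_fun measurableSet_Ioi fun u hu => ?_
    rw [NNReal.smul_def, Real.coe_toNNReal _ (Real.rpow_nonneg (le_of_lt hu) _), Complex.real_smul]
    congr 2
    push_cast; ring
  have hset : Set.Ioi (0 : ℝ) ⊆ interior (integrableExpSet (fun u : ℝ => -u) ν) := by
    refine interior_maximal (fun r hr => ?_) isOpen_Ioi
    rw [integrableExpSet, Set.mem_ofPred_eq, hν, integrable_withDensity_iff_integrable_smul hmeas]
    have h1 : IntegrableOn (fun u : ℝ => u ^ (a - 1) * Real.exp (-(r * u))) (Set.Ioi 0) := by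
      have := integrableOn_rpow_mul_exp_neg_mul_rpow (s := a - 1) (p := 1) (b := r)
        (by linarith) one_pos hr
      simpa using this
    refine Integrable.congr h1 ?_
    refine (ae_restrict_iff' measurableSet_Ioi).2 (Eventually.of_forall fun u hu => ?_)
    simp only [NNReal.smul_def, Real.coe_toNNReal _ (Real.rpow_nonneg (le_of_lt hu) _),
      smul_eq_mul, mul_neg]
  have hA : AnalyticOnNhd ℂ (complexMGF (fun u : ℝ => -u) ν) {z : ℂ | 0 < z.re} :=
    analyticOnNhd_complexMGF.mono fun w hw => hset hw
  have hB : AnalyticOnNhd ℂ (fun z : ℂ => (Real.Gamma a : ℂ) * z ^ (-(a : ℂ)))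
      {z : ℂ | 0 < z.re} := by
    refine DifferentiableOn.analyticOnNhd (fun w hw => ?_)
      (isOpen_lt continuous_const Complex.continuous_re)
    refine (DifferentiableAt.const_mul ?_ _).differentiableWithinAt
    exact differentiableAt_id.cpow_const (Or.inl hw)
  have hE := AnalyticOnNhd.eqOn_of_preconnected_of_frequently_eq hA hB
    (convex_halfSpace_re_gt 0).isPreconnected (z₀ := 1) (by simp) ?_
  · rw [← hmgf]; exact hE hz
  have h_real : ∃ᶠ x : ℝ in 𝓝[≠] 1, complexMGF (fun u : ℝ => -u) ν x =
      (Real.Gamma a : ℂ) * (x : ℂ) ^ (-(a : ℂ)) := by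
    refine Eventually.frequently ?_
    have : ∀ᶠ x : ℝ in 𝓝[≠] 1, 0 < x :=
      eventually_nhdsWithin_of_eventually_nhds (lt_mem_nhds one_pos)
    filter_upwards [this] with x hx
    have h1 := Real.integral_rpow_mul_exp_neg_mul_Ioi ha hx
    rw [hmgf, mul_comm (Real.Gamma a : ℂ)]
    have h2 : (x : ℂ) ^ (-(a : ℂ)) = (((1 / x) ^ a : ℝ) : ℂ) := by
      rw [one_div, Real.inv_rpow hx.le, ← Real.rpow_neg hx.le, Complex.ofReal_cpow hx.le]
      simp
    rw [h2, ← Complex.ofReal_mul, ← h1, ← integral_complex_ofReal]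
    congr 1; ext u
    push_cast; congr 2; ring
  rw [frequently_iff_seq_forall] at h_real ⊢
  obtain ⟨xs, hx_tendsto, hx_eq⟩ := h_real
  refine ⟨fun n => xs n, ?_, fun n => hx_eq n⟩
  rw [tendsto_nhdsWithin_iff] at hx_tendsto ⊢
  constructor
  · rw [← Complex.ofReal_one, tendsto_ofReal_iff]
    exact hx_tendsto.1
  · simpa using hx_tendsto.2
section Multipliers

variable {C : ℝ} {c : ℂ} {X : ℝ → ℂ}

lemma one_le_re_freq_add (hc : -C ≤ c.re) (ξ : ℝ) : 1 ≤ (freq (C + 1) ξ + c).re := by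
  rw [Complex.add_re, freq_re]; linarith

lemma one_le_norm_freq_add (hc : -C ≤ c.re) (ξ : ℝ) : 1 ≤ ‖freq (C + 1) ξ + c‖ :=
  (one_le_re_freq_add hc ξ).trans (Complex.re_le_norm _)

lemma norm_exp_neg_mul_le_of_one_le_re {z : ℂ} (hz : 1 ≤ z.re) {w : ℝ} (hw : 0 ≤ w) :
    ‖Complex.exp (-z * (w : ℂ))‖ ≤ Real.exp (-w) := by
  rw [Complex.norm_exp]
  refine Real.exp_le_exp.2 ?_
  simp only [neg_mul, Complex.neg_re, Complex.mul_re, Complex.ofReal_re, Complex.ofReal_im,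
    mul_zero, sub_zero]
  nlinarith

/-- Translation by `w` and damping by `exp(-wc)` multiply the symbol by `exp(-zw)`. -/
lemma exp_mul_mode (T w : ℝ) : Complex.exp (-(w : ℂ) * c) * mode (C + 1) X (T + w) =
    mode (C + 1) (fun ξ => Complex.exp (-(freq (C + 1) ξ + c) * (w : ℂ)) * X ξ) T := by
  simp only [mode]
  rw [← integral_const_mul]
  congr 1; ext ξ
  rw [← mul_assoc, ← mul_assoc, ← Complex.exp_add, ← Complex.exp_add]
  congr 2
  push_cast; ring

lemma measurable_exp_freq : Measurable fun q : ℝ × ℝ =>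
    Complex.exp (-(freq (C + 1) q.2 + c) * (q.1 : ℂ)) := by
  have := measurable_freq (C + 1)
  fun_prop

lemma measurable_laplace_freq (ν : Measure ℝ) [SFinite ν] :
    Measurable fun ξ => laplace ν (freq (C + 1) ξ + c) := by
  have : Measurable fun q : ℝ × ℝ => Complex.exp (-(freq (C + 1) q.1 + c) * (q.2 : ℂ)) := by
    have := measurable_freq (C + 1)
    fun_prop
  exact (this.stronglyMeasurable.integral_prod_right' (ν := ν)).measurable

/-- One waiting time acts on superpositions of exponentials as the multiplier `φ(z)`, where `z =
freq + c`. -/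
lemma waitShift_mode {ν : Measure ℝ} [IsFiniteMeasure ν] (hpos : ν (Set.Iic 0) = 0)
    (hc : -C ≤ c.re) (hX : Integrable X) (T : ℝ) :
    waitShift ν c (mode (C + 1) X) T =
      mode (C + 1) (fun ξ => laplace ν (freq (C + 1) ξ + c) * X ξ) T := by
  unfold waitShift laplace
  simp_rw [exp_mul_mode]
  refine integral_mode hX measurable_exp_freq (G := fun _ => 1) (integrable_const _) ?_ T
  filter_upwards [ae_pos_of_measure_Iic hpos] with w hw ξ
  refine (norm_exp_neg_mul_le_of_one_le_re (one_le_re_freq_add hc ξ) hw.le).trans ?_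
  exact Real.exp_le_one_iff.2 (by linarith)

lemma integral_exp_neg_mul {z : ℂ} (hz : z ≠ 0) {w : ℝ} (hw : 0 ≤ w) :
    laplace (volume.restrict (Set.Ioc 0 w)) z = (1 - Complex.exp (-z * w)) / z := by
  rw [laplace, ← intervalIntegral.integral_of_le hw, integral_exp_mul_complex (neg_ne_zero.2 hz)]
  simp only [Complex.ofReal_zero, mul_zero, Complex.exp_zero]
  field_simp
  ring

/-- The time before the first jump acts as the multiplier `(1 - φ(z)) / z`, the Laplace transform
of the survival function. -/
lemma holdInt_mode {ν : Measure ℝ} [IsProbabilityMeasure ν] (hpos : ν (Set.Iic 0) = 0)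
    (hc : -C ≤ c.re) (hX : Integrable X) (T : ℝ) :
    holdInt ν c (mode (C + 1) X) T =
      mode (C + 1) (fun ξ => (1 - laplace ν (freq (C + 1) ξ + c)) / (freq (C + 1) ξ + c) * X ξ)
        T := by
  have hz : ∀ ξ, freq (C + 1) ξ + c ≠ 0 := fun ξ h => by
    have := one_le_norm_freq_add hc ξ
    rw [h, norm_zero] at this
    linarith
  have e : ∀ w : ℝ, 0 < w →
      ∫ u in (0 : ℝ)..w, Complex.exp (-(u : ℂ) * c) * mode (C + 1) X (T + u) =
      mode (C + 1) (fun ξ => (1 - Complex.exp (-(freq (C + 1) ξ + c) * w)) /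
        (freq (C + 1) ξ + c) * X ξ) T := by
    intro w hw
    have h0 : (volume.restrict (Set.Ioc 0 w)) (Set.Iic 0) = 0 := by
      rw [Measure.restrict_apply measurableSet_Iic, Set.Iic_inter_Ioc_of_le hw.le, Set.Ioc_self,
        measure_empty]
    have h1 := waitShift_mode h0 hc hX T
    rw [waitShift, ← intervalIntegral.integral_of_le hw.le] at h1
    rw [h1]
    congr 1; ext ξ
    rw [integral_exp_neg_mul (hz ξ) hw.le]
  rw [holdInt, integral_congr_ae ((ae_pos_of_measure_Iic hpos).mono e)]
  have hm : Measurable fun q : ℝ × ℝ => (1 - Complex.exp (-(freq (C + 1) q.2 + c) * (q.1 : ℂ))) /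
      (freq (C + 1) q.2 + c) := by
    have := measurable_freq (C + 1)
    fun_prop
  rw [integral_mode hX hm (G := fun _ => 2) (integrable_const _) ?_ T]
  · congr 1; ext ξ
    congr 1
    rw [integral_div, integral_sub (integrable_const _), laplace]
    · simp
    · refine Integrable.of_bound (by fun_prop) 1 ?_
      filter_upwards [ae_pos_of_measure_Iic hpos] with w hw
      refine (norm_exp_neg_mul_le_of_one_le_re (one_le_re_freq_add hc ξ) hw.le).trans ?_
      exact Real.exp_le_one_iff.2 (by linarith)
  · filter_upwards [ae_pos_of_measure_Iic hpos] with w hw ξ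
    rw [norm_div, div_le_iff₀ (by linarith [one_le_norm_freq_add hc ξ])]
    have h1 := norm_sub_le (1 : ℂ) (Complex.exp (-(freq (C + 1) ξ + c) * w))
    have h2 := norm_exp_neg_mul_le_of_one_le_re (one_le_re_freq_add hc ξ) hw.le
    have h3 : Real.exp (-w) ≤ 1 := Real.exp_le_one_iff.2 (by linarith)
    rw [norm_one] at h1
    linarith [one_le_norm_freq_add hc ξ]

/-- The substantial fractional integral of order `1 - β`, acting on functions of the future. -/
def substInt (β : ℝ) (c : ℂ) (f : ℝ → ℂ) (T : ℝ) : ℂ :=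
  ((Real.Gamma (1 - β))⁻¹ : ℂ) *
    ∫ u in Set.Ioi (0 : ℝ), ((u ^ (-β) : ℝ) : ℂ) * (Complex.exp (-(u : ℂ) * c) * f (T + u))

lemma integrableOn_rpow_mul_exp_neg {β : ℝ} (hβ : β < 1) :
    IntegrableOn (fun u : ℝ => u ^ (-β) * Real.exp (-u)) (Set.Ioi 0) := by
  have := Real.GammaIntegral_convergent (s := 1 - β) (by linarith)
  simpa [mul_comm, sub_sub_cancel_left] using this

/-- The substantial fractional integral of order `1 - β` acts as the multiplier `z^(β - 1)`. -/
lemma substInt_mode {β : ℝ} (hβ : β < 1) (hc : -C ≤ c.re) (hX : Integrable X) (T : ℝ) :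
    substInt β c (mode (C + 1) X) T =
      mode (C + 1) (fun ξ => (freq (C + 1) ξ + c) ^ ((β - 1 : ℝ) : ℂ) * X ξ) T := by
  have hre := one_le_re_freq_add hc
  have e : ∀ u : ℝ, ((u ^ (-β) : ℝ) : ℂ) *
      (Complex.exp (-(u : ℂ) * c) * mode (C + 1) X (T + u)) =
      mode (C + 1) (fun ξ => (((u ^ (-β) : ℝ) : ℂ) *
        Complex.exp (-(freq (C + 1) ξ + c) * (u : ℂ))) * X ξ) T := by
    intro u
    rw [exp_mul_mode, ← mode_const_mul]
    simp only [mul_assoc]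
  rw [substInt]
  simp_rw [e]
  have hm : Measurable fun q : ℝ × ℝ => ((q.1 ^ (-β) : ℝ) : ℂ) *
      Complex.exp (-(freq (C + 1) q.2 + c) * (q.1 : ℂ)) := by
    have := measurable_freq (C + 1)
    fun_prop
  rw [integral_mode hX hm (integrableOn_rpow_mul_exp_neg hβ) ?_ T, ← mode_const_mul]
  · congr 1; ext ξ
    rw [← mul_assoc]
    congr 1
    have h1 := integral_rpow_mul_cexp_neg_mul_Ioi (a := 1 - β) (by linarith)
      (z := freq (C + 1) ξ + c) (by linarith [hre ξ])
    rw [sub_sub_cancel_left] at h1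
    have hG : (Real.Gamma (1 - β) : ℂ) ≠ 0 := by
      exact_mod_cast (Real.Gamma_pos_of_pos (by linarith)).ne'
    rw [h1, inv_mul_cancel_left₀ hG]
    congr 1
    push_cast; ring
  · refine (ae_restrict_iff' measurableSet_Ioi).2 (Eventually.of_forall fun u hu ξ => ?_)
    have hu0 : (0 : ℝ) ≤ u := le_of_lt hu
    rw [norm_mul, Complex.norm_real, Real.norm_of_nonneg (Real.rpow_nonneg hu0 _)]
    exact mul_le_mul_of_nonneg_left (norm_exp_neg_mul_le_of_one_le_re (hre ξ) hu0)
      (Real.rpow_nonneg hu0 _)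

end Multipliers

/-! ### Consequences of the power law of the Laplace transform -/

/-- The law of a waiting time multiplied by `ε^(1/α)`. -/
def scaledLaw (α : ℝ) (μ : Measure ℝ) (ε : ℝ) : Measure ℝ := μ.map (fun t => ε ^ (1 / α) * t)

/-- The relative error in `1 - φ(z) ≈ b z^α`. -/
def kappa (ν : Measure ℝ) (α b : ℝ) (z : ℂ) : ℂ :=
  1 - (1 - laplace ν z) / ((b : ℂ) * z ^ (α : ℂ))

section
variable {μ : Measure ℝ} {α B : ℝ}

instance [IsProbabilityMeasure μ] (ε : ℝ) : IsProbabilityMeasure (scaledLaw α μ ε) :=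
  Measure.isProbabilityMeasure_map (by fun_prop)

lemma scaledLaw_Iic (hpos : μ (Set.Iic 0) = 0) {ε : ℝ} (hε : 0 < ε) :
    scaledLaw α μ ε (Set.Iic 0) = 0 := by
  rw [scaledLaw, Measure.map_apply (by fun_prop) measurableSet_Iic]
  convert hpos using 2
  ext t
  have : 0 < ε ^ (1 / α) := Real.rpow_pos_of_pos hε _
  rw [Set.mem_preimage, Set.mem_Iic, Set.mem_Iic, mul_nonpos_iff_pos_imp_nonpos]
  exact ⟨fun h => h.1 this, fun h => ⟨fun _ => h, fun _ => this.le⟩⟩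

lemma laplace_scaledLaw (ε : ℝ) (z : ℂ) :
    laplace (scaledLaw α μ ε) z = laplace μ (((ε ^ (1 / α) : ℝ) : ℂ) * z) := by
  rw [laplace, scaledLaw, integral_map (by fun_prop) (by fun_prop), laplace]
  congr 1; ext t
  congr 1
  push_cast; ring

lemma norm_laplace_le_one [IsProbabilityMeasure μ] (hpos : μ (Set.Iic 0) = 0) {z : ℂ}
    (hz : 0 ≤ z.re) : ‖laplace μ z‖ ≤ 1 := by
  have := norm_integral_le_of_norm_le_const (μ := μ) (f := fun t : ℝ => Complex.exp (-z * t))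
    (C := 1) ((ae_pos_of_measure_Iic hpos).mono fun t ht => by
      rw [Complex.norm_exp, Real.exp_le_one_iff]
      simp only [neg_mul, Complex.neg_re, Complex.mul_re, Complex.ofReal_re, Complex.ofReal_im,
        mul_zero, sub_zero]
      nlinarith)
  simpa [laplace] using this

/-- The local power law, turned into a bound on the whole half plane. -/
lemma exists_norm_laplaceError_le [IsProbabilityMeasure μ] (hpos : μ (Set.Iic 0) = 0)
    (hα : 0 < α) (hB : 0 < B) {p : ℕ}
    (herr : (fun s : ℂ => laplaceError μ α B s)
      =o[𝓝[{s : ℂ | 0 < s.re}] 0] (fun s : ℂ => ‖s‖ ^ (p * α))) {η : ℝ} (hη : 0 < η) :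
    ∃ D, 0 ≤ D ∧ ∀ ζ : ℂ, 0 < ζ.re →
      ‖laplaceError μ α B ζ‖ ≤ η * (‖ζ‖ ^ α) ^ p + D * (‖ζ‖ ^ α) ^ (p + 1) := by
  have h1 := herr.def hη
  rw [Filter.Eventually, Metric.mem_nhdsWithin_iff] at h1
  obtain ⟨δ, hδ, hsub⟩ := h1
  set d := δ ^ α with hd
  have hd0 : 0 < d := Real.rpow_pos_of_pos hδ _
  refine ⟨2 / d ^ (p + 1) + B / d ^ p, by positivity, fun ζ hζ => ?_⟩
  set r := ‖ζ‖ ^ α with hr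
  have hζ0 : 0 < ‖ζ‖ := hζ.trans_le (Complex.re_le_norm ζ)
  have hr0 : 0 < r := Real.rpow_pos_of_pos hζ0 _
  by_cases hlt : ‖ζ‖ < δ
  · have h2 : ζ ∈ Metric.ball (0 : ℂ) δ ∩ {s : ℂ | 0 < s.re} :=
      ⟨by simpa using hlt, hζ⟩
    have h3 : ‖laplaceError μ α B ζ‖ ≤ η * ‖‖ζ‖ ^ (p * α)‖ := hsub h2
    have h4 : ‖ζ‖ ^ (p * α) = r ^ p := by
      rw [hr, ← Real.rpow_mul_natCast hζ0.le, mul_comm]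
    rw [h4, Real.norm_of_nonneg (by positivity)] at h3
    have : 0 ≤ (2 / d ^ (p + 1) + B / d ^ p) * r ^ (p + 1) := by positivity
    linarith
  -- away from `0` the trivial bound `|φ| ≤ 1` suffices, the powers of `r ≥ d` being bounded below
  · have hdr : d ≤ r := Real.rpow_le_rpow hδ.le (not_lt.1 hlt) hα.le
    have h2 : ‖laplaceError μ α B ζ‖ ≤ 2 + B * r := by
      have e : laplaceError μ α B ζ = laplace μ ζ - (1 - (B : ℂ) * ζ ^ (α : ℂ)) := rfl
      have e2 : ‖(B : ℂ) * ζ ^ (α : ℂ)‖ = B * r := by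
        rw [norm_mul, Complex.norm_cpow_real, Complex.norm_real, Real.norm_of_nonneg hB.le]
      have e3 := norm_laplace_le_one (μ := μ) hpos hζ.le
      have e4 := norm_sub_le (1 : ℂ) ((B : ℂ) * ζ ^ (α : ℂ))
      have e5 := norm_sub_le (laplace μ ζ) (1 - (B : ℂ) * ζ ^ (α : ℂ))
      rw [norm_one] at e4
      rw [e]; linarith
    have h3 : 1 ≤ r ^ (p + 1) / d ^ (p + 1) := by
      rw [one_le_div (by positivity)]; gcongr
    have h4 : 1 ≤ r ^ p / d ^ p := by
      rw [one_le_div (by positivity)]; gcongr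
    have h5 : (2 / d ^ (p + 1) + B / d ^ p) * r ^ (p + 1) =
        2 * (r ^ (p + 1) / d ^ (p + 1)) + B * r * (r ^ p / d ^ p) := by
      field_simp
      ring
    have h6 : B * r ≤ B * r * (r ^ p / d ^ p) := le_mul_of_one_le_right (by positivity) h4
    have h7 : 0 ≤ η * r ^ p := by positivity
    linarith

lemma ofReal_mul_cpow {r : ℝ} (hr : 0 < r) {z : ℂ} (hz : z ≠ 0) (a : ℝ) :
    ((r : ℂ) * z) ^ (a : ℂ) = ((r ^ a : ℝ) : ℂ) * z ^ (a : ℂ) := by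
  have hr' : (r : ℂ) ≠ 0 := by exact_mod_cast hr.ne'
  rw [Complex.cpow_def_of_ne_zero (mul_ne_zero hr' hz), Complex.log_ofReal_mul hr hz, add_mul,
    Complex.exp_add, Complex.ofReal_cpow hr.le, Complex.cpow_def_of_ne_zero hr',
    Complex.cpow_def_of_ne_zero hz, Complex.ofReal_log hr.le]

section Scaling
variable {ε : ℝ}

lemma scale_rpow (hα : 0 < α) (hε : 0 < ε) : (ε ^ (1 / α)) ^ α = ε := by
  rw [← Real.rpow_mul hε.le, one_div, inv_mul_cancel₀ hα.ne', Real.rpow_one]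

lemma norm_scale_rpow (hα : 0 < α) (hε : 0 < ε) (z : ℂ) :
    ‖((ε ^ (1 / α) : ℝ) : ℂ) * z‖ ^ α = ε * ‖z‖ ^ α := by
  have h : 0 < ε ^ (1 / α) := Real.rpow_pos_of_pos hε _
  rw [norm_mul, Complex.norm_real, Real.norm_of_nonneg h.le,
    Real.mul_rpow h.le (norm_nonneg _), scale_rpow hα hε]

lemma laplaceError_scale (hα : 0 < α) (hε : 0 < ε) {z : ℂ} (hz : z ≠ 0) :
    laplaceError μ α B (((ε ^ (1 / α) : ℝ) : ℂ) * z) =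
      laplace (scaledLaw α μ ε) z - (1 - ((ε * B : ℝ) : ℂ) * z ^ (α : ℂ)) := by
  rw [laplace_scaledLaw, laplaceError, ofReal_mul_cpow (Real.rpow_pos_of_pos hε _) hz,
    scale_rpow hα hε, laplace]
  push_cast; ring

variable {η D : ℝ} {p : ℕ}

/-- The relative error of the rescaled law is the error of the original law at `ε^(1/α) z` divided
by its main term.  A power law with an error of order `p + 1` in `s^α` makes it of order `o(ε^p)`,
at the price of a polynomial growth in `z`. -/
lemma norm_kappa_le (hα : 0 < α) (hα1 : α < 1) (hB : 0 < B) (hε : 0 < ε) (hη : 0 < η) (hD : 0 ≤ D)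
    (hp : p ≤ 1) (hbd : ∀ ζ : ℂ, 0 < ζ.re →
      ‖laplaceError μ α B ζ‖ ≤ η * (‖ζ‖ ^ α) ^ (p + 1) + D * (‖ζ‖ ^ α) ^ (p + 2))
    {z : ℂ} (hz : 1 ≤ z.re) :
    ‖kappa (scaledLaw α μ ε) α (ε * B) z‖ ≤ ε ^ p * ((η + D * ε) / B) * ‖z‖ ^ 2 := by
  have hz1 : 1 ≤ ‖z‖ := hz.trans (Complex.re_le_norm z)
  have hz0 : z ≠ 0 := norm_pos_iff.1 (by linarith)
  have hzr : 0 < (((ε ^ (1 / α) : ℝ) : ℂ) * z).re := by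
    have h : 0 < ε ^ (1 / α) := Real.rpow_pos_of_pos hε _
    rw [Complex.re_ofReal_mul]; nlinarith
  have h1 := hbd _ hzr
  rw [norm_scale_rpow hα hε] at h1
  set y := ‖z‖ ^ α with hy
  have hy1 : 1 ≤ y := Real.one_le_rpow hz1 hα.le
  have hyz : y ≤ ‖z‖ := by
    calc y ≤ ‖z‖ ^ (1 : ℝ) := Real.rpow_le_rpow_of_exponent_le hz1 hα1.le
      _ = ‖z‖ := Real.rpow_one _
  have hzα : z ^ (α : ℂ) ≠ 0 := by
    rw [Complex.cpow_def_of_ne_zero hz0]; exact Complex.exp_ne_zero _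
  have hεB : ((ε * B : ℝ) : ℂ) ≠ 0 := by exact_mod_cast (mul_pos hε hB).ne'
  have e : kappa (scaledLaw α μ ε) α (ε * B) z =
      laplaceError μ α B (((ε ^ (1 / α) : ℝ) : ℂ) * z) / (((ε * B : ℝ) : ℂ) * z ^ (α : ℂ)) := by
    rw [laplaceError_scale hα hε hz0, kappa]
    field_simp
    ring
  have e2 : ‖((ε * B : ℝ) : ℂ) * z ^ (α : ℂ)‖ = B * (ε * y) := by
    rw [norm_mul, Complex.norm_cpow_real, Complex.norm_real,
      Real.norm_of_nonneg (mul_pos hε hB).le]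
    ring
  have hεy : 0 < ε * y := by positivity
  rw [e, norm_div, e2, div_le_iff₀ (by positivity)]
  refine h1.trans ?_
  have e3 : ε ^ p * ((η + D * ε) / B) * ‖z‖ ^ 2 * (B * (ε * y)) =
      η * (ε ^ p * ‖z‖ ^ 2 * (ε * y)) + D * (ε ^ (p + 1) * ‖z‖ ^ 2 * (ε * y)) := by
    field_simp
    ring
  rw [e3]
  have h2 : ∀ n : ℕ, n ≤ 2 → (ε * y) ^ n ≤ ε ^ n * ‖z‖ ^ 2 := by
    intro n hn
    rw [mul_pow]
    have : y ^ n ≤ ‖z‖ ^ 2 := (pow_le_pow_left₀ (by linarith) hyz n).trans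
      (pow_le_pow_right₀ hz1 hn)
    gcongr
  have h3 : (ε * y) ^ (p + 1) ≤ ε ^ p * ‖z‖ ^ 2 * (ε * y) := by
    rw [pow_succ]
    exact mul_le_mul_of_nonneg_right (h2 p (by omega)) hεy.le
  have h4 : (ε * y) ^ (p + 2) ≤ ε ^ (p + 1) * ‖z‖ ^ 2 * (ε * y) := by
    rw [pow_succ]
    exact mul_le_mul_of_nonneg_right (h2 (p + 1) (by omega)) hεy.le
  gcongr

lemma norm_one_sub_laplace_le (hα : 0 < α) (hα1 : α < 1) (hB : 0 < B) (hε : 0 < ε) (hη : 0 < η)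
    (hD : 0 ≤ D) (hbd : ∀ ζ : ℂ, 0 < ζ.re →
      ‖laplaceError μ α B ζ‖ ≤ η * (‖ζ‖ ^ α) ^ 1 + D * (‖ζ‖ ^ α) ^ 2)
    {z : ℂ} (hz : 1 ≤ z.re) :
    ‖1 - laplace (scaledLaw α μ ε) z‖ ≤ ε * (B + η + D * ε) * ‖z‖ ^ 2 := by
  have hz1 : 1 ≤ ‖z‖ := hz.trans (Complex.re_le_norm z)
  have hz0 : z ≠ 0 := norm_pos_iff.1 (by linarith)
  have hzr : 0 < (((ε ^ (1 / α) : ℝ) : ℂ) * z).re := by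
    have h : 0 < ε ^ (1 / α) := Real.rpow_pos_of_pos hε _
    rw [Complex.re_ofReal_mul]; nlinarith
  have h1 := hbd _ hzr
  rw [norm_scale_rpow hα hε] at h1
  set y := ‖z‖ ^ α with hy
  have hy1 : 1 ≤ y := Real.one_le_rpow hz1 hα.le
  have hyz : y ≤ ‖z‖ := by
    calc y ≤ ‖z‖ ^ (1 : ℝ) := Real.rpow_le_rpow_of_exponent_le hz1 hα1.le
      _ = ‖z‖ := Real.rpow_one _
  have e : 1 - laplace (scaledLaw α μ ε) z = ((ε * B : ℝ) : ℂ) * z ^ (α : ℂ) -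
      laplaceError μ α B (((ε ^ (1 / α) : ℝ) : ℂ) * z) := by
    rw [laplaceError_scale hα hε hz0]; ring
  have e2 : ‖((ε * B : ℝ) : ℂ) * z ^ (α : ℂ)‖ = B * (ε * y) := by
    rw [norm_mul, Complex.norm_cpow_real, Complex.norm_real,
      Real.norm_of_nonneg (mul_pos hε hB).le]
    ring
  rw [e]
  refine (norm_sub_le _ _).trans ?_
  rw [e2]
  have hy2 : y ^ 2 ≤ ‖z‖ ^ 2 := pow_le_pow_left₀ (by linarith) hyz 2
  have hy3 : y ≤ ‖z‖ ^ 2 := by nlinarith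
  calc B * (ε * y) + ‖laplaceError μ α B (((ε ^ (1 / α) : ℝ) : ℂ) * z)‖
      ≤ B * (ε * y) + (η * (ε * y) ^ 1 + D * (ε * y) ^ 2) := by linarith
    _ = ε * ((B + η) * y + D * ε * y ^ 2) := by ring
    _ ≤ ε * ((B + η) * ‖z‖ ^ 2 + D * ε * ‖z‖ ^ 2) := by gcongr
    _ = _ := by ring

end Scaling

/-- The mean damping of one rescaled waiting time is at most `1 - k ε`. -/
lemma exists_integral_exp_neg_scaledLaw_le [IsProbabilityMeasure μ] (hpos : μ (Set.Iic 0) = 0)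
    (hα : 0 < α) (hB : 0 < B)
    (herr : (fun s : ℂ => laplaceError μ α B s)
      =o[𝓝[{s : ℂ | 0 < s.re}] 0] (fun s : ℂ => ‖s‖ ^ α)) :
    ∃ k, 0 < k ∧ ∀ᶠ ε in 𝓝[>] (0 : ℝ), ∫ w, Real.exp (-w) ∂(scaledLaw α μ ε) ≤ 1 - k * ε := by
  obtain ⟨D, hD, hbd⟩ := exists_norm_laplaceError_le hpos hα hB (p := 1)
    (by simpa using herr) (η := B / 4) (by positivity)
  refine ⟨B / 2, by positivity, ?_⟩
  have hsmall : ∀ᶠ ε in 𝓝[>] (0 : ℝ), D * ε < B / 4 := by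
    have : Tendsto (fun ε : ℝ => D * ε) (𝓝[>] 0) (𝓝 (D * 0)) :=
      (tendsto_const_nhds.mul tendsto_id).mono_left nhdsWithin_le_nhds
    exact this.eventually (gt_mem_nhds (by rw [mul_zero]; positivity))
  filter_upwards [hsmall, self_mem_nhdsWithin] with ε hDε hε
  have hε : 0 < ε := hε
  have hzr : 0 < (((ε ^ (1 / α) : ℝ) : ℂ) * 1).re := by
    simpa using Real.rpow_pos_of_pos hε _
  have h1 := hbd _ hzr
  rw [norm_scale_rpow hα hε, laplaceError_scale hα hε one_ne_zero] at h1
  simp only [norm_one, Real.one_rpow, mul_one, Complex.one_cpow, pow_one] at h1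
  have h2 : ∫ w, Real.exp (-w) ∂(scaledLaw α μ ε) = (laplace (scaledLaw α μ ε) 1).re := by
    have : laplace (scaledLaw α μ ε) 1 = ((∫ w, Real.exp (-w) ∂(scaledLaw α μ ε) : ℝ) : ℂ) := by
      rw [laplace, ← integral_complex_ofReal]
      congr 1; ext w; push_cast; simp
    rw [this, Complex.ofReal_re]
  have h3 := (Complex.re_le_norm _).trans h1
  simp only [Complex.sub_re, Complex.one_re, Complex.ofReal_re] at h3
  rw [h2]
  nlinarith

/-! #### Action of the multipliers on symbols -/

/-- A multiplier that grows like the power `k` costs `k` powers of decay of the symbol. -/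
lemma IsSymbol.mul {b K A : ℝ} {j k : ℕ} {X m : ℝ → ℂ} (hX : IsSymbol b (j + k) K X)
    (hA : 0 ≤ A) (hm : Measurable m) (hmA : ∀ ξ, ‖m ξ‖ ≤ A * ‖freq b ξ‖ ^ k) :
    IsSymbol b j (A * K) (fun ξ => m ξ * X ξ) := by
  refine ⟨hm.mul hX.measurable, fun ξ => ?_⟩
  rw [norm_mul]
  calc ‖m ξ‖ * ‖X ξ‖ * ‖freq b ξ‖ ^ j ≤ A * ‖freq b ξ‖ ^ k * ‖X ξ‖ * ‖freq b ξ‖ ^ j := by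
        gcongr; exact hmA ξ
    _ = A * (‖X ξ‖ * ‖freq b ξ‖ ^ (j + k)) := by rw [pow_add]; ring
    _ ≤ A * K := mul_le_mul_of_nonneg_left (hX.norm_le ξ) hA

variable {C C₀ : ℝ} {c : ℂ}

lemma norm_freq_add_le (hC : 0 ≤ C) (hc0 : ‖c‖ ≤ C₀) (ξ : ℝ) :
    ‖freq (C + 1) ξ + c‖ ≤ (1 + C₀) * ‖freq (C + 1) ξ‖ := by
  have h1 := norm_add_le (freq (C + 1) ξ) c
  have h2 := le_norm_freq (C + 1) ξ
  have h3 := norm_nonneg c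
  nlinarith

lemma measurable_kappa (ν : Measure ℝ) [SFinite ν] (α b : ℝ) :
    Measurable fun ξ => kappa ν α b (freq (C + 1) ξ + c) := by
  have h1 := measurable_laplace_freq (C := C) (c := c) ν
  have h2 := measurable_freq (C + 1)
  unfold kappa
  fun_prop

/-- Superpositions of exponentials weighted with the relative error `kappa` are small, uniformly
in the rate `c` and in the symbol. -/
lemma eventually_norm_mode_kappa_le [IsProbabilityMeasure μ] (hpos : μ (Set.Iic 0) = 0)
    (hα : 0 < α) (hα1 : α < 1) (hB : 0 < B) {p : ℕ} (hp : p ≤ 1)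
    (herr : (fun s : ℂ => laplaceError μ α B s)
      =o[𝓝[{s : ℂ | 0 < s.re}] 0] (fun s : ℂ => ‖s‖ ^ ((p + 1 : ℕ) * α)))
    (hC : 0 ≤ C) (C₀ K : ℝ) {δ : ℝ} (hδ : 0 < δ) :
    ∀ᶠ ε in 𝓝[>] (0 : ℝ), ∀ c : ℂ, -C ≤ c.re → ‖c‖ ≤ C₀ → ∀ X, IsSymbol (C + 1) 4 K X → ∀ T,
      ‖mode (C + 1) (fun ξ => kappa (scaledLaw α μ ε) α (ε * B) (freq (C + 1) ξ + c) * X ξ) T‖ ≤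
        ε ^ p * δ * Real.exp (-((C + 1) * T)) := by
  -- `π = ∫ dξ / (1 + ξ²)` bounds the superposition of a symbol of order two
  set E := (1 + |C₀|) ^ 2 * |K| * Real.pi / B with hE
  have hE0 : 0 ≤ E := by positivity
  set η := δ / (2 * (E + 1)) with hη
  have hη0 : 0 < η := by positivity
  obtain ⟨D, hD, hbd⟩ := exists_norm_laplaceError_le hpos hα hB (p := p + 1) herr hη0
  have hsmall : ∀ᶠ ε in 𝓝[>] (0 : ℝ), D * ε < η := by
    have : Tendsto (fun ε : ℝ => D * ε) (𝓝[>] 0) (𝓝 (D * 0)) :=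
      (tendsto_const_nhds.mul tendsto_id).mono_left nhdsWithin_le_nhds
    exact this.eventually (gt_mem_nhds (by rw [mul_zero]; exact hη0))
  filter_upwards [hsmall, self_mem_nhdsWithin] with ε hDε hε c hc hc0 X hX T
  have hε : 0 < ε := hε
  have hK : 0 ≤ K := hX.nonneg
  have hC0 : 0 ≤ C₀ := (norm_nonneg c).trans hc0
  have hA : 0 ≤ ε ^ p * ((η + D * ε) / B) := by positivity
  have hs := hX.mul (j := 2) (k := 2) (A := ε ^ p * ((η + D * ε) / B) * (1 + C₀) ^ 2)
    (by positivity) (measurable_kappa (C := C) (c := c) (scaledLaw α μ ε) α (ε * B)) (fun ξ => by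
      refine (norm_kappa_le hα hα1 hB hε hη0 hD hp hbd (one_le_re_freq_add hc ξ)).trans ?_
      rw [mul_assoc _ ((1 + C₀) ^ 2), ← mul_pow]
      exact mul_le_mul_of_nonneg_left
        (pow_le_pow_left₀ (norm_nonneg _) (norm_freq_add_le hC hc0 ξ) 2) hA)
  refine (norm_mode_le (by linarith) le_rfl hs T).trans ?_
  refine mul_le_mul_of_nonneg_right ?_ (Real.exp_pos _).le
  calc ε ^ p * ((η + D * ε) / B) * (1 + C₀) ^ 2 * K * Real.pi
      = ε ^ p * ((η + D * ε) * E) := by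
        rw [hE, abs_of_nonneg hC0, abs_of_nonneg hK]; ring
    _ ≤ ε ^ p * (2 * η * (E + 1)) := by
        refine mul_le_mul_of_nonneg_left ?_ (by positivity)
        exact mul_le_mul (by linarith) (by linarith) hE0 (by positivity)
    _ = ε ^ p * δ := by rw [hη]; field_simp

/-- Rescaled waiting times become short: `1 - φ(z)` has order `ε`. -/
lemma eventually_norm_mode_one_sub_laplace_le [IsProbabilityMeasure μ] (hpos : μ (Set.Iic 0) = 0)
    (hα : 0 < α) (hα1 : α < 1) (hB : 0 < B)
    (herr : (fun s : ℂ => laplaceError μ α B s)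
      =o[𝓝[{s : ℂ | 0 < s.re}] 0] (fun s : ℂ => ‖s‖ ^ α))
    (hC : 0 ≤ C) (C₀ K : ℝ) {δ : ℝ} (hδ : 0 < δ) :
    ∀ᶠ ε in 𝓝[>] (0 : ℝ), ∀ c : ℂ, -C ≤ c.re → ‖c‖ ≤ C₀ → ∀ X, IsSymbol (C + 1) 4 K X → ∀ T,
      ‖mode (C + 1) (fun ξ => (1 - laplace (scaledLaw α μ ε) (freq (C + 1) ξ + c)) * X ξ) T‖ ≤
        δ * Real.exp (-((C + 1) * T)) := by
  set E := (1 + |C₀|) ^ 2 * |K| * Real.pi with hE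
  have hE0 : 0 ≤ E := by positivity
  obtain ⟨D, hD, hbd⟩ := exists_norm_laplaceError_le hpos hα hB (p := 1)
    (by simpa using herr) one_pos
  have hsmall : ∀ᶠ ε in 𝓝[>] (0 : ℝ), ε * (B + 1 + D * ε) * E < δ := by
    have : Tendsto (fun ε : ℝ => ε * (B + 1 + D * ε) * E) (𝓝[>] 0)
        (𝓝 (0 * (B + 1 + D * 0) * E)) := by
      refine Tendsto.mono_left ?_ nhdsWithin_le_nhds
      exact Continuous.tendsto (by fun_prop) 0
    exact this.eventually (gt_mem_nhds (by rw [zero_mul, zero_mul]; exact hδ))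
  filter_upwards [hsmall, self_mem_nhdsWithin] with ε hDε hε c hc hc0 X hX T
  have hε : 0 < ε := hε
  have hK : 0 ≤ K := hX.nonneg
  have hC0 : 0 ≤ C₀ := (norm_nonneg c).trans hc0
  have hA : 0 ≤ ε * (B + 1 + D * ε) := by positivity
  have hs := hX.mul (j := 2) (k := 2) (A := ε * (B + 1 + D * ε) * (1 + C₀) ^ 2)
    (by positivity)
    (measurable_const.sub (measurable_laplace_freq (C := C) (c := c) (scaledLaw α μ ε)))
    (fun ξ => by
      refine (norm_one_sub_laplace_le hα hα1 hB hε one_pos hD hbd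
        (one_le_re_freq_add hc ξ)).trans ?_
      rw [mul_assoc _ ((1 + C₀) ^ 2), ← mul_pow]
      exact mul_le_mul_of_nonneg_left
        (pow_le_pow_left₀ (norm_nonneg _) (norm_freq_add_le hC hc0 ξ) 2) hA)
  refine (norm_mode_le (by linarith) le_rfl hs T).trans ?_
  refine mul_le_mul_of_nonneg_right ?_ (Real.exp_pos _).le
  calc ε * (B + 1 + D * ε) * (1 + C₀) ^ 2 * K * Real.pi = ε * (B + 1 + D * ε) * E := by
        rw [hE, abs_of_nonneg hC0, abs_of_nonneg hK]; ring
    _ ≤ δ := hDε.le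

end

/-! ### Test functions as superpositions of exponentials -/

section

/-- The Laplace transform in time of `ψ`, on the line `freq b`. -/
def symb (b : ℝ) (ψ : ℝ → ℝ → ℂ) (x ξ : ℝ) : ℂ :=
  ∫ t : ℝ, Complex.exp (freq b ξ * (t : ℂ)) * ψ x t

variable {ψ : ℝ → ℝ → ℂ}

lemma IsTest.continuous (h : IsTest ψ) : Continuous fun p : ℝ × ℝ => ψ p.1 p.2 := h.1.continuous

lemma IsTest.exists_bound (h : IsTest ψ) : ∃ R B : ℝ, 0 ≤ R ∧ 0 ≤ B ∧ (∀ x t, ‖ψ x t‖ ≤ B) ∧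
    (∀ x t, R < |x| → ψ x t = 0) ∧ (∀ x t, R < |t| → ψ x t = 0) := by
  obtain ⟨B, hB⟩ := h.2.exists_bound_of_continuous h.continuous
  obtain ⟨R, hR⟩ := h.2.isCompact.isBounded.exists_norm_le
  have key : ∀ x t : ℝ, ψ x t ≠ 0 → ‖(x, t)‖ ≤ R := fun x t hx =>
    hR _ (subset_tsupport _ (show (fun p : ℝ × ℝ => ψ p.1 p.2) (x, t) ≠ 0 from hx))
  refine ⟨max R 0, B, le_max_right _ _, (norm_nonneg _).trans (hB (0, 0)), fun x t => hB (x, t),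
    fun x t hx => ?_, fun x t ht => ?_⟩
  · by_contra h0
    have := (norm_fst_le (x, t)).trans (key x t h0)
    rw [Real.norm_eq_abs] at this
    exact absurd (this.trans (le_max_left _ _)) (not_le.2 hx)
  · by_contra h0
    have := (norm_snd_le (x, t)).trans (key x t h0)
    rw [Real.norm_eq_abs] at this
    exact absurd (this.trans (le_max_left _ _)) (not_le.2 ht)

lemma IsTest.contDiff_time (h : IsTest ψ) (x : ℝ) : ContDiff ℝ ∞ (ψ x) :=
  h.1.comp (contDiff_const.prodMk contDiff_id)

lemma IsTest.contDiff_space (h : IsTest ψ) (t : ℝ) : ContDiff ℝ ∞ (fun x => ψ x t) :=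
  h.1.comp (contDiff_id.prodMk contDiff_const)

lemma IsTest.lineDeriv (h : IsTest ψ) (v : ℝ × ℝ) :
    IsTest fun x t => fderiv ℝ (fun p : ℝ × ℝ => ψ p.1 p.2) (x, t) v := by
  refine ⟨?_, ?_⟩
  · exact (h.1.fderiv_right (m := ∞) le_rfl).clm_apply contDiff_const
  · exact (h.2.fderiv (𝕜 := ℝ)).comp_left (g := fun L : ℝ × ℝ →L[ℝ] ℂ => L v) rfl

lemma IsTest.deriv_time_eq (h : IsTest ψ) (x t : ℝ) :
    deriv (ψ x) t = fderiv ℝ (fun p : ℝ × ℝ => ψ p.1 p.2) (x, t) (0, 1) := by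
  have h1 : HasFDerivAt (fun p : ℝ × ℝ => ψ p.1 p.2) _ (x, t) :=
    (h.1.differentiable (by simp) (x, t)).hasFDerivAt
  have h2 : HasDerivAt (fun t : ℝ => (x, t)) ((0 : ℝ), (1 : ℝ)) t :=
    (hasDerivAt_const t x).prodMk (hasDerivAt_id t)
  exact (h1.comp_hasDerivAt t h2).deriv

lemma IsTest.deriv_space_eq (h : IsTest ψ) (x t : ℝ) :
    deriv (fun y => ψ y t) x = fderiv ℝ (fun p : ℝ × ℝ => ψ p.1 p.2) (x, t) (1, 0) := by
  have h1 : HasFDerivAt (fun p : ℝ × ℝ => ψ p.1 p.2) _ (x, t) :=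
    (h.1.differentiable (by simp) (x, t)).hasFDerivAt
  have h2 : HasDerivAt (fun y : ℝ => (y, t)) ((1 : ℝ), (0 : ℝ)) x :=
    (hasDerivAt_id x).prodMk (hasDerivAt_const x t)
  exact (h1.comp_hasDerivAt x h2).deriv

lemma IsTest.dt (h : IsTest ψ) : IsTest fun x t => deriv (ψ x) t := by
  simpa only [h.deriv_time_eq] using h.lineDeriv (0, 1)

lemma IsTest.dx (h : IsTest ψ) : IsTest fun x t => deriv (fun y => ψ y t) x := by
  simpa only [h.deriv_space_eq] using h.lineDeriv (1, 0)

lemma IsTest.dxx (h : IsTest ψ) : IsTest fun x t => iteratedDeriv 2 (fun y => ψ y t) x := by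
  have := h.dx.dx
  simpa only [iteratedDeriv_succ, iteratedDeriv_zero] using this

lemma IsTest.neg (h : IsTest ψ) : IsTest fun x t => -ψ x t := ⟨h.1.neg, HasCompactSupport.neg h.2⟩

lemma IsTest.hasCompactSupport_time (h : IsTest ψ) (x : ℝ) : HasCompactSupport (ψ x) := by
  obtain ⟨R, B, -, -, -, -, h3⟩ := h.exists_bound
  refine HasCompactSupport.intro (isCompact_Icc (a := -R) (b := R)) fun t ht => h3 x t ?_
  rw [Set.mem_Icc, ← abs_le] at ht
  exact not_le.1 ht

section
variable {b : ℝ}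

lemma IsTest.integrable_exp_mul (h : IsTest ψ) (x ξ : ℝ) :
    Integrable fun t : ℝ => Complex.exp (freq b ξ * (t : ℂ)) * ψ x t := by
  have hc : Continuous fun t : ℝ => Complex.exp (freq b ξ * (t : ℂ)) := by fun_prop
  exact (hc.mul (h.contDiff_time x).continuous).integrable_of_hasCompactSupport
    ((h.hasCompactSupport_time x).mul_left)

lemma IsTest.exists_norm_symb_le (h : IsTest ψ) (hb : 0 ≤ b) :
    ∃ K, ∀ x ξ, ‖symb b ψ x ξ‖ ≤ K := by
  obtain ⟨R, B, hR, hB, h1, -, h3⟩ := h.exists_bound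
  refine ⟨Real.exp (b * R) * B * (2 * R), fun x ξ => ?_⟩
  have e : symb b ψ x ξ = ∫ t in Set.Icc (-R) R, Complex.exp (freq b ξ * (t : ℂ)) * ψ x t := by
    refine (setIntegral_eq_integral_of_forall_compl_eq_zero fun t ht => ?_).symm
    rw [Set.mem_Icc, ← abs_le] at ht
    rw [h3 x t (not_le.1 ht), mul_zero]
  rw [e]
  have := norm_setIntegral_le_of_norm_le_const (μ := volume) (s := Set.Icc (-R) R)
    (f := fun t : ℝ => Complex.exp (freq b ξ * (t : ℂ)) * ψ x t) (C := Real.exp (b * R) * B)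
    (by simp) (fun t ht => by
      rw [norm_mul, Complex.norm_exp]
      have e2 : (freq b ξ * (t : ℂ)).re = b * t := by simp [freq]
      rw [e2]
      have : b * t ≤ b * R := mul_le_mul_of_nonneg_left ht.2 hb
      exact mul_le_mul (Real.exp_le_exp.2 this) (h1 x t) (norm_nonneg _) (Real.exp_pos _).le)
  refine this.trans (le_of_eq ?_)
  rw [Measure.real, Real.volume_Icc, ENNReal.toReal_ofReal (by linarith)]
  ring

/-- Integration by parts: a time derivative multiplies the symbol by `-freq`. -/
lemma IsTest.symb_deriv (h : IsTest ψ) (x ξ : ℝ) :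
    symb b (fun x t => deriv (ψ x) t) x ξ = -freq b ξ * symb b ψ x ξ := by
  have hu : ∀ t : ℝ, HasDerivAt (fun t : ℝ => Complex.exp (freq b ξ * (t : ℂ)))
      (freq b ξ * Complex.exp (freq b ξ * (t : ℂ))) t := by
    intro t
    have h1 : HasDerivAt (fun t : ℝ => freq b ξ * (t : ℂ)) (freq b ξ * 1) t :=
      (Complex.ofRealCLM.hasDerivAt (x := t)).const_mul _
    convert! h1.cexp using 1
    ring
  have hv : ∀ t : ℝ, HasDerivAt (ψ x) (deriv (ψ x) t) t := fun t =>
    ((h.contDiff_time x).differentiable (by simp) t).hasDerivAt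
  have := integral_mul_deriv_eq_deriv_mul_of_integrable (u := fun t : ℝ =>
    Complex.exp (freq b ξ * (t : ℂ))) (v := ψ x) (fun t _ => hu t) (fun t _ => hv t)
    (h.dt.integrable_exp_mul x ξ)
    (by
      have := (h.integrable_exp_mul (b := b) x ξ).const_mul (freq b ξ)
      refine this.congr (Eventually.of_forall fun t => ?_)
      simp only [Pi.mul_apply]; ring)
    (h.integrable_exp_mul x ξ)
  unfold symb
  rw [this, ← integral_const_mul, ← integral_neg]
  congr 1; ext t; ring

lemma IsTest.measurable_symb (h : IsTest ψ) (x : ℝ) : Measurable (symb b ψ x) := by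
  have h1 := measurable_freq b
  have h2 := (h.contDiff_time x).continuous.measurable
  have : Measurable fun q : ℝ × ℝ => Complex.exp (freq b q.1 * (q.2 : ℂ)) * ψ x q.2 := by fun_prop
  exact (this.stronglyMeasurable.integral_prod_right' (ν := volume)).measurable

/-- The symbols of a test function decay faster than any power, uniformly in space. -/
lemma IsTest.exists_isSymbol (hb : 0 ≤ b) (m : ℕ) {ψ : ℝ → ℝ → ℂ} (h : IsTest ψ) :
    ∃ K, ∀ x, IsSymbol b m K (symb b ψ x) := by
  suffices ∃ K, ∀ x ξ, ‖symb b ψ x ξ‖ * ‖freq b ξ‖ ^ m ≤ K by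
    obtain ⟨K, hK⟩ := this
    exact ⟨K, fun x => ⟨h.measurable_symb x, hK x⟩⟩
  induction m generalizing ψ with
  | zero => simpa using h.exists_norm_symb_le hb
  | succ m ih =>
    obtain ⟨K, hK⟩ := ih h.dt
    refine ⟨K, fun x ξ => le_trans (le_of_eq ?_) (hK x ξ)⟩
    rw [h.symb_deriv, norm_mul, norm_neg, pow_succ]
    ring

/-- Fourier inversion: a test function is the superposition of exponentials with its symbol. -/
lemma IsTest.eq_mode (hb : 1 ≤ b) (h : IsTest ψ) (x : ℝ) : ψ x = mode b (symb b ψ x) := by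
  obtain ⟨K, hK⟩ := h.exists_isSymbol (b := b) (by linarith) 2
  -- the line `freq b` is the imaginary axis shifted by `b`, that is, the Fourier transform of `F`
  set F : ℝ → ℂ := fun t => Complex.exp ((b * t : ℝ) : ℂ) * ψ x t with hF
  have hFc : Continuous F := by
    have := (h.contDiff_time x).continuous
    fun_prop
  have hFi : Integrable F := by
    refine hFc.integrable_of_hasCompactSupport ?_
    exact (h.hasCompactSupport_time x).mul_left
  have e1 : ∀ ξ, FourierTransform.fourier F ξ = symb b ψ x (-ξ) := by
    intro ξ
    rw [Real.fourier_real_eq_integral_exp_smul, symb]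
    congr 1; ext t
    rw [smul_eq_mul, hF, ← mul_assoc, ← Complex.exp_add, freq]
    congr 2
    push_cast; ring
  have hsi := (hK x).integrable hb le_rfl
  have hi : Integrable (FourierTransform.fourier F) := by
    rw [show FourierTransform.fourier F = fun ξ => symb b ψ x (-ξ) from funext e1]
    exact hsi.comp_neg
  have inv := hFc.fourier_fourierInv_eq hFi hi
  ext T
  have h2 := congrFun inv T
  have e3 : ∀ ξ, FourierTransformInv.fourierInv F ξ = symb b ψ x ξ := by
    intro ξ
    rw [Real.fourierInv_eq_fourier_neg, e1, neg_neg]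
  rw [Real.fourier_real_eq_integral_exp_smul] at h2
  simp_rw [e3, smul_eq_mul] at h2
  have h3 : ψ x T = Complex.exp (((-(b * T) : ℝ) : ℂ)) * F T := by
    rw [hF]
    simp only
    rw [← mul_assoc, ← Complex.exp_add]
    push_cast
    rw [neg_add_cancel, Complex.exp_zero, one_mul]
  rw [h3, ← h2, mode, ← integral_const_mul]
  congr 1; ext ξ
  rw [← mul_assoc, ← Complex.exp_add, freq]
  congr 2
  push_cast; ring

end

/-- The adjoint `-∂ₜ + c` of the substantial time derivative. -/
def adjDt (c : ℝ → ℂ) (ψ : ℝ → ℝ → ℂ) (x t : ℝ) : ℂ := -deriv (ψ x) t + c x * ψ x t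

/-- The adjoint of the substantial time derivative acts as the multiplier `z = freq + c`. -/
lemma IsTest.adjDt_eq_mode {b : ℝ} (hb : 1 ≤ b) (h : IsTest ψ) (c : ℝ → ℂ) (x : ℝ) :
    adjDt c ψ x = mode b (fun ξ => (freq b ξ + c x) * symb b ψ x ξ) := by
  obtain ⟨K, hK⟩ := h.exists_isSymbol (b := b) (by linarith) 2
  obtain ⟨K', hK'⟩ := h.dt.exists_isSymbol (b := b) (by linarith) 2
  ext t
  have e : (fun ξ => (freq b ξ + c x) * symb b ψ x ξ) =
      fun ξ => (-1) * symb b (fun x t => deriv (ψ x) t) x ξ + c x * symb b ψ x ξ := by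
    ext ξ; rw [h.symb_deriv]; ring
  rw [e, mode_add (((hK' x).integrable hb le_rfl).const_mul _)
    (((hK x).integrable hb le_rfl).const_mul _), mode_const_mul, mode_const_mul,
    ← h.eq_mode hb, ← h.dt.eq_mode hb, adjDt]
  ring

end

/-! ### Pairings written as integrals over trajectories -/

/-- A measurable function of space and time, damped in time and supported in `|x| ≤ R`. -/
structure IsDampedOn (b K R : ℝ) (χ : ℝ → ℝ → ℂ) : Prop where
  measurable : Measurable (fun q : ℝ × ℝ => χ q.1 q.2)
  norm_le : ∀ x t, ‖χ x t‖ ≤ K * Real.exp (-(b * t))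
  eq_zero : ∀ x t, R < |x| → χ x t = 0

/-- On bounded test functions supported in `|x| ≤ R`, the distribution `g t` is the law of the
position `π y t` weighted with the density `k y t`, where `y` is distributed according to `ν`. -/
structure IsRep {Y : Type*} [MeasurableSpace Y] (C L R : ℝ) (ν : Measure Y) (k : Y → ℝ → ℂ)
    (π : Y → ℝ → ℝ) (g : DistPath) : Prop where
  measurable_weight : Measurable (fun q : Y × ℝ => k q.1 q.2)
  measurable_pos : Measurable (fun q : Y × ℝ => π q.1 q.2)
  norm_weight_le : ∀ y t, 0 ≤ t → ‖k y t‖ ≤ L * Real.exp (C * t)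
  eq_integral : ∀ t, 0 < t → ∀ (h : ℝ → ℂ) (K : ℝ), Measurable h → (∀ x, ‖h x‖ ≤ K) →
    (∀ x, R < |x| → h x = 0) → g t h = ∫ y, k y t * h (π y t) ∂ν

/-- The pairing of a represented distribution with `χ`, the time integral being taken first. -/
def repPair {Y : Type*} [MeasurableSpace Y] (ν : Measure Y) (k : Y → ℝ → ℂ)
    (π : Y → ℝ → ℝ) (χ : ℝ → ℝ → ℂ) : ℂ :=
  ∫ y, (∫ t in Set.Ioi (0 : ℝ), k y t * χ (π y t) t) ∂ν

section
variable {Y : Type*} [MeasurableSpace Y] {C L R K K' : ℝ} {ν : Measure Y} {k : Y → ℝ → ℂ}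
  {π : Y → ℝ → ℝ} {g : DistPath} {χ χ' : ℝ → ℝ → ℂ}

lemma IsDampedOn.mono {R' : ℝ} {b : ℝ} (h : IsDampedOn b K R χ) (hR : R ≤ R') :
    IsDampedOn b K R' χ :=
  ⟨h.measurable, h.norm_le, fun x t hx => h.eq_zero x t (hR.trans_lt hx)⟩

lemma IsDampedOn.add {b : ℝ} (h : IsDampedOn b K R χ) (h' : IsDampedOn b K' R χ') :
    IsDampedOn b (K + K') R (fun x t => χ x t + χ' x t) :=
  ⟨h.measurable.add h'.measurable, fun x t => by
    rw [add_mul]; exact (norm_add_le _ _).trans (add_le_add (h.norm_le x t) (h'.norm_le x t)),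
    fun x t hx => by simp [h.eq_zero x t hx, h'.eq_zero x t hx]⟩

lemma IsDampedOn.const_mul {b : ℝ} (h : IsDampedOn b K R χ) (a : ℂ) :
    IsDampedOn b (‖a‖ * K) R (fun x t => a * χ x t) :=
  ⟨h.measurable.const_mul a, fun x t => by
    rw [norm_mul, mul_assoc]; exact mul_le_mul_of_nonneg_left (h.norm_le x t) (norm_nonneg a),
    fun x t hx => by simp [h.eq_zero x t hx]⟩

lemma IsRep.norm_mul_le (hg : IsRep C L R ν k π g) (hχ : IsDampedOn (C + 1) K R χ) (y : Y) {t : ℝ}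
    (ht : 0 ≤ t) : ‖k y t * χ (π y t) t‖ ≤ L * K * Real.exp (-t) := by
  have hL : 0 ≤ L := by
    have := (norm_nonneg _).trans (hg.norm_weight_le y 0 le_rfl)
    simpa using this
  rw [norm_mul]
  calc _ ≤ L * Real.exp (C * t) * (K * Real.exp (-((C + 1) * t))) :=
        mul_le_mul (hg.norm_weight_le y t ht) (hχ.norm_le _ _) (norm_nonneg _)
          (by positivity)
    _ = L * K * (Real.exp (C * t) * Real.exp (-((C + 1) * t))) := by ring
    _ = _ := by rw [← Real.exp_add]; congr 2; ring

lemma IsRep.integrable_prod [IsFiniteMeasure ν] (hg : IsRep C L R ν k π g)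
    (hχ : IsDampedOn (C + 1) K R χ) :
    Integrable (fun q : Y × ℝ => k q.1 q.2 * χ (π q.1 q.2) q.2)
      (ν.prod (volume.restrict (Set.Ioi 0))) := by
  have hm : Measurable fun q : Y × ℝ => k q.1 q.2 * χ (π q.1 q.2) q.2 :=
    hg.measurable_weight.mul
      (hχ.measurable.comp (f := fun q : Y × ℝ => (π q.1 q.2, q.2))
        (hg.measurable_pos.prodMk measurable_snd))
  have h1 : Integrable (fun t : ℝ => L * K * Real.exp (-t)) (volume.restrict (Set.Ioi 0)) :=
    (integrableOn_exp_neg_Ioi 0).const_mul _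
  refine Integrable.mono' (h1.comp_snd ν) hm.aestronglyMeasurable ?_
  have h2 : ∀ᵐ t ∂(volume.restrict (Set.Ioi (0 : ℝ))), ∀ y, ‖k y t * χ (π y t) t‖ ≤
      L * K * Real.exp (-t) :=
    (ae_restrict_iff' measurableSet_Ioi).2
      (Eventually.of_forall fun t ht y => hg.norm_mul_le hχ y (le_of_lt ht))
  have h3 : ∀ᵐ q : Y × ℝ ∂(ν.prod (volume.restrict (Set.Ioi 0))), ∀ y,
      ‖k y q.2 * χ (π y q.2) q.2‖ ≤ L * K * Real.exp (-q.2) :=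
    Measure.quasiMeasurePreserving_snd.ae h2
  exact h3.mono fun q hq => hq q.1

lemma IsRep.pair_eq [IsFiniteMeasure ν] (hg : IsRep C L R ν k π g)
    (hχ : IsDampedOn (C + 1) K R χ) : pair g χ = repPair ν k π χ := by
  have h1 : pair g χ = ∫ t in Set.Ioi (0 : ℝ), (∫ y, k y t * χ (π y t) t ∂ν) := by
    refine setIntegral_congr_fun measurableSet_Ioi fun t ht => ?_
    exact hg.eq_integral t ht _ _ (hχ.measurable.comp (f := fun x : ℝ => (x, t))
      (measurable_id.prodMk measurable_const)) (fun x => hχ.norm_le x t)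
        fun x hx => hχ.eq_zero x t hx
  rw [h1, repPair]
  exact (integral_integral_swap (f := fun y t => k y t * χ (π y t) t)
    (hg.integrable_prod hχ)).symm

lemma IsRep.repPair_add [IsFiniteMeasure ν] (hg : IsRep C L R ν k π g)
    (hχ : IsDampedOn (C + 1) K R χ) (hχ' : IsDampedOn (C + 1) K' R χ') :
    repPair ν k π (fun x t => χ x t + χ' x t) = repPair ν k π χ + repPair ν k π χ' := by
  have h1 := hg.integrable_prod hχ
  have h2 := hg.integrable_prod hχ'
  unfold repPair
  rw [← integral_add h1.integral_prod_left h2.integral_prod_left]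
  refine integral_congr_ae ?_
  filter_upwards [h1.prod_right_ae, h2.prod_right_ae] with y h3 h4
  rw [← integral_add h3 h4]
  simp only [mul_add]

lemma IsRep.repPair_sub_weight [IsFiniteMeasure ν] {L' : ℝ} {k' : Y → ℝ → ℂ} {g' : DistPath}
    (hg : IsRep C L R ν k π g) (hg' : IsRep C L' R ν k' π g') (hχ : IsDampedOn (C + 1) K R χ) :
    repPair ν (fun y t => k y t - k' y t) π χ = repPair ν k π χ - repPair ν k' π χ := by
  have h1 := hg.integrable_prod hχ
  have h2 := hg'.integrable_prod hχ
  unfold repPair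
  rw [← integral_sub h1.integral_prod_left h2.integral_prod_left]
  refine integral_congr_ae ?_
  filter_upwards [h1.prod_right_ae, h2.prod_right_ae] with y h3 h4
  rw [← integral_sub h3 h4]
  simp only [sub_mul]

lemma repPair_const_mul (a : ℂ) :
    repPair ν k π (fun x t => a * χ x t) = a * repPair ν k π χ := by
  unfold repPair
  simp_rw [mul_left_comm _ a, integral_const_mul]

section Subst

variable {c : ℝ → ℂ} {ψ : ℝ → ℝ → ℂ}

lemma IsTest.exists_isDampedOn (hψ : IsTest ψ) {b : ℝ} (hb : 0 ≤ b) :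
    ∃ K R, IsDampedOn b K R ψ := by
  obtain ⟨R, B, hR, hB, h1, h2, h3⟩ := hψ.exists_bound
  refine ⟨B * Real.exp (b * R), R, hψ.continuous.measurable, fun x t => ?_, h2⟩
  by_cases ht : R < |t|
  · rw [h3 x t ht, norm_zero]; positivity
  · have h4 : t ≤ R := (le_abs_self t).trans (not_lt.1 ht)
    rw [mul_assoc, ← Real.exp_add]
    refine (h1 x t).trans (le_mul_of_one_le_right hB (Real.one_le_exp ?_))
    nlinarith

lemma IsTest.exists_isDampedOn_mul (hψ : IsTest ψ) {b : ℝ} (hb : 0 ≤ b) (hc : Measurable c)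
    (hloc : ∀ R : ℝ, ∃ D : ℝ, ∀ x : ℝ, |x| ≤ R → ‖c x‖ ≤ D) :
    ∃ K R, IsDampedOn b K R (fun x t => c x * ψ x t) := by
  obtain ⟨K, R, h⟩ := hψ.exists_isDampedOn hb
  obtain ⟨D, hD⟩ := hloc R
  refine ⟨|D| * K, R, (hc.comp measurable_fst).mul h.measurable, fun x t => ?_,
    fun x t hx => by simp [h.eq_zero x t hx]⟩
  by_cases hx : R < |x|
  · rw [h.eq_zero x t hx, mul_zero, norm_zero, mul_assoc]
    exact mul_nonneg (abs_nonneg _) ((norm_nonneg _).trans (h.norm_le x t))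
  · rw [norm_mul, mul_assoc]
    exact mul_le_mul ((hD x (not_lt.1 hx)).trans (le_abs_self D)) (h.norm_le x t) (norm_nonneg _)
      (abs_nonneg _)

lemma IsTest.exists_isDampedOn_adjDt (hψ : IsTest ψ) {b : ℝ} (hb : 0 ≤ b) (hc : Measurable c)
    (hloc : ∀ R : ℝ, ∃ D : ℝ, ∀ x : ℝ, |x| ≤ R → ‖c x‖ ≤ D) :
    ∃ K R, IsDampedOn b K R (adjDt c ψ) := by
  obtain ⟨K, R, h⟩ := hψ.dt.neg.exists_isDampedOn hb
  obtain ⟨K', R', h'⟩ := hψ.exists_isDampedOn_mul hb hc hloc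
  exact ⟨_, _, (h.mono (le_max_left R R')).add (h'.mono (le_max_right R R'))⟩

lemma measurable_substInt {β : ℝ} (hc : Measurable c)
    (hχ : Measurable (fun q : ℝ × ℝ => χ q.1 q.2)) :
    Measurable fun q : ℝ × ℝ => substInt β (c q.1) (χ q.1) q.2 := by
  have : Measurable fun q : (ℝ × ℝ) × ℝ => ((q.2 ^ (-β) : ℝ) : ℂ) *
      (Complex.exp (-(q.2 : ℂ) * c q.1.1) * χ q.1.1 (q.1.2 + q.2)) := by
    have h1 : Measurable fun q : (ℝ × ℝ) × ℝ => χ q.1.1 (q.1.2 + q.2) :=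
      hχ.comp (f := fun q : (ℝ × ℝ) × ℝ => (q.1.1, q.1.2 + q.2)) (by fun_prop)
    fun_prop
  exact ((this.stronglyMeasurable.integral_prod_right'
    (ν := volume.restrict (Set.Ioi (0 : ℝ)))).measurable).const_mul _

lemma IsDampedOn.substInt {β : ℝ} (hβ : β < 1) (hcm : Measurable c) (hc : ∀ x, -C ≤ (c x).re)
    (hχ : IsDampedOn (C + 1) K R χ) :
    IsDampedOn (C + 1) K R (fun x => substInt β (c x) (χ x)) := by
  refine ⟨measurable_substInt hcm hχ.measurable, fun x T => ?_, fun x T hx => ?_⟩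
  · have hΓ : 0 < Real.Gamma (1 - β) := Real.Gamma_pos_of_pos (by linarith)
    have h1 := norm_integral_le_of_norm_le (μ := volume.restrict (Set.Ioi (0 : ℝ)))
      (f := fun u : ℝ => ((u ^ (-β) : ℝ) : ℂ) *
        (Complex.exp (-(u : ℂ) * c x) * χ x (T + u)))
      (g := fun u => K * Real.exp (-((C + 1) * T)) * (u ^ (-β) * Real.exp (-u)))
      ((integrableOn_rpow_mul_exp_neg hβ).const_mul _)
      ((ae_restrict_iff' measurableSet_Ioi).2 (Eventually.of_forall fun u hu => by
        have hu0 : (0 : ℝ) ≤ u := le_of_lt hu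
        rw [norm_mul, Complex.norm_real, Real.norm_of_nonneg (Real.rpow_nonneg hu0 _)]
        refine (mul_le_mul_of_nonneg_left (norm_shift_le (hc x) (hχ.norm_le x) T hu0)
          (Real.rpow_nonneg hu0 _)).trans (le_of_eq (by ring))))
    have h2 : ∫ u in Set.Ioi (0 : ℝ), u ^ (-β) * Real.exp (-u) = Real.Gamma (1 - β) := by
      rw [Real.Gamma_eq_integral (by linarith), sub_sub_cancel_left]
      congr 1; ext u; ring
    rw [integral_const_mul, h2] at h1
    rw [FcP.substInt, norm_mul, norm_inv, Complex.norm_real, Real.norm_of_nonneg hΓ.le]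
    calc _ ≤ (Real.Gamma (1 - β))⁻¹ * (K * Real.exp (-((C + 1) * T)) * Real.Gamma (1 - β)) :=
          mul_le_mul_of_nonneg_left h1 (inv_nonneg.2 hΓ.le)
      _ = _ := by field_simp
  · simp [FcP.substInt, hχ.eq_zero _ _ hx]

/-- The kernel of the substantial fractional integral is integrable on `0 < r < t`. -/
lemma integrable_substKernel {β : ℝ} (hβ : β < 1) :
    Integrable (fun q : ℝ × ℝ => (Set.Ioi (0 : ℝ)).indicator (fun r => Real.exp (-r)) q.2 *
      (Set.Ioi (0 : ℝ)).indicator (fun u => u ^ (-β) * Real.exp (-u)) (q.1 - q.2))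
      (volume.prod volume) := by
  have h1 : Integrable ((Set.Ioi (0 : ℝ)).indicator (fun r => Real.exp (-r))) :=
    (integrable_indicator_iff measurableSet_Ioi).2 (integrableOn_exp_neg_Ioi 0)
  have h2 : Integrable ((Set.Ioi (0 : ℝ)).indicator (fun u : ℝ => u ^ (-β) * Real.exp (-u))) :=
    (integrable_indicator_iff measurableSet_Ioi).2 (integrableOn_rpow_mul_exp_neg hβ)
  exact h1.convolution_integrand (ContinuousLinearMap.mul ℝ ℝ) h2

/-- Fubini: the pairing with the fractional substantial derivative, in which the outer
derivative `∂ₜ + c` has been moved to the test function, moves the fractional integral to the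
test function too. -/
lemma IsRep.substPair_eq [IsFiniteMeasure ν] (hg : IsRep C L R ν k π g) {β : ℝ} (hβ : β < 1)
    (hcm : Measurable c) (hc : ∀ x, -C ≤ (c x).re)
    (hχ : IsDampedOn (C + 1) K R (adjDt c ψ)) :
    substPair β c g ψ = repPair ν k π (fun x => substInt β (c x) (adjDt c ψ x)) := by
  set χ := adjDt c ψ with hχdef
  set Θ : (ℝ × ℝ) × Y → ℂ := fun z => (Set.Ioi (0 : ℝ)).indicator (fun r : ℝ =>
    (Set.Ioi (0 : ℝ)).indicator (fun u : ℝ => ((u ^ (-β) : ℝ) : ℂ) * (k z.2 r *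
      (Complex.exp (-(u : ℂ) * c (π z.2 r)) * χ (π z.2 r) (r + u)))) (z.1.1 - r)) z.1.2 with hΘ
  have hΘm : Measurable Θ := by
    have e : Θ = {z : (ℝ × ℝ) × Y | 0 < z.1.2 ∧ 0 < z.1.1 - z.1.2}.indicator (fun z =>
        (((z.1.1 - z.1.2) ^ (-β) : ℝ) : ℂ) * (k z.2 z.1.2 *
        (Complex.exp (-((z.1.1 - z.1.2 : ℝ) : ℂ) * c (π z.2 z.1.2)) *
          χ (π z.2 z.1.2) (z.1.2 + (z.1.1 - z.1.2))))) := by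
      ext z
      by_cases h1 : 0 < z.1.2 <;> simp [hΘ, Set.indicator, h1]
    rw [e]
    have hset : MeasurableSet {z : (ℝ × ℝ) × Y | 0 < z.1.2 ∧ 0 < z.1.1 - z.1.2} :=
      (measurableSet_lt measurable_const (measurable_snd.comp measurable_fst)).inter
        (measurableSet_lt measurable_const
          ((measurable_fst.comp measurable_fst).sub (measurable_snd.comp measurable_fst)))
    refine Measurable.indicator ?_ hset
    have h1 : Measurable fun z : (ℝ × ℝ) × Y => k z.2 z.1.2 :=
      hg.measurable_weight.comp (f := fun z : (ℝ × ℝ) × Y => (z.2, z.1.2)) (by fun_prop)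
    have h2 : Measurable fun z : (ℝ × ℝ) × Y => π z.2 z.1.2 :=
      hg.measurable_pos.comp (f := fun z : (ℝ × ℝ) × Y => (z.2, z.1.2)) (by fun_prop)
    have h3 : Measurable fun z : (ℝ × ℝ) × Y => χ (π z.2 z.1.2) (z.1.2 + (z.1.1 - z.1.2)) :=
      hχ.measurable.comp
        (f := fun z : (ℝ × ℝ) × Y => (π z.2 z.1.2, z.1.2 + (z.1.1 - z.1.2)))
        (h2.prodMk (by fun_prop))
    have h4 : Measurable fun z : (ℝ × ℝ) × Y => c (π z.2 z.1.2) := hcm.comp h2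
    have h5 : Measurable fun z : (ℝ × ℝ) × Y => (((z.1.1 - z.1.2) ^ (-β) : ℝ) : ℂ) := by
      fun_prop
    have h6 : Measurable fun z : (ℝ × ℝ) × Y => Complex.exp (-((z.1.1 - z.1.2 : ℝ) : ℂ) *
        c (π z.2 z.1.2)) :=
      Complex.measurable_exp.comp ((Complex.measurable_ofReal.comp
        ((measurable_fst.comp measurable_fst).sub (measurable_snd.comp measurable_fst))).neg.mul h4)
    exact h5.mul (h1.mul (h6.mul h3))
  have hK : 0 ≤ K := by
    have := (norm_nonneg _).trans (hχ.norm_le 0 0)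
    simpa using this
  have hΘb : ∀ z, ‖Θ z‖ ≤ |L| * K * ((Set.Ioi (0 : ℝ)).indicator (fun r => Real.exp (-r)) z.1.2 *
      (Set.Ioi (0 : ℝ)).indicator (fun u => u ^ (-β) * Real.exp (-u)) (z.1.1 - z.1.2)) := by
    intro z
    by_cases h1 : z.1.2 ∈ Set.Ioi (0 : ℝ)
    · by_cases h2 : z.1.1 - z.1.2 ∈ Set.Ioi (0 : ℝ)
      · simp only [hΘ]
        rw [Set.indicator_of_mem h1, Set.indicator_of_mem h2, Set.indicator_of_mem h1,
          Set.indicator_of_mem h2]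
        have hu0 : (0 : ℝ) ≤ z.1.1 - z.1.2 := le_of_lt h2
        have hr0 : (0 : ℝ) ≤ z.1.2 := le_of_lt h1
        rw [norm_mul, norm_mul, Complex.norm_real, Real.norm_of_nonneg (Real.rpow_nonneg hu0 _)]
        have h3 := norm_shift_le (hc (π z.2 z.1.2)) (hχ.norm_le (π z.2 z.1.2)) z.1.2 hu0
        have h4 := hg.norm_weight_le z.2 z.1.2 hr0
        calc _ ≤ (z.1.1 - z.1.2) ^ (-β) * (|L| * Real.exp (C * z.1.2) *
              (K * Real.exp (-((C + 1) * z.1.2)) * Real.exp (-(z.1.1 - z.1.2)))) := by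
              refine mul_le_mul_of_nonneg_left ?_ (Real.rpow_nonneg hu0 _)
              exact mul_le_mul (h4.trans (mul_le_mul_of_nonneg_right (le_abs_self L)
                (Real.exp_pos _).le)) h3 (norm_nonneg _) (by positivity)
          _ = |L| * K * ((Real.exp (C * z.1.2) * Real.exp (-((C + 1) * z.1.2))) *
              ((z.1.1 - z.1.2) ^ (-β) * Real.exp (-(z.1.1 - z.1.2)))) := by ring
          _ = _ := by rw [← Real.exp_add]; congr 4; ring
      · simp only [hΘ]
        rw [Set.indicator_of_mem h1, Set.indicator_of_notMem h2, Set.indicator_of_notMem h2]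
        simp
    · simp only [hΘ]
      rw [Set.indicator_of_notMem h1, Set.indicator_of_notMem h1]
      simp
  have hker := (integrable_substKernel hβ).const_mul (|L| * K)
  have hΘi : Integrable Θ ((volume.prod volume).prod ν) :=
    Integrable.mono' (hker.comp_fst ν) hΘm.aestronglyMeasurable (Eventually.of_forall hΘb)
  have hΘy : ∀ y, Integrable (fun q : ℝ × ℝ => Θ (q, y)) (volume.prod volume) := fun y =>
    Integrable.mono' hker
      (hΘm.comp (f := fun q : ℝ × ℝ => (q, y)) (by fun_prop)).aestronglyMeasurable
      (Eventually.of_forall fun q => hΘb (q, y))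
  -- the left side is the integral of `Θ` in the order `t, r, y`
  have hL : substPair β c g ψ =
      ((Real.Gamma (1 - β))⁻¹ : ℂ) * ∫ t, ∫ r, (∫ y, Θ ((t, r), y) ∂ν) := by
    rw [substPair, integral_const_mul]
    congr 1
    rw [← integral_indicator measurableSet_Ioi]
    congr 1; ext t
    by_cases ht : t ∈ Set.Ioi (0 : ℝ)
    · rw [Set.indicator_of_mem ht, intervalIntegral.integral_of_le (le_of_lt ht),
        ← integral_indicator measurableSet_Ioc]
      refine integral_congr_ae ?_
      have hne : ∀ᵐ r : ℝ, r ≠ t := by simp [ae_iff, measure_singleton]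
      filter_upwards [hne] with r hr
      by_cases h1 : r ∈ Set.Ioi (0 : ℝ)
      · by_cases h2 : t - r ∈ Set.Ioi (0 : ℝ)
        · rw [Set.indicator_of_mem (show r ∈ Set.Ioc 0 t from
            ⟨h1, by have : 0 < t - r := h2; linarith⟩)]
          have h3 : Measurable fun x : ℝ => Complex.exp (-((t - r : ℝ) : ℂ) * c x) *
              (-deriv (ψ x) t + c x * ψ x t) := by
            have : Measurable fun x : ℝ => χ x t :=
              hχ.measurable.comp (f := fun x : ℝ => (x, t)) (by fun_prop)
            have : Measurable fun x : ℝ => -deriv (ψ x) t + c x * ψ x t := this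
            fun_prop
          have h4 : ∀ x, ‖Complex.exp (-((t - r : ℝ) : ℂ) * c x) *
              (-deriv (ψ x) t + c x * ψ x t)‖ ≤
              K * Real.exp (-((C + 1) * r)) * Real.exp (-(t - r)) := fun x => by
            have := norm_shift_le (hc x) (hχ.norm_le x) r (le_of_lt h2)
            rwa [add_sub_cancel] at this
          rw [hg.eq_integral r h1 _ _ h3 h4 (fun x hx => by
            have : -deriv (ψ x) t + c x * ψ x t = 0 := hχ.eq_zero x t hx
            rw [this, mul_zero]), ← integral_const_mul]
          congr 1; ext y
          simp only [hΘ]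
          rw [Set.indicator_of_mem h1, Set.indicator_of_mem h2, add_sub_cancel]
          rfl
        · have : r ∉ Set.Ioc 0 t := fun h => h2 (sub_pos.2 (lt_of_le_of_ne h.2 hr))
          rw [Set.indicator_of_notMem this]
          simp only [hΘ]
          simp_rw [Set.indicator_of_mem h1, Set.indicator_of_notMem h2]
          simp
      · have : r ∉ Set.Ioc 0 t := fun h => h1 h.1
        rw [Set.indicator_of_notMem this]
        simp only [hΘ]
        simp_rw [Set.indicator_of_notMem h1]
        simp
    · rw [Set.indicator_of_notMem ht]
      symm
      refine integral_eq_zero_of_ae (Eventually.of_forall fun r => ?_)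
      refine integral_eq_zero_of_ae (Eventually.of_forall fun y => ?_)
      simp only [hΘ]
      by_cases h1 : r ∈ Set.Ioi (0 : ℝ)
      · have h2 : t - r ∉ Set.Ioi (0 : ℝ) := by
          simp only [Set.mem_Ioi, not_lt] at h1 ht ⊢; linarith
        rw [Set.indicator_of_mem h1, Set.indicator_of_notMem h2]; rfl
      · rw [Set.indicator_of_notMem h1]; rfl
  -- the right side is the integral of `Θ` in the order `y, r, t`
  have hR : repPair ν k π (fun x => FcP.substInt β (c x) (χ x)) =
      ((Real.Gamma (1 - β))⁻¹ : ℂ) * ∫ y, (∫ r, ∫ t, Θ ((t, r), y)) ∂ν := by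
    rw [repPair, ← integral_const_mul]
    congr 1; ext y
    rw [← integral_const_mul, ← integral_indicator measurableSet_Ioi]
    congr 1; ext r
    by_cases h1 : r ∈ Set.Ioi (0 : ℝ)
    · rw [Set.indicator_of_mem h1, FcP.substInt, mul_left_comm, ← integral_const_mul]
      congr 1
      have e : ∫ t, Θ ((t, r), y) = ∫ t, (Set.Ioi (0 : ℝ)).indicator (fun u : ℝ =>
          ((u ^ (-β) : ℝ) : ℂ) * (k y r *
          (Complex.exp (-(u : ℂ) * c (π y r)) * χ (π y r) (r + u)))) (t - r) := by
        congr 1; ext t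
        simp only [hΘ]
        rw [Set.indicator_of_mem h1]
      rw [e, integral_sub_right_eq_self (fun u => (Set.Ioi (0 : ℝ)).indicator (fun u : ℝ =>
          ((u ^ (-β) : ℝ) : ℂ) * (k y r *
          (Complex.exp (-(u : ℂ) * c (π y r)) * χ (π y r) (r + u)))) u),
        integral_indicator measurableSet_Ioi]
      congr 1; ext u; ring
    · rw [Set.indicator_of_notMem h1]
      have : ∀ t, Θ ((t, r), y) = 0 := fun t => by
        simp only [hΘ]; rw [Set.indicator_of_notMem h1]
      simp [this]
  rw [hL, hR]
  congr 1
  have s1 : ∫ t, ∫ r, (∫ y, Θ ((t, r), y) ∂ν) =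
      ∫ q : ℝ × ℝ, (∫ y, Θ (q, y) ∂ν) ∂(volume.prod volume) :=
    (integral_prod (fun q : ℝ × ℝ => ∫ y, Θ (q, y) ∂ν) hΘi.integral_prod_left).symm
  have s2 : ∫ q : ℝ × ℝ, (∫ y, Θ (q, y) ∂ν) ∂(volume.prod volume) =
      ∫ y, (∫ q : ℝ × ℝ, Θ (q, y) ∂(volume.prod volume)) ∂ν :=
    integral_integral_swap (f := fun q y => Θ (q, y)) hΘi
  rw [s1, s2]
  congr 1; ext y
  exact integral_prod_symm (fun q : ℝ × ℝ => Θ (q, y)) (hΘy y)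

end Subst

end

/-! ### Gaussian averages of smooth functions -/

/-- One step of Taylor's formula: a bound `K |y|^n` on the derivative gives `K |y|^(n+1)`. -/
lemma norm_le_pow_succ_of_hasDerivAt {f f' : ℝ → ℂ} (hf : ∀ y, HasDerivAt f (f' y) y)
    (h0 : f 0 = 0) {K r : ℝ} (hK : 0 ≤ K) {n : ℕ} (hb : ∀ y, |y| ≤ r → ‖f' y‖ ≤ K * |y| ^ n)
    (y : ℝ) (hy : |y| ≤ r) : ‖f y‖ ≤ K * |y| ^ (n + 1) := by
  have h := (convex_closedBall (0 : ℝ) |y|).norm_image_sub_le_of_norm_hasDerivWithin_le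
    (f := f) (f' := f') (C := K * |y| ^ n) (x := 0) (y := y)
    (fun z _ => (hf z).hasDerivWithinAt)
    (fun z hz => by
      have hz : |z| ≤ |y| := by simpa using hz
      exact (hb z (hz.trans hy)).trans (by gcongr))
    (by simp) (by simp)
  rw [h0, sub_zero, sub_zero, Real.norm_eq_abs] at h
  rw [pow_succ]; linarith

section Taylor
variable {h : ℝ → ℂ} {K : ℝ}

lemma hasDerivAt_deriv_comp_add {h : ℝ → ℂ} {n : ℕ} (hh : ContDiff ℝ (n + 1 : ℕ) h) (x y : ℝ) :
    HasDerivAt (fun y => iteratedDeriv n h (x + y)) (iteratedDeriv (n + 1) h (x + y)) y := by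
  have h1 : HasDerivAt (iteratedDeriv n h) (iteratedDeriv (n + 1) h (x + y)) (x + y) := by
    rw [iteratedDeriv_succ]
    exact ((hh.differentiable_iteratedDeriv n (by exact_mod_cast Nat.lt_succ_self n)) _).hasDerivAt
  exact h1.comp_const_add x y

/-- Taylor's formula of order two, the remainder being bounded by the oscillation of the second
derivative. -/
lemma norm_taylor_two_le (hh : ContDiff ℝ 2 h) (hK : 0 ≤ K) (x y : ℝ)
    (hb : ∀ z, |z| ≤ |y| → ‖iteratedDeriv 2 h (x + z) - iteratedDeriv 2 h x‖ ≤ K) :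
    ‖h (x + y) - h x - (y : ℂ) * deriv h x - ((y ^ 2 / 2 : ℝ) : ℂ) * iteratedDeriv 2 h x‖ ≤
      K * |y| ^ 2 := by
  have e0 : ∀ y, HasDerivAt (fun y => h (x + y)) (deriv h (x + y)) y := fun y => by
    simpa using hasDerivAt_deriv_comp_add (n := 0) (hh.of_le (by norm_num)) x y
  have e1 : ∀ y, HasDerivAt (fun y => deriv h (x + y)) (iteratedDeriv 2 h (x + y)) y := fun y => by
    simpa using hasDerivAt_deriv_comp_add (n := 1) (hh.of_le (by norm_num)) x y
  have hid : ∀ y : ℝ, HasDerivAt (fun y : ℝ => (y : ℂ)) 1 y := fun y =>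
    Complex.ofRealCLM.hasDerivAt
  have hsq : ∀ y : ℝ, HasDerivAt (fun y : ℝ => ((y ^ 2 / 2 : ℝ) : ℂ)) (y : ℂ) y := fun y => by
    have : HasDerivAt (fun y : ℝ => y ^ 2 / 2) y y := by
      have := ((hasDerivAt_id y).pow 2).div_const 2
      convert! this using 1
      simp
    exact this.ofReal_comp
  have s2 : ∀ z : ℝ, |z| ≤ |y| → ‖deriv h (x + z) - deriv h x - (z : ℂ) * iteratedDeriv 2 h x‖ ≤
      K * |z| ^ 1 :=
    norm_le_pow_succ_of_hasDerivAt (n := 0)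
      (f := fun y : ℝ => deriv h (x + y) - deriv h x - (y : ℂ) * iteratedDeriv 2 h x)
      (fun y => (((e1 y).sub_const _).sub ((hid y).mul_const _)).congr_deriv
        (by rw [one_mul])) (by simp) hK (fun z hz => by simpa using hb z hz)
  exact norm_le_pow_succ_of_hasDerivAt
    (f := fun y : ℝ => h (x + y) - h x - (y : ℂ) * deriv h x -
      ((y ^ 2 / 2 : ℝ) : ℂ) * iteratedDeriv 2 h x)
    (fun y => ((((e0 y).sub_const _).sub ((hid y).mul_const _)).sub
      ((hsq y).mul_const _)).congr_deriv (by rw [one_mul])) (by simp) hK s2 y le_rfl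

lemma norm_iteratedDeriv_two_sub_le (hh : ContDiff ℝ 3 h) (hK : 0 ≤ K)
    (hb : ∀ x, ‖iteratedDeriv 3 h x‖ ≤ K) (x y : ℝ) :
    ‖iteratedDeriv 2 h (x + y) - iteratedDeriv 2 h x‖ ≤ K * |y| := by
  have e2 : ∀ y, HasDerivAt (fun y => iteratedDeriv 2 h (x + y)) (iteratedDeriv 3 h (x + y)) y :=
    fun y => hasDerivAt_deriv_comp_add (n := 2) (hh.of_le (by norm_num)) x y
  simpa using norm_le_pow_succ_of_hasDerivAt (n := 0) (r := |y|)
      (f := fun y => iteratedDeriv 2 h (x + y) - iteratedDeriv 2 h x)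
      (fun y => (e2 y).sub_const _) (by simp) hK (fun y _ => by simpa using hb _) y le_rfl

end Taylor

lemma integral_gaussianReal_eq_scale (s : ℝ≥0) {E : Type*} [NormedAddCommGroup E]
    [NormedSpace ℝ E] {f : ℝ → E} (hf : StronglyMeasurable f) :
    ∫ y, f y ∂(gaussianReal 0 s) = ∫ z, f (√(s : ℝ) * z) ∂(gaussianReal 0 1) := by
  have h1 : gaussianReal 0 s = (gaussianReal 0 1).map (fun z => √(s : ℝ) * z) := by
    rw [gaussianReal_map_const_mul, mul_zero, mul_one]
    congr 1
    ext
    exact (Real.sq_sqrt s.2).symm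
  rw [h1, integral_map (by fun_prop) hf.aestronglyMeasurable]

lemma integrable_abs_pow_gaussianReal (s : ℝ≥0) (n : ℕ) :
    Integrable (fun z : ℝ => |z| ^ n) (gaussianReal 0 s) := by
  have := (memLp_id_gaussianReal (μ := 0) (v := s) n).integrable_norm_pow'
  simpa using this

lemma integral_sq_gaussianReal (s : ℝ≥0) : ∫ z, z ^ 2 ∂(gaussianReal 0 s) = s := by
  have h1 := variance_fun_id_gaussianReal (μ := 0) (v := s)
  rw [variance_eq_integral (by fun_prop)] at h1
  simpa using h1

/-- The error of the diffusion approximation `h + (s/2) h''` to the average of `h` over a centred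
Gaussian jump of variance `s`. -/
def jumpDefect (s : ℝ≥0) (h : ℝ → ℂ) (x : ℝ) : ℂ :=
  (∫ y, h (x + y) ∂(gaussianReal 0 s)) - h x - ((s / 2 : ℝ) : ℂ) * iteratedDeriv 2 h x

/-- The first moment of the jump vanishes and the second is its variance, so that the Taylor
polynomial of degree two has no effect on the defect. -/
lemma jumpDefect_eq_integral {h : ℝ → ℂ} {s : ℝ≥0} {x : ℝ}
    (hi : Integrable (fun y => h (x + y)) (gaussianReal 0 s)) :
    jumpDefect s h x = ∫ y : ℝ, (h (x + y) - h x - (y : ℂ) * deriv h x -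
      ((y ^ 2 / 2 : ℝ) : ℂ) * iteratedDeriv 2 h x) ∂(gaussianReal 0 s) := by
  have i1 : Integrable (fun y : ℝ => (y : ℂ)) (gaussianReal 0 s) := by
    have := integrable_abs_pow_gaussianReal s 1
    refine this.mono' (by fun_prop) (Eventually.of_forall fun y => by simp)
  have i2 : Integrable (fun y : ℝ => ((y ^ 2 / 2 : ℝ) : ℂ)) (gaussianReal 0 s) := by
    have := integrable_abs_pow_gaussianReal s 2
    refine this.mono' (by fun_prop) (Eventually.of_forall fun y => ?_)
    rw [Complex.norm_real, Real.norm_of_nonneg (by positivity), sq_abs]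
    nlinarith [sq_nonneg y]
  have i3 : Integrable (fun y => h (x + y) - h x) (gaussianReal 0 s) :=
    hi.sub (integrable_const _)
  have i4 : Integrable (fun y : ℝ => h (x + y) - h x - (y : ℂ) * deriv h x) (gaussianReal 0 s) :=
    i3.sub (i1.mul_const _)
  rw [integral_sub i4 (i2.mul_const _), integral_sub i3 (i1.mul_const _),
    integral_sub hi (integrable_const _), integral_mul_const, integral_mul_const,
    integral_complex_ofReal, integral_complex_ofReal, integral_div, integral_sq_gaussianReal,
    integral_id_gaussianReal, jumpDefect]
  simp

lemma norm_jumpDefect_le {h : ℝ → ℂ} (hh : ContDiff ℝ 3 h) {B K : ℝ} (hB : ∀ x, ‖h x‖ ≤ B)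
    (hK : 0 ≤ K) (hb : ∀ x, ‖iteratedDeriv 3 h x‖ ≤ K) (s : ℝ≥0) (x : ℝ) :
    ‖jumpDefect s h x‖ ≤ K * (√(s : ℝ) ^ 3 * ∫ z, |z| ^ 3 ∂(gaussianReal 0 1)) := by
  have hi : Integrable (fun y => h (x + y)) (gaussianReal 0 s) := by
    have := hh.continuous
    exact Integrable.of_bound (by fun_prop) B (Eventually.of_forall fun y => hB _)
  rw [jumpDefect_eq_integral hi]
  refine (norm_integral_le_of_norm_le ((integrable_abs_pow_gaussianReal s 3).const_mul K)
    (Eventually.of_forall fun y => (norm_taylor_two_le (hh.of_le (by norm_num))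
      (K := K * |y|) (by positivity) x y fun z hz =>
        (norm_iteratedDeriv_two_sub_le hh hK hb x z).trans (by gcongr)).trans
      (le_of_eq (by ring)))).trans (le_of_eq ?_)
  rw [integral_const_mul, integral_gaussianReal_eq_scale s (f := fun z => |z| ^ 3)
    (by fun_prop)]
  simp_rw [abs_mul, abs_of_nonneg (Real.sqrt_nonneg _), mul_pow, integral_const_mul]

/-! ### One step of the walk applied to a test function -/

section OneStep
variable {C : ℝ} {c : ℂ} {ν : Measure ℝ} {f g : ℝ → ℂ} {K K' : ℝ}

lemma waitShift_add [IsFiniteMeasure ν] (hpos : ν (Set.Iic 0) = 0) (hc : -C ≤ c.re)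
    (hfm : Measurable f) (hf : ∀ t, ‖f t‖ ≤ K * Real.exp (-((C + 1) * t)))
    (hgm : Measurable g) (hg : ∀ t, ‖g t‖ ≤ K' * Real.exp (-((C + 1) * t))) (T : ℝ) :
    waitShift ν c (fun t => f t + g t) T = waitShift ν c f T + waitShift ν c g T := by
  unfold waitShift
  rw [← integral_add (integrable_shift hpos hc hfm hf T) (integrable_shift hpos hc hgm hg T)]
  simp only [mul_add]

lemma waitShift_const_mul (a : ℂ) (T : ℝ) :
    waitShift ν c (fun t => a * f t) T = a * waitShift ν c f T := by
  unfold waitShift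
  simp_rw [mul_left_comm _ a, integral_const_mul]

lemma holdInt_add [IsFiniteMeasure ν] (hpos : ν (Set.Iic 0) = 0) (hc : -C ≤ c.re)
    (hfm : Measurable f) (hf : ∀ t, ‖f t‖ ≤ K * Real.exp (-((C + 1) * t)))
    (hgm : Measurable g) (hg : ∀ t, ‖g t‖ ≤ K' * Real.exp (-((C + 1) * t))) (T : ℝ) :
    holdInt ν c (fun t => f t + g t) T = holdInt ν c f T + holdInt ν c g T := by
  unfold holdInt
  rw [← integral_add (integrable_holdPrimitive hpos hc hfm hf T)
    (integrable_holdPrimitive hpos hc hgm hg T)]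
  refine integral_congr_ae ((ae_pos_of_measure_Iic hpos).mono fun w hw => ?_)
  simp only [mul_add]
  refine intervalIntegral.integral_add ?_ ?_
  · exact (intervalIntegrable_iff_integrableOn_Ioc_of_le hw.le).2
      ((integrableOn_shift_Ioi hc hfm hf T).mono_set Set.Ioc_subset_Ioi_self)
  · exact (intervalIntegrable_iff_integrableOn_Ioc_of_le hw.le).2
      ((integrableOn_shift_Ioi hc hgm hg T).mono_set Set.Ioc_subset_Ioi_self)

lemma holdInt_const_mul (a : ℂ) (T : ℝ) :
    holdInt ν c (fun t => a * f t) T = a * holdInt ν c f T := by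
  unfold holdInt
  simp_rw [mul_left_comm _ a, intervalIntegral.integral_const_mul, integral_const_mul]

end OneStep

section Vector
variable {N : ℕ} {M : Matrix (Fin N) (Fin N) ℝ} {μ : Fin N → Measure ℝ} {s : ℝ≥0}
  {C K K' : ℝ} {v v' : Fin N → ℝ → ℝ → ℂ}

lemma IsDamped.add {b : ℝ} (hv : IsDamped b K v) (hv' : IsDamped b K' v') :
    IsDamped b (K + K') (fun j x t => v j x t + v' j x t) :=
  ⟨fun j => (hv.measurable j).add (hv'.measurable j), fun j x t => by
    rw [add_mul]; exact (norm_add_le _ _).trans (add_le_add (hv.norm_le j x t) (hv'.norm_le j x t))⟩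

lemma stepOp_add [∀ i, IsProbabilityMeasure (μ i)] (hpos : ∀ i, μ i (Set.Iic 0) = 0)
    (hM : M ∈ Matrix.rowStochastic ℝ (Fin N)) {c : ℝ → ℂ} (hc : ∀ x, -C ≤ (c x).re)
    (hv : IsDamped (C + 1) K v) (hv' : IsDamped (C + 1) K' v') (a : Fin N) (x T : ℝ) :
    stepOp M μ s c (fun j x t => v j x t + v' j x t) a x T =
      stepOp M μ s c v a x T + stepOp M μ s c v' a x T := by
  have h1 : FcP.jumpAvg M s (fun j x t => v j x t + v' j x t) a x =
      fun t => FcP.jumpAvg M s v a x t + FcP.jumpAvg M s v' a x t := by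
    ext t
    unfold FcP.jumpAvg
    rw [← integral_add (hv.integrable_jump hM a x t) (hv'.integrable_jump hM a x t)]
    simp only [mul_add, Finset.sum_add_distrib]
  rw [stepOp, h1]
  exact waitShift_add (hpos a) (hc x) ((hv.jumpAvg hM).measurable_time a x)
    ((hv.jumpAvg hM).norm_le a x) ((hv'.jumpAvg hM).measurable_time a x)
    ((hv'.jumpAvg hM).norm_le a x) T

/-- A family of damped functions has a common bound and a common support. -/
lemma exists_isDampedOn_forall {b : ℝ} {h : Fin N → ℝ → ℝ → ℂ}
    (H : ∀ j, ∃ K R, IsDampedOn b K R (h j)) : ∃ K R, ∀ j, IsDampedOn b K R (h j) := by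
  choose K R H using H
  refine ⟨∑ j, |K j|, ∑ j, |R j|, fun j => ?_⟩
  have h1 : K j ≤ ∑ j, |K j| := (le_abs_self _).trans
    (Finset.single_le_sum (f := fun j => |K j|) (fun _ _ => abs_nonneg _) (Finset.mem_univ j))
  have h2 : R j ≤ ∑ j, |R j| := (le_abs_self _).trans
    (Finset.single_le_sum (f := fun j => |R j|) (fun _ _ => abs_nonneg _) (Finset.mem_univ j))
  exact ⟨(H j).measurable, fun x t => ((H j).norm_le x t).trans (by gcongr),
    fun x t hx => (H j).eq_zero x t (h2.trans_lt hx)⟩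

lemma isDamped_of_forall {b R : ℝ} {h : Fin N → ℝ → ℝ → ℂ} (H : ∀ j, IsDampedOn b K R (h j)) :
    IsDamped b K h := ⟨fun j => (H j).measurable, fun j => (H j).norm_le⟩

end Vector

section Symbols
variable {C C₀ : ℝ} {c : ℝ → ℂ} {ν : Measure ℝ} {ψ : ℝ → ℝ → ℂ} {x : ℝ}

lemma norm_freq_add_cpow_le (hc : -C ≤ (c x).re) {a : ℝ} (ha : a ≤ 0) (ξ : ℝ) :
    ‖(freq (C + 1) ξ + c x) ^ (a : ℂ)‖ ≤ 1 := by
  have h1 := one_le_norm_freq_add hc ξ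
  rw [Complex.norm_cpow_real]
  exact Real.rpow_le_one_of_one_le_of_nonpos h1 ha

lemma measurable_freq_add_cpow (a : ℝ) :
    Measurable fun ξ => (freq (C + 1) ξ + c x) ^ (a : ℂ) := by
  have := measurable_freq (C + 1)
  fun_prop

lemma norm_kappa_le_const [IsProbabilityMeasure ν] (hpos : ν (Set.Iic 0) = 0)
    (hc : -C ≤ (c x).re) {α b : ℝ} (hα : 0 ≤ α) (hb : 0 < b) (ξ : ℝ) :
    ‖kappa ν α b (freq (C + 1) ξ + c x)‖ ≤ 1 + 2 / b := by
  have h1 := one_le_norm_freq_add hc ξ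
  have h2 : ‖laplace ν (freq (C + 1) ξ + c x)‖ ≤ 1 :=
    norm_laplace_le_one hpos (zero_le_one.trans (one_le_re_freq_add hc ξ))
  unfold kappa
  refine (norm_sub_le _ _).trans (add_le_add (by simp) ?_)
  rw [norm_div, norm_mul, Complex.norm_cpow_real, Complex.norm_real, Real.norm_of_nonneg hb.le]
  have h3 : 1 ≤ ‖freq (C + 1) ξ + c x‖ ^ α := Real.one_le_rpow h1 hα
  have h4 : ‖1 - laplace ν (freq (C + 1) ξ + c x)‖ ≤ 2 :=
    (norm_sub_le _ _).trans (by rw [norm_one]; linarith)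
  refine div_le_div₀ (by norm_num) h4 hb (le_mul_of_one_le_right hb.le h3)

lemma IsTest.exists_isSymbol_mul (hψ : IsTest ψ) (hC : 0 ≤ C) (m : ℕ) (x : ℝ) :
    ∃ K, IsSymbol (C + 1) m K (fun ξ => (freq (C + 1) ξ + c x) * symb (C + 1) ψ x ξ) := by
  obtain ⟨K, hK⟩ := hψ.exists_isSymbol (b := C + 1) (by linarith) (m + 1)
  have := measurable_freq (C + 1)
  exact ⟨_, (hK x).mul (k := 1) (A := 1 + ‖c x‖) (by positivity) (by fun_prop)
    (fun ξ => by rw [pow_one]; exact norm_freq_add_le hC le_rfl ξ)⟩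

lemma IsTest.integrable_symb (hψ : IsTest ψ) (hC : 0 ≤ C) (x : ℝ) :
    Integrable (symb (C + 1) ψ x) := by
  obtain ⟨K, hK⟩ := hψ.exists_isSymbol (b := C + 1) (by linarith) 2
  exact (hK x).integrable (by linarith) le_rfl

lemma IsTest.integrable_kappa_symb [IsProbabilityMeasure ν] (hpos : ν (Set.Iic 0) = 0)
    (hψ : IsTest ψ) (hC : 0 ≤ C) (hc : -C ≤ (c x).re) {α b : ℝ} (hα : 0 ≤ α) (hb : 0 < b) :
    Integrable fun ξ => kappa ν α b (freq (C + 1) ξ + c x) * symb (C + 1) ψ x ξ := by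
  obtain ⟨K, hK⟩ := hψ.exists_isSymbol (b := C + 1) (by linarith) 2
  exact ((hK x).mul (j := 2) (k := 0) (A := 1 + 2 / b) (by positivity) (measurable_kappa ν α b)
    (fun ξ => by simpa using norm_kappa_le_const hpos hc hα hb ξ)).integrable (by linarith) le_rfl

/-- Multiplier form: `(1 - φ)/z` times `z` is `1 - φ`. -/
lemma IsTest.holdInt_adjDt [IsProbabilityMeasure ν] (hpos : ν (Set.Iic 0) = 0) (hψ : IsTest ψ)
    (hC : 0 ≤ C) (hc : -C ≤ (c x).re) (T : ℝ) :
    holdInt ν (c x) (adjDt c ψ x) T = ψ x T - waitShift ν (c x) (ψ x) T := by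
  obtain ⟨K, hK⟩ := hψ.exists_isSymbol_mul (c := c) hC 2 x
  have hi := hψ.integrable_symb hC x
  have hl : Integrable fun ξ => laplace ν (freq (C + 1) ξ + c x) * symb (C + 1) ψ x ξ :=
    hi.bdd_mul (c := 1) (measurable_laplace_freq ν).aestronglyMeasurable
      (Eventually.of_forall fun ξ =>
        norm_laplace_le_one hpos (zero_le_one.trans (one_le_re_freq_add hc ξ)))
  rw [hψ.adjDt_eq_mode (b := C + 1) (by linarith) c x,
    holdInt_mode hpos hc (hK.integrable (by linarith) le_rfl)]
  conv_rhs => rw [hψ.eq_mode (b := C + 1) (by linarith) x, waitShift_mode hpos hc hi]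
  rw [← mode_sub hi hl]
  congr 1; ext ξ
  have h0 : freq (C + 1) ξ + c x ≠ 0 :=
    norm_pos_iff.1 (zero_lt_one.trans_le (one_le_norm_freq_add hc ξ))
  field_simp

/-- Multiplier form: `(1 - φ)/z` times `z^(-α)` times `z` is `(1 - φ) z^(-α) = b (1 - kappa)`.
This is where the fractional derivative cancels the power law of the waiting times. -/
lemma IsTest.holdInt_substInt_adjDt [IsProbabilityMeasure ν] (hpos : ν (Set.Iic 0) = 0)
    (hψ : IsTest ψ) (hC : 0 ≤ C) (hc : -C ≤ (c x).re) {α b : ℝ} (hα : 0 < α) (hb : 0 < b) (T : ℝ) :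
    holdInt ν (c x) (substInt (1 - α) (c x) (adjDt c ψ x)) T =
      b * (ψ x T - mode (C + 1) (fun ξ => kappa ν α b (freq (C + 1) ξ + c x) *
        symb (C + 1) ψ x ξ) T) := by
  obtain ⟨K, hK⟩ := hψ.exists_isSymbol_mul (c := c) hC 2 x
  have hi := hψ.integrable_symb hC x
  have hs : substInt (1 - α) (c x) (adjDt c ψ x) = mode (C + 1) (fun ξ =>
      (freq (C + 1) ξ + c x) ^ ((1 - α - 1 : ℝ) : ℂ) *
        ((freq (C + 1) ξ + c x) * symb (C + 1) ψ x ξ)) := by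
    ext T
    rw [hψ.adjDt_eq_mode (b := C + 1) (by linarith) c x,
      substInt_mode (by linarith) hc (hK.integrable (by linarith) le_rfl)]
  rw [hs, holdInt_mode hpos hc ((hK.mul (j := 2) (k := 0) (A := 1) zero_le_one
    (measurable_freq_add_cpow (1 - α - 1)) (fun ξ => by
      simpa using norm_freq_add_cpow_le hc (a := 1 - α - 1) (by linarith) ξ)).integrable
        (by linarith) le_rfl)]
  conv_rhs => rw [hψ.eq_mode (b := C + 1) (by linarith) x]
  rw [← mode_sub hi (hψ.integrable_kappa_symb hpos hC hc hα.le hb), ← mode_const_mul]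
  congr 1; ext ξ
  have h0 : freq (C + 1) ξ + c x ≠ 0 :=
    norm_pos_iff.1 (zero_lt_one.trans_le (one_le_norm_freq_add hc ξ))
  have h1 : (freq (C + 1) ξ + c x) ^ (α : ℂ) ≠ 0 := by
    rw [Complex.cpow_ne_zero_iff]; exact Or.inl h0
  have hb' : (b : ℂ) ≠ 0 := by exact_mod_cast hb.ne'
  rw [show ((1 - α - 1 : ℝ) : ℂ) = -(α : ℂ) by push_cast; ring, Complex.cpow_neg, kappa]
  field_simp
  ring

end Symbols

/-! ### The adjoint of the forward equation -/

section
variable {N : ℕ} {M : Matrix (Fin N) (Fin N) ℝ} {μ : Fin N → Measure ℝ}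
  {α B : Fin N → ℝ} {c : ℝ → ℂ} {ψ : ℝ → ℝ → ℂ} {C : ℝ}

/-- The function with which the vector `G` is paired when the forward operator, without the
source, is moved to the test function `w ⊗ ψ`. -/
def forwardTest (M : Matrix (Fin N) (Fin N) ℝ) (α B K : Fin N → ℝ) (c : ℝ → ℂ) (w : Fin N → ℂ)
    (ψ : ℝ → ℝ → ℂ) (j : Fin N) (x t : ℝ) : ℂ :=
  (∑ i, (M j i : ℂ) * w i) * adjDt c ψ x t +
    (-((∑ i, (M j i : ℂ) * w i - w j) * (B j : ℂ)⁻¹) *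
        substInt (1 - α j) (c x) (adjDt c ψ x) t +
      -((∑ i, (M j i : ℂ) * w i) * K j) *
        substInt (1 - α j) (c x)
          (adjDt c (fun x t => iteratedDeriv 2 (fun y => ψ y t) x) x) t)

lemma IsTest.exists_isDampedOn_substInt (hψ : IsTest ψ) (hC : 0 ≤ C) (hcm : Measurable c)
    (hc : ∀ x, -C ≤ (c x).re) (hloc : ∀ R : ℝ, ∃ D : ℝ, ∀ x : ℝ, |x| ≤ R → ‖c x‖ ≤ D) {β : ℝ}
    (hβ : β < 1) :
    ∃ K R, IsDampedOn (C + 1) K R (fun x => substInt β (c x) (adjDt c ψ x)) := by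
  obtain ⟨K, R, h⟩ := hψ.exists_isDampedOn_adjDt (b := C + 1) (by linarith) hcm hloc
  exact ⟨K, R, h.substInt hβ hcm hc⟩

lemma IsDampedOn.exists_add {b K K' R R' : ℝ} {χ χ' : ℝ → ℝ → ℂ} (h : IsDampedOn b K R χ)
    (h' : IsDampedOn b K' R' χ') : ∃ K R, IsDampedOn b K R (fun x t => χ x t + χ' x t) :=
  ⟨_, _, (h.mono (le_max_left R R')).add (h'.mono (le_max_right R R'))⟩

lemma IsTest.exists_isDampedOn_forwardTest (hψ : IsTest ψ) (hC : 0 ≤ C) (hcm : Measurable c)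
    (hc : ∀ x, -C ≤ (c x).re) (hloc : ∀ R : ℝ, ∃ D : ℝ, ∀ x : ℝ, |x| ≤ R → ‖c x‖ ≤ D)
    (hα : ∀ i, 0 < α i) (K : Fin N → ℝ) (w : Fin N → ℂ) :
    ∃ K' R, ∀ j, IsDampedOn (C + 1) K' R (forwardTest M α B K c w ψ j) := by
  refine exists_isDampedOn_forall fun j => ?_
  obtain ⟨K1, R1, h1⟩ := hψ.exists_isDampedOn_adjDt (b := C + 1) (by linarith) hcm hloc
  obtain ⟨K2, R2, h2⟩ := hψ.exists_isDampedOn_substInt hC hcm hc hloc (β := 1 - α j)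
    (by linarith [hα j])
  obtain ⟨K3, R3, h3⟩ := hψ.dxx.exists_isDampedOn_substInt hC hcm hc hloc (β := 1 - α j)
    (by linarith [hα j])
  obtain ⟨K4, R4, h4⟩ := (h2.const_mul (-((∑ i, (M j i : ℂ) * w i - w j) * (B j : ℂ)⁻¹))).exists_add
    (h3.const_mul (-((∑ i, (M j i : ℂ) * w i) * K j)))
  exact (h1.const_mul (∑ i, (M j i : ℂ) * w i)).exists_add h4

/-- The contribution to the value function of `forwardTest` of the time before the first jump. -/
lemma IsTest.holdInt_forwardTest [∀ i, IsProbabilityMeasure (μ i)]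
    (hpos : ∀ i, μ i (Set.Iic 0) = 0) (hψ : IsTest ψ) (hC : 0 ≤ C) (hcm : Measurable c)
    (hc : ∀ x, -C ≤ (c x).re) (hloc : ∀ R : ℝ, ∃ D : ℝ, ∀ x : ℝ, |x| ≤ R → ‖c x‖ ≤ D)
    (hα : ∀ i, 0 < α i) (hB : ∀ i, 0 < B i) {K : Fin N → ℝ} {d : ℝ} (hK : ∀ i, K i * B i = d)
    (w : Fin N → ℂ) (j : Fin N) (x T : ℝ) :
    holdInt (μ j) (c x) (forwardTest M α B K c w ψ j x) T =
      (∑ i, (M j i : ℂ) * w i) * (ψ x T - waitShift (μ j) (c x) (ψ x) T) -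
      (∑ i, (M j i : ℂ) * w i - w j) *
        (ψ x T - mode (C + 1) (fun ξ => kappa (μ j) (α j) (B j) (freq (C + 1) ξ + c x) *
          symb (C + 1) ψ x ξ) T) -
      (∑ i, (M j i : ℂ) * w i) * d *
        (iteratedDeriv 2 (fun y => ψ y T) x -
          mode (C + 1) (fun ξ => kappa (μ j) (α j) (B j) (freq (C + 1) ξ + c x) *
          symb (C + 1) (fun x t => iteratedDeriv 2 (fun y => ψ y t) x) x ξ) T) := by
  obtain ⟨K1, R1, h1⟩ := hψ.exists_isDampedOn_adjDt (b := C + 1) (by linarith) hcm hloc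
  obtain ⟨K2, R2, h2⟩ := hψ.exists_isDampedOn_substInt hC hcm hc hloc (β := 1 - α j)
    (by linarith [hα j])
  obtain ⟨K3, R3, h3⟩ := hψ.dxx.exists_isDampedOn_substInt hC hcm hc hloc (β := 1 - α j)
    (by linarith [hα j])
  have hm : ∀ {K R} {χ : ℝ → ℝ → ℂ}, IsDampedOn (C + 1) K R χ → Measurable (χ x) := fun h =>
    h.measurable.comp (f := fun t : ℝ => (x, t)) (by fun_prop)
  have e1 := h1.const_mul (∑ i, (M j i : ℂ) * w i)
  have e2 := h2.const_mul (-((∑ i, (M j i : ℂ) * w i - w j) * (B j : ℂ)⁻¹))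
  have e3 := h3.const_mul (-((∑ i, (M j i : ℂ) * w i) * K j))
  have e4 := (e2.mono (le_max_left R2 R3)).add (e3.mono (le_max_right R2 R3))
  unfold forwardTest
  rw [holdInt_add (hpos j) (hc x) (hm e1) (e1.norm_le x) (hm e4) (e4.norm_le x),
    holdInt_add (hpos j) (hc x) (hm e2) (e2.norm_le x) (hm e3) (e3.norm_le x),
    holdInt_const_mul, holdInt_const_mul, holdInt_const_mul,
    hψ.holdInt_adjDt (hpos j) hC (hc x), hψ.holdInt_substInt_adjDt (hpos j) hC (hc x) (hα j) (hB j),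
    hψ.dxx.holdInt_substInt_adjDt (hpos j) hC (hc x) (hα j) (hB j)]
  have hb : (B j : ℂ) ≠ 0 := by exact_mod_cast (hB j).ne'
  rw [← hK j]
  push_cast
  field_simp
  ring

/-- The state vector `w` times the test function `ψ`. -/
def tensor (w : Fin N → ℂ) (ψ : ℝ → ℝ → ℂ) (j : Fin N) (x t : ℝ) : ℂ := w j * ψ x t

lemma IsTest.exists_isDampedOn_tensor (hψ : IsTest ψ) (hC : 0 ≤ C) (w : Fin N → ℂ) :
    ∃ K R, ∀ j, IsDampedOn (C + 1) K R (tensor w ψ j) := by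
  obtain ⟨K, R, h⟩ := hψ.exists_isDampedOn (b := C + 1) (by linarith)
  exact exists_isDampedOn_forall fun j => ⟨_, _, h.const_mul (w j)⟩

lemma IsTest.exists_norm_jumpDefect_le (hψ : IsTest ψ) (hC : 0 ≤ C) :
    ∃ K, 0 ≤ K ∧ ∀ (s : ℝ≥0) (x T : ℝ), ‖jumpDefect s (fun x => ψ x T) x‖ ≤
      K * √(s : ℝ) ^ 3 * Real.exp (-((C + 1) * T)) := by
  obtain ⟨K, R, h⟩ := hψ.dxx.dx.exists_isDampedOn (b := C + 1) (by linarith)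
  obtain ⟨R', B, -, -, hB, -⟩ := hψ.exists_bound
  have hK : 0 ≤ K := by
    have := (norm_nonneg _).trans (h.norm_le 0 0)
    simpa using this
  have hm : 0 ≤ ∫ z, |z| ^ 3 ∂(gaussianReal 0 1) := integral_nonneg fun z => by positivity
  refine ⟨K * ∫ z, |z| ^ 3 ∂(gaussianReal 0 1), by positivity, fun s x T => ?_⟩
  refine (norm_jumpDefect_le (h := fun x => ψ x T)
    (by exact_mod_cast contDiff_infty.1 (hψ.contDiff_space T) 3) (fun x => hB x T)
    (K := K * Real.exp (-((C + 1) * T))) (by positivity) (fun y => ?_) s x).trans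
    (le_of_eq (by ring))
  rw [iteratedDeriv_succ]
  exact h.norm_le y T

lemma IsTest.measurable_jumpDefect (hψ : IsTest ψ) (s : ℝ≥0) :
    Measurable fun q : ℝ × ℝ => jumpDefect s (fun x => ψ x q.2) q.1 := by
  have h1 : Measurable fun q : (ℝ × ℝ) × ℝ => ψ (q.1.1 + q.2) q.1.2 :=
    hψ.continuous.measurable.comp (f := fun q : (ℝ × ℝ) × ℝ => (q.1.1 + q.2, q.1.2))
      (by fun_prop)
  have h2 : Measurable fun q : ℝ × ℝ => ∫ y, ψ (q.1 + y) q.2 ∂(gaussianReal 0 s) :=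
    (h1.stronglyMeasurable.integral_prod_right' (ν := gaussianReal 0 s)).measurable
  exact (h2.sub hψ.continuous.measurable).sub (hψ.dxx.continuous.measurable.const_mul _)

/-- One step of the walk, applied to a test function: the diffusion approximation. -/
lemma IsTest.stepOp_tensor [∀ i, IsProbabilityMeasure (μ i)]
    (hpos : ∀ i, μ i (Set.Iic 0) = 0) (hψ : IsTest ψ) (hC : 0 ≤ C)
    (hc : ∀ x, -C ≤ (c x).re) (w : Fin N → ℂ) (s : ℝ≥0) (j : Fin N) (x T : ℝ) :
    stepOp M μ s c (tensor w ψ) j x T = (∑ i, (M j i : ℂ) * w i) *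
      (waitShift (μ j) (c x) (ψ x) T +
        (((s / 2 : ℝ) : ℂ) * waitShift (μ j) (c x)
          (fun t => iteratedDeriv 2 (fun y => ψ y t) x) T +
        waitShift (μ j) (c x) (fun t => jumpDefect s (fun x => ψ x t) x) T)) := by
  obtain ⟨K1, R1, h1⟩ := hψ.exists_isDampedOn (b := C + 1) (by linarith)
  obtain ⟨K2, R2, h2⟩ := hψ.dxx.exists_isDampedOn (b := C + 1) (by linarith)
  obtain ⟨K3, hK3, h3⟩ := hψ.exists_norm_jumpDefect_le hC
  have e2 := h2.const_mul ((s / 2 : ℝ) : ℂ)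
  have hm : ∀ {χ : ℝ → ℝ → ℂ}, Measurable (fun q : ℝ × ℝ => χ q.1 q.2) → Measurable (χ x) :=
    fun h => h.comp (f := fun t : ℝ => (x, t)) (by fun_prop)
  have m3 : Measurable (fun t => jumpDefect s (fun x => ψ x t) x) :=
    hm (χ := fun x t => jumpDefect s (fun x => ψ x t) x) (hψ.measurable_jumpDefect s)
  have hj : jumpAvg M s (tensor w ψ) j x = fun t => (∑ i, (M j i : ℂ) * w i) *
      (ψ x t + (((s / 2 : ℝ) : ℂ) * iteratedDeriv 2 (fun y => ψ y t) x +
        jumpDefect s (fun x => ψ x t) x)) := by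
    ext t
    have : jumpDefect s (fun x => ψ x t) x = _ := rfl
    rw [this, jumpDefect]
    unfold jumpAvg tensor
    simp_rw [← mul_assoc, ← Finset.sum_mul, integral_const_mul]
    ring
  have m2 : Measurable (fun t => ((s / 2 : ℝ) : ℂ) * iteratedDeriv 2 (fun y => ψ y t) x) :=
    hm (χ := fun x t => ((s / 2 : ℝ) : ℂ) * iteratedDeriv 2 (fun y => ψ y t) x) e2.measurable
  have n2 : ∀ t, ‖((s / 2 : ℝ) : ℂ) * iteratedDeriv 2 (fun y => ψ y t) x‖ ≤
      ‖((s / 2 : ℝ) : ℂ)‖ * K2 * Real.exp (-((C + 1) * t)) := e2.norm_le x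
  have n4 : ∀ t, ‖((s / 2 : ℝ) : ℂ) * iteratedDeriv 2 (fun y => ψ y t) x +
      jumpDefect s (fun x => ψ x t) x‖ ≤
      (‖((s / 2 : ℝ) : ℂ)‖ * K2 + K3 * √(s : ℝ) ^ 3) * Real.exp (-((C + 1) * t)) := fun t => by
    rw [add_mul]
    exact (norm_add_le _ _).trans (add_le_add (n2 t) (h3 s x t))
  have m4 : Measurable (fun t => ((s / 2 : ℝ) : ℂ) * iteratedDeriv 2 (fun y => ψ y t) x +
      jumpDefect s (fun x => ψ x t) x) := m2.add m3
  rw [stepOp, hj, waitShift_const_mul, waitShift_add (hpos j) (hc x) (hm h1.measurable)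
    (h1.norm_le x) m4 n4, waitShift_add (hpos j) (hc x) m2 n2 m3 (h3 s x),
    waitShift_const_mul]

end

/-! ### The forward equation for the adjoint value function -/

section
variable {N : ℕ} {M : Matrix (Fin N) (Fin N) ℝ} {μ : Fin N → Measure ℝ}
  {α B : Fin N → ℝ} {U : ℝ → ℝ} {ρ : ℂ} {ψ : ℝ → ℝ → ℂ} {C : ℝ}

/-- The value function of `forwardTest` nearly solves the same one-step equation as `w ⊗ ψ`. -/
lemma IsTest.value_sub_stepOp_eq [∀ i, IsProbabilityMeasure (μ i)]
    (hpos : ∀ i, μ i (Set.Iic 0) = 0) (hM : M ∈ Matrix.rowStochastic ℝ (Fin N))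
    (hψ : IsTest ψ) (hC : 0 ≤ C) (hU : Measurable U)
    (hc : ∀ x, -C ≤ (ρ * (U x : ℂ)).re)
    (hloc : ∀ R : ℝ, ∃ D : ℝ, ∀ x : ℝ, |x| ≤ R → ‖ρ * (U x : ℂ)‖ ≤ D)
    (hα : ∀ i, 0 < α i) (hB : ∀ i, 0 < B i) {K : Fin N → ℝ} {s : ℝ≥0}
    (hK : ∀ i, K i * B i = s / 2) {P : Fin N → Measure (Path N)} (hP : IsChainFamily M μ s P)
    (w : Fin N → ℂ) :
    ∃ K', IsDamped (C + 1) K' (fun j x T =>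
        value U ρ P (forwardTest M α B K (fun x => ρ * (U x : ℂ)) w ψ) j x T +
          tensor (fun i => -w i) ψ j x T) ∧
      ∀ j x T, value U ρ P (forwardTest M α B K (fun x => ρ * (U x : ℂ)) w ψ) j x T +
          tensor (fun i => -w i) ψ j x T - stepOp M μ s (fun x => ρ * (U x : ℂ))
        (fun j x T => value U ρ P (forwardTest M α B K (fun x => ρ * (U x : ℂ)) w ψ) j x T +
          tensor (fun i => -w i) ψ j x T) j x T =
        (∑ i, (M j i : ℂ) * w i - w j) *
          mode (C + 1) (fun ξ => kappa (μ j) (α j) (B j) (freq (C + 1) ξ + ρ * (U x : ℂ)) *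
            symb (C + 1) ψ x ξ) T +
        (∑ i, (M j i : ℂ) * w i) * (((s / 2 : ℝ) : ℂ) *
          (mode (C + 1) (fun ξ => kappa (μ j) (α j) (B j) (freq (C + 1) ξ + ρ * (U x : ℂ)) *
            symb (C + 1) (fun x t => iteratedDeriv 2 (fun y => ψ y t) x) x ξ) T -
          mode (C + 1) (fun ξ => (1 - laplace (μ j) (freq (C + 1) ξ + ρ * (U x : ℂ))) *
            symb (C + 1) (fun x t => iteratedDeriv 2 (fun y => ψ y t) x) x ξ) T)) -
        (∑ i, (M j i : ℂ) * w i) *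
          -waitShift (μ j) (ρ * (U x : ℂ)) (fun t => jumpDefect s (fun x => ψ x t) x) T := by
  have hcm : Measurable fun x => ρ * (U x : ℂ) := by fun_prop
  obtain ⟨K1, R1, h1⟩ := hψ.exists_isDampedOn_forwardTest (M := M) (B := B) hC hcm hc hloc hα K w
  have hv := (isDamped_of_forall h1).value hP hU hC hc
  obtain ⟨K2, R2, h2⟩ := hψ.exists_isDampedOn_tensor hC (fun i => -w i)
  have ht := isDamped_of_forall h2
  refine ⟨_, hv.add ht, fun j x T => ?_⟩
  have hi := hψ.dxx.integrable_symb hC x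
  have hl : Integrable fun ξ => laplace (μ j) (freq (C + 1) ξ + ρ * (U x : ℂ)) *
      symb (C + 1) (fun x t => iteratedDeriv 2 (fun y => ψ y t) x) x ξ :=
    hi.bdd_mul (c := 1) (measurable_laplace_freq (μ j)).aestronglyMeasurable
      (Eventually.of_forall fun ξ =>
        norm_laplace_le_one (hpos j) (zero_le_one.trans (one_le_re_freq_add (hc x) ξ)))
  have e1 : mode (C + 1) (fun ξ => (1 - laplace (μ j) (freq (C + 1) ξ + ρ * (U x : ℂ))) *
      symb (C + 1) (fun x t => iteratedDeriv 2 (fun y => ψ y t) x) x ξ) T =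
      iteratedDeriv 2 (fun y => ψ y T) x - waitShift (μ j) (ρ * (U x : ℂ))
        (fun t => iteratedDeriv 2 (fun y => ψ y t) x) T := by
    have h3 := hψ.dxx.eq_mode (b := C + 1) (by linarith) x
    have h4 : waitShift (μ j) (ρ * (U x : ℂ)) (fun t => iteratedDeriv 2 (fun y => ψ y t) x) T =
        mode (C + 1) (fun ξ => laplace (μ j) (freq (C + 1) ξ + ρ * (U x : ℂ)) *
          symb (C + 1) (fun x t => iteratedDeriv 2 (fun y => ψ y t) x) x ξ) T := by
      rw [h3, waitShift_mode (hpos j) (hc x) hi]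
    rw [h4, congrFun h3 T, ← mode_sub hi hl]
    congr 1; ext ξ; ring
  rw [stepOp_add hpos hM hc hv ht, (isDamped_of_forall h1).value_eq hpos hM hP hU hC hc,
    hψ.stepOp_tensor hpos hC hc,
    hψ.holdInt_forwardTest (c := fun x => ρ * (U x : ℂ)) hpos hC hcm hc hloc hα hB hK, e1]
  simp only [tensor, mul_neg, Finset.sum_neg_distrib]
  push_cast
  ring

lemma exists_forall_integral_exp_neg_le [∀ i, IsProbabilityMeasure (μ i)]
    (hpos : ∀ i, μ i (Set.Iic 0) = 0) (hα : ∀ i, 0 < α i) (hB : ∀ i, 0 < B i)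
    (herr : ∀ i, (fun s : ℂ => laplaceError (μ i) (α i) (B i) s)
      =o[𝓝[{s : ℂ | 0 < s.re}] 0] (fun s : ℂ => ‖s‖ ^ (α i))) :
    ∃ k, 0 < k ∧ ∀ᶠ ε in 𝓝[>] (0 : ℝ), ∀ i,
      ∫ w, Real.exp (-w) ∂(scaledWait α μ ε i) ≤ 1 - k * ε := by
  choose k hk0 hk using fun i =>
    exists_integral_exp_neg_scaledLaw_le (hpos i) (hα i) (hB i) (herr i)
  rcases isEmpty_or_nonempty (Fin N) with h | h
  · exact ⟨1, one_pos, Eventually.of_forall fun ε i => (h.false i).elim⟩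
  obtain ⟨i₀, hi₀⟩ := Finite.exists_min k
  refine ⟨k i₀, hk0 i₀, ?_⟩
  filter_upwards [eventually_all.2 hk, self_mem_nhdsWithin] with ε h hε i
  have hε : 0 < ε := hε
  refine (h i).trans ?_
  have := mul_le_mul_of_nonneg_right (hi₀ i) hε.le
  linarith

/-- The value function of `forwardTest` reproduces `w ⊗ ψ` at the starting point.  The error
`κ` of the power law enters with the vector `M w - w`, and the division by `ε` is the price of
the contraction estimate. -/
lemma IsTest.eventually_norm_value_sub_le [∀ i, IsProbabilityMeasure (μ i)]
    (hpos : ∀ i, μ i (Set.Iic 0) = 0) (hM : M ∈ Matrix.rowStochastic ℝ (Fin N))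
    (hψ : IsTest ψ) (hC : 0 ≤ C) (hU : Measurable U)
    (hc : ∀ x, -C ≤ (ρ * (U x : ℂ)).re)
    (hloc : ∀ R : ℝ, ∃ D : ℝ, ∀ x : ℝ, |x| ≤ R → ‖ρ * (U x : ℂ)‖ ≤ D)
    (hα : ∀ i, 0 < α i ∧ α i < 1) (hB : ∀ i, 0 < B i) (σ : ℝ)
    (herr : ∀ i, (fun s : ℂ => laplaceError (μ i) (α i) (B i) s)
      =o[𝓝[{s : ℂ | 0 < s.re}] 0] (fun s : ℂ => ‖s‖ ^ (α i)))
    {p : ℕ} (hp : p ≤ 1) (herr' : ∀ i, (fun s : ℂ => laplaceError (μ i) (α i) (B i) s)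
      =o[𝓝[{s : ℂ | 0 < s.re}] 0] (fun s : ℂ => ‖s‖ ^ ((p + 1 : ℕ) * α i)))
    (w : Fin N → ℂ) {W : ℝ} (hW0 : 0 ≤ W) (hW : ∀ j, ‖∑ i, (M j i : ℂ) * w i - w j‖ ≤ W)
    {δ : ℝ} (hδ : 0 < δ) :
    ∀ᶠ ε in 𝓝[>] (0 : ℝ), ∀ P : Fin N → Measure (Path N),
      IsChainFamily M (scaledWait α μ ε) (Real.toNNReal (2 * (ε * σ ^ 2))) P → ∀ a,
        ε * ‖value U ρ P (forwardTest M α (fun j => ε * B j) (fun j => σ ^ 2 / B j)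
          (fun x => ρ * (U x : ℂ)) w ψ) a 0 0 - w a * ψ 0 0‖ ≤ W * ε ^ p * δ + ε * δ := by
  obtain ⟨k, hk0, hk⟩ := exists_forall_integral_exp_neg_le hpos (fun i => (hα i).1) hB herr
  obtain ⟨R, Bψ, -, -, -, hR, -⟩ := hψ.exists_bound
  obtain ⟨R', Bψ', -, -, -, hR', -⟩ := hψ.dxx.exists_bound
  obtain ⟨D, hD⟩ := hloc (max R R')
  obtain ⟨KX, hX⟩ := hψ.exists_isSymbol (b := C + 1) (by linarith) 4
  obtain ⟨KY, hY⟩ := hψ.dxx.exists_isSymbol (b := C + 1) (by linarith) 4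
  obtain ⟨KJ, hKJ, hJ⟩ := hψ.exists_norm_jumpDefect_le hC
  set A := ∑ j, ‖∑ i, (M j i : ℂ) * w i‖ with hA
  have hA0 : 0 ≤ A := Finset.sum_nonneg fun _ _ => norm_nonneg _
  have hAj : ∀ j, ‖∑ i, (M j i : ℂ) * w i‖ ≤ A := fun j =>
    Finset.single_le_sum (f := fun j => ‖∑ i, (M j i : ℂ) * w i‖) (fun _ _ => norm_nonneg _)
      (Finset.mem_univ j)
  -- `δ₁` bounds the multiplier errors; the factor `k` makes up for the contraction estimate, which
  -- divides by `1 - θ = k ε`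
  set δ₁ := k * δ / (1 + 4 * A * σ ^ 2) with hδ₁
  have hδ₁0 : 0 < δ₁ := by positivity
  have hδ₁k : δ₁ ≤ k * δ :=
    div_le_self (by positivity) (by nlinarith [mul_nonneg hA0 (sq_nonneg σ)])
  have hδ₁A : A * σ ^ 2 * (2 * δ₁) ≤ k * δ / 2 := by
    have : δ₁ * (1 + 4 * A * σ ^ 2) = k * δ := by rw [hδ₁]; field_simp
    nlinarith
  -- only the term with `M w - w` needs the sharper power law of order `p + 1`: the terms with
  -- `∂ₓₓψ` carry the jump variance, of order `ε`, already
  have hκX := eventually_all.2 fun i => eventually_norm_mode_kappa_le (hpos i) (hα i).1 (hα i).2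
    (hB i) hp (herr' i) hC D KX hδ₁0
  have hκY := eventually_all.2 fun i => eventually_norm_mode_kappa_le (hpos i) (hα i).1 (hα i).2
    (hB i) (p := 0) (by norm_num) (by simpa using herr i) hC D KY hδ₁0
  have hφY := eventually_all.2 fun i => eventually_norm_mode_one_sub_laplace_le (hpos i) (hα i).1
    (hα i).2 (hB i) (herr i) hC D KY hδ₁0
  have hsmall : ∀ᶠ ε in 𝓝[>] (0 : ℝ), A * KJ * √(2 * (ε * σ ^ 2)) * (2 * σ ^ 2) < k * δ / 2 := by
    have : Tendsto (fun ε : ℝ => A * KJ * √(2 * (ε * σ ^ 2)) * (2 * σ ^ 2)) (𝓝[>] 0)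
        (𝓝 (A * KJ * √(2 * (0 * σ ^ 2)) * (2 * σ ^ 2))) :=
      (Continuous.tendsto (by fun_prop) 0).mono_left nhdsWithin_le_nhds
    exact this.eventually (gt_mem_nhds (by simp; positivity))
  filter_upwards [hk, hκX, hκY, hφY, hsmall, self_mem_nhdsWithin] with
    ε hk hκX hκY hφY hsmall hε P hP a
  have hε : 0 < ε := hε
  set s := Real.toNNReal (2 * (ε * σ ^ 2)) with hs
  have hsε : (s : ℝ) = 2 * (ε * σ ^ 2) := Real.coe_toNNReal _ (by positivity)
  have hposε : ∀ i, scaledWait α μ ε i (Set.Iic 0) = 0 := fun i => scaledLaw_Iic (hpos i) hε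
  have : ∀ i, IsProbabilityMeasure (scaledWait α μ ε i) := fun i =>
    inferInstanceAs (IsProbabilityMeasure (scaledLaw (α i) (μ i) ε))
  obtain ⟨K', hv, hg⟩ := hψ.value_sub_stepOp_eq (α := α) (B := fun j => ε * B j)
    (K := fun j => σ ^ 2 / B j) hposε hM hC hU hc hloc (fun i => (hα i).1)
    (fun i => mul_pos hε (hB i)) (s := s)
    (fun i => by rw [hsε]; have := (hB i).ne'; field_simp) hP w
  have key := hv.norm_le_of_sub_stepOp (s := s) hposε hM hc (θ := 1 - k * ε) (by nlinarith) hk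
    (η := W * ε ^ p * (k * δ) + ε * (k * δ)) (fun j x T => ?_) a 0 0
  · rw [mul_zero, neg_zero, Real.exp_zero, mul_one, sub_sub_cancel] at key
    have e : tensor (fun i => -w i) ψ a 0 0 = -(w a * ψ 0 0) := by simp [tensor]
    rw [e, ← sub_eq_add_neg] at key
    refine (mul_le_mul_of_nonneg_left key hε.le).trans (le_of_eq ?_)
    field_simp
  · refine (congrArg norm (hg j x T)).le.trans ?_
    have hexp := (Real.exp_pos (-((C + 1) * T))).le
    set e := Real.exp (-((C + 1) * T)) with he
    -- off the support of `ψ`, where the rate is not controlled, all symbols vanish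
    have hzero : ∀ {χ : ℝ → ℝ → ℂ}, (∀ t, χ x t = 0) → ∀ ξ, symb (C + 1) χ x ξ = 0 :=
      fun h ξ => by simp [symb, h]
    have b1 : ‖mode (C + 1) (fun ξ => kappa (scaledWait α μ ε j) (α j) (ε * B j)
        (freq (C + 1) ξ + ρ * (U x : ℂ)) * symb (C + 1) ψ x ξ) T‖ ≤ ε ^ p * δ₁ * e := by
      by_cases hx : |x| ≤ max R R'
      · exact hκX j _ (hc x) (hD x hx) _ (hX x) T
      · have : ∀ t, ψ x t = 0 := fun t => hR x t ((le_max_left _ _).trans_lt (not_le.1 hx))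
        simp only [hzero this, mul_zero, mode, integral_zero, norm_zero]
        positivity
    have b2 : ‖mode (C + 1) (fun ξ => kappa (scaledWait α μ ε j) (α j) (ε * B j)
        (freq (C + 1) ξ + ρ * (U x : ℂ)) *
          symb (C + 1) (fun x t => iteratedDeriv 2 (fun y => ψ y t) x) x ξ) T‖ ≤ δ₁ * e := by
      by_cases hx : |x| ≤ max R R'
      · have := hκY j _ (hc x) (hD x hx) _ (hY x) T
        rwa [pow_zero, one_mul] at this
      · have : ∀ t, (fun x t => iteratedDeriv 2 (fun y => ψ y t) x) x t = 0 := fun t =>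
          hR' x t ((le_max_right _ _).trans_lt (not_le.1 hx))
        simp only [hzero (χ := fun x t => iteratedDeriv 2 (fun y => ψ y t) x) this, mul_zero,
          mode, integral_zero, norm_zero]
        positivity
    have b3 : ‖mode (C + 1) (fun ξ => (1 - laplace (scaledWait α μ ε j)
        (freq (C + 1) ξ + ρ * (U x : ℂ))) *
          symb (C + 1) (fun x t => iteratedDeriv 2 (fun y => ψ y t) x) x ξ) T‖ ≤ δ₁ * e := by
      by_cases hx : |x| ≤ max R R'
      · exact hφY j _ (hc x) (hD x hx) _ (hY x) T
      · have : ∀ t, (fun x t => iteratedDeriv 2 (fun y => ψ y t) x) x t = 0 := fun t =>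
          hR' x t ((le_max_right _ _).trans_lt (not_le.1 hx))
        simp only [hzero (χ := fun x t => iteratedDeriv 2 (fun y => ψ y t) x) this, mul_zero,
          mode, integral_zero, norm_zero]
        positivity
    have b4 : ‖waitShift (scaledWait α μ ε j) (ρ * (U x : ℂ))
        (fun t => jumpDefect s (fun x => ψ x t) x) T‖ ≤ KJ * √(s : ℝ) ^ 3 * e := by
      refine (norm_waitShift_le (hposε j) (hc x) (hJ s x) T).trans
        (mul_le_of_le_one_right (by positivity) ((hk j).trans ?_))
      nlinarith
    -- the third-order remainder of the jump is `O(ε^(3/2))`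
    have hsq : √(s : ℝ) ^ 3 = ε * (√(2 * (ε * σ ^ 2)) * (2 * σ ^ 2)) := by
      rw [hsε, pow_succ, Real.sq_sqrt (by positivity)]; ring
    have hs2 : ‖((s / 2 : ℝ) : ℂ)‖ = ε * σ ^ 2 := by
      rw [Complex.norm_real, hsε, Real.norm_of_nonneg (by positivity)]; ring
    calc _ ≤ W * (ε ^ p * δ₁ * e) + A * (ε * σ ^ 2 * (δ₁ * e + δ₁ * e)) +
          A * (KJ * √(s : ℝ) ^ 3 * e) := by
          refine (norm_sub_le _ _).trans (add_le_add ((norm_add_le _ _).trans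
            (add_le_add ?_ ?_)) ?_)
          · rw [norm_mul]
            exact mul_le_mul (hW j) b1 (norm_nonneg _) hW0
          · rw [norm_mul, norm_mul, hs2]
            refine mul_le_mul (hAj j) ?_ (by positivity) hA0
            exact mul_le_mul_of_nonneg_left ((norm_sub_le _ _).trans (add_le_add b2 b3))
              (by positivity)
          · rw [norm_mul, norm_neg]
            exact mul_le_mul (hAj j) b4 (norm_nonneg _) hA0
      _ = (W * ε ^ p * δ₁ + ε * (A * σ ^ 2 * (2 * δ₁) +
          A * KJ * √(2 * (ε * σ ^ 2)) * (2 * σ ^ 2))) * e := by rw [hsq]; ring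
      _ ≤ _ := by
          refine mul_le_mul_of_nonneg_right (add_le_add ?_ ?_) hexp
          · exact mul_le_mul_of_nonneg_left hδ₁k (by positivity)
          · exact mul_le_mul_of_nonneg_left (by linarith) hε.le

end

/-! ### The forward defect as an expectation over trajectories -/

section
variable {N : ℕ} {M : Matrix (Fin N) (Fin N) ℝ} {init : Fin N → ℝ} {μ : Fin N → Measure ℝ}
  {s : ℝ≥0} {U : ℝ → ℝ} {ρ : ℂ} {C : ℝ}

/-- The weight of a path on the event that the state at time `t` is `j`. -/
def stateWeight (U : ℝ → ℝ) (ρ : ℂ) (j : Fin N) (p : Path N) (t : ℝ) : ℂ :=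
  if pathState t p = j then pathWeight U ρ 0 t p else 0

lemma measurable_stateWeight (hU : Measurable U) (j : Fin N) :
    Measurable fun q : Path N × ℝ => stateWeight U ρ j q.1 q.2 := by
  refine Measurable.ite ?_ ?_ measurable_const
  · exact (measurable_pathState.comp (f := fun q : Path N × ℝ => (q.2, q.1)) (by fun_prop))
      (measurableSet_singleton j)
  · exact (measurable_pathWeight (ρ := ρ) hU).comp
      (f := fun q : Path N × ℝ => ((0 : ℝ), q.2, q.1)) (by fun_prop)

lemma Walk.position_eq (F : Walk.{u} M init μ s) (x t : ℝ) (w : F.Ω) :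
    F.position x t w = pathPos x t (F.path w) := rfl

lemma Walk.internal_eq (F : Walk.{u} M init μ s) (t : ℝ) (w : F.Ω) :
    F.internal t w = pathState t (F.path w) := rfl

lemma Walk.functional_eq (F : Walk.{u} M init μ s) (x t : ℝ) (w : F.Ω) :
    F.functional U x t w = pathFun U x t (F.path w) := rfl

lemma Walk.measurable_position (F : Walk.{u} M init μ s) (x t : ℝ) :
    Measurable (F.position x t) := by
  simp only [funext (F.position_eq x t)]
  exact (measurable_pathPos.comp (f := fun p : Path N => (x, t, p)) (by fun_prop)).comp
    F.measurable_path

lemma Walk.measurable_internal (F : Walk.{u} M init μ s) (t : ℝ) :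
    Measurable (F.internal t) := by
  simp only [funext (F.internal_eq t)]
  exact (measurable_pathState.comp (f := fun p : Path N => (t, p)) (by fun_prop)).comp
    F.measurable_path

lemma Walk.measurable_functional (F : Walk.{u} M init μ s) (hU : Measurable U) (x t : ℝ) :
    Measurable (F.functional U x t) := by
  simp only [funext (F.functional_eq (U := U) x t)]
  exact ((measurable_pathFun hU).comp (f := fun p : Path N => (x, t, p)) (by fun_prop)).comp
    F.measurable_path

lemma Walk.isRep_forwardG (F : Walk.{u} M init μ s) (hU : Measurable U) (hC0 : 0 ≤ C)
    (hC : ∀ x, -C ≤ (ρ * (U x : ℂ)).re) (R : ℝ) (j : Fin N) :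
    IsRep C 1 R F.pathLaw (stateWeight U ρ j) (fun p t => pathPos 0 t p) (forwardG F U ρ j) := by
  have hpos : ∀ t : ℝ, Measurable fun p : Path N => pathPos 0 t p := fun t =>
    measurable_pathPos.comp (f := fun p : Path N => ((0 : ℝ), t, p)) (by fun_prop)
  refine ⟨measurable_stateWeight hU j, measurable_pathPos.comp
    (f := fun q : Path N × ℝ => ((0 : ℝ), q.2, q.1)) (by fun_prop), fun p t ht => ?_,
    fun t ht h _ hh _ _ => ?_⟩
  · rw [one_mul]
    unfold stateWeight
    split_ifs
    · exact norm_pathWeight_le hC0 hC ht 0 p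
    · rw [norm_zero]; exact (Real.exp_pos _).le
  · have hm : Measurable fun w => (F.position 0 t w, F.functional U 0 t w) :=
      (F.measurable_position 0 t).prodMk (F.measurable_functional hU 0 t)
    have hset : MeasurableSet {w | F.internal t w = j} :=
      F.measurable_internal t (measurableSet_singleton j)
    have hw : Measurable fun p : Path N => stateWeight U ρ j p t * h (pathPos 0 t p) :=
      ((measurable_stateWeight (ρ := ρ) hU j).comp (f := fun p : Path N => (p, t)) (by fun_prop)).mul
        (hh.comp (hpos t))
    unfold forwardG Walk.jointLaw Walk.pathLaw
    rw [integral_map hm.aemeasurable (by fun_prop), ← integral_indicator hset,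
      integral_map F.measurable_path.aemeasurable hw.aestronglyMeasurable]
    congr 1; ext w
    by_cases hj : pathState t (F.path w) = j
    · rw [Set.indicator_of_mem (show w ∈ {w | F.internal t w = j} from hj), stateWeight,
        if_pos hj]
      rfl
    · rw [Set.indicator_of_notMem (show w ∉ {w | F.internal t w = j} from hj), stateWeight,
        if_neg hj, zero_mul]

lemma Walk.isFiniteMeasure_pathLaw [∀ i, IsProbabilityMeasure (μ i)] (F : Walk.{u} M init μ s) :
    IsFiniteMeasure F.pathLaw :=
  ⟨by rw [F.isChainLaw.measure_univ]; exact ENNReal.sum_lt_top.2 fun _ _ => ENNReal.ofReal_lt_top⟩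

/-- The vector pairing is the expectation of the value function at the initial state. -/
lemma Walk.sum_repPair_eq [∀ i, IsProbabilityMeasure (μ i)] (F : Walk.{u} M init μ s)
    (hinit : ∀ i, 0 ≤ init i) {P : Fin N → Measure (Path N)} (hP : IsChainFamily M μ s P)
    (hU : Measurable U) (hC0 : 0 ≤ C) (hC : ∀ x, -C ≤ (ρ * (U x : ℂ)).re) {K R : ℝ}
    {χ : Fin N → ℝ → ℝ → ℂ} (hχ : ∀ j, IsDampedOn (C + 1) K R (χ j)) :
    ∑ j, repPair F.pathLaw (stateWeight U ρ j) (fun p t => pathPos 0 t p) (χ j) =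
      ∑ a, (init a : ℂ) * value U ρ P χ a 0 0 := by
  have := F.isFiniteMeasure_pathLaw
  have hd := isDamped_of_forall hχ
  have hi := fun j => (F.isRep_forwardG hU hC0 hC R j).integrable_prod (hχ j)
  have e1 : ∑ j, repPair F.pathLaw (stateWeight U ρ j) (fun p t => pathPos 0 t p) (χ j) =
      ∫ p, pathIntegral U ρ χ 0 0 p ∂F.pathLaw := by
    unfold repPair
    rw [← integral_finsetSum _ fun j _ => (hi j).integral_prod_left]
    refine integral_congr_ae ?_
    filter_upwards [eventually_all.2 fun j => (hi j).prod_right_ae] with p hp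
    rw [← integral_finsetSum _ fun j _ => hp j]
    unfold pathIntegral
    congr 1; ext t
    simp [stateWeight, ite_mul]
  rw [e1, F.isChainLaw.eq_sum hinit hP, integral_finsetSum_measure]
  · refine Finset.sum_congr rfl fun a _ => ?_
    rw [integral_smul_measure, ENNReal.toReal_ofReal (hinit a), Complex.real_smul]
    rfl
  · intro a _
    have := hP.isProbabilityMeasure a
    refine Integrable.smul_measure ?_ ENNReal.ofReal_ne_top
    exact Integrable.of_bound (((hd.measurable_pathIntegral hU).comp
      (f := fun p : Path N => ((0 : ℝ), (0 : ℝ), p)) (by fun_prop)).aestronglyMeasurable) _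
      (Eventually.of_forall fun p => hd.norm_pathIntegral_le hC0 hC 0 0 p)

/-- The forward defect, contracted with a state vector `w`. -/
lemma Walk.sum_forwardDefect_eq [∀ i, IsProbabilityMeasure (μ i)] (F : Walk.{u} M init μ s)
    (hinit : ∀ i, 0 ≤ init i) {P : Fin N → Measure (Path N)} (hP : IsChainFamily M μ s P)
    (hU : Measurable U) (hC0 : 0 ≤ C) (hC : ∀ x, -C ≤ (ρ * (U x : ℂ)).re)
    (hloc : ∀ R : ℝ, ∃ D : ℝ, ∀ x : ℝ, |x| ≤ R → ‖ρ * (U x : ℂ)‖ ≤ D)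
    {α B K : Fin N → ℝ} (hα : ∀ i, 0 < α i) {ψ : ℝ → ℝ → ℂ} (hψ : IsTest ψ) (w : Fin N → ℂ) :
    ∑ i, w i * forwardDefect M init α B K (fun x => ρ * (U x : ℂ)) (forwardG F U ρ) ψ i =
      ∑ a, (init a : ℂ) * (value U ρ P
        (forwardTest M α B K (fun x => ρ * (U x : ℂ)) w ψ) a 0 0 - w a * ψ 0 0) := by
  have := F.isFiniteMeasure_pathLaw
  have hcm : Measurable fun x => ρ * (U x : ℂ) := by fun_prop
  obtain ⟨K0, R0, h0⟩ := hψ.exists_isDampedOn_forwardTest (M := M) (B := B) hC0 hcm hC hloc hα K w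
  set p : Fin N → (ℝ → ℝ → ℂ) → ℂ := fun j χ =>
    repPair F.pathLaw (stateWeight U ρ j) (fun p t => pathPos 0 t p) χ with hp
  have padd : ∀ j {K K' R R' : ℝ} {χ χ' : ℝ → ℝ → ℂ}, IsDampedOn (C + 1) K R χ →
      IsDampedOn (C + 1) K' R' χ' → p j (fun x t => χ x t + χ' x t) = p j χ + p j χ' :=
    fun j K K' R R' χ χ' h h' => (F.isRep_forwardG hU hC0 hC (max R R') j).repPair_add
      (h.mono (le_max_left _ _)) (h'.mono (le_max_right _ _))
  have hb : (0 : ℝ) ≤ C + 1 := by linarith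
  obtain ⟨K1, R1, h1⟩ := hψ.dt.neg.exists_isDampedOn hb
  obtain ⟨K2, R2, h2⟩ := hψ.exists_isDampedOn_mul hb hcm hloc
  obtain ⟨K3, R3, h3⟩ := hψ.exists_isDampedOn_adjDt hb hcm hloc
  obtain ⟨K4, R4, h4⟩ := hψ.dxx.exists_isDampedOn_adjDt hb hcm hloc
  have hβ : ∀ j, 1 - α j < 1 := fun j => by linarith [hα j]
  have eL : ∀ j, dtPair (forwardG F U ρ j) ψ +
      pair (forwardG F U ρ j) (fun x t => ρ * (U x : ℂ) * ψ x t) =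
      p j (adjDt (fun x => ρ * (U x : ℂ)) ψ) := fun j => by
    have e1 : dtPair (forwardG F U ρ j) ψ = p j (fun x t => -deriv (ψ x) t) :=
      (F.isRep_forwardG hU hC0 hC R1 j).pair_eq h1
    rw [e1, (F.isRep_forwardG hU hC0 hC R2 j).pair_eq h2]
    exact (padd j h1 h2).symm
  have eS : ∀ j, substPair (1 - α j) (fun x => ρ * (U x : ℂ)) (forwardG F U ρ j) ψ =
      p j (fun x => substInt (1 - α j) (ρ * (U x : ℂ))
        (adjDt (fun x => ρ * (U x : ℂ)) ψ x)) := fun j =>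
    (F.isRep_forwardG hU hC0 hC R3 j).substPair_eq (hβ j) hcm hC h3
  have eX : ∀ j, substPair (1 - α j) (fun x => ρ * (U x : ℂ)) (forwardG F U ρ j)
      (fun x t => iteratedDeriv 2 (fun y => ψ y t) x) =
      p j (fun x => substInt (1 - α j) (ρ * (U x : ℂ))
        (adjDt (fun x => ρ * (U x : ℂ)) (fun x t => iteratedDeriv 2 (fun y => ψ y t) x) x)) :=
    fun j => (F.isRep_forwardG hU hC0 hC R4 j).substPair_eq (hβ j) hcm hC h4
  have eχ : ∀ j, p j (forwardTest M α B K (fun x => ρ * (U x : ℂ)) w ψ j) =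
      (∑ i, (M j i : ℂ) * w i) * (dtPair (forwardG F U ρ j) ψ +
        pair (forwardG F U ρ j) (fun x t => ρ * (U x : ℂ) * ψ x t)) +
      (-((∑ i, (M j i : ℂ) * w i - w j) * (B j : ℂ)⁻¹) *
        substPair (1 - α j) (fun x => ρ * (U x : ℂ)) (forwardG F U ρ j) ψ +
      -((∑ i, (M j i : ℂ) * w i) * K j) *
        substPair (1 - α j) (fun x => ρ * (U x : ℂ)) (forwardG F U ρ j)
          (fun x t => iteratedDeriv 2 (fun y => ψ y t) x)) := fun j => by
    have d2 := (h3.substInt (hβ j) hcm hC).const_mul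
      (-((∑ i, (M j i : ℂ) * w i - w j) * (B j : ℂ)⁻¹))
    have d3 := (h4.substInt (hβ j) hcm hC).const_mul (-((∑ i, (M j i : ℂ) * w i) * K j))
    obtain ⟨K5, R5, d4⟩ := d2.exists_add d3
    rw [eL, eS, eX]
    refine (padd j (h3.const_mul (∑ i, (M j i : ℂ) * w i)) d4).trans ?_
    rw [padd j d2 d3]
    simp only [hp, repPair_const_mul]
  simp_rw [mul_sub, Finset.sum_sub_distrib]
  rw [← F.sum_repPair_eq hinit hP hU hC0 hC h0]
  change _ = ∑ j, p j (forwardTest M α B K (fun x => ρ * (U x : ℂ)) w ψ j) - _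
  simp_rw [eχ]
  unfold forwardDefect
  have hone : ∀ i j, ((M.transpose - 1) i j : ℂ) = (M j i : ℂ) - if i = j then 1 else 0 := by
    intro i j
    rw [Matrix.sub_apply, Matrix.transpose_apply, Matrix.one_apply]
    split_ifs <;> simp
  simp_rw [hone, Matrix.transpose_apply]
  set a := fun j => dtPair (forwardG F U ρ j) ψ
  set d := fun j => pair (forwardG F U ρ j) (fun x t => ρ * (U x : ℂ) * ψ x t)
  set e := fun j => substPair (1 - α j) (fun x => ρ * (U x : ℂ)) (forwardG F U ρ j) ψ
  set f := fun j => substPair (1 - α j) (fun x => ρ * (U x : ℂ)) (forwardG F U ρ j)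
          (fun x t => iteratedDeriv 2 (fun y => ψ y t) x)
  have swap : ∀ g : Fin N → ℂ, ∑ i, w i * ∑ j, (M j i : ℂ) * g j =
      ∑ j, (∑ i, (M j i : ℂ) * w i) * g j := fun g => by
    simp_rw [Finset.mul_sum, Finset.sum_mul]
    rw [Finset.sum_comm]
    exact Finset.sum_congr rfl fun _ _ => Finset.sum_congr rfl fun _ _ => by ring
  have l : ∀ i, w i * ((∑ j, (M j i : ℂ) * a j - (init i : ℂ) * ψ 0 0) -
      (∑ j, ((M j i : ℂ) - if i = j then 1 else 0) * ((B j : ℂ)⁻¹ * e j) +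
        ∑ j, (M j i : ℂ) * ((K j : ℂ) * f j) - ∑ j, (M j i : ℂ) * d j)) =
      w i * (∑ j, (M j i : ℂ) * (a j + d j - (B j : ℂ)⁻¹ * e j - (K j : ℂ) * f j)) +
        w i * ((B i : ℂ)⁻¹ * e i) - (init i : ℂ) * (w i * ψ 0 0) := fun i => by
    simp only [mul_add, mul_sub, sub_mul, Finset.sum_add_distrib, Finset.sum_sub_distrib, ite_mul,
      one_mul, zero_mul, Finset.sum_ite_eq, Finset.mem_univ, if_true]
    ring
  refine (Finset.sum_congr rfl fun i _ => l i).trans ?_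
  rw [Finset.sum_sub_distrib, Finset.sum_add_distrib, swap, ← Finset.sum_add_distrib]
  congr 1
  refine Finset.sum_congr rfl fun j _ => ?_
  ring

/-- The forward equation, contracted with a state vector `w`.  A unit vector gives one component,
with an error of the order of the power law; for `w = (1, …, 1)` one can take `W = 0`, since `M` is
stochastic, and the leading order drops out. -/
lemma IsTest.eventually_norm_sum_forwardDefect_le [∀ i, IsProbabilityMeasure (μ i)]
    (hpos : ∀ i, μ i (Set.Iic 0) = 0) (hM : M ∈ Matrix.rowStochastic ℝ (Fin N))
    (hinit : init ∈ stdSimplex ℝ (Fin N)) {ψ : ℝ → ℝ → ℂ}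
    (hψ : IsTest ψ) (hC : 0 ≤ C) (hU : Measurable U)
    (hc : ∀ x, -C ≤ (ρ * (U x : ℂ)).re)
    (hloc : ∀ R : ℝ, ∃ D : ℝ, ∀ x : ℝ, |x| ≤ R → ‖ρ * (U x : ℂ)‖ ≤ D) {α B : Fin N → ℝ}
    (hα : ∀ i, 0 < α i ∧ α i < 1) (hB : ∀ i, 0 < B i) (σ : ℝ)
    (herr : ∀ i, (fun s : ℂ => laplaceError (μ i) (α i) (B i) s)
      =o[𝓝[{s : ℂ | 0 < s.re}] 0] (fun s : ℂ => ‖s‖ ^ (α i)))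
    {p : ℕ} (hp : p ≤ 1) (herr' : ∀ i, (fun s : ℂ => laplaceError (μ i) (α i) (B i) s)
      =o[𝓝[{s : ℂ | 0 < s.re}] 0] (fun s : ℂ => ‖s‖ ^ ((p + 1 : ℕ) * α i)))
    (w : Fin N → ℂ) {W : ℝ} (hW0 : 0 ≤ W) (hW : ∀ j, ‖∑ i, (M j i : ℂ) * w i - w j‖ ≤ W)
    {δ : ℝ} (hδ : 0 < δ) :
    ∀ᶠ ε in 𝓝[>] (0 : ℝ), ∀ P : Fin N → Measure (Path N),
      IsChainFamily M (scaledWait α μ ε) (Real.toNNReal (2 * (ε * σ ^ 2))) P →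
      ∀ F : Walk.{u} M init (scaledWait α μ ε) (Real.toNNReal (2 * (ε * σ ^ 2))),
        ε * ‖∑ i, w i * forwardDefect M init α (fun j => ε * B j) (fun j => σ ^ 2 / B j)
          (fun x => ρ * (U x : ℂ)) (forwardG F U ρ) ψ i‖ ≤ W * ε ^ p * δ + ε * δ := by
  filter_upwards [hψ.eventually_norm_value_sub_le hpos hM hC hU hc hloc hα hB σ herr hp herr' w hW0
    hW hδ, self_mem_nhdsWithin] with ε h hε P hP F
  have hε : 0 < ε := hε
  have : ∀ i, IsProbabilityMeasure (scaledWait α μ ε i) := fun i =>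
    inferInstanceAs (IsProbabilityMeasure (scaledLaw (α i) (μ i) ε))
  rw [F.sum_forwardDefect_eq hinit.1 hP hU hC hc hloc (fun i => (hα i).1) hψ w]
  calc _ ≤ ε * ∑ a, init a * ‖value U ρ P (forwardTest M α (fun j => ε * B j)
          (fun j => σ ^ 2 / B j) (fun x => ρ * (U x : ℂ)) w ψ) a 0 0 - w a * ψ 0 0‖ := by
        refine mul_le_mul_of_nonneg_left ((norm_sum_le _ _).trans (le_of_eq ?_)) hε.le
        refine Finset.sum_congr rfl fun a _ => ?_
        rw [norm_mul, Complex.norm_real, Real.norm_of_nonneg (hinit.1 a)]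
    _ = ∑ a, init a * (ε * ‖value U ρ P (forwardTest M α (fun j => ε * B j)
          (fun j => σ ^ 2 / B j) (fun x => ρ * (U x : ℂ)) w ψ) a 0 0 - w a * ψ 0 0‖) := by
        rw [Finset.mul_sum]
        exact Finset.sum_congr rfl fun _ _ => by ring
    _ ≤ ∑ a, init a * (W * ε ^ p * δ + ε * δ) :=
        Finset.sum_le_sum fun a _ => mul_le_mul_of_nonneg_left (h P hP a) (hinit.1 a)
    _ = _ := by rw [← Finset.sum_mul, hinit.2, one_mul]

end

/-! ### Gaussian smoothing and its adjoint -/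

lemma integral_comp_neg_gaussianReal (s : ℝ≥0) (f : ℝ → ℂ) :
    ∫ y, f (-y) ∂(gaussianReal 0 s) = ∫ y, f y ∂(gaussianReal 0 s) := by
  have h := gaussianReal_map_neg (μ := 0) (v := s)
  rw [neg_zero] at h
  conv_rhs => rw [← h]
  exact ((MeasurableEquiv.neg ℝ).measurableEmbedding.integral_map f).symm

/-- A Gaussian average is symmetric in the function and the weight. -/
lemma integral_mul_gaussian_comm {γ h : ℝ → ℂ} {L : ℝ} (hγ : Measurable γ)
    (hL : ∀ x, ‖γ x‖ ≤ L) (hh : Integrable h) (s : ℝ≥0) :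
    ∫ x, h x * ∫ y, γ (x + y) ∂(gaussianReal 0 s) =
      ∫ y, (∫ x, h (x + y) * γ x) ∂(gaussianReal 0 s) := by
  have hi : Integrable (fun q : ℝ × ℝ => h q.1 * γ (q.1 + q.2))
      (volume.prod (gaussianReal 0 s)) := by
    have h1 : Integrable (fun q : ℝ × ℝ => h q.1) (volume.prod (gaussianReal 0 s)) :=
      hh.comp_fst _
    exact h1.mul_bdd (c := L) (hγ.comp (f := fun q : ℝ × ℝ => q.1 + q.2)
      (by fun_prop)).aestronglyMeasurable (Eventually.of_forall fun q => hL _)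
  simp_rw [← integral_const_mul]
  rw [integral_integral_swap (f := fun x y => h x * γ (x + y)) hi,
    ← integral_comp_neg_gaussianReal]
  congr 1; ext y
  rw [← integral_add_right_eq_self (fun x => h x * γ (x + -y)) y]
  simp

/-- `m = E (1 + |z|)² z²` for a standard Gaussian variable `z`. -/
def gaussMoment : ℝ := ∫ z : ℝ, (1 + |z|) ^ 2 * z ^ 2 ∂(gaussianReal 0 1)

lemma integrable_gaussMoment (s : ℝ≥0) (a b c d : ℝ) :
    Integrable (fun z : ℝ => (a + b * |z|) * (c + d * |z|) * z ^ 2) (gaussianReal 0 s) := by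
  have e : (fun z : ℝ => (a + b * |z|) * (c + d * |z|) * z ^ 2) = fun z =>
      a * c * |z| ^ 2 + (a * d + b * c) * |z| ^ 3 + b * d * |z| ^ 4 := by
    ext z
    rw [← sq_abs z]; ring
  rw [e]
  exact (((integrable_abs_pow_gaussianReal s 2).const_mul _).add
    ((integrable_abs_pow_gaussianReal s 3).const_mul _)).add
    ((integrable_abs_pow_gaussianReal s 4).const_mul _)

lemma gaussMoment_nonneg : 0 ≤ gaussMoment := integral_nonneg fun z => by positivity

section Duality
variable {γ h : ℝ → ℂ} {L R η A : ℝ}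

lemma deriv_eq_zero_of_support (hsupp : ∀ x, R < |x| → h x = 0) {x : ℝ} (hx : R < |x|) :
    deriv h x = 0 := by
  have : h =ᶠ[𝓝 x] fun _ => 0 := by
    filter_upwards [(isOpen_lt continuous_const continuous_abs).mem_nhds hx] with y hy
    exact hsupp y hy
  rw [this.deriv_eq, deriv_const]

lemma iteratedDeriv_two_eq_zero_of_support (hsupp : ∀ x, R < |x| → h x = 0) {x : ℝ}
    (hx : R < |x|) : iteratedDeriv 2 h x = 0 := by
  rw [iteratedDeriv_succ, iteratedDeriv_one]
  exact deriv_eq_zero_of_support (fun _ => deriv_eq_zero_of_support hsupp) hx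

lemma integrable_of_support (hh : Continuous h) (hsupp : ∀ x, R < |x| → h x = 0) :
    Integrable h := by
  refine hh.integrable_of_hasCompactSupport
    (HasCompactSupport.intro (isCompact_Icc (a := -R) (b := R)) fun t ht => hsupp t ?_)
  rw [Set.mem_Icc, ← abs_le] at ht
  exact not_le.1 ht

/-- The diffusion approximation in its weak form: the function `γ` that is averaged over the jump
need not be smooth, since the derivatives are on `h`. -/
lemma norm_integral_gaussian_sub_le (hγ : Measurable γ) (hL : ∀ x, ‖γ x‖ ≤ L)
    (hh : ContDiff ℝ 2 h) (hR : 0 ≤ R) (hsupp : ∀ x, R < |x| → h x = 0) (hη : 0 ≤ η) (hA : 0 ≤ A)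
    (hmod : ∀ x y, ‖iteratedDeriv 2 h (x + y) - iteratedDeriv 2 h x‖ ≤ η + A * |y|)
    {s : ℝ≥0} (hs : s ≤ 1) :
    ‖(∫ x, h x * ∫ y, γ (x + y) ∂(gaussianReal 0 s)) - (∫ x, h x * γ x) -
      ((s / 2 : ℝ) : ℂ) * ∫ x, iteratedDeriv 2 h x * γ x‖ ≤
        L * (2 * (R + 1)) * (s * (η + A * √(s : ℝ))) * gaussMoment := by
  have hL0 : 0 ≤ L := (norm_nonneg _).trans (hL 0)
  have hi0 : Integrable h := integrable_of_support hh.continuous hsupp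
  have hi1 : Integrable (deriv h) := integrable_of_support (hh.continuous_deriv (by norm_num))
    fun _ => deriv_eq_zero_of_support hsupp
  have hi2 : Integrable (iteratedDeriv 2 h) := integrable_of_support
    (hh.continuous_iteratedDeriv 2 le_rfl) fun _ => iteratedDeriv_two_eq_zero_of_support hsupp
  have hmul : ∀ {f : ℝ → ℂ}, Integrable f → Integrable fun x => f x * γ x := fun hf =>
    hf.mul_bdd (c := L) hγ.aestronglyMeasurable (Eventually.of_forall hL)
  set a₀ := ∫ x, h x * γ x
  set a₁ := ∫ x, deriv h x * γ x
  set a₂ := ∫ x, iteratedDeriv 2 h x * γ x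
  have hΨm : StronglyMeasurable fun y => ∫ x, h (x + y) * γ x := by
    have : Measurable fun q : ℝ × ℝ => h (q.2 + q.1) * γ q.2 :=
      (hh.continuous.measurable.comp (f := fun q : ℝ × ℝ => q.2 + q.1) (by fun_prop)).mul
        (hγ.comp measurable_snd)
    exact this.stronglyMeasurable.integral_prod_right' (ν := volume)
  have hΨb : ∀ y, ‖∫ x, h (x + y) * γ x‖ ≤ (∫ x, ‖h x‖) * L := fun y => by
    refine (norm_integral_le_integral_norm _).trans ?_
    rw [← integral_mul_const, ← integral_add_right_eq_self (fun x => ‖h x‖ * L) y]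
    refine integral_mono ((hmul (hi0.comp_add_right y)).norm) ?_ fun x => ?_
    · exact (hi0.comp_add_right y).norm.mul_const L
    · rw [norm_mul]; exact mul_le_mul_of_nonneg_left (hL x) (norm_nonneg _)
  have hΨi : Integrable (fun y => ∫ x, h (x + y) * γ x) (gaussianReal 0 s) :=
    Integrable.of_bound hΨm.aestronglyMeasurable _ (Eventually.of_forall hΨb)
  have i1 : Integrable (fun y : ℝ => (y : ℂ)) (gaussianReal 0 s) := by
    have := integrable_abs_pow_gaussianReal s 1
    refine this.mono' (by fun_prop) (Eventually.of_forall fun y => by simp)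
  have i2 : Integrable (fun y : ℝ => ((y ^ 2 / 2 : ℝ) : ℂ)) (gaussianReal 0 s) := by
    have := integrable_abs_pow_gaussianReal s 2
    refine this.mono' (by fun_prop) (Eventually.of_forall fun y => ?_)
    rw [Complex.norm_real, Real.norm_of_nonneg (by positivity), sq_abs]
    nlinarith [sq_nonneg y]
  have i3 : Integrable (fun y => (∫ x, h (x + y) * γ x) - a₀) (gaussianReal 0 s) :=
    hΨi.sub (integrable_const _)
  have i4 : Integrable (fun y : ℝ => (∫ x, h (x + y) * γ x) - a₀ - (y : ℂ) * a₁)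
      (gaussianReal 0 s) := i3.sub (i1.mul_const _)
  -- the Gaussian average is moved to `h`, whose Taylor expansion to second order has mean `a₀ +
  -- (s/2) a₂`
  have e1 : (∫ x, h x * ∫ y, γ (x + y) ∂(gaussianReal 0 s)) - a₀ - ((s / 2 : ℝ) : ℂ) * a₂ =
      ∫ y : ℝ, ((∫ x, h (x + y) * γ x) - a₀ - (y : ℂ) * a₁ - ((y ^ 2 / 2 : ℝ) : ℂ) * a₂)
        ∂(gaussianReal 0 s) := by
    rw [integral_sub i4 (i2.mul_const _), integral_sub i3 (i1.mul_const _),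
      integral_sub hΨi (integrable_const _), integral_mul_const, integral_mul_const,
      integral_complex_ofReal, integral_complex_ofReal, integral_div, integral_sq_gaussianReal,
      integral_id_gaussianReal, integral_mul_gaussian_comm hγ hL hi0]
    simp
  have e2 : ∀ y : ℝ, ‖(∫ x, h (x + y) * γ x) - a₀ - (y : ℂ) * a₁ -
      ((y ^ 2 / 2 : ℝ) : ℂ) * a₂‖ ≤ L * 2 * ((η + A * |y|) * (R + 1 * |y|) * y ^ 2) := fun y => by
    have j1 : Integrable fun x => h (x + y) * γ x - h x * γ x :=
      (hmul (hi0.comp_add_right y)).sub (hmul hi0)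
    have j2 : Integrable fun x => h (x + y) * γ x - h x * γ x - (y : ℂ) * (deriv h x * γ x) :=
      j1.sub ((hmul hi1).const_mul _)
    have e3 : (∫ x, h (x + y) * γ x) - a₀ - (y : ℂ) * a₁ - ((y ^ 2 / 2 : ℝ) : ℂ) * a₂ =
        ∫ x, (h (x + y) - h x - (y : ℂ) * deriv h x -
          ((y ^ 2 / 2 : ℝ) : ℂ) * iteratedDeriv 2 h x) * γ x := by
      rw [← integral_sub (hmul (hi0.comp_add_right y)) (hmul hi0), ← integral_const_mul,
        ← integral_sub j1 ((hmul hi1).const_mul _), ← integral_const_mul,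
        ← integral_sub j2 ((hmul hi2).const_mul _)]
      congr 1; ext x; ring
    rw [e3]
    -- the Taylor remainder lives on `|x| ≤ R + |y|`
    have e4 : ∫ x, (h (x + y) - h x - (y : ℂ) * deriv h x -
          ((y ^ 2 / 2 : ℝ) : ℂ) * iteratedDeriv 2 h x) * γ x =
        ∫ x in Set.Icc (-(R + |y|)) (R + |y|), (h (x + y) - h x - (y : ℂ) * deriv h x -
          ((y ^ 2 / 2 : ℝ) : ℂ) * iteratedDeriv 2 h x) * γ x := by
      refine (setIntegral_eq_integral_of_forall_compl_eq_zero fun x hx => ?_).symm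
      rw [Set.mem_Icc, ← abs_le, not_le] at hx
      have hx0 : R < |x| := lt_of_le_of_lt (by linarith [abs_nonneg y]) hx
      have hx1 : R < |x + y| := by
        have := abs_sub_abs_le_abs_sub x (-y)
        rw [abs_neg, sub_neg_eq_add] at this
        linarith
      rw [hsupp x hx0, hsupp _ hx1, deriv_eq_zero_of_support hsupp hx0,
        iteratedDeriv_two_eq_zero_of_support hsupp hx0]
      simp
    rw [e4]
    have := norm_setIntegral_le_of_norm_le_const (μ := volume)
      (s := Set.Icc (-(R + |y|)) (R + |y|)) (f := fun x => (h (x + y) - h x - (y : ℂ) * deriv h x -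
          ((y ^ 2 / 2 : ℝ) : ℂ) * iteratedDeriv 2 h x) * γ x)
      (C := (η + A * |y|) * |y| ^ 2 * L) (by simp) (fun x _ => by
        rw [norm_mul]
        refine mul_le_mul (norm_taylor_two_le hh (by positivity) x y fun z hz =>
          (hmod x z).trans (by gcongr)) (hL x) (norm_nonneg _) (by positivity))
    refine this.trans (le_of_eq ?_)
    rw [Measure.real, Real.volume_Icc, ENNReal.toReal_ofReal (by linarith [abs_nonneg y]), sq_abs]
    ring
  rw [e1]
  refine (norm_integral_le_of_norm_le ((integrable_gaussMoment s η A R 1).const_mul (L * 2))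
    (Eventually.of_forall e2)).trans ?_
  rw [integral_const_mul, integral_gaussianReal_eq_scale s
    (f := fun y : ℝ => (η + A * |y|) * (R + 1 * |y|) * y ^ 2) (by fun_prop)]
  have hr0 : 0 ≤ √(s : ℝ) := Real.sqrt_nonneg _
  have hr1 : √(s : ℝ) ≤ 1 := Real.sqrt_le_one.2 (by exact_mod_cast hs)
  have hrs : √(s : ℝ) ^ 2 = s := Real.sq_sqrt s.2
  set r := √(s : ℝ) with hr
  -- after the rescaling `y = r z` to a standard Gaussian, powers of `r ≤ 1` are dropped except for
  -- the factor `r² (η + A r)`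
  have hmono : ∫ z : ℝ, (η + A * |r * z|) * (R + 1 * |r * z|) * (r * z) ^ 2 ∂(gaussianReal 0 1) ≤
      ∫ z : ℝ, (R + 1) * (s * (η + A * r)) * ((1 + |z|) ^ 2 * z ^ 2) ∂(gaussianReal 0 1) := by
    refine integral_mono ?_ ?_ fun z => ?_
    · have := (integrable_gaussMoment 1 η (A * r) R r).const_mul (r ^ 2)
      refine this.congr (Eventually.of_forall fun z => ?_)
      simp only [abs_mul, abs_of_nonneg hr0]
      ring
    · have := (integrable_gaussMoment 1 1 1 1 1).const_mul ((R + 1) * (s * (η + A * r)))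
      refine this.congr (Eventually.of_forall fun z => ?_)
      simp only
      ring
    · simp only [abs_mul, abs_of_nonneg hr0]
      have hz := abs_nonneg z
      have b1 : η + A * (r * |z|) ≤ (η + A * r) * (1 + |z|) := by
        nlinarith [mul_nonneg hη hz, mul_nonneg hA hr0]
      have b2 : R + 1 * (r * |z|) ≤ (R + 1) * (1 + |z|) := by
        nlinarith [mul_nonneg hR hz, mul_le_mul_of_nonneg_right hr1 hz]
      calc (η + A * (r * |z|)) * (R + 1 * (r * |z|)) * (r * z) ^ 2 ≤
            (η + A * r) * (1 + |z|) * ((R + 1) * (1 + |z|)) * (r * z) ^ 2 := by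
            gcongr
        _ = _ := by rw [← hrs]; ring
  rw [integral_const_mul] at hmono
  calc _ ≤ L * 2 * ((R + 1) * (s * (η + A * r)) * gaussMoment) :=
        mul_le_mul_of_nonneg_left hmono (by positivity)
    _ = _ := by ring

end Duality

/-! ### Continuity of translations in the mean -/

/-- Translations act continuously on `L¹`. -/
lemma tendsto_integral_norm_translate {g : ℝ × ℝ → ℂ} (hg : Integrable g) :
    Tendsto (fun v : ℝ × ℝ => ∫ q, ‖g (v + q) - g q‖) (𝓝 0) (𝓝 0) := by
  have : Fact ((1 : ENNReal) ≠ ⊤) := ⟨ENNReal.one_ne_top⟩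
  set F := hg.toL1 g
  have h1 : Continuous fun v : ℝ × ℝ => ‖(DomAddAct.mk v +ᵥ F) - F‖ := by
    have : Continuous fun v : ℝ × ℝ => DomAddAct.mk v +ᵥ F :=
      (continuous_vadd.comp (DomAddAct.continuous_mk.prodMk continuous_const))
    fun_prop
  have h2 := h1.tendsto 0
  have e : ∀ v : ℝ × ℝ, ‖(DomAddAct.mk v +ᵥ F) - F‖ = ∫ q, ‖g (v + q) - g q‖ := by
    intro v
    rw [L1.norm_eq_integral_norm]
    refine integral_congr_ae ?_
    have a1 := DomAddAct.vadd_Lp_ae_eq (DomAddAct.mk v) F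
    have a2 : ∀ᵐ q, F q = g q := hg.coeFn_toL1
    have a3 : ∀ᵐ q, F (v + q) = g (v + q) :=
      (measurePreserving_add_left volume v).quasiMeasurePreserving.ae a2
    filter_upwards [Lp.coeFn_sub (DomAddAct.mk v +ᵥ F) F, a1, a2, a3] with q b1 b2 b3 b4
    rw [b1, Pi.sub_apply, b2, b3]
    congr 2
  simp_rw [e] at h2
  convert h2
  simp

/-- The mean displacement in `L¹` by a Gaussian translation in space tends to zero with the
variance. -/
lemma tendsto_integral_gaussian_translate {g : ℝ × ℝ → ℂ} (hgm : Measurable g)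
    (hg : Integrable g) :
    Tendsto (fun s : ℝ≥0 => ∫ y, (∫ q : ℝ × ℝ, ‖g (q.1 + y, q.2) - g q‖) ∂(gaussianReal 0 s))
      (𝓝 0) (𝓝 0) := by
  set Φ : ℝ → ℝ := fun y => ∫ q : ℝ × ℝ, ‖g (q.1 + y, q.2) - g q‖ with hΦ
  have hΦm : StronglyMeasurable Φ := by
    have : Measurable fun r : ℝ × ℝ × ℝ => ‖g (r.2.1 + r.1, r.2.2) - g r.2‖ :=
      ((hgm.comp (f := fun r : ℝ × ℝ × ℝ => (r.2.1 + r.1, r.2.2)) (by fun_prop)).sub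
        (hgm.comp measurable_snd)).norm
    exact this.stronglyMeasurable.integral_prod_right' (ν := volume)
  have hshift : ∀ y, Integrable fun q : ℝ × ℝ => g (q.1 + y, q.2) := fun y => by
    have := hg.comp_add_right ((y, 0) : ℝ × ℝ)
    refine this.congr (Eventually.of_forall fun q => ?_)
    simp [Prod.add_def]
  have hΦb : ∀ y, ‖Φ y‖ ≤ 2 * ∫ q, ‖g q‖ := fun y => by
    rw [Real.norm_of_nonneg (integral_nonneg fun q => norm_nonneg _)]
    have e : ∫ q : ℝ × ℝ, ‖g (q.1 + y, q.2)‖ = ∫ q, ‖g q‖ := by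
      rw [← integral_add_right_eq_self (fun q => ‖g q‖) ((y, 0) : ℝ × ℝ)]
      simp [Prod.add_def]
    calc Φ y ≤ ∫ q : ℝ × ℝ, (‖g (q.1 + y, q.2)‖ + ‖g q‖) :=
          integral_mono ((hshift y).sub hg).norm ((hshift y).norm.add hg.norm)
            fun q => norm_sub_le _ _
      _ = _ := by rw [integral_add (hshift y).norm hg.norm, e]; ring
  have hΦ0 : Tendsto Φ (𝓝 0) (𝓝 0) := by
    have h1 : Tendsto (fun y : ℝ => ((y, 0) : ℝ × ℝ)) (𝓝 0) (𝓝 0) :=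
      (Continuous.tendsto (by fun_prop) 0)
    have h2 := (tendsto_integral_norm_translate hg).comp h1
    refine h2.congr fun y => ?_
    simp [hΦ, Prod.add_def, add_comm]
  simp_rw [integral_gaussianReal_eq_scale _ hΦm]
  have key := tendsto_integral_filter_of_dominated_convergence (μ := gaussianReal 0 1)
    (l := 𝓝 (0 : ℝ≥0)) (F := fun (s : ℝ≥0) z => Φ (√(s : ℝ) * z)) (f := fun _ => (0 : ℝ))
    (fun _ => 2 * ∫ q, ‖g q‖)
    (Eventually.of_forall fun s => (hΦm.comp_measurable (by fun_prop)).aestronglyMeasurable)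
    (Eventually.of_forall fun s => Eventually.of_forall fun z => hΦb _) (integrable_const _)
    (Eventually.of_forall fun z => ?_)
  · simpa using key
  · refine hΦ0.comp ?_
    have : Continuous fun s : ℝ≥0 => √(s : ℝ) * z := by fun_prop
    simpa using this.tendsto 0

/-! ### The backward functions and their renewal equation -/

/-- A measurable function of space and time that grows at most like `L exp(C t)`. -/
structure IsKernel (C L : ℝ) (k : ℝ → ℝ → ℂ) : Prop where
  measurable : Measurable (fun q : ℝ × ℝ => k q.1 q.2)
  norm_le : ∀ x t, 0 ≤ t → ‖k x t‖ ≤ L * Real.exp (C * t)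

/-- The distribution in space with density `k · t`. -/
def kernelDist (k : ℝ → ℝ → ℂ) : DistPath := fun t h => ∫ x, h x * k x t

section
variable {N : ℕ} {M : Matrix (Fin N) (Fin N) ℝ} {μ : Fin N → Measure ℝ}
  {s : ℝ≥0} {U : ℝ → ℝ} {ρ : ℂ} {C L R : ℝ}

lemma IsKernel.measurable_space {k : ℝ → ℝ → ℂ} (hk : IsKernel C L k) (t : ℝ) :
    Measurable fun x => k x t :=
  hk.measurable.comp (f := fun x : ℝ => (x, t)) (by fun_prop)

lemma IsKernel.sub {L' : ℝ} {k k' : ℝ → ℝ → ℂ} (hk : IsKernel C L k) (hk' : IsKernel C L' k') :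
    IsKernel C (L + L') (fun x t => k x t - k' x t) :=
  ⟨hk.measurable.sub hk'.measurable, fun x t ht => by
    rw [add_mul]
    exact (norm_sub_le _ _).trans (add_le_add (hk.norm_le x t ht) (hk'.norm_le x t ht))⟩

/-- A distribution with a density is represented by the position itself. -/
lemma IsKernel.isRep {k : ℝ → ℝ → ℂ} (hk : IsKernel C L k) {g : DistPath} (R : ℝ)
    (hg : ∀ t, 0 < t → ∀ (h : ℝ → ℂ) (K : ℝ), Measurable h → (∀ x, ‖h x‖ ≤ K) →
      (∀ x, R < |x| → h x = 0) → g t h = ∫ x, h x * k x t) :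
    IsRep C L R (volume.restrict (Set.Icc (-R) R)) k (fun x _ => x) g := by
  refine ⟨hk.measurable, by fun_prop, hk.norm_le, fun t ht h K hh hb hs => ?_⟩
  rw [hg t ht h K hh hb hs]
  simp_rw [mul_comm (h _)]
  refine (setIntegral_eq_integral_of_forall_compl_eq_zero fun x hx => ?_).symm
  rw [Set.mem_Icc, ← abs_le, not_le] at hx
  rw [hs x hx, mul_zero]

lemma IsKernel.isRep_kernelDist {k : ℝ → ℝ → ℂ} (hk : IsKernel C L k) (R : ℝ) :
    IsRep C L R (volume.restrict (Set.Icc (-R) R)) k (fun x _ => x) (kernelDist k) :=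
  hk.isRep R fun _ _ _ _ _ _ _ => rfl

lemma IsKernel.integrable_mul {k : ℝ → ℝ → ℂ} (hk : IsKernel C L k) {t : ℝ} (ht : 0 ≤ t)
    {h : ℝ → ℂ} (hh : Integrable h) : Integrable fun x => h x * k x t :=
  hh.mul_bdd (hk.measurable_space t).aestronglyMeasurable
    (Eventually.of_forall fun x => hk.norm_le x t ht)

lemma integrable_of_bounded_support {h : ℝ → ℂ} {K : ℝ} (hm : Measurable h) (hb : ∀ x, ‖h x‖ ≤ K)
    (hs : ∀ x, R < |x| → h x = 0) : Integrable h := by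
  have h1 : IntegrableOn h (Set.Icc (-R) R) :=
    Measure.integrableOn_of_bounded (by simp) hm.aestronglyMeasurable (Eventually.of_forall hb)
  refine (integrableOn_iff_integrable_of_support_subset fun x hx => ?_).1 h1
  rw [Set.mem_Icc, ← abs_le]
  by_contra h0
  exact hx (hs x (not_le.1 h0))

/-- The expectation of the weight `exp(-ρ A(t))` for the walk that starts at `x` in state `b`. -/
def startMean (U : ℝ → ℝ) (ρ : ℂ) (P : Fin N → Measure (Path N)) (b : Fin N) (x t : ℝ) : ℂ :=
  ∫ p, pathWeight U ρ x t p ∂(P b)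

/-- The average of `startMean` after a change of state. -/
def mixMean (M : Matrix (Fin N) (Fin N) ℝ) (U : ℝ → ℝ) (ρ : ℂ) (P : Fin N → Measure (Path N))
    (i : Fin N) (x t : ℝ) : ℂ := ∑ b, (M i b : ℂ) * startMean U ρ P b x t

variable {P : Fin N → Measure (Path N)}

lemma isKernel_startMean [∀ i, IsProbabilityMeasure (μ i)] (hP : IsChainFamily M μ s P)
    (hU : Measurable U) (hC0 : 0 ≤ C) (hC : ∀ x, -C ≤ (ρ * (U x : ℂ)).re) (b : Fin N) :
    IsKernel C 1 (startMean U ρ P b) := by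
  have := hP.isProbabilityMeasure b
  refine ⟨?_, fun x t ht => ?_⟩
  · have : Measurable fun q : (ℝ × ℝ) × Path N => pathWeight U ρ q.1.1 q.1.2 q.2 :=
      (measurable_pathWeight (ρ := ρ) hU).comp
        (f := fun q : (ℝ × ℝ) × Path N => (q.1.1, q.1.2, q.2)) (by fun_prop)
    exact (this.stronglyMeasurable.integral_prod_right' (ν := P b)).measurable
  · have := norm_integral_le_of_norm_le_const (μ := P b)
      (Eventually.of_forall fun p => norm_pathWeight_le (ρ := ρ) hC0 hC ht x p)
    simpa [startMean] using this

lemma isKernel_mixMean [∀ i, IsProbabilityMeasure (μ i)] (hM : M ∈ Matrix.rowStochastic ℝ (Fin N))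
    (hP : IsChainFamily M μ s P)
    (hU : Measurable U) (hC0 : 0 ≤ C) (hC : ∀ x, -C ≤ (ρ * (U x : ℂ)).re) (i : Fin N) :
    IsKernel C 1 (mixMean M U ρ P i) := by
  have hk := fun b => isKernel_startMean hP hU hC0 hC b
  refine ⟨Finset.measurable_sum _ fun b _ => (hk b).measurable.const_mul _, fun x t ht => ?_⟩
  refine (norm_sum_le _ _).trans ?_
  calc _ ≤ ∑ b, M i b * (1 * Real.exp (C * t)) := by
        refine Finset.sum_le_sum fun b _ => ?_
        rw [norm_mul, Complex.norm_real, Real.norm_of_nonneg (hM.1 i b)]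
        exact mul_le_mul_of_nonneg_left ((hk b).norm_le x t ht) (hM.1 i b)
    _ = _ := by rw [← Finset.sum_mul, sum_row hM i, one_mul]

lemma IsKernel.gaussian {k : ℝ → ℝ → ℂ} (hk : IsKernel C L k) (s : ℝ≥0) :
    IsKernel C L (fun x t => ∫ y, k (x + y) t ∂(gaussianReal 0 s)) := by
  refine ⟨?_, fun x t ht => ?_⟩
  · have : Measurable fun q : (ℝ × ℝ) × ℝ => k (q.1.1 + q.2) q.1.2 :=
      hk.measurable.comp (f := fun q : (ℝ × ℝ) × ℝ => (q.1.1 + q.2, q.1.2)) (by fun_prop)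
    exact (this.stronglyMeasurable.integral_prod_right' (ν := gaussianReal 0 s)).measurable
  · have := norm_integral_le_of_norm_le_const (μ := gaussianReal 0 s)
      (Eventually.of_forall fun y => hk.norm_le (x + y) t ht)
    simpa using this

lemma Walk.backwardG_eq {init : Fin N → Fin N → ℝ} (F : ∀ i, Walk.{u} M (init i) μ s)
    (hU : Measurable U) (b : Fin N) :
    backwardG F U ρ b = kernelDist (startMean U ρ (fun i => (F i).pathLaw) b) := by
  ext t h
  unfold backwardG kernelDist
  congr 1; ext x
  congr 1
  have hm : Measurable fun p : Path N => pathWeight U ρ x t p :=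
    (measurable_pathWeight (ρ := ρ) hU).comp (f := fun p : Path N => (x, t, p)) (by fun_prop)
  rw [Walk.functionalLaw, integral_map ((F b).measurable_functional hU x t).aemeasurable
    (by fun_prop), startMean, Walk.pathLaw,
    integral_map (F b).measurable_path.aemeasurable hm.aestronglyMeasurable]
  rfl

/-- The renewal equation of the backward functions in weak form: up to the first jump the particle
stays at `x` in state `i`, then it starts afresh. -/
lemma setIntegral_startMean_mul [∀ i, IsProbabilityMeasure (μ i)]
    (hpos : ∀ i, μ i (Set.Iic 0) = 0) (hM : M ∈ Matrix.rowStochastic ℝ (Fin N))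
    (hP : IsChainFamily M μ s P) (hU : Measurable U) (hC0 : 0 ≤ C)
    (hC : ∀ x, -C ≤ (ρ * (U x : ℂ)).re) {f : ℝ → ℂ} {K : ℝ} (hfm : Measurable f)
    (hf : ∀ t, ‖f t‖ ≤ K * Real.exp (-((C + 1) * t))) (i : Fin N) (x : ℝ) :
    ∫ t in Set.Ioi (0 : ℝ), startMean U ρ P i x t * f t =
      holdInt (μ i) (ρ * (U x : ℂ)) f 0 +
        ∫ t in Set.Ioi (0 : ℝ), (∫ y, mixMean M U ρ P i (x + y) t ∂(gaussianReal 0 s)) *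
          waitShift (μ i) (ρ * (U x : ℂ)) f t := by
  set h : Fin N → ℝ → ℝ → ℂ := fun _ _ t => f t with hh
  have hd : IsDamped (C + 1) K h := ⟨fun _ => hfm.comp measurable_snd, fun _ _ t => hf t⟩
  have hK : 0 ≤ K := by
    have := (norm_nonneg _).trans (hf 0)
    simpa using this
  have hexp : Integrable (fun t : ℝ => Real.exp (-t)) (volume.restrict (Set.Ioi 0)) :=
    integrableOn_exp_neg_Ioi 0
  -- all integrands below are dominated by a multiple of `exp(-t)`
  have hdom : ∀ {k : ℝ → ℝ → ℂ}, IsKernel C 1 k → ∀ (y T : ℝ) {t : ℝ}, 0 ≤ t →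
      ‖k y t * f (T + t)‖ ≤ K * Real.exp (-((C + 1) * T)) * Real.exp (-t) := by
    intro k hk y T t ht
    rw [norm_mul]
    calc _ ≤ 1 * Real.exp (C * t) * (K * Real.exp (-((C + 1) * (T + t)))) :=
          mul_le_mul (hk.norm_le y t ht) (hf _) (norm_nonneg _) (by positivity)
      _ = K * (Real.exp (C * t) * Real.exp (-((C + 1) * (T + t)))) := by ring
      _ = _ := by
        rw [mul_assoc, ← Real.exp_add, ← Real.exp_add]; congr 2; ring
  have hkS := fun b => isKernel_startMean hP hU hC0 hC b
  have hkM := isKernel_mixMean hM hP hU hC0 hC i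
  have hkE := hkM.gaussian s
  have haet : ∀ {Y : Type} [MeasurableSpace Y] (ν : Measure Y) [SFinite ν],
      ∀ᵐ q : Y × ℝ ∂(ν.prod (volume.restrict (Set.Ioi 0))), 0 < q.2 := by
    intro Y _ ν _
    exact Measure.quasiMeasurePreserving_snd.ae (ae_restrict_mem measurableSet_Ioi)
  have e1 : ∀ b y T, value U ρ P h b y T =
      ∫ t in Set.Ioi (0 : ℝ), startMean U ρ P b y t * f (T + t) := by
    intro b y T
    have := hP.isProbabilityMeasure b
    have hi : Integrable (fun q : Path N × ℝ => pathWeight U ρ y q.2 q.1 * f (T + q.2))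
        ((P b).prod (volume.restrict (Set.Ioi 0))) := by
      refine Integrable.mono' ((hexp.const_mul (K * Real.exp (-((C + 1) * T)))).comp_snd (P b))
        ?_ ((haet (P b)).mono fun q hq => hd.norm_integrand_le hC0 hC y T hq.le q.1)
      exact (((measurable_pathWeight (ρ := ρ) hU).comp
        (f := fun q : Path N × ℝ => (y, q.2, q.1)) (by fun_prop)).mul
        (hfm.comp (f := fun q : Path N × ℝ => T + q.2) (by fun_prop))).aestronglyMeasurable
    unfold FcP.value pathIntegral startMean
    rw [integral_integral_swap (f := fun p t => pathWeight U ρ y t p * f (T + t)) hi]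
    congr 1; ext t
    rw [integral_mul_const]
  have e2 : ∀ w, jumpAvg M s (value U ρ P h) i x w =
      ∫ t in Set.Ioi (0 : ℝ), (∫ y, mixMean M U ρ P i (x + y) t ∂(gaussianReal 0 s)) *
        f (w + t) := by
    intro w
    have hi : Integrable (fun q : ℝ × ℝ => mixMean M U ρ P i (x + q.1) q.2 * f (w + q.2))
        ((gaussianReal 0 s).prod (volume.restrict (Set.Ioi 0))) := by
      refine Integrable.mono' ((hexp.const_mul (K * Real.exp (-((C + 1) * w)))).comp_snd
        (gaussianReal 0 s)) ?_ ((haet (gaussianReal 0 s)).mono fun q hq => hdom hkM _ w hq.le)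
      exact ((hkM.measurable.comp (f := fun q : ℝ × ℝ => (x + q.1, q.2)) (by fun_prop)).mul
        (hfm.comp (f := fun q : ℝ × ℝ => w + q.2) (by fun_prop))).aestronglyMeasurable
    have hib : ∀ b y, Integrable (fun t => startMean U ρ P b y t * f (w + t))
        (volume.restrict (Set.Ioi 0)) := fun b y => by
      refine Integrable.mono' (hexp.const_mul (K * Real.exp (-((C + 1) * w)))) ?_
        ((ae_restrict_mem measurableSet_Ioi).mono fun t ht => hdom (hkS b) y w (le_of_lt ht))
      exact (((hkS b).measurable.comp (f := fun t : ℝ => (y, t)) (by fun_prop)).mul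
        (hfm.comp (f := fun t : ℝ => w + t) (by fun_prop))).aestronglyMeasurable
    simp_rw [← integral_mul_const]
    rw [← integral_integral_swap (f := fun y t => mixMean M U ρ P i (x + y) t * f (w + t)) hi]
    unfold jumpAvg
    congr 1; ext y
    simp_rw [e1, ← integral_const_mul]
    rw [← integral_finsetSum _ fun b _ => (hib b (x + y)).const_mul _]
    congr 1; ext t
    rw [mixMean, Finset.sum_mul]
    exact Finset.sum_congr rfl fun b _ => by ring
  have hval := hd.value_eq hpos hM hP hU hC0 hC i x 0
  rw [e1] at hval
  simp only [zero_add] at hval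
  rw [hval]
  congr 1
  have hi : Integrable (fun q : ℝ × ℝ => Complex.exp (-(q.1 : ℂ) * (ρ * (U x : ℂ))) *
      ((∫ y, mixMean M U ρ P i (x + y) q.2 ∂(gaussianReal 0 s)) * f (q.1 + q.2)))
      ((μ i).prod (volume.restrict (Set.Ioi 0))) := by
    refine Integrable.mono' ((hexp.const_mul K).comp_snd (μ i)) ?_ ?_
    · have h1 := hkE.measurable.comp (f := fun q : ℝ × ℝ => (x, q.2)) (by fun_prop)
      have h2 := hfm.comp (f := fun q : ℝ × ℝ => q.1 + q.2) (by fun_prop)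
      have h3 : Measurable fun q : ℝ × ℝ => Complex.exp (-(q.1 : ℂ) * (ρ * (U x : ℂ))) := by
        fun_prop
      exact (h3.mul (h1.mul h2)).aestronglyMeasurable
    · have hw : ∀ᵐ q : ℝ × ℝ ∂((μ i).prod (volume.restrict (Set.Ioi 0))), 0 < q.1 :=
        Measure.quasiMeasurePreserving_fst.ae (ae_pos_of_measure_Iic (hpos i))
      filter_upwards [hw, haet (μ i)] with q h1 h2
      rw [norm_mul]
      calc _ ≤ Real.exp (C * q.1) * (K * Real.exp (-((C + 1) * q.1)) * Real.exp (-q.2)) :=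
            mul_le_mul (norm_exp_neg_mul_le (hC x) h1.le) (hdom hkE x q.1 h2.le)
              (norm_nonneg _) (Real.exp_pos _).le
        _ = K * (Real.exp (C * q.1) * Real.exp (-((C + 1) * q.1))) * Real.exp (-q.2) := by ring
        _ ≤ K * 1 * Real.exp (-q.2) := by
            have : Real.exp (C * q.1) * Real.exp (-((C + 1) * q.1)) ≤ 1 := by
              rw [← Real.exp_add, Real.exp_le_one_iff]
              nlinarith
            gcongr
        _ = _ := by rw [mul_one]
  unfold stepOp waitShift
  simp_rw [zero_add, e2, ← integral_const_mul]
  rw [integral_integral_swap (f := fun (w : ℝ) t => Complex.exp (-(w : ℂ) * (ρ * (U x : ℂ))) *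
      ((∫ y, mixMean M U ρ P i (x + y) t ∂(gaussianReal 0 s)) * f (w + t))) hi]
  congr 1; ext t
  congr 1; ext w
  rw [add_comm w t]; ring

end

/-! ### Pairings with the backward functions -/

/-- The space-time pairing of a kernel with `χ`, over `|x| ≤ R` and `t > 0`. -/
def boxPair (R : ℝ) (k χ : ℝ → ℝ → ℂ) : ℂ :=
  repPair (volume.restrict (Set.Icc (-R) R)) k (fun x _ => x) χ

section
variable {C L R K : ℝ} {k χ : ℝ → ℝ → ℂ}

lemma IsKernel.norm_boxPair_le (hk : IsKernel C L k) (hχ : IsDampedOn (C + 1) K R χ) (hR : 0 ≤ R) :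
    ‖boxPair R k χ‖ ≤ L * K * (2 * R) := by
  have hr := hk.isRep_kernelDist R
  have h1 : ∀ x, ‖∫ t in Set.Ioi (0 : ℝ), k x t * χ x t‖ ≤ L * K := fun x => by
    have := norm_integral_le_of_norm_le (μ := volume.restrict (Set.Ioi (0 : ℝ)))
      (f := fun t => k x t * χ x t) ((integrableOn_exp_neg_Ioi 0).const_mul (L * K))
      ((ae_restrict_mem measurableSet_Ioi).mono fun t ht => hr.norm_mul_le hχ x (le_of_lt ht))
    rwa [integral_const_mul, integral_exp_neg_Ioi_zero, mul_one] at this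
  have := norm_setIntegral_le_of_norm_le_const (μ := volume) (s := Set.Icc (-R) R)
    (f := fun x => ∫ t in Set.Ioi (0 : ℝ), k x t * χ x t) (by simp) (fun x _ => h1 x)
  refine this.trans (le_of_eq ?_)
  rw [Measure.real, Real.volume_Icc, ENNReal.toReal_ofReal (by linarith)]
  ring

/-- A Gaussian average in the first variable is symmetric in the function and the weight. -/
lemma integral_mul_gaussian_comm_prod {γ g : ℝ × ℝ → ℂ} {L : ℝ} (hγ : Measurable γ)
    (hL : ∀ q, ‖γ q‖ ≤ L) (hg : Integrable g) (s : ℝ≥0) :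
    ∫ q, g q * ∫ y, γ (q.1 + y, q.2) ∂(gaussianReal 0 s) =
      ∫ y, (∫ q : ℝ × ℝ, g (q.1 + y, q.2) * γ q) ∂(gaussianReal 0 s) := by
  have hi : Integrable (fun r : (ℝ × ℝ) × ℝ => g r.1 * γ (r.1.1 + r.2, r.1.2))
      ((volume : Measure (ℝ × ℝ)).prod (gaussianReal 0 s)) := by
    have h1 : Integrable (fun r : (ℝ × ℝ) × ℝ => g r.1)
        ((volume : Measure (ℝ × ℝ)).prod (gaussianReal 0 s)) := hg.comp_fst _
    exact h1.mul_bdd (c := L) (hγ.comp (f := fun r : (ℝ × ℝ) × ℝ => (r.1.1 + r.2, r.1.2))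
      (by fun_prop)).aestronglyMeasurable (Eventually.of_forall fun q => hL _)
  simp_rw [← integral_const_mul]
  rw [integral_integral_swap (f := fun (q : ℝ × ℝ) y => g q * γ (q.1 + y, q.2)) hi,
    ← integral_comp_neg_gaussianReal]
  congr 1; ext y
  rw [← integral_add_right_eq_self (fun q : ℝ × ℝ => g q * γ (q.1 + -y, q.2)) ((y, 0) : ℝ × ℝ)]
  simp [Prod.add_def]

lemma norm_integral_gaussian_translate_le {γ g : ℝ × ℝ → ℂ} {L : ℝ} (hγ : Measurable γ)
    (hL : ∀ q, ‖γ q‖ ≤ L) (hgm : Measurable g) (hg : Integrable g) (s : ℝ≥0) :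
    ‖(∫ q, g q * ∫ y, γ (q.1 + y, q.2) ∂(gaussianReal 0 s)) - ∫ q, g q * γ q‖ ≤
      L * ∫ y, (∫ q : ℝ × ℝ, ‖g (q.1 + y, q.2) - g q‖) ∂(gaussianReal 0 s) := by
  have hL0 : 0 ≤ L := (norm_nonneg _).trans (hL 0)
  have hshift : ∀ y, Integrable fun q : ℝ × ℝ => g (q.1 + y, q.2) := fun y => by
    have := hg.comp_add_right ((y, 0) : ℝ × ℝ)
    refine this.congr (Eventually.of_forall fun q => ?_)
    simp [Prod.add_def]
  have hnorm : ∀ y, ∫ q : ℝ × ℝ, ‖g (q.1 + y, q.2)‖ = ∫ q, ‖g q‖ := fun y => by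
    rw [← integral_add_right_eq_self (fun q => ‖g q‖) ((y, 0) : ℝ × ℝ)]
    simp [Prod.add_def]
  have hmul : ∀ {f : ℝ × ℝ → ℂ}, Integrable f → Integrable fun q => f q * γ q := fun hf =>
    hf.mul_bdd (c := L) hγ.aestronglyMeasurable (Eventually.of_forall hL)
  have hm1 : StronglyMeasurable fun y => ∫ q : ℝ × ℝ, g (q.1 + y, q.2) * γ q := by
    have : Measurable fun r : ℝ × (ℝ × ℝ) => g (r.2.1 + r.1, r.2.2) * γ r.2 :=
      (hgm.comp (f := fun r : ℝ × (ℝ × ℝ) => (r.2.1 + r.1, r.2.2)) (by fun_prop)).mul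
        (hγ.comp measurable_snd)
    exact this.stronglyMeasurable.integral_prod_right' (ν := volume)
  have hm2 : StronglyMeasurable fun y => ∫ q : ℝ × ℝ, ‖g (q.1 + y, q.2) - g q‖ := by
    have : Measurable fun r : ℝ × (ℝ × ℝ) => ‖g (r.2.1 + r.1, r.2.2) - g r.2‖ :=
      ((hgm.comp (f := fun r : ℝ × (ℝ × ℝ) => (r.2.1 + r.1, r.2.2)) (by fun_prop)).sub
        (hgm.comp measurable_snd)).norm
    exact this.stronglyMeasurable.integral_prod_right' (ν := volume)
  have hi1 : Integrable (fun y => ∫ q : ℝ × ℝ, g (q.1 + y, q.2) * γ q) (gaussianReal 0 s) := by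
    refine Integrable.of_bound hm1.aestronglyMeasurable ((∫ q, ‖g q‖) * L)
      (Eventually.of_forall fun y => (norm_integral_le_integral_norm _).trans ?_)
    rw [← hnorm y, ← integral_mul_const]
    refine integral_mono (hmul (hshift y)).norm ((hshift y).norm.mul_const L) fun q => ?_
    rw [norm_mul]; exact mul_le_mul_of_nonneg_left (hL q) (norm_nonneg _)
  have hi2 : Integrable (fun y => ∫ q : ℝ × ℝ, ‖g (q.1 + y, q.2) - g q‖) (gaussianReal 0 s) := by
    refine Integrable.of_bound hm2.aestronglyMeasurable ((∫ q, ‖g q‖) + ∫ q, ‖g q‖)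
      (Eventually.of_forall fun y => ?_)
    rw [Real.norm_of_nonneg (integral_nonneg fun q => norm_nonneg _)]
    nth_rewrite 1 [← hnorm y]
    rw [← integral_add (hshift y).norm hg.norm]
    exact integral_mono ((hshift y).sub hg).norm ((hshift y).norm.add hg.norm)
      fun q => norm_sub_le _ _
  have e : (∫ q, g q * ∫ y, γ (q.1 + y, q.2) ∂(gaussianReal 0 s)) - ∫ q, g q * γ q =
      ∫ y, ((∫ q : ℝ × ℝ, g (q.1 + y, q.2) * γ q) - ∫ q, g q * γ q) ∂(gaussianReal 0 s) := by
    rw [integral_mul_gaussian_comm_prod hγ hL hg, integral_sub hi1 (integrable_const _)]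
    simp
  rw [e, ← integral_const_mul]
  refine norm_integral_le_of_norm_le (hi2.const_mul L) (Eventually.of_forall fun y => ?_)
  rw [← integral_sub (hmul (hshift y)) (hmul hg), ← integral_const_mul]
  refine norm_integral_le_of_norm_le (((hshift y).sub hg).norm.const_mul L)
    (Eventually.of_forall fun q => ?_)
  rw [← sub_mul, norm_mul, mul_comm]
  exact mul_le_mul_of_nonneg_right (hL q) (norm_nonneg _)

/-- The kernel may be averaged over a small Gaussian jump: the effect on the pairing with a fixed
`χ` vanishes with the variance, uniformly in the kernel. -/
lemma IsDampedOn.eventually_norm_boxPair_sub_le (hχ : IsDampedOn (C + 1) K R χ) {δ : ℝ}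
    (hδ : 0 < δ) : ∀ᶠ s in 𝓝 (0 : ℝ≥0), ∀ k : ℝ → ℝ → ℂ, IsKernel C 1 k →
      ‖boxPair R (fun x t => ∫ y, k (x + y) t ∂(gaussianReal 0 s)) χ - boxPair R k χ‖ ≤ δ := by
  -- the growth `exp(C t)` of the kernels is moved to `χ`, which leaves bounded kernels
  set g : ℝ × ℝ → ℂ := (Set.univ ×ˢ Set.Ioi 0).indicator
    (fun q => (Real.exp (C * q.2) : ℂ) * χ q.1 q.2) with hg
  have hset : MeasurableSet ((Set.univ : Set ℝ) ×ˢ Set.Ioi (0 : ℝ)) :=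
    MeasurableSet.univ.prod measurableSet_Ioi
  have hgm : Measurable g := by
    refine Measurable.indicator ?_ hset
    have := hχ.measurable
    fun_prop
  have hK : 0 ≤ K := by
    have := (norm_nonneg _).trans (hχ.norm_le 0 0)
    simpa using this
  have hgi : Integrable g := by
    have h1 : Integrable (fun q : ℝ × ℝ => (Set.Icc (-R) R).indicator (fun _ => K) q.1 *
        (Set.Ioi (0 : ℝ)).indicator (fun t => Real.exp (-t)) q.2) (volume.prod volume) := by
      refine Integrable.mul_prod ?_ ?_
      · exact (integrable_indicator_iff measurableSet_Icc).2 (by simp)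
      · exact (integrable_indicator_iff measurableSet_Ioi).2 (integrableOn_exp_neg_Ioi 0)
    refine Integrable.mono' h1 hgm.aestronglyMeasurable (Eventually.of_forall fun q => ?_)
    by_cases h2 : q ∈ (Set.univ : Set ℝ) ×ˢ Set.Ioi (0 : ℝ)
    · rw [hg, Set.indicator_of_mem h2, Set.indicator_of_mem h2.2]
      by_cases h3 : q.1 ∈ Set.Icc (-R) R
      · rw [Set.indicator_of_mem h3, norm_mul, Complex.norm_real,
          Real.norm_of_nonneg (Real.exp_pos _).le]
        calc _ ≤ Real.exp (C * q.2) * (K * Real.exp (-((C + 1) * q.2))) :=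
              mul_le_mul_of_nonneg_left (hχ.norm_le _ _) (Real.exp_pos _).le
          _ = K * (Real.exp (C * q.2) * Real.exp (-((C + 1) * q.2))) := by ring
          _ = _ := by rw [← Real.exp_add]; congr 2; ring
      · rw [Set.indicator_of_notMem h3]
        rw [Set.mem_Icc, ← abs_le, not_le] at h3
        rw [hχ.eq_zero _ _ h3]
        simp
    · rw [hg, Set.indicator_of_notMem h2, norm_zero]
      refine mul_nonneg (Set.indicator_nonneg (fun _ _ => hK) _)
        (Set.indicator_nonneg (fun _ _ => (Real.exp_pos _).le) _)
  have hT := tendsto_integral_gaussian_translate hgm hgi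
  filter_upwards [hT.eventually (gt_mem_nhds hδ)] with s hs k hk
  set γ : ℝ × ℝ → ℂ := (Set.univ ×ˢ Set.Ioi 0).indicator
    (fun q => (Real.exp (-(C * q.2)) : ℂ) * k q.1 q.2) with hγ
  have hγm : Measurable γ := by
    refine Measurable.indicator ?_ hset
    have := hk.measurable
    fun_prop
  have hγb : ∀ q, ‖γ q‖ ≤ 1 := fun q => by
    by_cases h2 : q ∈ (Set.univ : Set ℝ) ×ˢ Set.Ioi (0 : ℝ)
    · rw [hγ, Set.indicator_of_mem h2, norm_mul, Complex.norm_real,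
        Real.norm_of_nonneg (Real.exp_pos _).le]
      calc _ ≤ Real.exp (-(C * q.2)) * (1 * Real.exp (C * q.2)) :=
            mul_le_mul_of_nonneg_left (hk.norm_le _ _ (le_of_lt h2.2)) (Real.exp_pos _).le
        _ = _ := by rw [one_mul, ← Real.exp_add, neg_add_cancel, Real.exp_zero]
    · rw [hγ, Set.indicator_of_notMem h2, norm_zero]; exact zero_le_one
  -- the exponential weights in `g` and `γ` cancel
  have key : ∀ {k' : ℝ → ℝ → ℂ} {γ' : ℝ × ℝ → ℂ}, IsKernel C 1 k' →
      (∀ q : ℝ × ℝ, 0 < q.2 → γ' q = (Real.exp (-(C * q.2)) : ℂ) * k' q.1 q.2) →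
      boxPair R k' χ = ∫ q, g q * γ' q := by
    intro k' γ' hk' hγ'
    have hi := (hk'.isRep_kernelDist R).integrable_prod hχ
    rw [boxPair, repPair, integral_integral (f := fun x t => k' x t * χ x t) hi,
      Measure.prod_restrict, ← integral_indicator (measurableSet_Icc.prod measurableSet_Ioi)]
    refine integral_congr_ae (Eventually.of_forall fun q => ?_)
    simp only
    by_cases h2 : q.2 ∈ Set.Ioi (0 : ℝ)
    · rw [hg, Set.indicator_of_mem (show q ∈ (Set.univ : Set ℝ) ×ˢ Set.Ioi (0 : ℝ) from
        ⟨trivial, h2⟩), hγ' q h2]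
      have hE : (Real.exp (C * q.2) : ℂ) * (Real.exp (-(C * q.2)) : ℂ) = 1 := by
        rw [← Complex.ofReal_mul, ← Real.exp_add, add_neg_cancel, Real.exp_zero, Complex.ofReal_one]
      have e : (Real.exp (C * q.2) : ℂ) * χ q.1 q.2 *
          ((Real.exp (-(C * q.2)) : ℂ) * k' q.1 q.2) = k' q.1 q.2 * χ q.1 q.2 := by
        linear_combination (k' q.1 q.2 * χ q.1 q.2) * hE
      rw [e]
      by_cases h3 : q.1 ∈ Set.Icc (-R) R
      · rw [Set.indicator_of_mem (show q ∈ Set.Icc (-R) R ×ˢ Set.Ioi (0 : ℝ) from ⟨h3, h2⟩)]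
      · rw [Set.indicator_of_notMem (fun h => h3 h.1)]
        rw [Set.mem_Icc, ← abs_le, not_le] at h3
        rw [hχ.eq_zero _ _ h3, mul_zero]
    · rw [hg, Set.indicator_of_notMem (fun h => h2 h.2), Set.indicator_of_notMem (fun h => h2 h.2),
        zero_mul]
  have hγk : ∀ q : ℝ × ℝ, 0 < q.2 → γ q = (Real.exp (-(C * q.2)) : ℂ) * k q.1 q.2 := fun q hq => by
    rw [hγ, Set.indicator_of_mem (show q ∈ (Set.univ : Set ℝ) ×ˢ Set.Ioi (0 : ℝ) from
      ⟨trivial, hq⟩)]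
  rw [key hk hγk, key (hk.gaussian s) (γ' := fun q => ∫ y, γ (q.1 + y, q.2) ∂(gaussianReal 0 s))
    fun q hq => by
      rw [← integral_const_mul]
      congr 1; ext y
      exact hγk (q.1 + y, q.2) hq]
  refine (norm_integral_gaussian_translate_le hγm hγb hgm hgi s).trans ?_
  rw [one_mul]
  exact hs.le

end

/-! ### The renewal equation in terms of symbols -/

section Symbols
variable {C K : ℝ} {c : ℂ} {ν : Measure ℝ} {Z : ℝ → ℂ} {α b : ℝ}

lemma IsSymbol.of_le {m k : ℕ} (hZ : IsSymbol (C + 1) m K Z) (hC : 0 ≤ C) (h : k ≤ m) :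
    IsSymbol (C + 1) k K Z :=
  ⟨hZ.measurable, fun ξ => le_trans (mul_le_mul_of_nonneg_left (pow_le_pow_right₀
    ((by linarith : (1 : ℝ) ≤ C + 1).trans (le_norm_freq _ ξ)) h) (norm_nonneg _)) (hZ.norm_le ξ)⟩

lemma IsSymbol.freq_add_cpow_mul {m : ℕ} (hZ : IsSymbol (C + 1) m K Z) (hc : -C ≤ c.re) {a : ℝ}
    (ha : a ≤ 0) : IsSymbol (C + 1) m K (fun ξ => (freq (C + 1) ξ + c) ^ (a : ℂ) * Z ξ) := by
  have := hZ.mul (j := m) (k := 0) (A := 1) zero_le_one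
    (measurable_freq_add_cpow (C := C) (c := fun _ => c) (x := 0) a)
    (fun ξ => by simpa using norm_freq_add_cpow_le (c := fun _ => c) (x := 0) hc ha ξ)
  rwa [one_mul] at this

lemma IsSymbol.kappa_mul [IsProbabilityMeasure ν] (hpos : ν (Set.Iic 0) = 0) {m : ℕ}
    (hZ : IsSymbol (C + 1) m K Z) (hc : -C ≤ c.re) (hα : 0 ≤ α) (hb : 0 < b) :
    IsSymbol (C + 1) m ((1 + 2 / b) * K) (fun ξ => kappa ν α b (freq (C + 1) ξ + c) * Z ξ) :=
  hZ.mul (j := m) (k := 0) (by positivity) (measurable_kappa ν α b)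
    (fun ξ => by
      simpa using norm_kappa_le_const (c := fun _ => c) (x := 0) hpos hc hα hb ξ)

lemma freq_add_ne_zero (hc : -C ≤ c.re) (ξ : ℝ) : freq (C + 1) ξ + c ≠ 0 :=
  norm_pos_iff.1 (zero_lt_one.trans_le (one_le_norm_freq_add hc ξ))

/-- The survival function multiplies symbols by `b z^(α-1) (1 - kappa)`. -/
lemma IsSymbol.holdInt_eq [IsProbabilityMeasure ν] (hpos : ν (Set.Iic 0) = 0) (hC : 0 ≤ C)
    (hZ : IsSymbol (C + 1) 2 K Z) (hc : -C ≤ c.re) (hα : 0 ≤ α) (hb : 0 < b) (T : ℝ) :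
    holdInt ν c (mode (C + 1) (fun ξ => (freq (C + 1) ξ + c) ^ ((-α : ℝ) : ℂ) * Z ξ)) T =
      b * (mode (C + 1) (fun ξ => (freq (C + 1) ξ + c) ^ ((-1 : ℝ) : ℂ) * Z ξ) T -
        mode (C + 1) (fun ξ => kappa ν α b (freq (C + 1) ξ + c) *
          ((freq (C + 1) ξ + c) ^ ((-1 : ℝ) : ℂ) * Z ξ)) T) := by
  have h1 : (1 : ℝ) ≤ C + 1 := by linarith
  have hZ1 := hZ.freq_add_cpow_mul hc (a := -1) (by norm_num)
  rw [holdInt_mode hpos hc ((hZ.freq_add_cpow_mul hc (by linarith)).integrable h1 le_rfl),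
    ← mode_sub (hZ1.integrable h1 le_rfl)
      ((hZ1.kappa_mul hpos hc hα hb).integrable h1 le_rfl), ← mode_const_mul]
  congr 1; ext ξ
  have h0 := freq_add_ne_zero hc ξ
  have h2 : (freq (C + 1) ξ + c) ^ (α : ℂ) ≠ 0 := by
    rw [Complex.cpow_ne_zero_iff]; exact Or.inl h0
  have hb' : (b : ℂ) ≠ 0 := by exact_mod_cast hb.ne'
  rw [Complex.ofReal_neg, Complex.cpow_neg, Complex.ofReal_neg, Complex.cpow_neg,
    Complex.ofReal_one, Complex.cpow_one, kappa]
  field_simp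
  ring

/-- One waiting time multiplies symbols by `1 - b z^α (1 - kappa)`. -/
lemma IsSymbol.waitShift_eq [IsProbabilityMeasure ν] (hpos : ν (Set.Iic 0) = 0) (hC : 0 ≤ C)
    (hZ : IsSymbol (C + 1) 2 K Z) (hc : -C ≤ c.re) (hα : 0 ≤ α) (hb : 0 < b) (T : ℝ) :
    waitShift ν c (mode (C + 1) (fun ξ => (freq (C + 1) ξ + c) ^ ((-α : ℝ) : ℂ) * Z ξ)) T =
      mode (C + 1) (fun ξ => (freq (C + 1) ξ + c) ^ ((-α : ℝ) : ℂ) * Z ξ) T -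
      b * (mode (C + 1) Z T -
        mode (C + 1) (fun ξ => kappa ν α b (freq (C + 1) ξ + c) * Z ξ) T) := by
  have h1 : (1 : ℝ) ≤ C + 1 := by linarith
  have hi := (hZ.freq_add_cpow_mul hc (a := -α) (by linarith)).integrable h1 le_rfl
  have hZi := hZ.integrable h1 le_rfl
  have hκ := (hZ.kappa_mul hpos hc hα hb).integrable h1 le_rfl
  rw [waitShift_mode hpos hc hi, ← mode_sub hZi hκ, ← mode_const_mul,
    ← mode_sub hi (show Integrable fun ξ => (b : ℂ) * (Z ξ - kappa ν α b (freq (C + 1) ξ + c) * Z ξ)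
      from (hZi.sub hκ).const_mul _)]
  congr 1; ext ξ
  have h0 := freq_add_ne_zero hc ξ
  have h2 : (freq (C + 1) ξ + c) ^ (α : ℂ) ≠ 0 := by
    rw [Complex.cpow_ne_zero_iff]; exact Or.inl h0
  have hb' : (b : ℂ) ≠ 0 := by exact_mod_cast hb.ne'
  rw [Complex.ofReal_neg, Complex.cpow_neg, kappa]
  field_simp
  ring

end Symbols

section Pairing
variable {N : ℕ} {M : Matrix (Fin N) (Fin N) ℝ} {μ : Fin N → Measure ℝ}
  {s : ℝ≥0} {U : ℝ → ℝ} {ρ : ℂ} {C R K : ℝ} {P : Fin N → Measure (Path N)} {χ : ℝ → ℝ → ℂ}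

lemma IsDampedOn.waitShift {ν : Measure ℝ} [IsProbabilityMeasure ν] (hpos : ν (Set.Iic 0) = 0)
    {c : ℝ → ℂ} (hcm : Measurable c) (hc : ∀ x, -C ≤ (c x).re) (hχ : IsDampedOn (C + 1) K R χ) :
    IsDampedOn (C + 1) K R (fun x => waitShift ν (c x) (χ x)) := by
  refine ⟨?_, fun x T => ?_, fun x T hx => ?_⟩
  · have : Measurable fun q : (ℝ × ℝ) × ℝ => Complex.exp (-(q.2 : ℂ) * c q.1.1) *
        χ q.1.1 (q.1.2 + q.2) := by
      have h1 : Measurable fun q : (ℝ × ℝ) × ℝ => χ q.1.1 (q.1.2 + q.2) :=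
        hχ.measurable.comp (f := fun q : (ℝ × ℝ) × ℝ => (q.1.1, q.1.2 + q.2)) (by fun_prop)
      have h2 : Measurable fun q : (ℝ × ℝ) × ℝ => Complex.exp (-(q.2 : ℂ) * c q.1.1) := by fun_prop
      exact h2.mul h1
    exact (this.stronglyMeasurable.integral_prod_right' (ν := ν)).measurable
  · have h1 : ∫ w, Real.exp (-w) ∂ν ≤ 1 := by
      have := integral_mono_ae (integrable_exp_neg_of_pos hpos) (integrable_const (1 : ℝ))
        ((ae_pos_of_measure_Iic hpos).mono fun w hw => Real.exp_le_one_iff.2 (by linarith))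
      simpa using this
    refine (norm_waitShift_le hpos (hc x) (hχ.norm_le x) T).trans
      (mul_le_of_le_one_right ((norm_nonneg _).trans (hχ.norm_le x T)) h1)
  · simp [FcP.waitShift, hχ.eq_zero _ _ hx]

/-- The renewal equation, paired with `χ`. -/
lemma IsDampedOn.boxPair_startMean [∀ i, IsProbabilityMeasure (μ i)]
    (hpos : ∀ i, μ i (Set.Iic 0) = 0) (hM : M ∈ Matrix.rowStochastic ℝ (Fin N))
    (hP : IsChainFamily M μ s P) (hU : Measurable U) (hC0 : 0 ≤ C)
    (hC : ∀ x, -C ≤ (ρ * (U x : ℂ)).re) (hχ : IsDampedOn (C + 1) K R χ) (i : Fin N) :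
    IntegrableOn (fun x => holdInt (μ i) (ρ * (U x : ℂ)) (χ x) 0) (Set.Icc (-R) R) ∧
    boxPair R (startMean U ρ P i) χ =
      (∫ x in Set.Icc (-R) R, holdInt (μ i) (ρ * (U x : ℂ)) (χ x) 0) +
        boxPair R (fun x t => ∫ y, mixMean M U ρ P i (x + y) t ∂(gaussianReal 0 s))
          (fun x => FcP.waitShift (μ i) (ρ * (U x : ℂ)) (χ x)) := by
  have hcm : Measurable fun x => ρ * (U x : ℂ) := by fun_prop
  have hχm : ∀ x, Measurable (χ x) := fun x =>
    hχ.measurable.comp (f := fun t : ℝ => (x, t)) (by fun_prop)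
  have hG := ((isKernel_startMean hP hU hC0 hC i).isRep_kernelDist R).integrable_prod hχ
  have hE := (((isKernel_mixMean hM hP hU hC0 hC i).gaussian s).isRep_kernelDist R).integrable_prod
    (hχ.waitShift (hpos i) hcm hC)
  have e := fun x => setIntegral_startMean_mul hpos hM hP hU hC0 hC (hχm x) (hχ.norm_le x) i x
  have hi : IntegrableOn (fun x => holdInt (μ i) (ρ * (U x : ℂ)) (χ x) 0) (Set.Icc (-R) R) := by
    refine (hG.integral_prod_left.sub hE.integral_prod_left).congr
      (Eventually.of_forall fun x => ?_)
    exact sub_eq_of_eq_add (e x)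
  refine ⟨hi, ?_⟩
  unfold boxPair repPair
  rw [← integral_add hi hE.integral_prod_left]
  exact integral_congr_ae (Eventually.of_forall e)

/-- The main part of the backward equation: for `χ` with the symbol `z^(-α) Z`, the renewal
equation becomes an equation between the pairings with `mode Z`, with `mode (z⁻¹ Z)` at time `0`,
and with `χ`, up to errors that vanish with `ε`. -/
lemma eventually_norm_renewal_le [∀ i, IsProbabilityMeasure (μ i)]
    (hpos : ∀ i, μ i (Set.Iic 0) = 0) (hM : M ∈ Matrix.rowStochastic ℝ (Fin N))
    (hU : Measurable U) (hC0 : 0 ≤ C) (hC : ∀ x, -C ≤ (ρ * (U x : ℂ)).re)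
    (hloc : ∀ R : ℝ, ∃ D : ℝ, ∀ x : ℝ, |x| ≤ R → ‖ρ * (U x : ℂ)‖ ≤ D) {α B : Fin N → ℝ}
    (hα : ∀ i, 0 < α i ∧ α i < 1) (hB : ∀ i, 0 < B i) (σ : ℝ)
    (herr : ∀ i, (fun s : ℂ => laplaceError (μ i) (α i) (B i) s)
      =o[𝓝[{s : ℂ | 0 < s.re}] 0] (fun s : ℂ => ‖s‖ ^ (α i))) (i : Fin N) (hR : 0 ≤ R)
    {Z : ℝ → ℝ → ℂ} {KZ : ℝ} (hZ : ∀ x, IsSymbol (C + 1) 4 KZ (Z x))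
    (hχ : IsDampedOn (C + 1) K R χ)
    (eχ : ∀ x, χ x = mode (C + 1) (fun ξ =>
      (freq (C + 1) ξ + ρ * (U x : ℂ)) ^ ((-α i : ℝ) : ℂ) * Z x ξ))
    {S : ℝ → ℝ → ℂ} {K' : ℝ} (hS : IsDampedOn (C + 1) K' R S) (eS : ∀ x, S x = mode (C + 1) (Z x))
    {A : ℝ → ℝ → ℂ} {K'' : ℝ} (hA : IsDampedOn (C + 1) K'' R A)
    (eA : ∀ x, A x = mode (C + 1) (fun ξ =>
      (freq (C + 1) ξ + ρ * (U x : ℂ)) ^ ((-1 : ℝ) : ℂ) * Z x ξ))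
    {δ : ℝ} (hδ : 0 < δ) :
    ∀ᶠ ε in 𝓝[>] (0 : ℝ), ∀ P : Fin N → Measure (Path N),
      IsChainFamily M (scaledWait α μ ε) (Real.toNNReal (2 * (ε * σ ^ 2))) P →
      ‖boxPair R (mixMean M U ρ P i) S - (∫ x in Set.Icc (-R) R, A x 0) -
        ((ε * B i : ℝ) : ℂ)⁻¹ * (boxPair R (mixMean M U ρ P i) χ -
          boxPair R (startMean U ρ P i) χ) -
        ((ε * B i : ℝ) : ℂ)⁻¹ * (boxPair R (fun x t => ∫ y, mixMean M U ρ P i (x + y) t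
          ∂(gaussianReal 0 (Real.toNNReal (2 * (ε * σ ^ 2))))) χ -
          boxPair R (mixMean M U ρ P i) χ)‖ ≤ δ := by
  obtain ⟨D, hD⟩ := hloc R
  set δ' := δ / (2 * (1 + 4 * R)) with hδ'
  have hδ'0 : 0 < δ' := by positivity
  have hcm : Measurable fun x => ρ * (U x : ℂ) := by fun_prop
  have hs : Tendsto (fun ε : ℝ => Real.toNNReal (2 * (ε * σ ^ 2))) (𝓝[>] 0) (𝓝 0) := by
    have h1 : Continuous fun ε : ℝ => Real.toNNReal (2 * (ε * σ ^ 2)) := by fun_prop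
    have h2 := h1.tendsto 0
    simp only [zero_mul, mul_zero, Real.toNNReal_zero] at h2
    exact h2.mono_left nhdsWithin_le_nhds
  filter_upwards [eventually_norm_mode_kappa_le (hpos i) (hα i).1 (hα i).2 (hB i) (p := 0)
    (by norm_num) (by simpa using herr i) hC0 D KZ hδ'0, self_mem_nhdsWithin,
    hs.eventually (hS.eventually_norm_boxPair_sub_le (half_pos hδ))] with ε hκ hε hG P hP
  have hε : 0 < ε := hε
  have hb : 0 < ε * B i := mul_pos hε (hB i)
  have : ∀ i, IsProbabilityMeasure (scaledWait α μ ε i) := fun i =>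
    inferInstanceAs (IsProbabilityMeasure (scaledLaw (α i) (μ i) ε))
  have hpos' : ∀ i, scaledWait α μ ε i (Set.Iic 0) = 0 := fun i => scaledLaw_Iic (hpos i) hε
  set sε := Real.toNNReal (2 * (ε * σ ^ 2)) with hsε
  set E : ℝ → ℝ → ℂ := fun x t => ∫ y, mixMean M U ρ P i (x + y) t ∂(gaussianReal 0 sε) with hE
  have hkE : IsKernel C 1 E := (isKernel_mixMean hM hP hU hC0 hC i).gaussian sε
  have hZ2 : ∀ x, IsSymbol (C + 1) 2 KZ (Z x) := fun x => (hZ x).of_le hC0 (by norm_num)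
  -- the two error terms
  set κS : ℝ → ℝ → ℂ := fun x => mode (C + 1) (fun ξ =>
    kappa (scaledWait α μ ε i) (α i) (ε * B i) (freq (C + 1) ξ + ρ * (U x : ℂ)) * Z x ξ) with hκS
  set k0 : ℝ → ℂ := fun x => mode (C + 1) (fun ξ =>
    kappa (scaledWait α μ ε i) (α i) (ε * B i) (freq (C + 1) ξ + ρ * (U x : ℂ)) *
      ((freq (C + 1) ξ + ρ * (U x : ℂ)) ^ ((-1 : ℝ) : ℂ) * Z x ξ)) 0 with hk0
  have hb' : ((ε * B i : ℝ) : ℂ) ≠ 0 := by exact_mod_cast hb.ne'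
  -- the two operators of the renewal equation, in terms of symbols
  have e1 : ∀ x T, waitShift (scaledWait α μ ε i) (ρ * (U x : ℂ)) (χ x) T =
      χ x T - ((ε * B i : ℝ) : ℂ) * (S x T - κS x T) := fun x T => by
    rw [eχ, eS]
    exact (hZ2 x).waitShift_eq (hpos' i) hC0 (hC x) (hα i).1.le hb T
  have e2 : ∀ x, holdInt (scaledWait α μ ε i) (ρ * (U x : ℂ)) (χ x) 0 =
      ((ε * B i : ℝ) : ℂ) * (A x 0 - k0 x) := fun x => by
    rw [eχ, eA]
    exact (hZ2 x).holdInt_eq (hpos' i) hC0 (hC x) (hα i).1.le hb 0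
  have hW := hχ.waitShift (hpos' i) hcm hC
  -- `κS` is small; it is measurable and supported in `|x| ≤ R` since the other terms of `e1` are
  have hκSd : IsDampedOn (C + 1) δ' R κS := by
    have e3 : ∀ x T, κS x T = S x T - ((ε * B i : ℝ) : ℂ)⁻¹ * (χ x T -
        waitShift (scaledWait α μ ε i) (ρ * (U x : ℂ)) (χ x) T) := fun x T => by
      rw [e1]; field_simp; ring
    have hz : ∀ x T, R < |x| → κS x T = 0 := fun x T hx => by
      rw [e3, hS.eq_zero x T hx, hχ.eq_zero x T hx, hW.eq_zero x T hx]; simp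
    refine ⟨?_, fun x T => ?_, hz⟩
    · simp_rw [e3]
      exact hS.measurable.sub ((hχ.measurable.sub hW.measurable).const_mul _)
    · by_cases hx : |x| ≤ R
      · have := hκ _ (hC x) (hD x hx) _ (hZ x) T
        rwa [pow_zero, one_mul] at this
      · rw [hz x T (not_le.1 hx), norm_zero]
        positivity
  obtain ⟨hHi, hren⟩ := hχ.boxPair_startMean hpos' hM hP hU hC0 hC i
  have hAi : IntegrableOn (fun x => A x 0) (Set.Icc (-R) R) := by
    refine Measure.integrableOn_of_bounded (M := K'') (by simp)
      (hA.measurable.comp (f := fun x : ℝ => (x, (0 : ℝ))) (by fun_prop)).aestronglyMeasurable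
      (Eventually.of_forall fun x => ?_)
    simpa using hA.norm_le x 0
  have hk0i : IntegrableOn k0 (Set.Icc (-R) R) := by
    refine (hAi.sub (hHi.const_mul ((ε * B i : ℝ) : ℂ)⁻¹)).congr
      (Eventually.of_forall fun x => ?_)
    simp only [Pi.sub_apply]
    rw [e2]; field_simp; ring
  have hhold : ∫ x in Set.Icc (-R) R, holdInt (scaledWait α μ ε i) (ρ * (U x : ℂ)) (χ x) 0 =
      ((ε * B i : ℝ) : ℂ) * ((∫ x in Set.Icc (-R) R, A x 0) - ∫ x in Set.Icc (-R) R, k0 x) := by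
    simp_rw [e2]
    rw [integral_const_mul, integral_sub hAi hk0i]
  have hrE := hkE.isRep_kernelDist R
  have hshift : boxPair R E (fun x => waitShift (scaledWait α μ ε i) (ρ * (U x : ℂ)) (χ x)) =
      boxPair R E χ + (-((ε * B i : ℝ) : ℂ) * boxPair R E S +
        ((ε * B i : ℝ) : ℂ) * boxPair R E κS) := by
    have e4 : (fun x => waitShift (scaledWait α μ ε i) (ρ * (U x : ℂ)) (χ x)) = fun x T =>
        χ x T + (-((ε * B i : ℝ) : ℂ) * S x T + ((ε * B i : ℝ) : ℂ) * κS x T) := by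
      ext x T; rw [e1]; ring
    have d1 := hS.const_mul (-((ε * B i : ℝ) : ℂ))
    have d2 := hκSd.const_mul ((ε * B i : ℝ) : ℂ)
    rw [e4]
    unfold boxPair
    rw [hrE.repPair_add hχ (d1.add d2), hrE.repPair_add d1 d2, repPair_const_mul, repPair_const_mul]
  have hn1 := hkE.norm_boxPair_le hκSd hR
  have hn2 : ‖∫ x in Set.Icc (-R) R, k0 x‖ ≤ δ' * (2 * R) := by
    have := norm_setIntegral_le_of_norm_le_const (μ := volume) (s := Set.Icc (-R) R) (f := k0)
      (C := δ') (by simp) (fun x hx => by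
        have := hκ _ (hC x) (hD x (abs_le.2 hx)) _ ((hZ x).freq_add_cpow_mul (hC x) (a := -1)
          (by norm_num)) 0
        rw [pow_zero, one_mul, mul_zero, neg_zero, Real.exp_zero, mul_one] at this
        exact this)
    refine this.trans (le_of_eq ?_)
    rw [Measure.real, Real.volume_Icc, ENNReal.toReal_ofReal (by linarith)]
    ring
  have hn3 := hG _ (isKernel_mixMean hM hP hU hC0 hC i)
  have key : boxPair R (mixMean M U ρ P i) S - (∫ x in Set.Icc (-R) R, A x 0) -
        ((ε * B i : ℝ) : ℂ)⁻¹ * (boxPair R (mixMean M U ρ P i) χ -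
          boxPair R (startMean U ρ P i) χ) -
        ((ε * B i : ℝ) : ℂ)⁻¹ * (boxPair R E χ - boxPair R (mixMean M U ρ P i) χ) =
      -(boxPair R E S - boxPair R (mixMean M U ρ P i) S) + boxPair R E κS -
        ∫ x in Set.Icc (-R) R, k0 x := by
    rw [hren, hhold, hshift]
    field_simp
    ring
  rw [key]
  calc _ ≤ δ / 2 + 1 * δ' * (2 * R) + δ' * (2 * R) := by
        refine (norm_sub_le _ _).trans (add_le_add ((norm_add_le _ _).trans
          (add_le_add ?_ hn1)) hn2)
        rw [norm_neg]; exact hn3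
    _ = δ / 2 + δ' * (4 * R) := by ring
    _ ≤ δ / 2 + δ / 2 := by
        have : δ' * (4 * R) ≤ δ' * (1 + 4 * R) := by gcongr; linarith
        refine add_le_add le_rfl (this.trans (le_of_eq ?_))
        rw [hδ']; field_simp
    _ = δ := by ring

end Pairing

/-! ### The integrated backward equation -/

section
variable {N : ℕ} {M : Matrix (Fin N) (Fin N) ℝ} {μ : Fin N → Measure ℝ}
  {s : ℝ≥0} {U : ℝ → ℝ} {ρ : ℂ} {C R : ℝ} {P : Fin N → Measure (Path N)} {ψ : ℝ → ℝ → ℂ}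

lemma act_sub_one (g : Fin N → DistPath) (i : Fin N) (t : ℝ) (h : ℝ → ℂ) :
    act (M - 1) g i t h = act M g i t h - g i t h := by
  have hone : ∀ j, ((M - 1) i j : ℂ) = (M i j : ℂ) - if i = j then 1 else 0 := fun j => by
    rw [Matrix.sub_apply, Matrix.one_apply]
    split_ifs <;> simp
  unfold act
  simp_rw [hone, sub_mul, Finset.sum_sub_distrib, ite_mul, one_mul, zero_mul, Finset.sum_ite_eq,
    Finset.mem_univ, if_true]

lemma act_kernelDist {k : Fin N → ℝ → ℝ → ℂ} (hk : ∀ b, IsKernel C 1 (k b)) (i : Fin N) {t : ℝ}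
    (ht : 0 ≤ t) {h : ℝ → ℂ} (hh : Integrable h) :
    act M (fun b => kernelDist (k b)) i t h = ∫ x, h x * ∑ b, (M i b : ℂ) * k b x t := by
  unfold act kernelDist
  simp_rw [← integral_const_mul]
  rw [← integral_finsetSum _ fun b _ => ((hk b).integrable_mul ht hh).const_mul _]
  congr 1; ext x
  rw [Finset.mul_sum]
  exact Finset.sum_congr rfl fun _ _ => by ring

/-- `M G` is a function, the average of the backward functions over the next state. -/
lemma isRep_act [∀ i, IsProbabilityMeasure (μ i)] (hM : M ∈ Matrix.rowStochastic ℝ (Fin N))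
    (hP : IsChainFamily M μ s P) (hU : Measurable U) (hC0 : 0 ≤ C)
    (hC : ∀ x, -C ≤ (ρ * (U x : ℂ)).re) (R : ℝ) (i : Fin N) :
    IsRep C 1 R (volume.restrict (Set.Icc (-R) R)) (mixMean M U ρ P i) (fun x _ => x)
      (act M (fun b => kernelDist (startMean U ρ P b)) i) :=
  (isKernel_mixMean hM hP hU hC0 hC i).isRep R fun _ ht _ _ hm hb hs =>
    act_kernelDist (fun b => isKernel_startMean hP hU hC0 hC b) i (le_of_lt ht)
      (integrable_of_bounded_support hm hb hs)

lemma isRep_act_sub_one [∀ i, IsProbabilityMeasure (μ i)]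
    (hM : M ∈ Matrix.rowStochastic ℝ (Fin N))
    (hP : IsChainFamily M μ s P) (hU : Measurable U) (hC0 : 0 ≤ C)
    (hC : ∀ x, -C ≤ (ρ * (U x : ℂ)).re) (R : ℝ) (i : Fin N) :
    IsRep C (1 + 1) R (volume.restrict (Set.Icc (-R) R))
      (fun x t => mixMean M U ρ P i x t - startMean U ρ P i x t) (fun x _ => x)
      (act (M - 1) (fun b => kernelDist (startMean U ρ P b)) i) := by
  have hk := fun b => isKernel_startMean hP hU hC0 hC b
  have hm := isKernel_mixMean hM hP hU hC0 hC i
  refine (hm.sub (hk i)).isRep R fun t ht h K hh hb hs => ?_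
  have hi := integrable_of_bounded_support hh hb hs
  have e : act M (fun b => kernelDist (startMean U ρ P b)) i t h =
      ∫ x, h x * mixMean M U ρ P i x t := act_kernelDist hk i ht.le hi
  rw [act_sub_one, e, kernelDist,
    ← integral_sub (hm.integrable_mul ht.le hi) ((hk i).integrable_mul ht.le hi)]
  simp only [mul_sub]

lemma boxPair_sub [∀ i, IsProbabilityMeasure (μ i)] (hM : M ∈ Matrix.rowStochastic ℝ (Fin N))
    (hP : IsChainFamily M μ s P) (hU : Measurable U) (hC0 : 0 ≤ C)
    (hC : ∀ x, -C ≤ (ρ * (U x : ℂ)).re) {K : ℝ} {χ : ℝ → ℝ → ℂ}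
    (hχ : IsDampedOn (C + 1) K R χ) (i : Fin N) :
    boxPair R (fun x t => mixMean M U ρ P i x t - startMean U ρ P i x t) χ =
      boxPair R (mixMean M U ρ P i) χ - boxPair R (startMean U ρ P i) χ :=
  (isRep_act hM hP hU hC0 hC R i).repPair_sub_weight
    ((isKernel_startMean hP hU hC0 hC i).isRep_kernelDist R) hχ

lemma IsRep.integrableOn_time {Y : Type*} [MeasurableSpace Y] {ν : Measure Y} [IsFiniteMeasure ν]
    {L K : ℝ} {k : Y → ℝ → ℂ} {π : Y → ℝ → ℝ} {g : DistPath} {χ : ℝ → ℝ → ℂ}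
    (hg : IsRep C L R ν k π g) (hχ : IsDampedOn (C + 1) K R χ) :
    IntegrableOn (fun t => g t (fun x => χ x t)) (Set.Ioi 0) := by
  refine (hg.integrable_prod hχ).integral_prod_right.congr
    ((ae_restrict_mem measurableSet_Ioi).mono fun t ht => ?_)
  exact (hg.eq_integral t ht _ _ (hχ.measurable.comp (f := fun x : ℝ => (x, t))
    (measurable_id.prodMk measurable_const)) (fun x => hχ.norm_le x t)
    fun x hx => hχ.eq_zero x t hx).symm

lemma IsTest.exists_norm_iteratedDeriv_three_le (hψ : IsTest ψ) :
    ∃ K, 0 ≤ K ∧ ∀ x t, ‖iteratedDeriv 3 (fun y => ψ y t) x‖ ≤ K := by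
  obtain ⟨-, K, -, hK, h, -⟩ := hψ.dxx.dx.exists_bound
  refine ⟨K, hK, fun x t => ?_⟩
  have := h x t
  rwa [iteratedDeriv_succ]

/-- The diffusion approximation, paired with a test function. -/
lemma IsTest.exists_norm_boxPair_gaussian_le (hψ : IsTest ψ) (hC0 : 0 ≤ C) {K K' : ℝ}
    (hR : 0 ≤ R) (hd : IsDampedOn (C + 1) K R ψ)
    (hd' : IsDampedOn (C + 1) K' R (fun x t => iteratedDeriv 2 (fun y => ψ y t) x)) :
    ∃ D, 0 ≤ D ∧ ∀ k, IsKernel C 1 k → ∀ s : ℝ≥0, s ≤ 1 →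
      ‖boxPair R (fun x t => ∫ y, k (x + y) t ∂(gaussianReal 0 s)) ψ - boxPair R k ψ -
        ((s / 2 : ℝ) : ℂ) * boxPair R k (fun x t => iteratedDeriv 2 (fun y => ψ y t) x)‖ ≤
      D * (s * √(s : ℝ)) := by
  obtain ⟨T, B, hT, hB, -, -, hz⟩ := hψ.exists_bound
  obtain ⟨K3, hK3, h3⟩ := hψ.exists_norm_iteratedDeriv_three_le
  have hg := gaussMoment_nonneg
  refine ⟨Real.exp (C * T) * (2 * (R + 1)) * K3 * gaussMoment * T, by positivity,
    fun k hk s hs => ?_⟩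
  have hE := hk.gaussian s
  set E : ℝ → ℝ → ℂ := fun x t => ∫ y, k (x + y) t ∂(gaussianReal 0 s) with hEdef
  have r1 := hE.isRep_kernelDist R
  have r2 := hk.isRep_kernelDist R
  have e1 : boxPair R E ψ = pair (kernelDist E) ψ := (r1.pair_eq hd).symm
  have e2 : boxPair R k ψ = pair (kernelDist k) ψ := (r2.pair_eq hd).symm
  have e3 : boxPair R k (fun x t => iteratedDeriv 2 (fun y => ψ y t) x) =
    pair (kernelDist k) (fun x t => iteratedDeriv 2 (fun y => ψ y t) x) := (r2.pair_eq hd').symm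
  rw [e1, e2, e3]
  unfold pair
  have i1 := r1.integrableOn_time hd
  have i2 := r2.integrableOn_time hd
  have i3 := (r2.integrableOn_time hd').const_mul ((s / 2 : ℝ) : ℂ)
  have i4 : IntegrableOn (fun t => kernelDist E t (fun x => ψ x t) -
      kernelDist k t (fun x => ψ x t)) (Set.Ioi 0) := i1.sub i2
  rw [← integral_const_mul, ← integral_sub i1 i2, ← integral_sub i4 i3]
  have hΘ : ∀ t, T < t → kernelDist E t (fun x => ψ x t) - kernelDist k t (fun x => ψ x t) -
      ((s / 2 : ℝ) : ℂ) * kernelDist k t (fun x => iteratedDeriv 2 (fun y => ψ y t) x) = 0 := by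
    intro t ht
    have h0 : ∀ x, ψ x t = 0 := fun x => hz x t (ht.trans_le (le_abs_self t))
    simp [kernelDist, h0]
  rw [setIntegral_eq_of_subset_of_forall_sdiff_eq_zero measurableSet_Ioi
    (show Set.Ioc 0 T ⊆ Set.Ioi 0 from Set.Ioc_subset_Ioi_self) fun t ht =>
      hΘ t (not_le.1 fun h => ht.2 ⟨ht.1, h⟩)]
  have := norm_setIntegral_le_of_norm_le_const (μ := volume) (s := Set.Ioc 0 T)
    (f := fun t => kernelDist E t (fun x => ψ x t) - kernelDist k t (fun x => ψ x t) -
      ((s / 2 : ℝ) : ℂ) * kernelDist k t (fun x => iteratedDeriv 2 (fun y => ψ y t) x))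
    (C := Real.exp (C * T) * (2 * (R + 1)) * (s * (0 + K3 * √(s : ℝ))) * gaussMoment) (by simp)
    (fun t ht => by
      refine norm_integral_gaussian_sub_le (hk.measurable_space t) (fun x => ?_)
        ((hψ.contDiff_space t).of_le (by norm_cast)) hR
        (fun x hx => hd.eq_zero x t hx) le_rfl hK3 (fun x y => ?_) hs
      · refine (hk.norm_le x t ht.1.le).trans ?_
        rw [one_mul]
        exact Real.exp_le_exp.2 (mul_le_mul_of_nonneg_left ht.2 hC0)
      · rw [zero_add]
        exact norm_iteratedDeriv_two_sub_le ((hψ.contDiff_space t).of_le (by norm_cast))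
          hK3 (fun x => h3 x t) x y)
  refine this.trans (le_of_eq ?_)
  rw [Measure.real, Real.volume_Ioc, ENNReal.toReal_ofReal (by linarith)]
  ring

/-- Fubini for the initial term of the integrated equation. -/
lemma integral_substInt_zero {β K : ℝ} (hβ : β < 1) {c : ℝ → ℂ} (hcm : Measurable c)
    (hc : ∀ x, -C ≤ (c x).re) (hd : IsDampedOn (C + 1) K R ψ) :
    ∫ t in Set.Ioi (0 : ℝ), ((Real.Gamma (1 - β))⁻¹ : ℂ) * ((t ^ (-β) : ℝ) : ℂ) *
        ∫ x : ℝ, Complex.exp (-(t : ℂ) * c x) * ψ x t =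
      ∫ x in Set.Icc (-R) R, substInt β (c x) (ψ x) 0 := by
  have hi : Integrable (fun q : ℝ × ℝ => ((q.2 ^ (-β) : ℝ) : ℂ) *
      (Complex.exp (-(q.2 : ℂ) * c q.1) * ψ q.1 (0 + q.2)))
      ((volume.restrict (Set.Icc (-R) R)).prod (volume.restrict (Set.Ioi 0))) := by
    refine Integrable.mono' (((integrableOn_rpow_mul_exp_neg hβ).const_mul K).comp_snd
      (volume.restrict (Set.Icc (-R) R))) ?_ ?_
    · have h1 : Measurable fun q : ℝ × ℝ => ψ q.1 (0 + q.2) :=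
        hd.measurable.comp (f := fun q : ℝ × ℝ => (q.1, 0 + q.2)) (by fun_prop)
      have h2 : Measurable fun q : ℝ × ℝ => Complex.exp (-(q.2 : ℂ) * c q.1) := by fun_prop
      have h3 : Measurable fun q : ℝ × ℝ => ((q.2 ^ (-β) : ℝ) : ℂ) := by fun_prop
      exact (h3.mul (h2.mul h1)).aestronglyMeasurable
    · have hae : ∀ᵐ q : ℝ × ℝ ∂((volume.restrict (Set.Icc (-R) R)).prod
          (volume.restrict (Set.Ioi 0))), 0 < q.2 :=
        Measure.quasiMeasurePreserving_snd.ae (ae_restrict_mem measurableSet_Ioi)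
      refine hae.mono fun q hq => ?_
      rw [norm_mul, Complex.norm_real, Real.norm_of_nonneg (Real.rpow_nonneg hq.le _)]
      have := norm_shift_le (hc q.1) (hd.norm_le q.1) 0 hq.le
      rw [mul_zero, neg_zero, Real.exp_zero, mul_one] at this
      calc _ ≤ q.2 ^ (-β) * (K * Real.exp (-q.2)) :=
            mul_le_mul_of_nonneg_left this (Real.rpow_nonneg hq.le _)
        _ = _ := by ring
  unfold substInt
  rw [integral_const_mul, integral_integral_swap (f := fun x t => ((t ^ (-β) : ℝ) : ℂ) *
      (Complex.exp (-(t : ℂ) * c x) * ψ x (0 + t))) hi, ← integral_const_mul]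
  congr 1; ext t
  rw [mul_assoc, integral_const_mul]
  congr 2
  simp_rw [zero_add]
  refine (setIntegral_eq_integral_of_forall_compl_eq_zero fun x hx => ?_).symm
  rw [Set.mem_Icc, ← abs_le, not_le] at hx
  rw [hd.eq_zero x t hx, mul_zero]

/-- The symbols `(z^a) X` for `0 ≤ a ≤ 1` decay uniformly in space, even though `c` is bounded only
on bounded sets: `X` vanishes off the support of `ψ`. -/
lemma IsTest.exists_isSymbol_cpow_mul (hψ : IsTest ψ) (hC0 : 0 ≤ C) {c : ℝ → ℂ}
    (hc : ∀ x, -C ≤ (c x).re) (hloc : ∀ R : ℝ, ∃ D : ℝ, ∀ x : ℝ, |x| ≤ R → ‖c x‖ ≤ D)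
    {a : ℝ} (ha1 : a ≤ 1) (m : ℕ) :
    ∃ K, ∀ x, IsSymbol (C + 1) m K
      (fun ξ => (freq (C + 1) ξ + c x) ^ (a : ℂ) * symb (C + 1) ψ x ξ) := by
  obtain ⟨R, B, -, -, -, hz, -⟩ := hψ.exists_bound
  obtain ⟨D, hD⟩ := hloc R
  obtain ⟨K, hK⟩ := hψ.exists_isSymbol (b := C + 1) (by linarith) (m + 1)
  have hK0 := (hK 0).nonneg
  refine ⟨(1 + |D|) * K, fun x => ?_⟩
  by_cases hx : |x| ≤ R
  · refine (hK x).mul (k := 1) (by positivity) (measurable_freq_add_cpow a) fun ξ => ?_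
    have h1 := one_le_norm_freq_add (hc x) ξ
    rw [Complex.norm_cpow_real, pow_one]
    refine (Real.rpow_le_rpow_of_exponent_le h1 ha1).trans ?_
    rw [Real.rpow_one]
    exact norm_freq_add_le hC0 ((hD x hx).trans (le_abs_self D)) ξ
  · have h0 : ∀ ξ, symb (C + 1) ψ x ξ = 0 := fun ξ => by
      simp [symb, hz x _ (not_le.1 hx)]
    refine ⟨by simp_rw [h0, mul_zero]; exact measurable_const, fun ξ => ?_⟩
    rw [h0, mul_zero, norm_zero, zero_mul]
    positivity

lemma cpow_mul_cpow_mul {C : ℝ} {c : ℂ} (hc : -C ≤ c.re) (a b : ℝ) (ξ : ℝ) (X : ℂ) :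
    (freq (C + 1) ξ + c) ^ (a : ℂ) * ((freq (C + 1) ξ + c) ^ (b : ℂ) * X) =
      (freq (C + 1) ξ + c) ^ ((a + b : ℝ) : ℂ) * X := by
  rw [← mul_assoc, Complex.ofReal_add, Complex.cpow_add _ _ (freq_add_ne_zero hc ξ)]

/-- The integrated backward equation holds up to an error that vanishes with `ε`. -/
lemma IsTest.eventually_norm_backwardIntegratedDefect_le [∀ i, IsProbabilityMeasure (μ i)]
    (hpos : ∀ i, μ i (Set.Iic 0) = 0) (hM : M ∈ Matrix.rowStochastic ℝ (Fin N))
    (hψ : IsTest ψ) (hU : Measurable U) (hC0 : 0 ≤ C) (hC : ∀ x, -C ≤ (ρ * (U x : ℂ)).re)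
    (hloc : ∀ R : ℝ, ∃ D : ℝ, ∀ x : ℝ, |x| ≤ R → ‖ρ * (U x : ℂ)‖ ≤ D) {α B : Fin N → ℝ}
    (hα : ∀ i, 0 < α i ∧ α i < 1) (hB : ∀ i, 0 < B i) (σ : ℝ)
    (herr : ∀ i, (fun s : ℂ => laplaceError (μ i) (α i) (B i) s)
      =o[𝓝[{s : ℂ | 0 < s.re}] 0] (fun s : ℂ => ‖s‖ ^ (α i))) (i : Fin N)
    {δ : ℝ} (hδ : 0 < δ) :
    ∀ᶠ ε in 𝓝[>] (0 : ℝ), ∀ P : Fin N → Measure (Path N),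
      IsChainFamily M (scaledWait α μ ε) (Real.toNNReal (2 * (ε * σ ^ 2))) P →
      ‖backwardIntegratedDefect M α (fun j => ε * B j) (fun j => σ ^ 2 / B j)
        (fun x => ρ * (U x : ℂ)) (fun b => kernelDist (startMean U ρ P b)) ψ i‖ ≤ δ := by
  have hcm : Measurable fun x => ρ * (U x : ℂ) := by fun_prop
  have hb : (0 : ℝ) ≤ C + 1 := by linarith
  have hb1 : (1 : ℝ) ≤ C + 1 := by linarith
  -- a common support
  obtain ⟨K1, R1, h1⟩ := hψ.exists_isDampedOn hb
  obtain ⟨K2, R2, h2⟩ := hψ.dxx.exists_isDampedOn hb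
  obtain ⟨K3, R3, h3⟩ := hψ.exists_isDampedOn_adjDt hb hcm hloc
  set R := max (max R1 R2) (max R3 0) with hRdef
  have hR : 0 ≤ R := le_max_of_le_right (le_max_right _ _)
  have h1 := h1.mono (show R1 ≤ R from le_max_of_le_left (le_max_left _ _))
  have h2 := h2.mono (show R2 ≤ R from le_max_of_le_left (le_max_right _ _))
  have h3 := h3.mono (show R3 ≤ R from le_max_of_le_right (le_max_left _ _))
  have hS := h3.substInt (hα i).2 hcm hC
  have hA := h1.substInt (hα i).2 hcm hC
  -- the renewal equation is used with `χ = ψ`, whose symbol is `z^(-α) Z` for `Z = z^α X`, where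
  -- `X` is the symbol of `ψ`
  obtain ⟨KZ, hZ⟩ := hψ.exists_isSymbol_cpow_mul hC0 hC hloc (hα i).2.le 4
  have hX := fun x => hψ.integrable_symb hC0 x
  have eχ : ∀ x, ψ x = mode (C + 1) (fun ξ =>
      (freq (C + 1) ξ + ρ * (U x : ℂ)) ^ ((-α i : ℝ) : ℂ) *
        ((freq (C + 1) ξ + ρ * (U x : ℂ)) ^ (α i : ℂ) * symb (C + 1) ψ x ξ)) := fun x => by
    simp_rw [cpow_mul_cpow_mul (hC x), neg_add_cancel, Complex.ofReal_zero, Complex.cpow_zero,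
      one_mul]
    exact hψ.eq_mode hb1 x
  have eS : ∀ x, substInt (α i) (ρ * (U x : ℂ)) (adjDt (fun x => ρ * (U x : ℂ)) ψ x) =
      mode (C + 1) (fun ξ => (freq (C + 1) ξ + ρ * (U x : ℂ)) ^ (α i : ℂ) *
        symb (C + 1) ψ x ξ) := fun x => by
    obtain ⟨K, hK⟩ := hψ.exists_isSymbol_mul (c := fun x => ρ * (U x : ℂ)) hC0 2 x
    ext T
    rw [hψ.adjDt_eq_mode hb1, substInt_mode (hα i).2 (hC x) (hK.integrable hb1 le_rfl)]
    congr 1; ext ξ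
    have := cpow_mul_cpow_mul (hC x) (α i - 1) 1 ξ (symb (C + 1) ψ x ξ)
    rwa [Complex.ofReal_one, Complex.cpow_one, sub_add_cancel] at this
  have eA : ∀ x, substInt (α i) (ρ * (U x : ℂ)) (ψ x) = mode (C + 1) (fun ξ =>
      (freq (C + 1) ξ + ρ * (U x : ℂ)) ^ ((-1 : ℝ) : ℂ) *
        ((freq (C + 1) ξ + ρ * (U x : ℂ)) ^ (α i : ℂ) * symb (C + 1) ψ x ξ)) := fun x => by
    ext T
    conv_lhs => rw [hψ.eq_mode hb1 x]
    rw [substInt_mode (hα i).2 (hC x) (hX x)]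
    simp_rw [cpow_mul_cpow_mul (hC x)]
    congr 1; ext ξ
    congr 3; ring
  obtain ⟨D, hD0, hD⟩ := hψ.exists_norm_boxPair_gaussian_le hC0 hR h1 h2
  have hsq : Tendsto (fun ε : ℝ => D * (2 * σ ^ 2 / B i * √(2 * (ε * σ ^ 2)))) (𝓝[>] 0) (𝓝 0) := by
    have h : Continuous fun ε : ℝ => D * (2 * σ ^ 2 / B i * √(2 * (ε * σ ^ 2))) := by fun_prop
    have h' := h.tendsto 0
    simp only [zero_mul, mul_zero, Real.sqrt_zero] at h'
    exact h'.mono_left nhdsWithin_le_nhds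
  have hs1 : Tendsto (fun ε : ℝ => 2 * (ε * σ ^ 2)) (𝓝[>] 0) (𝓝 0) := by
    have h : Continuous fun ε : ℝ => 2 * (ε * σ ^ 2) := by fun_prop
    have h' := h.tendsto 0
    simp only [zero_mul, mul_zero] at h'
    exact h'.mono_left nhdsWithin_le_nhds
  filter_upwards [eventually_norm_renewal_le hpos hM hU hC0 hC hloc hα hB σ herr i hR hZ h1 eχ hS eS
    hA eA (half_pos hδ), hsq.eventually (ge_mem_nhds (half_pos hδ)),
    hs1.eventually (ge_mem_nhds zero_lt_one), self_mem_nhdsWithin] with ε hmain hs hs1 hε P hP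
  have hε : 0 < ε := hε
  have : ∀ i, IsProbabilityMeasure (scaledWait α μ ε i) := fun i =>
    inferInstanceAs (IsProbabilityMeasure (scaledLaw (α i) (μ i) ε))
  have hr := isRep_act hM hP hU hC0 hC R i
  have e1 : substPair (α i) (fun x => ρ * (U x : ℂ))
      (act M (fun b => kernelDist (startMean U ρ P b)) i) ψ =
      boxPair R (mixMean M U ρ P i) (fun x => substInt (α i) (ρ * (U x : ℂ))
        (adjDt (fun x => ρ * (U x : ℂ)) ψ x)) := hr.substPair_eq (hα i).2 hcm hC h3
  have e2 : pair (act (M - 1) (fun b => kernelDist (startMean U ρ P b)) i) ψ =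
      boxPair R (mixMean M U ρ P i) ψ - boxPair R (startMean U ρ P i) ψ := by
    rw [(isRep_act_sub_one hM hP hU hC0 hC R i).pair_eq h1]
    exact boxPair_sub hM hP hU hC0 hC h1 i
  have e3 : pair (FcP.dxx (act M (fun b => kernelDist (startMean U ρ P b)) i)) ψ =
      boxPair R (mixMean M U ρ P i) (fun x t => iteratedDeriv 2 (fun y => ψ y t) x) :=
    hr.pair_eq h2
  have hmain := hmain P hP
  have hgauss := hD _ (isKernel_mixMean hM hP hU hC0 hC i)
    (Real.toNNReal (2 * (ε * σ ^ 2))) (Real.toNNReal_le_one.2 hs1)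
  have hs0 : 0 ≤ 2 * (ε * σ ^ 2) := by positivity
  rw [Real.coe_toNNReal _ hs0] at hgauss
  set E := boxPair R (fun x t => ∫ y, mixMean M U ρ P i (x + y) t
    ∂(gaussianReal 0 (Real.toNNReal (2 * (ε * σ ^ 2))))) ψ with hE
  have hb' : 0 < ε * B i := mul_pos hε (hB i)
  have key : backwardIntegratedDefect M α (fun j => ε * B j) (fun j => σ ^ 2 / B j)
        (fun x => ρ * (U x : ℂ)) (fun b => kernelDist (startMean U ρ P b)) ψ i =
      (boxPair R (mixMean M U ρ P i) (fun x => substInt (α i) (ρ * (U x : ℂ))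
        (adjDt (fun x => ρ * (U x : ℂ)) ψ x)) -
        (∫ x in Set.Icc (-R) R, substInt (α i) (ρ * (U x : ℂ)) (ψ x) 0) -
        ((ε * B i : ℝ) : ℂ)⁻¹ * (boxPair R (mixMean M U ρ P i) ψ -
          boxPair R (startMean U ρ P i) ψ) -
        ((ε * B i : ℝ) : ℂ)⁻¹ * (E - boxPair R (mixMean M U ρ P i) ψ)) +
      ((ε * B i : ℝ) : ℂ)⁻¹ * (E - boxPair R (mixMean M U ρ P i) ψ -
        ((2 * (ε * σ ^ 2) / 2 : ℝ) : ℂ) *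
          boxPair R (mixMean M U ρ P i) (fun x t => iteratedDeriv 2 (fun y => ψ y t) x)) := by
    rw [backwardIntegratedDefect, e1, e2, e3, integral_substInt_zero (hα i).2 hcm hC h1]
    have h4 : (ε : ℂ) ≠ 0 := by exact_mod_cast hε.ne'
    have h5 : (B i : ℂ) ≠ 0 := by exact_mod_cast (hB i).ne'
    push_cast
    field_simp
    ring
  rw [key]
  refine (norm_add_le _ _).trans (le_trans (add_le_add hmain ?_) (le_of_eq (add_halves δ)))
  rw [norm_mul, norm_inv, Complex.norm_real, Real.norm_of_nonneg hb'.le]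
  calc _ ≤ (ε * B i)⁻¹ * (D * (2 * (ε * σ ^ 2) * √(2 * (ε * σ ^ 2)))) :=
        mul_le_mul_of_nonneg_left hgauss (inv_nonneg.2 hb'.le)
    _ = D * (2 * σ ^ 2 / B i * √(2 * (ε * σ ^ 2))) := by
        have := (hB i).ne'
        field_simp
    _ ≤ δ / 2 := hs

end

/-! ### Fractional pairings and their diffusion approximation -/

section Partial
variable {E : Type*}

lemma contDiff_deriv_partial [NormedAddCommGroup E] [NormedSpace ℝ E] {n m : WithTop ℕ∞}
    {f : E × ℝ → ℂ} (hf : ContDiff ℝ m f) (hn : n + 1 ≤ m) :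
    ContDiff ℝ n (fun q : E × ℝ => deriv (fun x => f (q.1, x)) q.2) := by
  have h1 : ContDiff ℝ m (Function.uncurry fun (q : E × ℝ) (x : ℝ) => f (q.1, x)) :=
    hf.comp (by fun_prop : ContDiff ℝ m fun p : (E × ℝ) × ℝ => (p.1.1, p.2))
  have h2 := (h1.fderiv (contDiff_snd (n := n)) hn).clm_apply (contDiff_const (c := (1 : ℝ)))
  exact h2

lemma continuous_iteratedDeriv_two_partial [NormedAddCommGroup E] [NormedSpace ℝ E]
    {f : E × ℝ → ℂ} (hf : ContDiff ℝ 2 f) :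
    Continuous fun q : E × ℝ => iteratedDeriv 2 (fun x => f (q.1, x)) q.2 := by
  have h1 := contDiff_deriv_partial (n := 1) hf (by norm_num)
  have h2 := contDiff_deriv_partial (n := 0) h1 (by norm_num)
  simp only [iteratedDeriv_succ, iteratedDeriv_zero]
  exact h2.continuous

lemma exists_norm_le_of_support [TopologicalSpace E] {F : E × ℝ → ℂ} (hF : Continuous F) {Q : Set E}
    (hQ : IsCompact Q) {R : ℝ} (hz : ∀ p ∈ Q, ∀ x, R < |x| → F (p, x) = 0) :
    ∃ B, 0 ≤ B ∧ ∀ p ∈ Q, ∀ x, ‖F (p, x)‖ ≤ B := by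
  obtain ⟨B, hB⟩ := (hQ.prod (isCompact_Icc (a := -R) (b := R))).exists_bound_of_continuousOn
    hF.continuousOn
  refine ⟨max B 0, le_max_right _ _, fun p hp x => ?_⟩
  by_cases hx : |x| ≤ R
  · exact (hB (p, x) ⟨hp, abs_le.1 hx⟩).trans (le_max_left _ _)
  · rw [hz p hp x (not_le.1 hx), norm_zero]; exact le_max_right _ _

/-- A quantitative form of uniform continuity, linear in the displacement. -/
lemma exists_norm_translate_sub_le [PseudoMetricSpace E] {F : E × ℝ → ℂ} (hF : Continuous F)
    {Q : Set E} (hQ : IsCompact Q) {R : ℝ} (hz : ∀ p ∈ Q, ∀ x, R < |x| → F (p, x) = 0) {η : ℝ}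
    (hη : 0 < η) :
    ∃ A, 0 ≤ A ∧ ∀ p ∈ Q, ∀ x y, ‖F (p, x + y) - F (p, x)‖ ≤ η + A * |y| := by
  obtain ⟨B, hB0, hB⟩ := exists_norm_le_of_support hF hQ hz
  have huc := (hQ.prod (isCompact_Icc (a := -(R + 1)) (b := R + 1))).uniformContinuousOn_of_continuous
    hF.continuousOn
  obtain ⟨d, hd, h⟩ := Metric.uniformContinuousOn_iff.1 huc η hη
  set d' := min d 1 with hd'
  have hd'0 : 0 < d' := lt_min hd one_pos
  refine ⟨2 * B / d', by positivity, fun p hp x y => ?_⟩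
  -- small displacements by uniform continuity, the others by the bound on `F`
  rcases lt_or_ge |y| d' with hy | hy
  · have hy1 : |y| < 1 := hy.trans_le (min_le_right _ _)
    refine le_trans ?_ (le_add_of_nonneg_right (by positivity))
    by_cases hx : |x| ≤ R + 1 ∧ |x + y| ≤ R + 1
    · have := h (p, x + y) ⟨hp, abs_le.1 hx.2⟩ (p, x) ⟨hp, abs_le.1 hx.1⟩ (by
        rw [Prod.dist_eq, dist_self, Real.dist_eq, add_sub_cancel_left]
        exact max_lt hd (hy.trans_le (min_le_left _ _)))
      rw [dist_eq_norm] at this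
      exact this.le
    · have h1 : R < |x| ∧ R < |x + y| := by
        have h2 := abs_add_le x y
        have h3 := abs_sub_abs_le_abs_sub x (-y)
        rw [sub_neg_eq_add, abs_neg] at h3
        rw [not_and_or, not_le, not_le] at hx
        rcases hx with hx | hx
        · exact ⟨by linarith, by linarith⟩
        · exact ⟨by linarith, by linarith⟩
      rw [hz p hp _ h1.1, hz p hp _ h1.2, sub_zero, norm_zero]
      exact hη.le
  · have h1 : 2 * B ≤ 2 * B / d' * |y| := by
      rw [div_mul_eq_mul_div, le_div_iff₀ hd'0]
      exact mul_le_mul_of_nonneg_left hy (by positivity)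
    have h2 := (norm_sub_le (F (p, x + y)) (F (p, x))).trans (add_le_add (hB p hp _) (hB p hp _))
    linarith

end Partial

/-- The time integral of the fractional integral of order `1 - β` of `Θ t r` over `0 < r < t`. -/
def fracPair (β : ℝ) (Θ : ℝ × ℝ → ℂ) : ℂ :=
  ∫ t in Set.Ioi (0 : ℝ), ((Real.Gamma (1 - β))⁻¹ : ℂ) *
    ∫ r in (0 : ℝ)..t, (((t - r) ^ (-β) : ℝ) : ℂ) * Θ (t, r)

/-- The kernel of the fractional integral with exponential damping, on `0 < r < t`. -/
def dampedKernel (β : ℝ) (q : ℝ × ℝ) : ℝ :=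
  (Set.Ioi (0 : ℝ)).indicator (fun r => Real.exp (-r)) q.2 *
    (Set.Ioi (0 : ℝ)).indicator (fun u => u ^ (-β) * Real.exp (-u)) (q.1 - q.2)

section Frac
variable {β B T : ℝ} {Θ Θ₁ Θ₂ Θ₃ : ℝ × ℝ → ℂ}

lemma dampedKernel_nonneg (q : ℝ × ℝ) : 0 ≤ dampedKernel β q :=
  mul_nonneg (Set.indicator_nonneg (fun _ _ => (Real.exp_pos _).le) _)
    (Set.indicator_nonneg (fun _ hu => mul_nonneg (Real.rpow_nonneg (le_of_lt hu) _)
      (Real.exp_pos _).le) _)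

/-- Since `Θ` vanishes for `t > T`, the damping `exp(-t)` in the kernel costs a factor `exp T` at
most. -/
lemma norm_indicator_fracKernel_le (hB : 0 ≤ B) (hb : ∀ t r, 0 < r → r < t → ‖Θ (t, r)‖ ≤ B)
    (hz : ∀ t r, T < t → Θ (t, r) = 0) (q : ℝ × ℝ) :
    ‖{q : ℝ × ℝ | 0 < q.2 ∧ q.2 < q.1}.indicator
      (fun q => (((q.1 - q.2) ^ (-β) : ℝ) : ℂ) * Θ q) q‖ ≤ B * Real.exp T * dampedKernel β q := by
  have h0 := dampedKernel_nonneg (β := β) q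
  by_cases hq : q ∈ {q : ℝ × ℝ | 0 < q.2 ∧ q.2 < q.1}
  · rw [Set.indicator_of_mem hq]
    have hu : 0 < q.1 - q.2 := sub_pos.2 hq.2
    by_cases ht : T < q.1
    · rw [show Θ q = 0 from hz q.1 q.2 ht, mul_zero, norm_zero]
      positivity
    · rw [dampedKernel, Set.indicator_of_mem (show q.2 ∈ Set.Ioi (0 : ℝ) from hq.1),
        Set.indicator_of_mem (show q.1 - q.2 ∈ Set.Ioi (0 : ℝ) from hu), norm_mul,
        Complex.norm_real, Real.norm_of_nonneg (Real.rpow_nonneg hu.le _)]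
      have h1 : 1 ≤ Real.exp T * (Real.exp (-q.2) * Real.exp (-(q.1 - q.2))) := by
        rw [← Real.exp_add, ← Real.exp_add]
        exact Real.one_le_exp (by linarith [not_lt.1 ht])
      calc _ ≤ (q.1 - q.2) ^ (-β) * B :=
            mul_le_mul_of_nonneg_left (hb q.1 q.2 hq.1 hq.2) (Real.rpow_nonneg hu.le _)
        _ ≤ (q.1 - q.2) ^ (-β) * B * (Real.exp T * (Real.exp (-q.2) * Real.exp (-(q.1 - q.2)))) :=
            le_mul_of_one_le_right (mul_nonneg (Real.rpow_nonneg hu.le _) hB) h1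
        _ = _ := by ring
  · rw [Set.indicator_of_notMem hq, norm_zero]
    positivity

lemma integrable_indicator_fracKernel (hβ : β < 1) (hm : Measurable Θ) (hB : 0 ≤ B)
    (hb : ∀ t r, 0 < r → r < t → ‖Θ (t, r)‖ ≤ B) (hz : ∀ t r, T < t → Θ (t, r) = 0) :
    Integrable ({q : ℝ × ℝ | 0 < q.2 ∧ q.2 < q.1}.indicator
      (fun q => (((q.1 - q.2) ^ (-β) : ℝ) : ℂ) * Θ q)) (volume.prod volume) := by
  refine Integrable.mono' ((integrable_substKernel hβ).const_mul (B * Real.exp T)) ?_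
    (Eventually.of_forall (norm_indicator_fracKernel_le hB hb hz))
  refine (Measurable.indicator ?_ ?_).aestronglyMeasurable
  · have : Measurable fun q : ℝ × ℝ => (((q.1 - q.2) ^ (-β) : ℝ) : ℂ) := by fun_prop
    exact this.mul hm
  · exact (measurableSet_lt measurable_const measurable_snd).inter
      (measurableSet_lt measurable_snd measurable_fst)

lemma fracPair_eq (hβ : β < 1) (hm : Measurable Θ) (hB : 0 ≤ B)
    (hb : ∀ t r, 0 < r → r < t → ‖Θ (t, r)‖ ≤ B) (hz : ∀ t r, T < t → Θ (t, r) = 0) :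
    fracPair β Θ = ((Real.Gamma (1 - β))⁻¹ : ℂ) *
      ∫ q, {q : ℝ × ℝ | 0 < q.2 ∧ q.2 < q.1}.indicator
        (fun q => (((q.1 - q.2) ^ (-β) : ℝ) : ℂ) * Θ q) q ∂(volume.prod volume) := by
  rw [fracPair, integral_const_mul,
    integral_prod _ (integrable_indicator_fracKernel hβ hm hB hb hz),
    ← integral_indicator measurableSet_Ioi]
  congr 2; ext t
  by_cases ht : t ∈ Set.Ioi (0 : ℝ)
  · rw [Set.indicator_of_mem ht, intervalIntegral.integral_of_le (le_of_lt ht),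
      ← integral_indicator measurableSet_Ioc]
    have hne : ∀ᵐ r : ℝ, r ≠ t := by simp [ae_iff, measure_singleton]
    refine integral_congr_ae (hne.mono fun r hr => ?_)
    dsimp only
    by_cases h : 0 < r ∧ r < t
    · rw [Set.indicator_of_mem (show r ∈ Set.Ioc 0 t from ⟨h.1, h.2.le⟩),
        Set.indicator_of_mem (show (t, r) ∈ {q : ℝ × ℝ | 0 < q.2 ∧ q.2 < q.1} from h)]
    · rw [Set.indicator_of_notMem (fun h' : r ∈ Set.Ioc 0 t => h ⟨h'.1, lt_of_le_of_ne h'.2 hr⟩),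
        Set.indicator_of_notMem (show (t, r) ∉ {q : ℝ × ℝ | 0 < q.2 ∧ q.2 < q.1} from h)]
  · rw [Set.indicator_of_notMem ht]
    symm
    refine integral_eq_zero_of_ae (Eventually.of_forall fun r => ?_)
    have : (t, r) ∉ {q : ℝ × ℝ | 0 < q.2 ∧ q.2 < q.1} := fun h => ht (h.1.trans h.2)
    exact Set.indicator_of_notMem this _

/-- Fractional pairings are linear and continuous. -/
lemma norm_fracPair_sub_sub_le (hβ : β < 1) (hm₁ : Measurable Θ₁) (hm₂ : Measurable Θ₂)
    (hm₃ : Measurable Θ₃) (hB : 0 ≤ B) (hb₁ : ∀ t r, 0 < r → r < t → ‖Θ₁ (t, r)‖ ≤ B)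
    (hb₂ : ∀ t r, 0 < r → r < t → ‖Θ₂ (t, r)‖ ≤ B) (hb₃ : ∀ t r, 0 < r → r < t → ‖Θ₃ (t, r)‖ ≤ B)
    (hz₁ : ∀ t r, T < t → Θ₁ (t, r) = 0) (hz₂ : ∀ t r, T < t → Θ₂ (t, r) = 0)
    (hz₃ : ∀ t r, T < t → Θ₃ (t, r) = 0) {a : ℂ} {κ : ℝ} (hκ : 0 ≤ κ)
    (h : ∀ t r, 0 < r → r < t → ‖Θ₁ (t, r) - Θ₂ (t, r) - a * Θ₃ (t, r)‖ ≤ κ) :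
    ‖fracPair β Θ₁ - fracPair β Θ₂ - a * fracPair β Θ₃‖ ≤
      (Real.Gamma (1 - β))⁻¹ * (κ * Real.exp T *
        ∫ q, dampedKernel β q ∂(volume.prod volume)) := by
  have hΓ : 0 < Real.Gamma (1 - β) := Real.Gamma_pos_of_pos (by linarith)
  have i1 := integrable_indicator_fracKernel hβ hm₁ hB hb₁ hz₁
  have i2 := integrable_indicator_fracKernel hβ hm₂ hB hb₂ hz₂
  have i3 := (integrable_indicator_fracKernel hβ hm₃ hB hb₃ hz₃).const_mul a
  have e : fracPair β Θ₁ - fracPair β Θ₂ - a * fracPair β Θ₃ = ((Real.Gamma (1 - β))⁻¹ : ℂ) *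
      ∫ q, {q : ℝ × ℝ | 0 < q.2 ∧ q.2 < q.1}.indicator
        (fun q => (((q.1 - q.2) ^ (-β) : ℝ) : ℂ) * (Θ₁ q - Θ₂ q - a * Θ₃ q)) q
        ∂(volume.prod volume) := by
    rw [fracPair_eq hβ hm₁ hB hb₁ hz₁, fracPair_eq hβ hm₂ hB hb₂ hz₂, fracPair_eq hβ hm₃ hB hb₃ hz₃,
      mul_left_comm, ← mul_sub, ← mul_sub, ← integral_const_mul]
    have e2 := integral_sub (i1.sub i2) i3
    simp only [Pi.sub_apply] at e2
    rw [← integral_sub i1 i2, ← e2]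
    congr 2; ext q
    by_cases hq : q ∈ {q : ℝ × ℝ | 0 < q.2 ∧ q.2 < q.1}
    · simp only [Set.indicator_of_mem hq]; ring
    · simp only [Set.indicator_of_notMem hq]; ring
  rw [e, norm_mul, norm_inv, Complex.norm_real, Real.norm_of_nonneg hΓ.le, ← integral_const_mul]
  refine mul_le_mul_of_nonneg_left ?_ (inv_nonneg.2 hΓ.le)
  refine norm_integral_le_of_norm_le ((integrable_substKernel hβ).const_mul (κ * Real.exp T))
    (Eventually.of_forall fun q => ?_)
  exact norm_indicator_fracKernel_le (Θ := fun q => Θ₁ q - Θ₂ q - a * Θ₃ q) hκ h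
    (fun t r ht => by rw [hz₁ t r ht, hz₂ t r ht, hz₃ t r ht]; simp) q

end Frac

lemma norm_integral_mul_le_of_support {h γ : ℝ → ℂ} {R B L : ℝ} (hR : 0 ≤ R)
    (hs : ∀ x, R < |x| → h x = 0) (hb : ∀ x, ‖h x‖ ≤ B) (hL : ∀ x, ‖γ x‖ ≤ L) :
    ‖∫ x, h x * γ x‖ ≤ B * L * (2 * R) := by
  have hB : 0 ≤ B := (norm_nonneg _).trans (hb 0)
  have e : ∫ x, h x * γ x = ∫ x in Set.Icc (-R) R, h x * γ x := by
    refine (setIntegral_eq_integral_of_forall_compl_eq_zero fun x hx => ?_).symm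
    rw [Set.mem_Icc, ← abs_le, not_le] at hx
    rw [hs x hx, zero_mul]
  rw [e]
  have := norm_setIntegral_le_of_norm_le_const (μ := volume) (s := Set.Icc (-R) R)
    (f := fun x => h x * γ x) (C := B * L) (by simp) (fun x _ => by
      rw [norm_mul]
      exact mul_le_mul (hb x) (hL x) (norm_nonneg _) hB)
  refine this.trans (le_of_eq ?_)
  rw [Measure.real, Real.volume_Icc, ENNReal.toReal_ofReal (by linarith)]
  ring

section Gauss
variable {C R K : ℝ} {ψ : ℝ → ℝ → ℂ} {c : ℝ → ℂ}

lemma IsTest.contDiff_exp_mul_adjDt (hψ : IsTest ψ) (hc : ContDiff ℝ 2 c) :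
    ContDiff ℝ 2 fun q : (ℝ × ℝ) × ℝ =>
      Complex.exp (-(q.1.1 : ℂ) * c q.2) * adjDt c ψ q.2 q.1.2 := by
  have h1 : ContDiff ℝ 2 fun q : (ℝ × ℝ) × ℝ => -deriv (ψ q.2) q.1.2 :=
    (hψ.dt.neg.1.of_le (by norm_cast)).comp
      (by fun_prop : ContDiff ℝ 2 fun q : (ℝ × ℝ) × ℝ => (q.2, q.1.2))
  have h2 : ContDiff ℝ 2 fun q : (ℝ × ℝ) × ℝ => ψ q.2 q.1.2 :=
    (hψ.1.of_le (by norm_cast)).comp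
      (by fun_prop : ContDiff ℝ 2 fun q : (ℝ × ℝ) × ℝ => (q.2, q.1.2))
  have h3 : ContDiff ℝ 2 fun q : (ℝ × ℝ) × ℝ => c q.2 := hc.comp contDiff_snd
  have h4 : ContDiff ℝ 2 fun q : (ℝ × ℝ) × ℝ => (q.1.1 : ℂ) :=
    Complex.ofRealCLM.contDiff.comp (contDiff_fst.comp contDiff_fst)
  exact (h4.neg.mul h3).cexp.mul (h1.add (h3.mul h2))

/-- The diffusion approximation under the fractional substantial derivative. -/
lemma IsTest.exists_norm_substPair_gaussian_le (hψ : IsTest ψ) (hC0 : 0 ≤ C)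
    (hc : ContDiff ℝ 2 c) {β : ℝ} (hβ : β < 1) :
    ∃ W, 0 ≤ W ∧ ∀ η, 0 < η → ∃ A, 0 ≤ A ∧ ∀ k, IsKernel C 1 k → ∀ s : ℝ≥0, s ≤ 1 →
      ‖substPair β c (kernelDist (fun x t => ∫ y, k (x + y) t ∂(gaussianReal 0 s))) ψ -
        substPair β c (kernelDist k) ψ -
        ((s / 2 : ℝ) : ℂ) * substPair β c (FcP.dxx (kernelDist k)) ψ‖ ≤
      W * (s * (η + A * √(s : ℝ))) := by
  obtain ⟨R₁, -, hR₁, -, -, hx₁, ht₁⟩ := hψ.exists_bound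
  obtain ⟨R₂, -, -, -, -, hx₂, ht₂⟩ := hψ.dt.exists_bound
  set R := max R₁ R₂ with hRdef
  have hR : 0 ≤ R := le_max_of_le_left hR₁
  set f : (ℝ × ℝ) × ℝ → ℂ := fun q =>
    Complex.exp (-(q.1.1 : ℂ) * c q.2) * adjDt c ψ q.2 q.1.2 with hf
  have hf2 : ContDiff ℝ 2 f := hψ.contDiff_exp_mul_adjDt hc
  have hfp : ∀ p : ℝ × ℝ, ContDiff ℝ 2 fun x => f (p, x) := fun p =>
    hf2.comp (by fun_prop : ContDiff ℝ 2 fun x : ℝ => (p, x))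
  have hfx : ∀ p : ℝ × ℝ, ∀ x, R < |x| → f (p, x) = 0 := fun p x hx => by
    simp [hf, adjDt, hx₁ x p.2 ((le_max_left _ _).trans_lt hx),
      hx₂ x p.2 ((le_max_right _ _).trans_lt hx)]
  have hft : ∀ (u t x : ℝ), R < t → f ((u, t), x) = 0 := fun u t x ht => by
    have ht' := ht.trans_le (le_abs_self t)
    simp [hf, adjDt, ht₁ x t ((le_max_left _ _).trans_lt ht'),
      ht₂ x t ((le_max_right _ _).trans_lt ht')]
  set F : (ℝ × ℝ) × ℝ → ℂ := fun q => iteratedDeriv 2 (fun x => f (q.1, x)) q.2 with hF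
  have hFc : Continuous F := continuous_iteratedDeriv_two_partial hf2
  have hFx : ∀ p : ℝ × ℝ, ∀ x, R < |x| → F (p, x) = 0 := fun p x hx =>
    iteratedDeriv_two_eq_zero_of_support (hfx p) hx
  have hFt : ∀ (u t x : ℝ), R < t → F ((u, t), x) = 0 := fun u t x ht => by
    have : (fun x => f ((u, t), x)) = fun _ => 0 := funext fun x => hft u t x ht
    simp [hF, this]
  -- `(t - r, t)` stays in a compact set, since `ψ` vanishes for `t > R`
  set Q : Set (ℝ × ℝ) := Set.Icc 0 R ×ˢ Set.Icc 0 R with hQ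
  have hQc : IsCompact Q := isCompact_Icc.prod isCompact_Icc
  have hQm : ∀ t r, 0 < r → r < t → t ≤ R → (t - r, t) ∈ Q := fun t r h0 h1 h2 =>
    ⟨⟨by linarith, by linarith⟩, ⟨by linarith, h2⟩⟩
  obtain ⟨B₁, hB₁, hb₁⟩ := exists_norm_le_of_support hf2.continuous hQc fun p _ => hfx p
  obtain ⟨B₂, hB₂, hb₂⟩ := exists_norm_le_of_support hFc hQc fun p _ => hFx p
  have hg := gaussMoment_nonneg
  have hker : 0 ≤ ∫ q, dampedKernel β q ∂((volume : Measure ℝ).prod (volume : Measure ℝ)) :=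
    integral_nonneg fun q => dampedKernel_nonneg q
  have hΓ : 0 < Real.Gamma (1 - β) := Real.Gamma_pos_of_pos (by linarith)
  refine ⟨(Real.Gamma (1 - β))⁻¹ * (Real.exp (C * R) * (2 * (R + 1)) * gaussMoment * Real.exp R *
    ∫ q, dampedKernel β q ∂((volume : Measure ℝ).prod (volume : Measure ℝ))), by positivity,
    fun η hη => ?_⟩
  obtain ⟨A, hA, hmod⟩ := exists_norm_translate_sub_le hFc hQc (fun p _ => hFx p) hη
  refine ⟨A, hA, fun k hk s hs => ?_⟩
  -- measurability and bounds of the three integrands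
  have hmeas : ∀ {k' : ℝ → ℝ → ℂ} {f' : (ℝ × ℝ) × ℝ → ℂ}, IsKernel C 1 k' → Continuous f' →
      Measurable fun q : ℝ × ℝ => ∫ x, f' ((q.1 - q.2, q.1), x) * k' x q.2 := by
    intro k' f' hk' hf'
    have h1 : Measurable fun p : (ℝ × ℝ) × ℝ => f' ((p.1.1 - p.1.2, p.1.1), p.2) :=
      (hf'.comp (by fun_prop : Continuous fun p : (ℝ × ℝ) × ℝ =>
        ((p.1.1 - p.1.2, p.1.1), p.2))).measurable
    have h2 : Measurable fun p : (ℝ × ℝ) × ℝ => k' p.2 p.1.2 :=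
      hk'.measurable.comp (f := fun p : (ℝ × ℝ) × ℝ => (p.2, p.1.2)) (by fun_prop)
    exact ((h1.mul h2).stronglyMeasurable.integral_prod_right' (ν := volume)).measurable
  have hkb : ∀ {k' : ℝ → ℝ → ℂ}, IsKernel C 1 k' → ∀ {r : ℝ}, 0 < r → r ≤ R → ∀ x,
      ‖k' x r‖ ≤ Real.exp (C * R) := by
    intro k' hk' r h0 h1 x
    refine (hk'.norm_le x r h0.le).trans ?_
    rw [one_mul]
    exact Real.exp_le_exp.2 (mul_le_mul_of_nonneg_left h1 hC0)
  have hbd : ∀ {k' : ℝ → ℝ → ℂ} {f' : (ℝ × ℝ) × ℝ → ℂ} {B' : ℝ}, IsKernel C 1 k' →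
      (∀ p : ℝ × ℝ, ∀ x, R < |x| → f' (p, x) = 0) → (∀ u t x, R < t → f' ((u, t), x) = 0) →
      (∀ p ∈ Q, ∀ x, ‖f' (p, x)‖ ≤ B') → B' ≤ B₁ + B₂ → ∀ t r, 0 < r → r < t →
      ‖∫ x, f' ((t - r, t), x) * k' x r‖ ≤ (B₁ + B₂) * Real.exp (C * R) * (2 * R) := by
    intro k' f' B' hk' hx ht hb hB' t r h0 h1
    by_cases h2 : t ≤ R
    · exact norm_integral_mul_le_of_support hR (hx _)
        (fun x => (hb _ (hQm t r h0 h1 h2) x).trans hB') (hkb hk' h0 (h1.le.trans h2))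
    · simp only [ht _ t _ (not_le.1 h2), zero_mul, integral_zero, norm_zero]
      positivity
  have hzero : ∀ (k' : ℝ → ℝ → ℂ) {f' : (ℝ × ℝ) × ℝ → ℂ},
      (∀ u t x, R < t → f' ((u, t), x) = 0) → ∀ t r : ℝ, R < t →
      ∫ x, f' ((t - r, t), x) * k' x r = 0 := by
    intro k' f' ht t r h
    simp only [ht _ t _ h, zero_mul, integral_zero]
  have hE := hk.gaussian s
  have main := norm_fracPair_sub_sub_le (T := R) (a := ((s / 2 : ℝ) : ℂ))
    (κ := Real.exp (C * R) * (2 * (R + 1)) * (s * (η + A * √(s : ℝ))) * gaussMoment)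
    hβ (hmeas hE hf2.continuous) (hmeas hk hf2.continuous) (hmeas hk hFc)
    (by positivity) (hbd hE hfx hft hb₁ (by linarith)) (hbd hk hfx hft hb₁ (by linarith))
    (hbd hk hFx hFt hb₂ (by linarith)) (hzero (fun x t => ∫ y, k (x + y) t ∂(gaussianReal 0 s)) hft)
    (hzero k hft) (hzero k hFt) (by positivity)
    (fun t r h0 h1 => by
      by_cases h2 : t ≤ R
      · exact norm_integral_gaussian_sub_le (hk.measurable_space r)
          (hkb hk h0 (h1.le.trans h2)) (hfp _) hR (hfx _) hη.le hA
          (hmod _ (hQm t r h0 h1 h2)) hs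
      · simp only [hft _ t _ (not_le.1 h2), hFt _ t _ (not_le.1 h2), zero_mul, integral_zero,
          mul_zero, sub_zero, norm_zero]
        positivity)
  refine le_trans (le_of_eq ?_) (main.trans (le_of_eq ?_))
  · rfl
  · ring

end Gauss

/-! ### The backward equation -/

section
variable {N : ℕ} {M : Matrix (Fin N) (Fin N) ℝ} {μ : Fin N → Measure ℝ}
  {s : ℝ≥0} {U : ℝ → ℝ} {ρ : ℂ} {C R : ℝ} {P : Fin N → Measure (Path N)} {ψ : ℝ → ℝ → ℂ}

/-- On `C²` functions the matrix `M` may be applied before or after the space derivatives. -/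
lemma IsTest.substPair_act_dxx (hψ : IsTest ψ) {c : ℝ → ℂ} (hc : ContDiff ℝ 2 c)
    {k : Fin N → ℝ → ℝ → ℂ} (hk : ∀ b, IsKernel C 1 (k b)) (β : ℝ) (i : Fin N) :
    substPair β c (act M (fun b => FcP.dxx (kernelDist (k b))) i) ψ =
      substPair β c (FcP.dxx (kernelDist fun x t => ∑ b, (M i b : ℂ) * k b x t)) ψ := by
  obtain ⟨R₁, -, -, -, -, hx₁, -⟩ := hψ.exists_bound
  obtain ⟨R₂, -, -, -, -, hx₂, -⟩ := hψ.dt.exists_bound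
  refine setIntegral_congr_fun measurableSet_Ioi fun t ht => ?_
  have ht : 0 < t := ht
  congr 1
  refine intervalIntegral.integral_congr fun r hr => ?_
  rw [Set.uIcc_of_le ht.le] at hr
  congr 1
  set h : ℝ → ℂ := fun x => Complex.exp (-((t - r : ℝ) : ℂ) * c x) *
    (-deriv (ψ x) t + c x * ψ x t) with hh
  have h2 : ContDiff ℝ 2 h := (hψ.contDiff_exp_mul_adjDt hc).comp
    (by fun_prop : ContDiff ℝ 2 fun x : ℝ => ((t - r, t), x))
  have hs : ∀ x, max R₁ R₂ < |x| → h x = 0 := fun x hx => by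
    simp [hh, hx₁ x t ((le_max_left _ _).trans_lt hx), hx₂ x t ((le_max_right _ _).trans_lt hx)]
  exact act_kernelDist hk i hr.1 (integrable_of_support (h2.continuous_iteratedDeriv 2 le_rfl)
    fun x hx => iteratedDeriv_two_eq_zero_of_support hs hx)

/-- The backward equation holds up to an error that vanishes with `ε`. -/
lemma IsTest.eventually_norm_backwardDefect_le [∀ i, IsProbabilityMeasure (μ i)]
    (hpos : ∀ i, μ i (Set.Iic 0) = 0) (hM : M ∈ Matrix.rowStochastic ℝ (Fin N))
    (hψ : IsTest ψ) (hU : ContDiff ℝ 2 U) (hC0 : 0 ≤ C) (hC : ∀ x, -C ≤ (ρ * (U x : ℂ)).re)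
    (hloc : ∀ R : ℝ, ∃ D : ℝ, ∀ x : ℝ, |x| ≤ R → ‖ρ * (U x : ℂ)‖ ≤ D) {α B : Fin N → ℝ}
    (hα : ∀ i, 0 < α i ∧ α i < 1) (hB : ∀ i, 0 < B i) (σ : ℝ)
    (herr : ∀ i, (fun s : ℂ => laplaceError (μ i) (α i) (B i) s)
      =o[𝓝[{s : ℂ | 0 < s.re}] 0] (fun s : ℂ => ‖s‖ ^ (α i))) (i : Fin N)
    {δ : ℝ} (hδ : 0 < δ) :
    ∀ᶠ ε in 𝓝[>] (0 : ℝ), ∀ P : Fin N → Measure (Path N),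
      IsChainFamily M (scaledWait α μ ε) (Real.toNNReal (2 * (ε * σ ^ 2))) P →
      ‖backwardDefect M α (fun j => ε * B j) (fun j => σ ^ 2 / B j)
        (fun x => ρ * (U x : ℂ)) (fun b => kernelDist (startMean U ρ P b)) ψ i‖ ≤ δ := by
  have hUm : Measurable U := hU.continuous.measurable
  have hcm : Measurable fun x => ρ * (U x : ℂ) := by fun_prop
  have hc2 : ContDiff ℝ 2 fun x => ρ * (U x : ℂ) :=
    contDiff_const.mul (Complex.ofRealCLM.contDiff.comp hU)
  have hb : (0 : ℝ) ≤ C + 1 := by linarith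
  have hb1 : (1 : ℝ) ≤ C + 1 := by linarith
  have hβ : 1 - α i < 1 := by linarith [(hα i).1]
  -- a common support
  obtain ⟨K1, R1, h1⟩ := hψ.exists_isDampedOn hb
  obtain ⟨K2, R2, h2⟩ := hψ.dt.neg.exists_isDampedOn hb
  obtain ⟨K3, R3, h3⟩ := hψ.exists_isDampedOn_adjDt hb hcm hloc
  obtain ⟨K4, R4, h4⟩ := hψ.exists_isDampedOn_mul hb hcm hloc
  set R := max (max R1 R2) (max R3 (max R4 0)) with hRdef
  have hR : 0 ≤ R := le_max_of_le_right (le_max_of_le_right (le_max_right _ _))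
  have h1 := h1.mono (show R1 ≤ R from le_max_of_le_left (le_max_left _ _))
  have h2 := h2.mono (show R2 ≤ R from le_max_of_le_left (le_max_right _ _))
  have h3 := h3.mono (show R3 ≤ R from le_max_of_le_right (le_max_left _ _))
  have h4 := h4.mono (show R4 ≤ R from le_max_of_le_right (le_max_of_le_right (le_max_left _ _)))
  have hχ := h3.substInt hβ hcm hC
  -- the renewal equation is used with `Z = z X`, where `X` is the symbol of `ψ`: then `mode Z` is
  -- `adjDt ψ`, `mode (z⁻¹ Z)` is `ψ`, and `χ = mode (z^(-α) Z)` belongs to the fractional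
  -- derivative
  obtain ⟨KZ, hZ⟩ := hψ.exists_isSymbol_cpow_mul hC0 hC hloc (a := 1) le_rfl 4
  have eS : ∀ x, adjDt (fun x => ρ * (U x : ℂ)) ψ x =
      mode (C + 1) (fun ξ => (freq (C + 1) ξ + ρ * (U x : ℂ)) ^ ((1 : ℝ) : ℂ) *
        symb (C + 1) ψ x ξ) := fun x => by
    simp_rw [Complex.ofReal_one, Complex.cpow_one]
    exact hψ.adjDt_eq_mode hb1 _ x
  have eχ : ∀ x, substInt (1 - α i) (ρ * (U x : ℂ)) (adjDt (fun x => ρ * (U x : ℂ)) ψ x) =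
      mode (C + 1) (fun ξ => (freq (C + 1) ξ + ρ * (U x : ℂ)) ^ ((-α i : ℝ) : ℂ) *
        ((freq (C + 1) ξ + ρ * (U x : ℂ)) ^ ((1 : ℝ) : ℂ) * symb (C + 1) ψ x ξ)) := fun x => by
    ext T
    rw [eS, substInt_mode hβ (hC x) ((hZ x).integrable hb1 (by norm_num)),
      show 1 - α i - 1 = -α i by ring]
  have eA : ∀ x, ψ x = mode (C + 1) (fun ξ =>
      (freq (C + 1) ξ + ρ * (U x : ℂ)) ^ ((-1 : ℝ) : ℂ) *
        ((freq (C + 1) ξ + ρ * (U x : ℂ)) ^ ((1 : ℝ) : ℂ) * symb (C + 1) ψ x ξ)) := fun x => by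
    simp_rw [cpow_mul_cpow_mul (hC x), neg_add_cancel, Complex.ofReal_zero, Complex.cpow_zero,
      one_mul]
    exact hψ.eq_mode hb1 x
  obtain ⟨W, hW0, hW⟩ := hψ.exists_norm_substPair_gaussian_le hC0 hc2 hβ
  -- the modulus of continuity `η + A |y|` is chosen with `η` small, and then `ε` beats `A`
  set w := W * (2 * σ ^ 2 / B i) with hw
  have hBi := hB i
  have hw0 : 0 ≤ w := by positivity
  set η := δ / (4 * (1 + w)) with hη
  have hη0 : 0 < η := by positivity
  obtain ⟨A, hA0, hA⟩ := hW η hη0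
  have hsq : Tendsto (fun ε : ℝ => w * (A * √(2 * (ε * σ ^ 2)))) (𝓝[>] 0) (𝓝 0) := by
    have h : Continuous fun ε : ℝ => w * (A * √(2 * (ε * σ ^ 2))) := by fun_prop
    have h' := h.tendsto 0
    simp only [zero_mul, mul_zero, Real.sqrt_zero] at h'
    exact h'.mono_left nhdsWithin_le_nhds
  have hs1 : Tendsto (fun ε : ℝ => 2 * (ε * σ ^ 2)) (𝓝[>] 0) (𝓝 0) := by
    have h : Continuous fun ε : ℝ => 2 * (ε * σ ^ 2) := by fun_prop
    have h' := h.tendsto 0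
    simp only [zero_mul, mul_zero] at h'
    exact h'.mono_left nhdsWithin_le_nhds
  filter_upwards [eventually_norm_renewal_le hpos hM hUm hC0 hC hloc hα hB σ herr i hR hZ hχ eχ h3
    eS h1 eA (half_pos hδ), hsq.eventually (ge_mem_nhds (show 0 < δ / 4 by positivity)),
    hs1.eventually (ge_mem_nhds zero_lt_one), self_mem_nhdsWithin] with ε hmain hs hs1 hε P hP
  have hε : 0 < ε := hε
  have : ∀ i, IsProbabilityMeasure (scaledWait α μ ε i) := fun i =>
    inferInstanceAs (IsProbabilityMeasure (scaledLaw (α i) (μ i) ε))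
  have hkM := isKernel_mixMean hM hP hUm hC0 hC i
  have hr := isRep_act hM hP hUm hC0 hC R i
  set G : Fin N → DistPath := fun b => kernelDist (startMean U ρ P b) with hG
  set E : ℝ → ℝ → ℂ := fun x t => ∫ y, mixMean M U ρ P i (x + y) t
    ∂(gaussianReal 0 (Real.toNNReal (2 * (ε * σ ^ 2)))) with hE
  set χ : ℝ → ℝ → ℂ := fun x => substInt (1 - α i) (ρ * (U x : ℂ))
    (adjDt (fun x => ρ * (U x : ℂ)) ψ x) with hχdef
  have e1 : dtPair (act M G i) ψ + pair (act M G i) (fun x t => ρ * (U x : ℂ) * ψ x t) =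
      boxPair R (mixMean M U ρ P i) (adjDt (fun x => ρ * (U x : ℂ)) ψ) := by
    have e : dtPair (act M G i) ψ = boxPair R (mixMean M U ρ P i) (fun x t => -deriv (ψ x) t) :=
      hr.pair_eq h2
    rw [e, hr.pair_eq h4]
    exact (hr.repPair_add h2 h4).symm
  have e2 : substPair (1 - α i) (fun x => ρ * (U x : ℂ)) (act (M - 1) G i) ψ =
      boxPair R (mixMean M U ρ P i) χ - boxPair R (startMean U ρ P i) χ := by
    rw [(isRep_act_sub_one hM hP hUm hC0 hC R i).substPair_eq hβ hcm hC h3]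
    exact boxPair_sub hM hP hUm hC0 hC hχ i
  have e3 : substPair (1 - α i) (fun x => ρ * (U x : ℂ)) (act M (fun j => FcP.dxx (G j)) i) ψ =
      substPair (1 - α i) (fun x => ρ * (U x : ℂ))
        (FcP.dxx (kernelDist (mixMean M U ρ P i))) ψ :=
    hψ.substPair_act_dxx hc2 (fun b => isKernel_startMean hP hUm hC0 hC b) (1 - α i) i
  have e4 : substPair (1 - α i) (fun x => ρ * (U x : ℂ)) (kernelDist E) ψ = boxPair R E χ :=
    ((hkM.gaussian _).isRep_kernelDist R).substPair_eq hβ hcm hC h3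
  have e5 : substPair (1 - α i) (fun x => ρ * (U x : ℂ)) (kernelDist (mixMean M U ρ P i)) ψ =
      boxPair R (mixMean M U ρ P i) χ :=
    (hkM.isRep_kernelDist R).substPair_eq hβ hcm hC h3
  have e6 : ∫ x, ψ x 0 = ∫ x in Set.Icc (-R) R, ψ x 0 := by
    refine (setIntegral_eq_integral_of_forall_compl_eq_zero fun x hx => ?_).symm
    rw [Set.mem_Icc, ← abs_le, not_le] at hx
    exact h1.eq_zero x 0 hx
  have hmain := hmain P hP
  have hgauss := hA _ hkM (Real.toNNReal (2 * (ε * σ ^ 2))) (Real.toNNReal_le_one.2 hs1)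
  have hs0 : 0 ≤ 2 * (ε * σ ^ 2) := by positivity
  rw [Real.coe_toNNReal _ hs0, e4, e5] at hgauss
  have hb' : 0 < ε * B i := mul_pos hε (hB i)
  have key : backwardDefect M α (fun j => ε * B j) (fun j => σ ^ 2 / B j)
        (fun x => ρ * (U x : ℂ)) G ψ i =
      (boxPair R (mixMean M U ρ P i) (adjDt (fun x => ρ * (U x : ℂ)) ψ) -
        (∫ x in Set.Icc (-R) R, ψ x 0) -
        ((ε * B i : ℝ) : ℂ)⁻¹ * (boxPair R (mixMean M U ρ P i) χ -
          boxPair R (startMean U ρ P i) χ) -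
        ((ε * B i : ℝ) : ℂ)⁻¹ * (boxPair R E χ - boxPair R (mixMean M U ρ P i) χ)) +
      ((ε * B i : ℝ) : ℂ)⁻¹ * (boxPair R E χ - boxPair R (mixMean M U ρ P i) χ -
        ((2 * (ε * σ ^ 2) / 2 : ℝ) : ℂ) * substPair (1 - α i) (fun x => ρ * (U x : ℂ))
        (FcP.dxx (kernelDist (mixMean M U ρ P i))) ψ) := by
    rw [backwardDefect, e2, e3, e6, ← e1]
    have h4 : (ε : ℂ) ≠ 0 := by exact_mod_cast hε.ne'
    have h5 : (B i : ℂ) ≠ 0 := by exact_mod_cast (hB i).ne'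
    push_cast
    field_simp
    ring
  rw [key]
  refine (norm_add_le _ _).trans (le_trans (add_le_add hmain ?_) (le_of_eq (add_halves δ)))
  rw [norm_mul, norm_inv, Complex.norm_real, Real.norm_of_nonneg hb'.le]
  calc _ ≤ (ε * B i)⁻¹ * (W * (2 * (ε * σ ^ 2) * (η + A * √(2 * (ε * σ ^ 2))))) :=
        mul_le_mul_of_nonneg_left hgauss (inv_nonneg.2 hb'.le)
    _ = w * η + w * (A * √(2 * (ε * σ ^ 2))) := by
        rw [hw]; field_simp
    _ ≤ δ / 4 + δ / 4 := by
        refine add_le_add ?_ hs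
        calc w * η ≤ (1 + w) * η := by gcongr; linarith
          _ = δ / 4 := by rw [hη]; field_simp
    _ = δ / 2 := by ring

end

/-! ### Initial values and mixtures of initial states -/

section
variable {N : ℕ} {M : Matrix (Fin N) (Fin N) ℝ} {init : Fin N → ℝ} {μ : Fin N → Measure ℝ}
  {s : ℝ≥0} {U : ℝ → ℝ}

lemma Walk.measure_univ [∀ i, IsProbabilityMeasure (μ i)] (F : Walk.{u} M init μ s) :
    F.P Set.univ = ∑ i, ENNReal.ofReal (init i) := by
  rw [← F.isChainLaw.measure_univ, Walk.pathLaw,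
    Measure.map_apply F.measurable_path MeasurableSet.univ, Set.preimage_univ]

lemma Walk.measure_state_eq [∀ i, IsProbabilityMeasure (μ i)] (F : Walk.{u} M init μ s)
    (i : Fin N) : F.P {w | F.state 0 w = i} = ENNReal.ofReal (init i) := by
  have := F.law 0 (fun _ => i) (fun _ => Set.univ) (fun _ => Set.univ)
    (fun _ => MeasurableSet.univ) (fun _ => MeasurableSet.univ)
  simpa using this

lemma Walk.ae_wait_pos (hpos : ∀ i, μ i (Set.Iic 0) = 0) (F : Walk.{u} M init μ s) :
    ∀ᵐ w ∂F.P, 0 < F.wait 0 w := by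
  have h : ∀ i, ∀ᵐ w ∂F.P, ¬(F.state 0 w = i ∧ F.wait 0 w ≤ 0) := fun i => by
    have := F.law 0 (fun _ => i) (fun _ => Set.Iic 0) (fun _ => Set.univ)
      (fun _ => measurableSet_Iic) (fun _ => MeasurableSet.univ)
    simp only [Nat.le_zero, forall_eq, Set.mem_univ, and_true, zero_add, Finset.prod_range_one,
      hpos, zero_mul, mul_zero, Set.mem_Iic] at this
    exact measure_eq_zero_iff_ae_notMem.1 this
  filter_upwards [eventually_all.2 h] with w hw
  exact not_le.1 fun h0 => hw _ ⟨rfl, h0⟩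

lemma Walk.count_zero {F : Walk.{u} M init μ s} {w : F.Ω} (hw : 0 < F.wait 0 w) :
    F.count 0 w = 0 :=
  Nat.sInf_eq_zero.2 (Or.inl (by simpa [Walk.renewalTime] using hw))

/-- Waiting times are positive, so at time `0` no jump has been made. -/
lemma Walk.jointLaw_zero [∀ i, IsProbabilityMeasure (μ i)] (hpos : ∀ i, μ i (Set.Iic 0) = 0)
    (F : Walk.{u} M init μ s) (U : ℝ → ℝ) (i : Fin N) :
    F.jointLaw U 0 i 0 = ENNReal.ofReal (init i) • Measure.dirac ((0 : ℝ), (0 : ℝ)) := by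
  have h1 : (fun w => (F.position 0 0 w, F.functional U 0 0 w)) =ᵐ[F.P.restrict
      {w | F.internal 0 w = i}] fun _ => ((0 : ℝ), (0 : ℝ)) := by
    refine ae_restrict_of_ae ((F.ae_wait_pos hpos).mono fun w hw => ?_)
    simp [Walk.position, Walk.functional, Walk.count_zero hw]
  have h2 : F.P {w | F.internal 0 w = i} = F.P {w | F.state 0 w = i} := by
    refine measure_congr ((F.ae_wait_pos hpos).mono fun w hw => ?_)
    have : F.internal 0 w = F.state 0 w := by rw [Walk.internal, Walk.count_zero hw]
    exact congrArg (· = i) this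
  rw [Walk.jointLaw, Measure.map_congr h1, Measure.map_const, Measure.restrict_apply_univ, h2,
    F.measure_state_eq]

lemma Walk.functionalLaw_zero [∀ i, IsProbabilityMeasure (μ i)] {i : Fin N}
    (F : Walk.{u} M (Pi.single i 1) μ s) (U : ℝ → ℝ) (x : ℝ) :
    F.functionalLaw U x 0 = Measure.dirac 0 := by
  have h : F.functional U x 0 = fun _ => 0 := by
    ext w; simp [Walk.functional]
  rw [Walk.functionalLaw, h, Measure.map_const, F.measure_univ, Finset.sum_eq_single i]
  · simp
  · intro b _ hb; simp [hb]
  · simp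

lemma Walk.functionalLaw_eq_map (F : Walk.{u} M init μ s) (hU : Measurable U) (x t : ℝ) :
    F.functionalLaw U x t = F.pathLaw.map (pathFun U x t) := by
  have hm : Measurable fun p : Path N => pathFun U x t p :=
    (measurable_pathFun hU).comp (f := fun p : Path N => (x, t, p)) (by fun_prop)
  rw [Walk.pathLaw, Measure.map_map hm F.measurable_path]
  rfl

/-- The law of the functional is linear in the initial distribution of the internal state. -/
lemma Walk.functionalLaw_eq_sum [∀ i, IsProbabilityMeasure (μ i)] (hinit : ∀ i, 0 ≤ init i)
    (F : Walk.{u} M init μ s) (F' : ∀ i : Fin N, Walk.{v} M (Pi.single i 1) μ s)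
    (hU : Measurable U) (x t : ℝ) :
    F.functionalLaw U x t = ∑ i, ENNReal.ofReal (init i) • (F' i).functionalLaw U x t := by
  have hm : Measurable fun p : Path N => pathFun U x t p :=
    (measurable_pathFun hU).comp (f := fun p : Path N => (x, t, p)) (by fun_prop)
  simp_rw [Walk.functionalLaw_eq_map _ hU]
  rw [F.isChainLaw.eq_sum hinit (P := fun i => (F' i).pathLaw) fun i => (F' i).isChainLaw]
  ext A hA
  rw [Measure.map_apply hm hA, Measure.finsetSum_apply, Measure.finsetSum_apply]
  refine Finset.sum_congr rfl fun i _ => ?_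
  rw [Measure.smul_apply, Measure.smul_apply, Measure.map_apply hm hA]

end

end FcP

end

theorem mainTheorem4 {N : ℕ} (M : Matrix (Fin N) (Fin N) ℝ)
    (hM : M ∈ Matrix.rowStochastic ℝ (Fin N))
    (init : Fin N → ℝ) (hinit : init ∈ stdSimplex ℝ (Fin N))
    (α B : Fin N → ℝ) (hα : ∀ i, 0 < α i ∧ α i < 1) (hB : ∀ i, 0 < B i)
    (σ : ℝ) (hσ : 0 < σ)
    (μ : Fin N → Measure ℝ) (hμ : ∀ i, IsProbabilityMeasure (μ i))
    (hμpos : ∀ i, μ i (Set.Iic 0) = 0)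
    (hμlap : ∀ i, (fun s : ℂ => FcP.laplaceError (μ i) (α i) (B i) s)
      =o[𝓝[{s : ℂ | 0 < s.re}] 0] (fun s : ℂ => ‖s‖ ^ (α i)))
    (U : ℝ → ℝ) (hU : Measurable U)
    (hUloc : ∀ R : ℝ, ∃ C : ℝ, ∀ x : ℝ, |x| ≤ R → |U x| ≤ C)
    (ρ : ℂ) (hρ : ∃ C : ℝ, ∀ x : ℝ, -C ≤ (ρ * (U x : ℂ)).re)
    (ε : ℕ → ℝ) (hε : ∀ n, 0 < ε n) (hε0 : Tendsto ε atTop (𝓝 0))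
    (F : ∀ n, FcP.Walk.{u} M init (FcP.scaledWait α μ (ε n))
      (Real.toNNReal (2 * (ε n * σ ^ 2))))
    (F' : ∀ n (i : Fin N), FcP.Walk.{v} M (Pi.single i 1) (FcP.scaledWait α μ (ε n))
      (Real.toNNReal (2 * (ε n * σ ^ 2)))) :
    -- initial conditions
    ((∀ n i, (F n).jointLaw U 0 i 0 = ENNReal.ofReal (init i) • Measure.dirac ((0 : ℝ), (0 : ℝ))) ∧
      (∀ n i x₀, (F' n i).functionalLaw U x₀ 0 = Measure.dirac (0 : ℝ))) ∧
    -- forward equation, to leading order, and its sum over the internal states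
    (∀ ψ : ℝ → ℝ → ℂ, FcP.IsTest ψ →
      (∀ i, Tendsto (fun n => (ε n : ℂ) *
        FcP.forwardDefect M init α (fun j => ε n * B j) (fun j => σ ^ 2 / B j)
          (fun x => ρ * (U x : ℂ)) (FcP.forwardG (F n) U ρ) ψ i) atTop (𝓝 0)) ∧
      Tendsto (fun n => ∑ i,
        FcP.forwardDefect M init α (fun j => ε n * B j) (fun j => σ ^ 2 / B j)
          (fun x => ρ * (U x : ℂ)) (FcP.forwardG (F n) U ρ) ψ i) atTop (𝓝 0)) ∧
    -- forward equation in each component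
    ((∀ i, (fun s : ℂ => FcP.laplaceError (μ i) (α i) (B i) s)
        =o[𝓝[{s : ℂ | 0 < s.re}] 0] (fun s : ℂ => ‖s‖ ^ (2 * α i))) →
      ∀ ψ : ℝ → ℝ → ℂ, FcP.IsTest ψ → ∀ i, Tendsto (fun n =>
        FcP.forwardDefect M init α (fun j => ε n * B j) (fun j => σ ^ 2 / B j)
          (fun x => ρ * (U x : ℂ)) (FcP.forwardG (F n) U ρ) ψ i) atTop (𝓝 0)) ∧
    -- backward equation
    (ContDiff ℝ 2 U → ∀ ψ : ℝ → ℝ → ℂ, FcP.IsTest ψ → ∀ i, Tendsto (fun n =>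
        FcP.backwardDefect M α (fun j => ε n * B j) (fun j => σ ^ 2 / B j)
          (fun x => ρ * (U x : ℂ)) (FcP.backwardG (F' n) U ρ) ψ i) atTop (𝓝 0)) ∧
    -- integrated form of the backward equation, for rough `U`
    (∀ ψ : ℝ → ℝ → ℂ, FcP.IsTest ψ → ∀ i, Tendsto (fun n =>
        FcP.backwardIntegratedDefect M α (fun j => ε n * B j) (fun j => σ ^ 2 / B j)
          (fun x => ρ * (U x : ℂ)) (FcP.backwardG (F' n) U ρ) ψ i) atTop (𝓝 0)) ∧
    -- the law of the functional for a general initial distribution of the internal state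
    (∀ n (x₀ t : ℝ), 0 ≤ t → (F n).functionalLaw U x₀ t =
      ∑ i, ENNReal.ofReal (init i) • (F' n i).functionalLaw U x₀ t) := by
  obtain ⟨C', hC'⟩ := hρ
  set C := max C' 0 with hCdef
  have hC0 : 0 ≤ C := le_max_right _ _
  have hC : ∀ x, -C ≤ (ρ * (U x : ℂ)).re := fun x =>
    (neg_le_neg (le_max_left C' 0)).trans (hC' x)
  have hloc : ∀ R : ℝ, ∃ D : ℝ, ∀ x : ℝ, |x| ≤ R → ‖ρ * (U x : ℂ)‖ ≤ D := fun R => by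
    obtain ⟨D, hD⟩ := hUloc R
    refine ⟨‖ρ‖ * D, fun x hx => ?_⟩
    rw [norm_mul, Complex.norm_real]
    exact mul_le_mul_of_nonneg_left (hD x hx) (norm_nonneg ρ)
  have hε1 : Tendsto ε atTop (𝓝[>] 0) :=
    tendsto_nhdsWithin_iff.2 ⟨hε0, Eventually.of_forall hε⟩
  have hμε : ∀ n i, IsProbabilityMeasure (FcP.scaledWait α μ (ε n) i) := fun n i =>
    inferInstanceAs (IsProbabilityMeasure (FcP.scaledLaw (α i) (μ i) (ε n)))
  have hposε : ∀ n i, FcP.scaledWait α μ (ε n) i (Set.Iic 0) = 0 := fun n i =>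
    FcP.scaledLaw_Iic (hμpos i) (hε n)
  have hfam : ∀ n, FcP.IsChainFamily M (FcP.scaledWait α μ (ε n))
      (Real.toNNReal (2 * (ε n * σ ^ 2))) fun i => (F' n i).pathLaw := fun n i =>
    (F' n i).isChainLaw
  have hback : ∀ n, FcP.backwardG (F' n) U ρ = fun b =>
      FcP.kernelDist (FcP.startMean U ρ (fun i => (F' n i).pathLaw) b) := fun n =>
    funext fun b => FcP.Walk.backwardG_eq (F' n) hU b
  have hsmall : ∀ {f : ℕ → ℂ}, (∀ δ, 0 < δ → ∀ᶠ n in atTop, ‖f n‖ ≤ δ) →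
      Tendsto f atTop (𝓝 0) := fun h => by
    rw [Metric.tendsto_nhds]
    intro δ hδ
    filter_upwards [h (δ / 2) (half_pos hδ)] with n hn
    rw [dist_zero_right]; linarith
  -- contracting the defect with the `i`-th unit vector gives its `i`-th component
  have hsingle : ∀ (d : Fin N → ℂ) (i : Fin N),
      ∑ j, (Pi.single i 1 : Fin N → ℂ) j * d j = d i := fun d i => by
    rw [Finset.sum_eq_single i]
    · simp
    · intro j _ hj; simp [hj]
    · simp
  have hW : ∀ i j : Fin N, ‖∑ k, (M j k : ℂ) * (Pi.single i 1 : Fin N → ℂ) k -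
      (Pi.single i 1 : Fin N → ℂ) j‖ ≤ 2 := fun i j => by
    have e : ∑ k, (M j k : ℂ) * (Pi.single i 1 : Fin N → ℂ) k = (M j i : ℂ) := by
      simp_rw [mul_comm (M j _ : ℂ)]
      exact hsingle (fun k => (M j k : ℂ)) i
    have h1 : M j i ≤ 1 := by
      rw [← FcP.sum_row hM j]
      exact Finset.single_le_sum (f := fun k => M j k) (fun k _ => hM.1 j k) (Finset.mem_univ i)
    rw [e]
    refine (norm_sub_le _ _).trans ?_
    rw [Complex.norm_real, Real.norm_of_nonneg (hM.1 j i)]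
    have h2 : ‖(Pi.single i 1 : Fin N → ℂ) j‖ ≤ 1 := by
      by_cases h : j = i
      · subst h; simp
      · simp [h]
    linarith
  refine ⟨⟨fun n i => (F n).jointLaw_zero (hposε n) U i, fun n i x =>
    (F' n i).functionalLaw_zero U x⟩, fun ψ hψ => ⟨fun i => hsmall fun δ hδ => ?_,
    hsmall fun δ hδ => ?_⟩, fun hlap ψ hψ i => hsmall fun δ hδ => ?_,
    fun hU2 ψ hψ i => hsmall fun δ hδ => ?_, fun ψ hψ i => hsmall fun δ hδ => ?_,
    fun n x t _ => (F n).functionalLaw_eq_sum hinit.1 (F' n) hU x t⟩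
  · have h := hψ.eventually_norm_sum_forwardDefect_le hμpos hM hinit hC0 hU hC hloc hα hB σ hμlap
      (p := 0) (by norm_num) (by simpa using hμlap) (Pi.single i 1) zero_le_two (hW i)
      (show 0 < δ / 3 by positivity)
    filter_upwards [hε1.eventually h, hε0.eventually (ge_mem_nhds zero_lt_one)] with n hn hn1
    have := hn _ (hfam n) (F n)
    rw [hsingle, pow_zero, mul_one] at this
    rw [norm_mul, Complex.norm_real, Real.norm_of_nonneg (hε n).le]
    have h1 : ε n * (δ / 3) ≤ 1 * (δ / 3) := by gcongr
    linarith
  · have h := hψ.eventually_norm_sum_forwardDefect_le hμpos hM hinit hC0 hU hC hloc hα hB σ hμlap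
      (p := 0) (by norm_num) (by simpa using hμlap) (fun _ => 1) le_rfl (fun j => by
        have := FcP.sum_row hM j
        simp only [mul_one, ← Complex.ofReal_sum, this, Complex.ofReal_one, sub_self, norm_zero,
          le_refl]) hδ
    filter_upwards [hε1.eventually h] with n hn
    have := hn _ (hfam n) (F n)
    simp only [zero_mul, zero_add, one_mul] at this
    exact le_of_mul_le_mul_left this (hε n)
  · have h := hψ.eventually_norm_sum_forwardDefect_le hμpos hM hinit hC0 hU hC hloc hα hB σ hμlap
      (p := 1) le_rfl (by simpa using hlap) (Pi.single i 1) zero_le_two (hW i)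
      (show 0 < δ / 3 by positivity)
    filter_upwards [hε1.eventually h] with n hn
    have := hn _ (hfam n) (F n)
    rw [hsingle, pow_one] at this
    refine le_of_mul_le_mul_left (this.trans (le_of_eq ?_)) (hε n)
    ring
  · filter_upwards [hε1.eventually (hψ.eventually_norm_backwardDefect_le hμpos hM hU2 hC0 hC hloc
      hα hB σ hμlap i hδ)] with n hn
    rw [hback]
    exact hn _ (hfam n)
  · filter_upwards [hε1.eventually (hψ.eventually_norm_backwardIntegratedDefect_le hμpos hM hU hC0
      hC hloc hα hB σ hμlap i hδ)] with n hn
    rw [hback]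
    exact hn _ (hfam n)
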